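/- Let $a>0$, $\gamma>1$, $k,A_0,\lambda,\varepsilon>0$, $L\ge 1$, $\mathfrak z\ge 0$, $\tilde\rho,\tilde\eta>0$, and let $P(s)=as^\gamma$. Put $$r_1=\sqrt{P'(\tilde\rho)},\quad r_2=\frac{k(L-1)+2\mathfrak z\tilde\eta}{\sqrt{P'(\tilde\rho)}},\quad r_3=\frac1{\sqrt{P'(\tilde\rho)}},\quad \beta=\frac{\sqrt{P'(\tilde\rho)}}{\tilde\rho},$$ $$h(s)=\frac1\beta\Big(\frac{P'(\tilde\rho)}{\tilde\rho}-\frac{P'(s+\tilde\rho)}{s+\tilde\rho}\Big),\qquad g(s)=\frac1\beta\Big(\frac1{\tilde\rho}-\frac1{s+\tilde\rho}\Big),$$ and, for $\mu\geq 0$ and $2\mu+3\nu\ge 0$, put $\mu_1=\mu/\tilde\rho$ and $\mu_2=(\mu+\nu)/\tilde\rho$. For scalar functions $\rho,\eta$, a vector field $u$ and a symmetric matrix field $\tau$ on $\mathbb R^3$, consider the system $$\begin{aligned} &\rho_t+r_1\,\mathrm{div}\,u=-\beta\,\mathrm{div}(\rho u),\\ &u_t+r_1\nabla\rho+r_2\nabla\eta-r_3\,\mathrm{div}\,\tau-\mu_1\Delta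 u-\mu_2\nabla\mathrm{div}\,u=\tilde S_2,\\ &\eta_t+\beta\tilde\eta\,\mathrm{div}\,u-\varepsilon\Delta\eta=-\beta\,\mathrm{div}(\eta u),\\ &\tau_t+\tfrac{A_0}{2\lambda}\tau-\varepsilon\Delta\tau-\beta k\tilde\eta(\nabla u+\nabla^{T}u)=-\beta\,\mathrm{div}(u\tau)+\beta(\nabla u\,\tau+\tau\nabla^{T}u)+\beta k\eta(\nabla u+\nabla^{T}u), \end{aligned}\tag{$*$}$$ where $(\nabla u)_{ij}=\partial_ju_i$, $(\mathrm{div}\,\tau)_i=\sum_j\partial_j\tau_{ij}$, $(\mathrm{div}(u\tau))_{ij}=\mathrm{div}(u\tau_{ij})$ and $$\tilde S_2=-\beta u\cdot\nabla u+h(\rho)\nabla\rho+g(\rho)\big[(k(L-1)+2\mathfrak z\tilde\eta)\nabla\eta-\mathrm{div}\,\tau\big]-\frac{2\mathfrak z}{\beta(\rho+\tilde\rho)}\eta\nabla\eta-\mu\beta g(\rho)\Delta u-(\mu+\nu)\beta g(\rho)\nabla\mathrm{div}\,u .$$ A strong solution of $(*)$ on $\mathbb R^3\times[0,T]$ with initial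 data $(\rho_0,u_0,\eta_0,\tau_0)$ is a quadruple $(\rho,u,\eta,\tau)$ that takes these initial values, satisfies $(*)$ almost everywhere, and is such that $\rho\in C([0,T];H^3)$, $\rho_t\in C([0,T];H^2)$, $(u,\eta,\tau)\in C([0,T];H^3)\cap L^2(0,T;H^4)$, $(u_t,\eta_t,\tau_t)\in C([0,T];H^1)\cap L^2(0,T;H^2)$, and $\rho+\tilde\rho$ and $\eta+\tilde\eta$ are bounded below by a positive constant on $\mathbb R^3\times[0,T]$. Then there are constants $C\ge1$, $\theta>0$ and $\delta>\frac{3\theta}2$ with $\sqrt C\,\theta\le\frac{2\delta}3$, depending only on $a,\gamma,k,L,\mathfrak z,A_0,\lambda,\varepsilon,\tilde\rho,\tilde\eta$ (in particular independent of $\mu,\nu$ and $T$), such that the following holds for all $\mu,\nu$ with $\mu\ge0$, $2\mu+3\nu\ge0$, $\mu,\nu\le1$ and all $T>0$. If $(\rho,u,\eta,\tau)$ is a strong solution of $(*)$ on $\mathbb R^3\times[0,T]$ whose initial data satisfy $\|(\rho_0,u_0,\eta_0,\tau_0)\|_{H^3}\le\theta$, and if $$\|(\rho,u,\eta,\tau)(t)\|_{H^3}\le\delta\quad\text{for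 all }t\in[0,T],$$ then for all $t\in[0,T]$ $$\begin{aligned}\|(\rho,u,\eta,\tau)(t)\|_{H^3}^2&+\int_0^t\big(\|\nabla(\rho,u)\|_{H^2}^2+\|\nabla(\eta,\tau)\|_{H^3}^2\big)\,ds\\&+\int_0^t\big(\mu_1\|\nabla u\|_{H^3}^2+\mu_2\|\mathrm{div}\,u\|_{H^3}^2\big)\,ds\le C\,\|(\rho_0,u_0,\eta_0,\tau_0)\|_{H^3}^2\le\frac{2\delta}3 .\end{aligned}$$ -/

import Mathlib

open MeasureTheory Set Filter Topology
open scoped ENNReal ContDiff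

noncomputable section

namespace OldroydB

/-- The physical space `ℝ³` with its Euclidean structure and Lebesgue measure. -/
abbrev Space := EuclideanSpace ℝ (Fin 3)

/-! ### Sobolev spaces `H^m(ℝ³)` through weak derivatives -/

/-- `g` is the weak partial derivative `∂_i f` on `ℝ³` (tested against `C_c^∞`). -/
def IsWeakPartial (i : Fin 3) (f g : Space → ℝ) : Prop :=
  LocallyIntegrable f volume ∧ LocallyIntegrable g volume ∧
    ∀ φ : Space → ℝ, ContDiff ℝ ∞ φ → HasCompactSupport φ →
      ∫ x, f x * fderiv ℝ φ x (EuclideanSpace.single i 1) = -∫ x, g x * φ x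

open Classical in
/-- The weak partial derivative `∂_i f`, unique up to a null set when it exists
(and `0` when it does not exist). -/
def weakPartial (i : Fin 3) (f : Space → ℝ) : Space → ℝ :=
  if h : ∃ g, IsWeakPartial i f g then h.choose else 0

open Classical in
/-- The squared norm `‖f‖²_{H^m} = ∑_{ℓ ≤ m} ‖∇^ℓ f‖²_{L²}`, where `|∇^ℓ f|²` is the sum of the
squares of all `3^ℓ` iterated weak partial derivatives of order `ℓ`. It is `∞` if one of these
weak derivatives does not exist or is not square integrable. -/
def sobSq : ℕ → (Space → ℝ) → ℝ≥0∞
  | 0, f => eLpNorm f 2 volume ^ 2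
  | m + 1, f =>
      if ∀ i : Fin 3, ∃ g, IsWeakPartial i f g then
        eLpNorm f 2 volume ^ 2 + ∑ i : Fin 3, sobSq m (weakPartial i f)
      else ⊤

/-- `f ∈ H^m(ℝ³)`. -/
def MemH (m : ℕ) (f : Space → ℝ) : Prop :=
  AEStronglyMeasurable f volume ∧ sobSq m f < ⊤

/-- `‖∇f‖²_{H^m}`. -/
def gradSq (m : ℕ) (f : Space → ℝ) : ℝ≥0∞ := ∑ i : Fin 3, sobSq m (weakPartial i f)

/-- The divergence of a vector field. -/
def divergence (v : Fin 3 → Space → ℝ) : Space → ℝ := fun x => ∑ i, weakPartial i (v i) x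

/-- The Laplacian. -/
def laplacian (f : Space → ℝ) : Space → ℝ := fun x => ∑ i, weakPartial i (weakPartial i f) x

/-! ### Functions of time with values in `H^m(ℝ³)` -/

/-- `f ∈ C([0,T]; H^m)`. -/
def ContH (m : ℕ) (T : ℝ) (f : ℝ → Space → ℝ) : Prop :=
  (∀ t ∈ Icc 0 T, MemH m (f t)) ∧
    ∀ t ∈ Icc 0 T, Tendsto (fun s => sobSq m (f s - f t)) (𝓝[Icc 0 T] t) (𝓝 0)

/-- `∫₀ᵀ ‖f(t)‖²_{H^m} dt < ∞`; for functions that are continuous in time with values in some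
`H^l` (the only ones for which it is used) this is `f ∈ L²(0,T; H^m)`. -/
def SqIntegrableH (m : ℕ) (T : ℝ) (f : ℝ → Space → ℝ) : Prop :=
  ∫⁻ t in Ioo 0 T, sobSq m (f t) < ⊤

/-- `f_t = g` with `f_t ∈ C([0,T]; H^m)`: the difference quotients of `f` converge to `g` in `H^m`
at every time of `[0,T]` (one-sided at the end points), and `g` is continuous with values
in `H^m`. -/
def HasTimeDerivH (m : ℕ) (T : ℝ) (f g : ℝ → Space → ℝ) : Prop :=
  ContH m T g ∧
    ∀ t ∈ Icc 0 T,
      Tendsto (fun s => sobSq m ((s - t)⁻¹ • (f s - f t) - g t)) (𝓝[Icc 0 T \ {t}] t) (𝓝 0)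

/-! ### The model -/

/-- The parameters of the model: pressure law `P(s) = a s^γ`, the constants `k, L, 𝔷, A₀, λ` of the
polymer, the centre-of-mass diffusion `ε`, and the equilibrium values `ρ̃, η̃`. -/
structure Params where
  a : ℝ
  γ : ℝ
  k : ℝ
  L : ℝ
  z : ℝ
  A₀ : ℝ
  lam : ℝ
  ε : ℝ
  ρt : ℝ
  ηt : ℝ
  a_pos : 0 < a
  one_lt_γ : 1 < γ
  k_pos : 0 < k
  one_le_L : 1 ≤ L
  z_nonneg : 0 ≤ z
  A₀_pos : 0 < A₀
  lam_pos : 0 < lam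
  ε_pos : 0 < ε
  ρt_pos : 0 < ρt
  ηt_pos : 0 < ηt

namespace Params

variable (P : Params)

/-- The pressure `P(s) = a s^γ`. -/
def pressure (s : ℝ) : ℝ := P.a * s ^ P.γ

/-- The derivative `P'` of the pressure. -/
def dPressure (s : ℝ) : ℝ := deriv P.pressure s

/-- `k (L - 1) + 2 𝔷 η̃`. -/
def κ : ℝ := P.k * (P.L - 1) + 2 * P.z * P.ηt

def r₁ : ℝ := √(P.dPressure P.ρt)

def r₂ : ℝ := P.κ / √(P.dPressure P.ρt)

def r₃ : ℝ := 1 / √(P.dPressure P.ρt)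

def β : ℝ := √(P.dPressure P.ρt) / P.ρt

/-- `h(s) = (P'(ρ̃)/ρ̃ - P'(s + ρ̃)/(s + ρ̃)) / β`. -/
def h (s : ℝ) : ℝ :=
  (P.dPressure P.ρt / P.ρt - P.dPressure (s + P.ρt) / (s + P.ρt)) * (1 / P.β)

/-- `g(s) = (1/ρ̃ - 1/(s + ρ̃)) / β`. -/
def g (s : ℝ) : ℝ := (1 / P.ρt - 1 / (s + P.ρt)) * (1 / P.β)

/-- `μ₁ = μ / ρ̃`. -/
def μ₁ (μ : ℝ) : ℝ := μ / P.ρt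

/-- `μ₂ = (μ + ν) / ρ̃`. -/
def μ₂ (μ ν : ℝ) : ℝ := (μ + ν) / P.ρt

end Params

/-- The unknowns at a fixed time, as perturbations of the equilibrium `(ρ̃, 0, η̃, 0)`: density `ρ`,
(rescaled) velocity `u`, polymer number density `η` and reduced extra stress `τ`. -/
structure State where
  ρ : Space → ℝ
  u : Fin 3 → Space → ℝ
  η : Space → ℝ
  τ : Fin 3 → Fin 3 → Space → ℝ

namespace State

/-- `‖(ρ, u, η, τ)‖²_{H^m}`. -/
def normSq (m : ℕ) (U : State) : ℝ≥0∞ :=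
  sobSq m U.ρ + ∑ i, sobSq m (U.u i) + sobSq m U.η + ∑ i, ∑ j, sobSq m (U.τ i j)

/-- `div τ`, `(div τ)_i = ∑_j ∂_j τ_{ij}`. -/
def divStress (U : State) (i : Fin 3) : Space → ℝ := divergence (fun j => U.τ i j)

/-- `‖∇(ρ, u)‖²_{H²} + ‖∇(η, τ)‖²_{H³}`. -/
def dissipation (U : State) : ℝ≥0∞ :=
  (gradSq 2 U.ρ + ∑ i, gradSq 2 (U.u i)) + (gradSq 3 U.η + ∑ i, ∑ j, gradSq 3 (U.τ i j))

/-- `μ₁ ‖∇u‖²_{H³} + μ₂ ‖div u‖²_{H³}`. -/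
def viscousDissipation (P : Params) (μ ν : ℝ) (U : State) : ℝ≥0∞ :=
  ENNReal.ofReal (P.μ₁ μ) * ∑ i, gradSq 3 (U.u i) +
    ENNReal.ofReal (P.μ₂ μ ν) * sobSq 3 (divergence U.u)

/-- `S₁ = -β div(ρ u)`. -/
def S₁ (P : Params) (U : State) (x : Space) : ℝ :=
  -P.β * divergence (fun i y => U.ρ y * U.u i y) x

/-- The `i`-th component of
`S₂ = -β u·∇u + h(ρ)∇ρ + g(ρ)[(k(L-1) + 2𝔷η̃)∇η - div τ] - 2𝔷/(β(ρ+ρ̃)) η∇η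
  - μβ g(ρ)Δu - (μ+ν)β g(ρ)∇div u`. -/
def S₂ (P : Params) (μ ν : ℝ) (U : State) (i : Fin 3) (x : Space) : ℝ :=
  -P.β * ∑ j, U.u j x * weakPartial j (U.u i) x
    + P.h (U.ρ x) * weakPartial i U.ρ x
    + P.g (U.ρ x) * (P.κ * weakPartial i U.η x - U.divStress i x)
    - 2 * P.z / (P.β * (U.ρ x + P.ρt)) * U.η x * weakPartial i U.η x
    - μ * P.β * P.g (U.ρ x) * laplacian (U.u i) x
    - (μ + ν) * P.β * P.g (U.ρ x) * weakPartial i (divergence U.u) x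

/-- `S₃ = -β div(η u)`. -/
def S₃ (P : Params) (U : State) (x : Space) : ℝ :=
  -P.β * divergence (fun i y => U.η y * U.u i y) x

/-- The `(i,j)` entry of `∇u + ∇ᵀu`, where `(∇u)_{ij} = ∂_j u_i`. -/
def symGrad (U : State) (i j : Fin 3) (x : Space) : ℝ :=
  weakPartial j (U.u i) x + weakPartial i (U.u j) x

/-- The `(i,j)` entry of
`S₄ = -β div(uτ) + β(∇u τ + τ ∇ᵀu) + βkη(∇u + ∇ᵀu)`, with `(div(uτ))_{ij} = div(u τ_{ij})`. -/
def S₄ (P : Params) (U : State) (i j : Fin 3) (x : Space) : ℝ :=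
  -P.β * divergence (fun l y => U.u l y * U.τ i j y) x
    + P.β * ∑ l, (weakPartial l (U.u i) x * U.τ l j x + U.τ i l x * weakPartial l (U.u j) x)
    + P.β * P.k * U.η x * U.symGrad i j x

/-- The viscous system at a fixed time, `V` being the time derivative of the unknown:
the four equations hold almost everywhere in `ℝ³`. -/
structure SolvesAt (P : Params) (μ ν : ℝ) (U V : State) : Prop where
  mass : ∀ᵐ x, V.ρ x + P.r₁ * divergence U.u x = U.S₁ P x
  momentum : ∀ i, ∀ᵐ x,
    V.u i x + P.r₁ * weakPartial i U.ρ x + P.r₂ * weakPartial i U.η x - P.r₃ * U.divStress i x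
      - P.μ₁ μ * laplacian (U.u i) x - P.μ₂ μ ν * weakPartial i (divergence U.u) x
      = U.S₂ P μ ν i x
  polymer : ∀ᵐ x,
    V.η x + P.β * P.ηt * divergence U.u x - P.ε * laplacian U.η x = U.S₃ P x
  stress : ∀ i j, ∀ᵐ x,
    V.τ i j x + P.A₀ / (2 * P.lam) * U.τ i j x - P.ε * laplacian (U.τ i j) x
      - P.β * P.k * P.ηt * U.symGrad i j x = U.S₄ P i j x

end State

/-- `U` is a strong solution on `ℝ³ × [0,T]` of the viscous system with viscosities `μ, ν` and
initial state `U₀`, and `V` is its time derivative. Since all terms of the equations are continuous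
in time with values in `L²`, it is the same to ask for them at every time or at almost every time. -/
structure IsStrongSolution (P : Params) (μ ν T : ℝ) (U₀ : State) (U V : ℝ → State) : Prop where
  initial : U 0 = U₀
  ρ_cont : ContH 3 T (fun t => (U t).ρ)
  u_cont : ∀ i, ContH 3 T (fun t => (U t).u i)
  η_cont : ContH 3 T (fun t => (U t).η)
  τ_cont : ∀ i j, ContH 3 T (fun t => (U t).τ i j)
  u_sq : ∀ i, SqIntegrableH 4 T (fun t => (U t).u i)
  η_sq : SqIntegrableH 4 T (fun t => (U t).η)
  τ_sq : ∀ i j, SqIntegrableH 4 T (fun t => (U t).τ i j)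
  ρ_deriv : HasTimeDerivH 2 T (fun t => (U t).ρ) (fun t => (V t).ρ)
  u_deriv : ∀ i, HasTimeDerivH 1 T (fun t => (U t).u i) (fun t => (V t).u i)
  η_deriv : HasTimeDerivH 1 T (fun t => (U t).η) (fun t => (V t).η)
  τ_deriv : ∀ i j, HasTimeDerivH 1 T (fun t => (U t).τ i j) (fun t => (V t).τ i j)
  ut_sq : ∀ i, SqIntegrableH 2 T (fun t => (V t).u i)
  ηt_sq : SqIntegrableH 2 T (fun t => (V t).η)
  τt_sq : ∀ i j, SqIntegrableH 2 T (fun t => (V t).τ i j)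
  /-- The total density and the total polymer number density are bounded away from zero. -/
  positive : ∃ c > 0, ∀ t ∈ Icc 0 T, ∀ᵐ x, c ≤ (U t).ρ x + P.ρt ∧ c ≤ (U t).η x + P.ηt
  /-- The stress is a symmetric matrix. -/
  symmetric : ∀ t ∈ Icc 0 T, ∀ i j, (U t).τ i j =ᵐ[volume] (U t).τ j i
  solves : ∀ t ∈ Icc 0 T, (U t).SolvesAt P μ ν (V t)

end OldroydB

end

open MeasureTheory Set Filter Topology
open scoped ENNReal ContDiff

noncomputable section

namespace OldroydB

/-! ### Weak derivatives in `L²(ℝ³)` -/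

/-- The real Hilbert space `L²(ℝ³)`. -/
abbrev L2 := Lp ℝ 2 (volume : Measure Space)

/-- The `i`-th standard basis vector of `ℝ³`. -/
abbrev basisVec (i : Fin 3) : Space := EuclideanSpace.single i 1

/-- Smooth compactly supported functions on `ℝ³`. -/
abbrev Test := {φ : Space → ℝ // ContDiff ℝ ∞ φ ∧ HasCompactSupport φ}

namespace Test

instance : CoeFun Test (fun _ => Space → ℝ) := ⟨Subtype.val⟩

theorem smooth (φ : Test) : ContDiff ℝ ∞ φ := φ.2.1

theorem compact (φ : Test) : HasCompactSupport φ := φ.2.2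

theorem continuous (φ : Test) : Continuous φ := φ.smooth.continuous

theorem differentiable (φ : Test) : Differentiable ℝ φ := φ.smooth.differentiable (by simp)

theorem memLp (φ : Test) (p : ℝ≥0∞) : MemLp φ p (volume : Measure Space) :=
  φ.continuous.memLp_of_hasCompactSupport φ.compact

/-- The element of `L²` defined by a test function. -/
def L (φ : Test) : L2 := (φ.memLp 2).toLp φ

theorem coe_L (φ : Test) : (φ.L : Space → ℝ) =ᵐ[volume] φ := MemLp.coeFn_toLp _

/-- The partial derivative of a test function. -/
def d (i : Fin 3) (φ : Test) : Test :=
  ⟨fun x => fderiv ℝ φ x (basisVec i),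
    (φ.smooth.fderiv_right (m := ∞) (by simp)).clm_apply contDiff_const,
    φ.compact.fderiv_apply ℝ (basisVec i)⟩

theorem d_apply (i : Fin 3) (φ : Test) (x : Space) : φ.d i x = fderiv ℝ φ x (basisVec i) := rfl

theorem d_comm (i j : Fin 3) (φ : Test) : (φ.d i).d j = (φ.d j).d i := by
  apply Subtype.ext
  funext x
  have h2 : ContDiffAt ℝ 2 φ x := (contDiff_infty.1 φ.smooth 2).contDiffAt
  have hs : IsSymmSndFDerivAt ℝ φ x := h2.isSymmSndFDerivAt (by simp)
  have hd : DifferentiableAt ℝ (fderiv ℝ φ) x :=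
    ((φ.smooth.fderiv_right (m := ∞) (by simp)).differentiable (by simp)) x
  have key : ∀ a b : Fin 3, fderiv ℝ (fun y => fderiv ℝ φ y (basisVec a)) x (basisVec b)
      = fderiv ℝ (fderiv ℝ φ) x (basisVec b) (basisVec a) := by
    intro a b
    rw [fderiv_clm_apply hd (differentiableAt_const _)]
    simp
  change fderiv ℝ (fun y => fderiv ℝ φ y (basisVec i)) x (basisVec j)
    = fderiv ℝ (fun y => fderiv ℝ φ y (basisVec j)) x (basisVec i)
  rw [key, key, hs.eq]

/-- Product of a smooth function and a test function. -/
def smulLeft (χ : Space → ℝ) (hχ : ContDiff ℝ ∞ χ) (φ : Test) : Test :=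
  ⟨fun x => χ x * φ x, hχ.mul φ.smooth, φ.compact.mul_left⟩

end Test

theorem L2.inner_eq (f g : L2) : inner ℝ f g = ∫ x, f x * g x := by
  rw [MeasureTheory.L2.inner_def]
  refine integral_congr_ae (Eventually.of_forall fun x => ?_)
  simp [mul_comm]

theorem L2.inner_test (f : L2) (φ : Test) : inner ℝ f φ.L = ∫ x, f x * φ x := by
  rw [L2.inner_eq]
  refine integral_congr_ae ?_
  filter_upwards [φ.coe_L] with x hx
  rw [hx]

theorem locallyIntegrable_L2 (f : L2) : LocallyIntegrable f (volume : Measure Space) :=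
  (Lp.memLp f).locallyIntegrable (by norm_num)

theorem L2.eq_of_inner_test {f g : L2} (h : ∀ φ : Test, inner ℝ f φ.L = inner ℝ g φ.L) : f = g := by
  apply Lp.ext
  refine ae_eq_of_integral_contDiff_smul_eq (locallyIntegrable_L2 f) (locallyIntegrable_L2 g) ?_
  intro φ h1 h2
  have e := h ⟨φ, h1, h2⟩
  have e1 := L2.inner_test f ⟨φ, h1, h2⟩
  have e2 := L2.inner_test g ⟨φ, h1, h2⟩
  simp only [smul_eq_mul, mul_comm (φ _)]
  exact e1.symm.trans (e.trans e2)

/-- `g` is the weak partial derivative of `f`, both in `L²`. -/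
def IsD (i : Fin 3) (f g : L2) : Prop := ∀ φ : Test, inner ℝ f (φ.d i).L = -inner ℝ g φ.L

open Classical in
/-- The weak partial derivative in `L²` (and `0` if there is none). -/
def D (i : Fin 3) (f : L2) : L2 := if h : ∃ g, IsD i f g then h.choose else 0

theorem IsD.unique {i : Fin 3} {f g g' : L2} (h : IsD i f g) (h' : IsD i f g') : g = g' :=
  L2.eq_of_inner_test fun φ => by linarith [h φ, h' φ]

theorem IsD.eq {i : Fin 3} {f g : L2} (h : IsD i f g) : D i f = g := by
  have h' : ∃ g, IsD i f g := ⟨g, h⟩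
  rw [D, dif_pos h']
  exact h'.choose_spec.unique h

theorem IsD.isD {i : Fin 3} {f g : L2} (h : IsD i f g) : IsD i f (D i f) := by rwa [h.eq]

theorem IsD.add {i : Fin 3} {f g f' g' : L2} (h : IsD i f g) (h' : IsD i f' g') :
    IsD i (f + f') (g + g') := fun φ => by
  rw [inner_add_left, inner_add_left, h, h']; ring

theorem IsD.smul {i : Fin 3} {f g : L2} (c : ℝ) (h : IsD i f g) : IsD i (c • f) (c • g) := fun φ => by
  rw [real_inner_smul_left, real_inner_smul_left, h]; ring

theorem isD_zero (i : Fin 3) : IsD i 0 0 := fun φ => by simp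

/-- The Sobolev space `H^m(ℝ³)` as a subspace of `L²`. -/
def Hs : ℕ → Submodule ℝ L2
  | 0 => ⊤
  | m + 1 =>
    { carrier := {f | ∀ i, ∃ g ∈ Hs m, IsD i f g}
      add_mem' := fun {a b} ha hb i => by
        obtain ⟨g, hg, h⟩ := ha i
        obtain ⟨g', hg', h'⟩ := hb i
        exact ⟨g + g', (Hs m).add_mem hg hg', h.add h'⟩
      zero_mem' := fun i => ⟨0, (Hs m).zero_mem, isD_zero i⟩
      smul_mem' := fun c {a} ha i => by
        obtain ⟨g, hg, h⟩ := ha i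
        exact ⟨c • g, (Hs m).smul_mem c hg, h.smul c⟩ }

@[simp] theorem mem_Hs_zero (f : L2) : f ∈ Hs 0 := by simp [Hs]

theorem mem_Hs_succ {m : ℕ} {f : L2} : f ∈ Hs (m + 1) ↔ ∀ i, ∃ g ∈ Hs m, IsD i f g := Iff.rfl

theorem Hs_mono_succ {m : ℕ} {f : L2} (h : f ∈ Hs (m + 1)) : f ∈ Hs m := by
  induction m generalizing f with
  | zero => simp
  | succ m ih =>
    intro i
    obtain ⟨g, hg, h⟩ := h i
    exact ⟨g, ih hg, h⟩

theorem Hs_mono {m n : ℕ} (hmn : m ≤ n) {f : L2} (h : f ∈ Hs n) : f ∈ Hs m := by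
  induction n, hmn using Nat.le_induction with
  | base => exact h
  | succ n _ ih => exact ih (Hs_mono_succ h)

theorem isD_of_mem {f : L2} (h : f ∈ Hs 1) (i : Fin 3) : IsD i f (D i f) := by
  obtain ⟨g, _, h⟩ := h i
  exact h.isD

theorem D_mem {m : ℕ} {f : L2} (h : f ∈ Hs (m + 1)) (i : Fin 3) : D i f ∈ Hs m := by
  obtain ⟨g, hg, h⟩ := h i
  rwa [h.eq]

theorem mem_Hs_of_D {m : ℕ} {f : L2} (h : f ∈ Hs 1) (hD : ∀ i, D i f ∈ Hs m) : f ∈ Hs (m + 1) :=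
  fun i => ⟨D i f, hD i, isD_of_mem h i⟩

theorem D_add {f g : L2} (hf : f ∈ Hs 1) (hg : g ∈ Hs 1) (i : Fin 3) : D i (f + g) = D i f + D i g :=
  ((isD_of_mem hf i).add (isD_of_mem hg i)).eq

theorem D_smul {f : L2} (hf : f ∈ Hs 1) (c : ℝ) (i : Fin 3) : D i (c • f) = c • D i f :=
  ((isD_of_mem hf i).smul c).eq

@[simp] theorem D_zero (i : Fin 3) : D i 0 = 0 := (isD_zero i).eq

theorem D_neg {f : L2} (hf : f ∈ Hs 1) (i : Fin 3) : D i (-f) = -D i f := by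
  simpa using D_smul hf (-1) i

theorem D_sub {f g : L2} (hf : f ∈ Hs 1) (hg : g ∈ Hs 1) (i : Fin 3) : D i (f - g) = D i f - D i g := by
  rw [sub_eq_add_neg, D_add hf ((Hs 1).neg_mem hg), D_neg hg, sub_eq_add_neg]

theorem D_sum {ι : Type*} (s : Finset ι) {f : ι → L2} (hf : ∀ k ∈ s, f k ∈ Hs 1) (i : Fin 3) :
    D i (∑ k ∈ s, f k) = ∑ k ∈ s, D i (f k) := by
  classical
  induction s using Finset.induction_on with
  | empty => simp
  | insert a s ha ih =>
    rw [Finset.sum_insert ha, Finset.sum_insert ha, D_add (hf a (by simp))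
      ((Hs 1).sum_mem fun k hk => hf k (by simp [hk])), ih fun k hk => hf k (by simp [hk])]

theorem D_comm {f : L2} (hf : f ∈ Hs 2) (i j : Fin 3) : D i (D j f) = D j (D i f) := by
  have h1 : f ∈ Hs 1 := Hs_mono_succ hf
  refine L2.eq_of_inner_test fun φ => ?_
  have a := isD_of_mem (D_mem hf j) i φ
  have b := isD_of_mem (D_mem hf i) j φ
  have a' := isD_of_mem h1 j (φ.d i)
  have b' := isD_of_mem h1 i (φ.d j)
  rw [Test.d_comm] at a'
  linarith

/-- An `ℓ¹`-type norm of `H^m`. -/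
def nm : ℕ → L2 → ℝ
  | 0, f => ‖f‖
  | m + 1, f => ‖f‖ + ∑ i, nm m (D i f)

theorem nm_succ (m : ℕ) (f : L2) : nm (m + 1) f = ‖f‖ + ∑ i, nm m (D i f) := rfl

theorem nm_nonneg (m : ℕ) (f : L2) : 0 ≤ nm m f := by
  induction m generalizing f with
  | zero => exact norm_nonneg _
  | succ m ih => exact add_nonneg (norm_nonneg _) (Finset.sum_nonneg fun i _ => ih _)

theorem norm_le_nm (m : ℕ) (f : L2) : ‖f‖ ≤ nm m f := by
  cases m with
  | zero => exact le_rfl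
  | succ m => exact le_add_of_nonneg_right (Finset.sum_nonneg fun i _ => nm_nonneg _ _)

theorem nm_D_le (m : ℕ) (f : L2) (i : Fin 3) : nm m (D i f) ≤ nm (m + 1) f := by
  rw [nm_succ]
  have := Finset.single_le_sum (f := fun i => nm m (D i f)) (fun i _ => nm_nonneg _ _)
    (Finset.mem_univ i)
  linarith [norm_nonneg f]

theorem norm_D_le (m : ℕ) (f : L2) (i : Fin 3) : ‖D i f‖ ≤ nm (m + 1) f :=
  (norm_le_nm m _).trans (nm_D_le m f i)

theorem nm_mono_succ (m : ℕ) (f : L2) : nm m f ≤ nm (m + 1) f := by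
  induction m generalizing f with
  | zero => exact norm_le_nm 1 f
  | succ m ih => rw [nm_succ, nm_succ (m + 1)]; gcongr; exact ih _

theorem nm_mono {m n : ℕ} (h : m ≤ n) (f : L2) : nm m f ≤ nm n f := by
  induction n, h using Nat.le_induction with
  | base => exact le_rfl
  | succ n _ ih => exact ih.trans (nm_mono_succ n f)

theorem nm_add_le {m : ℕ} {f g : L2} (hf : f ∈ Hs m) (hg : g ∈ Hs m) :
    nm m (f + g) ≤ nm m f + nm m g := by
  induction m generalizing f g with
  | zero => exact norm_add_le _ _
  | succ m ih =>
    have hf1 : f ∈ Hs 1 := Hs_mono (by omega) hf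
    have hg1 : g ∈ Hs 1 := Hs_mono (by omega) hg
    have h := Finset.sum_le_sum fun (i : Fin 3) (_ : i ∈ Finset.univ) =>
      (congrArg (nm m) (D_add hf1 hg1 i)).trans_le (ih (D_mem hf i) (D_mem hg i))
    rw [Finset.sum_add_distrib] at h
    rw [nm_succ, nm_succ, nm_succ]
    linarith [norm_add_le f g]

theorem nm_smul {m : ℕ} {f : L2} (hf : f ∈ Hs m) (c : ℝ) : nm m (c • f) = |c| * nm m f := by
  induction m generalizing f with
  | zero => simp [nm, norm_smul]
  | succ m ih =>
    have hf1 : f ∈ Hs 1 := Hs_mono (by omega) hf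
    rw [nm_succ, nm_succ, norm_smul, Real.norm_eq_abs, mul_add, Finset.mul_sum]
    congr 1
    refine Finset.sum_congr rfl fun i _ => ?_
    rw [D_smul hf1, ih (D_mem hf i)]

theorem nm_neg {m : ℕ} {f : L2} (hf : f ∈ Hs m) : nm m (-f) = nm m f := by
  simpa using nm_smul hf (-1)

theorem nm_sub_le {m : ℕ} {f g : L2} (hf : f ∈ Hs m) (hg : g ∈ Hs m) :
    nm m (f - g) ≤ nm m f + nm m g := by
  rw [sub_eq_add_neg, ← nm_neg hg]
  exact nm_add_le hf ((Hs m).neg_mem hg)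

@[simp] theorem nm_zero_right (m : ℕ) : nm m (0 : L2) = 0 := by
  simpa using nm_smul (Hs m).zero_mem 0

theorem nm_sum_le {m : ℕ} {ι : Type*} (s : Finset ι) {f : ι → L2} (hf : ∀ k ∈ s, f k ∈ Hs m) :
    nm m (∑ k ∈ s, f k) ≤ ∑ k ∈ s, nm m (f k) := by
  classical
  induction s using Finset.induction_on with
  | empty => simp
  | insert a s ha ih =>
    rw [Finset.sum_insert ha, Finset.sum_insert ha]
    have := nm_add_le (hf a (by simp)) ((Hs m).sum_mem fun k (hk : k ∈ s) => hf k (by simp [hk]))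
    linarith [ih fun k hk => hf k (by simp [hk])]

theorem IsD.of_tendsto {ι : Type*} {l : Filter ι} [l.NeBot] {i : Fin 3} {f g : L2} {F G : ι → L2}
    (hF : Tendsto F l (𝓝 f)) (hG : Tendsto G l (𝓝 g)) (h : ∀ n, IsD i (F n) (G n)) : IsD i f g := by
  intro φ
  have a : Tendsto (fun n => inner ℝ (F n) (φ.d i).L) l (𝓝 (inner ℝ f (φ.d i).L)) :=
    hF.inner tendsto_const_nhds
  have b : Tendsto (fun n => -inner ℝ (G n) φ.L) l (𝓝 (-inner ℝ g φ.L)) :=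
    (hG.inner tendsto_const_nhds).neg
  refine tendsto_nhds_unique a (b.congr fun n => (h n φ).symm)

/-! ### Test functions in `L²` -/

theorem integral_mul_fderiv_basisVec {f g : Space → ℝ} (hf : ContDiff ℝ 1 f) (hg : ContDiff ℝ 1 g)
    (hc : HasCompactSupport g) (i : Fin 3) :
    ∫ x, f x * fderiv ℝ g x (basisVec i) = -∫ x, fderiv ℝ f x (basisVec i) * g x := by
  have hf' : Continuous fun x => fderiv ℝ f x (basisVec i) :=
    (hf.continuous_fderiv one_ne_zero).clm_apply continuous_const
  have hg' : Continuous fun x => fderiv ℝ g x (basisVec i) :=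
    (hg.continuous_fderiv one_ne_zero).clm_apply continuous_const
  refine integral_mul_fderiv_eq_neg_fderiv_mul_of_integrable ?_ ?_ ?_
    (fun x _ => hf.differentiable one_ne_zero x) (fun x _ => hg.differentiable one_ne_zero x)
  · exact (hf'.mul hg.continuous).integrable_of_hasCompactSupport hc.mul_left
  · exact (hf.continuous.mul hg').integrable_of_hasCompactSupport
      (hc.fderiv_apply ℝ (basisVec i)).mul_left
  · exact (hf.continuous.mul hg.continuous).integrable_of_hasCompactSupport hc.mul_left

theorem Test.isD (φ : Test) (i : Fin 3) : IsD i φ.L (φ.d i).L := by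
  intro ψ
  rw [real_inner_comm, L2.inner_test, real_inner_comm, L2.inner_test]
  have := integral_mul_fderiv_basisVec (contDiff_infty.1 φ.smooth 1)
    (contDiff_infty.1 ψ.smooth 1) ψ.compact i
  calc ∫ x, (ψ.d i).L x * φ x = ∫ x, φ x * fderiv ℝ ψ x (basisVec i) := by
        refine integral_congr_ae ?_
        filter_upwards [(ψ.d i).coe_L] with x hx
        rw [hx, mul_comm]; rfl
    _ = _ := this
    _ = _ := by
        congr 1
        refine integral_congr_ae ?_
        filter_upwards [ψ.coe_L] with x hx
        rw [hx, mul_comm]; rfl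

theorem Test.D_L (φ : Test) (i : Fin 3) : D i φ.L = (φ.d i).L := (φ.isD i).eq

theorem Test.mem_Hs (φ : Test) (m : ℕ) : φ.L ∈ Hs m := by
  induction m generalizing φ with
  | zero => simp
  | succ m ih => exact fun i => ⟨_, ih (φ.d i), φ.isD i⟩

/-! ### Translations and difference quotients -/

/-- Translation by `v` on `L²`. -/
def trans (v : Space) : L2 →ₗᵢ[ℝ] L2 :=
  Lp.compMeasurePreservingₗᵢ ℝ (fun x => x + v) (measurePreserving_add_right volume v)

theorem coe_trans (v : Space) (f : L2) : (trans v f : Space → ℝ) =ᵐ[volume] fun x => f (x + v) :=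
  Lp.coeFn_compMeasurePreserving _ _

theorem norm_trans (v : Space) (f : L2) : ‖trans v f‖ = ‖f‖ := (trans v).norm_map f

theorem continuous_trans (f : L2) : Continuous fun v => trans v f := by
  refine Continuous.compMeasurePreservingLp (f := fun _ => f)
    (g := fun v : Space => (⟨fun x => x + v, by fun_prop⟩ : C(Space, Space))) continuous_const ?_
    (fun v => measurePreserving_add_right volume v) (by norm_num)
  refine ContinuousMap.continuous_of_continuous_uncurry _ ?_
  simp only [Function.uncurry_def, ContinuousMap.coe_mk]
  fun_prop

theorem trans_zero (f : L2) : trans 0 f = f := by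
  apply Lp.ext
  filter_upwards [coe_trans 0 f] with x hx
  simpa using hx

theorem trans_trans (v w : Space) (f : L2) : trans v (trans w f) = trans (v + w) f := by
  apply Lp.ext
  have h := (measurePreserving_add_right (volume : Measure Space) v).quasiMeasurePreserving.ae
    (coe_trans w f)
  filter_upwards [coe_trans v (trans w f), coe_trans (v + w) f, h] with x h1 h2 h3
  rw [h1, h2, h3, add_assoc]

theorem inner_trans (v : Space) (f g : L2) : inner ℝ (trans v f) g = inner ℝ f (trans (-v) g) := by
  have := (trans v).inner_map_map f (trans (-v) g)
  rw [trans_trans, add_neg_cancel, trans_zero] at this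
  exact this

/-- Translate of a test function. -/
def Test.shift (v : Space) (φ : Test) : Test :=
  ⟨fun x => φ (x + v), φ.smooth.comp (contDiff_id.add contDiff_const),
    φ.compact.comp_homeomorph (Homeomorph.addRight v)⟩

theorem Test.trans_L (v : Space) (φ : Test) : trans v φ.L = (φ.shift v).L := by
  apply Lp.ext
  have h := (measurePreserving_add_right (volume : Measure Space) v).quasiMeasurePreserving.ae
    φ.coe_L
  filter_upwards [coe_trans v φ.L, (φ.shift v).coe_L, h] with x h1 h2 h3
  rw [h1, h2, h3]; rfl

theorem Test.shift_d (v : Space) (φ : Test) (i : Fin 3) : (φ.shift v).d i = (φ.d i).shift v := by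
  apply Subtype.ext
  funext x
  change fderiv ℝ (fun y => φ (y + v)) x (basisVec i) = fderiv ℝ φ (x + v) (basisVec i)
  rw [fderiv_comp_add_right]

theorem IsD.trans {i : Fin 3} {f g : L2} (h : IsD i f g) (v : Space) :
    IsD i (trans v f) (trans v g) := by
  intro φ
  rw [inner_trans, inner_trans, Test.trans_L, Test.trans_L, ← Test.shift_d]
  exact h _

theorem D_trans {f : L2} (hf : f ∈ Hs 1) (v : Space) (i : Fin 3) :
    D i (trans v f) = trans v (D i f) := ((isD_of_mem hf i).trans v).eq

theorem trans_mem {m : ℕ} {f : L2} (hf : f ∈ Hs m) (v : Space) : trans v f ∈ Hs m := by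
  induction m generalizing f with
  | zero => simp
  | succ m ih => exact fun i => ⟨_, ih (D_mem hf i), (isD_of_mem (Hs_mono (by omega) hf) i).trans v⟩

/-- The difference quotient in direction `i` with step `h`, as a bounded operator on `L²`. -/
def dq (i : Fin 3) (h : ℝ) : L2 →L[ℝ] L2 :=
  h⁻¹ • ((trans (h • basisVec i)).toContinuousLinearMap - ContinuousLinearMap.id ℝ L2)

theorem dq_apply (i : Fin 3) (h : ℝ) (f : L2) :
    dq i h f = h⁻¹ • (trans (h • basisVec i) f - f) := rfl

theorem inner_dq (i : Fin 3) (h : ℝ) (f g : L2) :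
    inner ℝ (dq i h f) g = -inner ℝ f (dq i (-h) g) := by
  rw [dq_apply, dq_apply, real_inner_smul_left, real_inner_smul_right, inner_sub_left,
    inner_sub_right, inner_trans, neg_smul, inv_neg]
  ring

theorem dq_mem {m : ℕ} {f : L2} (hf : f ∈ Hs m) (i : Fin 3) (h : ℝ) : dq i h f ∈ Hs m :=
  (Hs m).smul_mem _ ((Hs m).sub_mem (trans_mem hf _) hf)

theorem D_dq {f : L2} (hf : f ∈ Hs 1) (i j : Fin 3) (h : ℝ) : D j (dq i h f) = dq i h (D j f) := by
  rw [dq_apply, dq_apply, D_smul ((Hs 1).sub_mem (trans_mem hf _) hf),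
    D_sub (trans_mem hf _) hf, D_trans hf]

/-! ### Multiplication by bounded functions -/

/-- `|a| ≤ K` almost everywhere. -/
def Bdd (a : L2) (K : ℝ) : Prop := ∀ᵐ x, |a x| ≤ K

theorem Bdd.nonneg {a : L2} {K : ℝ} (h : Bdd a K) : 0 ≤ K := by
  obtain ⟨x, hx⟩ := h.exists
  exact (abs_nonneg _).trans hx

theorem Bdd.mono {a : L2} {K K' : ℝ} (h : Bdd a K) (hK : K ≤ K') : Bdd a K' :=
  Filter.Eventually.mono h fun _ hx => le_trans hx hK

theorem Bdd.memLp {a : L2} {K : ℝ} (h : Bdd a K) (f : L2) :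
    MemLp (fun x => a x * f x) 2 (volume : Measure Space) := by
  refine MemLp.of_le_mul (c := K) (Lp.memLp f)
    ((Lp.aestronglyMeasurable a).mul (Lp.aestronglyMeasurable f)) ?_
  filter_upwards [h] with x hx
  rw [norm_mul, Real.norm_eq_abs]
  gcongr

open Classical in
/-- Multiplication by the essentially bounded function `a` as an operator on `L²`
(and `0` if `a` is not essentially bounded). -/
def Mu (a : L2) : L2 →L[ℝ] L2 :=
  if h : ∃ K, Bdd a K then
    LinearMap.mkContinuous
      { toFun := fun f => (h.choose_spec.memLp f).toLp _
        map_add' := fun f g => by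
          rw [← MemLp.toLp_add]
          refine (MemLp.toLp_eq_toLp_iff _ _).2 ?_
          filter_upwards [Lp.coeFn_add f g] with x hx
          rw [hx, Pi.add_apply, mul_add]; rfl
        map_smul' := fun c f => by
          rw [RingHom.id_apply, ← MemLp.toLp_const_smul]
          refine (MemLp.toLp_eq_toLp_iff _ _).2 ?_
          filter_upwards [Lp.coeFn_smul c f] with x hx
          rw [hx, Pi.smul_apply, smul_eq_mul, mul_left_comm]; rfl } h.choose
      fun f => by
        refine Lp.norm_le_mul_norm_of_ae_le_mul ?_
        filter_upwards [h.choose_spec, (h.choose_spec.memLp f).coeFn_toLp] with x hx hx'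
        simp only [LinearMap.coe_mk, AddHom.coe_mk]
        rw [hx', norm_mul, Real.norm_eq_abs]
        gcongr
  else 0

theorem coe_Mu {a : L2} {K : ℝ} (h : Bdd a K) (f : L2) :
    (Mu a f : Space → ℝ) =ᵐ[volume] fun x => a x * f x := by
  have h' : ∃ K, Bdd a K := ⟨K, h⟩
  rw [Mu, dif_pos h']
  exact (h'.choose_spec.memLp f).coeFn_toLp

theorem Mu_of_not {a : L2} (h : ¬ ∃ K, Bdd a K) : Mu a = 0 := dif_neg h

theorem norm_Mu_le {a : L2} {K : ℝ} (h : Bdd a K) (f : L2) : ‖Mu a f‖ ≤ K * ‖f‖ := by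
  refine Lp.norm_le_mul_norm_of_ae_le_mul ?_
  filter_upwards [h, coe_Mu h f] with x hx hx'
  rw [hx', norm_mul, Real.norm_eq_abs]
  gcongr

theorem inner_Mu (a f g : L2) : inner ℝ (Mu a f) g = inner ℝ f (Mu a g) := by
  by_cases h : ∃ K, Bdd a K
  · obtain ⟨K, h⟩ := h
    rw [L2.inner_eq, L2.inner_eq]
    refine integral_congr_ae ?_
    filter_upwards [coe_Mu h f, coe_Mu h g] with x h1 h2
    rw [h1, h2]; ring
  · simp [Mu_of_not h]

theorem Mu_Mu_comm (a b f : L2) : Mu a (Mu b f) = Mu b (Mu a f) := by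
  by_cases ha : ∃ K, Bdd a K
  · by_cases hb : ∃ K, Bdd b K
    · obtain ⟨K, ha⟩ := ha
      obtain ⟨K', hb⟩ := hb
      apply Lp.ext
      filter_upwards [coe_Mu ha f, coe_Mu hb f, coe_Mu ha (Mu b f), coe_Mu hb (Mu a f)]
        with x h1 h2 h3 h4
      rw [h3, h4, h1, h2]; ring
    · simp [Mu_of_not hb]
  · simp [Mu_of_not ha]

theorem Mu_comm {a b : L2} {K K' : ℝ} (ha : Bdd a K) (hb : Bdd b K') : Mu a b = Mu b a := by
  apply Lp.ext
  filter_upwards [coe_Mu ha b, coe_Mu hb a] with x h1 h2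
  rw [h1, h2]; ring

theorem Bdd.Mu {a b : L2} {K K' : ℝ} (ha : Bdd a K) (hb : Bdd b K') : Bdd (Mu a b) (K * K') := by
  filter_upwards [ha, hb, coe_Mu ha b] with x h1 h2 h3
  rw [h3, abs_mul]
  have := ha.nonneg
  gcongr

theorem Mu_Mu {a b : L2} {K K' : ℝ} (ha : Bdd a K) (hb : Bdd b K') (f : L2) :
    Mu (Mu a b) f = Mu a (Mu b f) := by
  apply Lp.ext
  filter_upwards [coe_Mu ha b, coe_Mu hb f, coe_Mu ha (Mu b f), coe_Mu (ha.Mu hb) f]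
    with x h1 h2 h3 h4
  rw [h3, h4, h1, h2]; ring

theorem Bdd.add {a b : L2} {K K' : ℝ} (ha : Bdd a K) (hb : Bdd b K') : Bdd (a + b) (K + K') := by
  filter_upwards [ha, hb, Lp.coeFn_add a b] with x h1 h2 h3
  rw [h3]
  exact (abs_add_le _ _).trans (add_le_add h1 h2)

theorem Bdd.smul {a : L2} {K : ℝ} (ha : Bdd a K) (c : ℝ) : Bdd (c • a) (|c| * K) := by
  filter_upwards [ha, Lp.coeFn_smul c a] with x h1 h3
  rw [h3, Pi.smul_apply, smul_eq_mul, abs_mul]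
  gcongr

theorem Mu_add_left {a b : L2} {K K' : ℝ} (ha : Bdd a K) (hb : Bdd b K') (f : L2) :
    Mu (a + b) f = Mu a f + Mu b f := by
  apply Lp.ext
  filter_upwards [coe_Mu ha f, coe_Mu hb f, coe_Mu (ha.add hb) f, Lp.coeFn_add a b,
    Lp.coeFn_add (Mu a f) (Mu b f)] with x h1 h2 h3 h4 h5
  rw [h3, h5, h4, Pi.add_apply, Pi.add_apply, h1, h2]; ring

theorem Mu_smul_left {a : L2} {K : ℝ} (ha : Bdd a K) (c : ℝ) (f : L2) :
    Mu (c • a) f = c • Mu a f := by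
  apply Lp.ext
  filter_upwards [coe_Mu ha f, coe_Mu (ha.smul c) f, Lp.coeFn_smul c a,
    Lp.coeFn_smul c (Mu a f)] with x h1 h2 h3 h4
  rw [h2, h3, h4, Pi.smul_apply, Pi.smul_apply, h1]; simp [mul_assoc]

theorem Test.exists_bdd (φ : Test) : ∃ K, (∀ x, |φ x| ≤ K) ∧ Bdd φ.L K := by
  obtain ⟨K, hK⟩ := φ.compact.exists_bound_of_continuous φ.continuous
  refine ⟨K, hK, ?_⟩
  filter_upwards [φ.coe_L] with x hx
  rw [hx]; exact hK x

theorem Test.coe_Mu (φ : Test) (f : L2) : (Mu φ.L f : Space → ℝ) =ᵐ[volume] fun x => φ x * f x := by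
  obtain ⟨K, _, h⟩ := φ.exists_bdd
  filter_upwards [OldroydB.coe_Mu h f, φ.coe_L] with x h1 h2
  rw [h1, h2]

theorem Test.isD_Mu (φ : Test) {i : Fin 3} {f g : L2} (h : IsD i f g) :
    IsD i (Mu φ.L f) (Mu φ.L g + Mu (φ.d i).L f) := by
  intro ψ
  have e1 : ∀ χ η : Test, Mu χ.L η.L = (Test.smulLeft χ χ.smooth η).L := by
    intro χ η
    apply Lp.ext
    filter_upwards [χ.coe_Mu η.L, η.coe_L, (Test.smulLeft χ χ.smooth η).coe_L] with x h1 h2 h3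
    rw [h1, h2, h3]; rfl
  have e2 : ((Test.smulLeft φ φ.smooth ψ).d i).L
      = (Test.smulLeft φ φ.smooth (ψ.d i)).L + (Test.smulLeft (φ.d i) (φ.d i).smooth ψ).L := by
    apply Lp.ext
    filter_upwards [Test.coe_L ((Test.smulLeft φ φ.smooth ψ).d i),
      (Test.smulLeft φ φ.smooth (ψ.d i)).coe_L, (Test.smulLeft (φ.d i) (φ.d i).smooth ψ).coe_L,
      Lp.coeFn_add (Test.smulLeft φ φ.smooth (ψ.d i)).L (Test.smulLeft (φ.d i) (φ.d i).smooth ψ).L]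
      with x h1 h2 h3 h4
    rw [h1, h4, Pi.add_apply, h2, h3]
    change fderiv ℝ (fun y => φ y * ψ y) x (basisVec i) = φ x * fderiv ℝ ψ x (basisVec i)
      + fderiv ℝ φ x (basisVec i) * ψ x
    rw [fderiv_fun_mul (φ.differentiable x) (ψ.differentiable x)]
    simp; ring
  have := h (Test.smulLeft φ φ.smooth ψ)
  rw [e2, inner_add_right] at this
  rw [inner_add_left, inner_Mu, inner_Mu, inner_Mu, e1, e1, e1]
  linarith

/-! ### Mollification -/

/-- The convolution of `f` with a test function. -/
def conv (φ : Test) (f : L2) : Space → ℝ :=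
  MeasureTheory.convolution f φ (ContinuousLinearMap.lsmul ℝ ℝ) volume

theorem conv_apply (φ : Test) (f : L2) (x : Space) : conv φ f x = ∫ t, f t * φ (x - t) := rfl

theorem conv_apply' (φ : Test) (f : L2) (x : Space) : conv φ f x = ∫ t, φ t * f (x - t) := by
  rw [conv_apply, ← integral_sub_left_eq_self (fun t => φ t * f (x - t)) volume x]
  simp [mul_comm]

theorem conv_contDiff (φ : Test) (f : L2) : ContDiff ℝ ∞ (conv φ f) :=
  φ.compact.contDiff_convolution_right _ (locallyIntegrable_L2 f) φ.smooth

/-- The function `t ↦ φ(x - t)`. -/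
def Test.reflect (x : Space) (φ : Test) : Test :=
  ⟨fun t => φ (x - t), φ.smooth.comp (contDiff_const.sub contDiff_id),
    φ.compact.comp_homeomorph (Homeomorph.subLeft x)⟩

theorem conv_fderiv {i : Fin 3} {f g : L2} (h : IsD i f g) (φ : Test) (x : Space) :
    fderiv ℝ (conv φ f) x (basisVec i) = conv φ g x := by
  have h1 : HasFDerivAt (conv φ f) _ x :=
    φ.compact.hasFDerivAt_convolution_right (ContinuousLinearMap.lsmul ℝ ℝ)
      (locallyIntegrable_L2 f) (contDiff_infty.1 φ.smooth 1) x
  have e1 := h (φ.reflect x)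
  rw [L2.inner_test, L2.inner_test] at e1
  have e2 : ∀ t, (φ.reflect x).d i t = -(φ.d i (x - t)) := by
    intro t
    change fderiv ℝ (fun t => φ (x - t)) t (basisVec i) = -(fderiv ℝ φ (x - t) (basisVec i))
    have := ((φ.differentiable (x - t)).hasFDerivAt.comp t
      ((hasFDerivAt_const x t).sub (hasFDerivAt_id t))).fderiv
    have h2 : fderiv ℝ (fun t => φ (x - t)) t = _ := this
    rw [h2]
    simp
  have e3 : conv (φ.d i) f x = conv φ g x := by
    rw [conv_apply, conv_apply]
    simp only [e2, mul_neg, integral_neg, neg_inj] at e1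
    exact e1
  rw [← e3, h1.fderiv, conv_apply]
  have hc : ConvolutionExistsAt f (fderiv ℝ φ) x
      ((ContinuousLinearMap.lsmul ℝ ℝ).precompR Space) volume :=
    (φ.compact.fderiv ℝ).convolutionExists_right _ (locallyIntegrable_L2 f)
      (φ.smooth.continuous_fderiv (by simp)) x
  rw [convolution_def, ContinuousLinearMap.integral_apply hc]
  rfl

/-- A nonnegative test function of mass one. -/
structure Mollifier (φ : Test) : Prop where
  nonneg : ∀ x, 0 ≤ φ x
  mass : ∫ x, φ x = 1

theorem conv_sub_sq_le {φ : Test} (hφ : Mollifier φ) (f : L2) :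
    ∫⁻ x, ‖conv φ f x - f x‖ₑ ^ 2
      ≤ ∫⁻ t, ENNReal.ofReal (φ t) * ‖trans (-t) f - f‖ₑ ^ 2 := by
  set ν : Measure Space := volume.withDensity fun t => ENNReal.ofReal (φ t) with hν
  have hm : Measurable fun t => ENNReal.ofReal (φ t) := φ.continuous.measurable.ennreal_ofReal
  have hprob : IsProbabilityMeasure ν := by
    constructor
    rw [hν, withDensity_apply _ MeasurableSet.univ, setLIntegral_univ,
      ← ofReal_integral_eq_lintegral_ofReal ((memLp_one_iff_integrable).1 (φ.memLp 1))
        (Eventually.of_forall hφ.nonneg), hφ.mass, ENNReal.ofReal_one]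
  have hf : StronglyMeasurable (f : Space → ℝ) := Lp.stronglyMeasurable f
  have hfm : Measurable (f : Space → ℝ) := hf.measurable
  have hk : ∀ x, Measurable fun t => f (x - t) - f x := fun x =>
    (hfm.comp (measurable_const.sub measurable_id)).sub measurable_const
  have hpt : ∀ x, ‖conv φ f x - f x‖ₑ ^ 2
      ≤ ∫⁻ t, ENNReal.ofReal (φ t) * ‖f (x - t) - f x‖ₑ ^ 2 := by
    intro x
    have hloc : Integrable (fun t => φ t * f (x - t)) := by
      have := (φ.compact.convolutionExists_left (ContinuousLinearMap.lsmul ℝ ℝ)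
        φ.continuous (locallyIntegrable_L2 f)) x
      exact this
    have h1 : conv φ f x - f x = ∫ t, φ t * (f (x - t) - f x) := by
      simp only [mul_sub]
      rw [integral_sub hloc (((memLp_one_iff_integrable).1 (φ.memLp 1)).mul_const _),
        integral_mul_const, hφ.mass, one_mul, conv_apply']
    have h2 : ‖conv φ f x - f x‖ₑ ≤ eLpNorm (fun t => f (x - t) - f x) 1 ν := by
      rw [h1, eLpNorm_one_eq_lintegral_enorm, hν,
        lintegral_withDensity_eq_lintegral_mul _ hm (hk x).enorm]
      refine (enorm_integral_le_lintegral_enorm _).trans (le_of_eq ?_)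
      refine lintegral_congr fun t => ?_
      rw [enorm_mul, Pi.mul_apply, Real.enorm_eq_ofReal (hφ.nonneg t)]
    have h3 : eLpNorm (fun t => f (x - t) - f x) 1 ν ≤ eLpNorm (fun t => f (x - t) - f x) 2 ν :=
      eLpNorm_le_eLpNorm_of_exponent_le (by norm_num) (hk x).aestronglyMeasurable
    have h4 : eLpNorm (fun t => f (x - t) - f x) 2 ν ^ 2
        = ∫⁻ t, ENNReal.ofReal (φ t) * ‖f (x - t) - f x‖ₑ ^ 2 := by
      have := eLpNorm_nnreal_pow_eq_lintegral (μ := ν) (f := fun t => f (x - t) - f x)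
        (p := 2) (by norm_num)
      simp only [NNReal.coe_ofNat, ENNReal.coe_ofNat, ENNReal.rpow_ofNat] at this
      rw [this, hν, lintegral_withDensity_eq_lintegral_mul _ hm ((hk x).enorm.pow_const 2)]
      rfl
    rw [← h4]
    gcongr
    exact h2.trans h3
  calc ∫⁻ x, ‖conv φ f x - f x‖ₑ ^ 2
      ≤ ∫⁻ x, ∫⁻ t, ENNReal.ofReal (φ t) * ‖f (x - t) - f x‖ₑ ^ 2 := lintegral_mono hpt
    _ = ∫⁻ t, ∫⁻ x, ENNReal.ofReal (φ t) * ‖f (x - t) - f x‖ₑ ^ 2 := by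
        refine lintegral_lintegral_swap ?_
        refine Measurable.aemeasurable ?_
        refine (hm.comp measurable_snd).mul (Measurable.pow_const (Measurable.enorm ?_) 2)
        exact (hfm.comp (measurable_fst.sub measurable_snd)).sub (hfm.comp measurable_fst)
    _ = _ := by
        refine lintegral_congr fun t => ?_
        rw [lintegral_const_mul' _ _ ENNReal.ofReal_ne_top]
        congr 1
        have := eLpNorm_nnreal_pow_eq_lintegral (μ := (volume : Measure Space))
          (f := (trans (-t) f - f : L2)) (p := 2) (by norm_num)
        simp only [NNReal.coe_ofNat, ENNReal.coe_ofNat, ENNReal.rpow_ofNat] at this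
        rw [Lp.enorm_def, this]
        refine lintegral_congr_ae ?_
        filter_upwards [coe_trans (-t) f, Lp.coeFn_sub (trans (-t) f) f] with x h1 h2
        rw [h2, Pi.sub_apply, h1, sub_eq_add_neg x t]

theorem conv_sub_le {φ : Test} (hφ : Mollifier φ) (f : L2) {ε : ℝ}
    (h : ∀ t, φ t ≠ 0 → ‖trans (-t) f - f‖ ≤ ε) :
    ∫⁻ x, ‖conv φ f x - f x‖ₑ ^ 2 ≤ ENNReal.ofReal ε ^ 2 := by
  refine (conv_sub_sq_le hφ f).trans ?_
  calc ∫⁻ t, ENNReal.ofReal (φ t) * ‖trans (-t) f - f‖ₑ ^ 2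
      ≤ ∫⁻ t, ENNReal.ofReal (φ t) * ENNReal.ofReal ε ^ 2 := by
        refine lintegral_mono fun t => ?_
        by_cases ht : φ t = (0 : ℝ)
        · simp [ht]
        · rw [← ofReal_norm]
          gcongr
          exact h t ht
    _ = _ := by
        rw [lintegral_mul_const' _ _ (by finiteness),
          ← ofReal_integral_eq_lintegral_ofReal ((memLp_one_iff_integrable).1 (φ.memLp 1))
          (Eventually.of_forall hφ.nonneg), hφ.mass, ENNReal.ofReal_one, one_mul]

theorem conv_memLp {φ : Test} (hφ : Mollifier φ) (f : L2) : MemLp (conv φ f) 2 volume := by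
  have h1 : MemLp (fun x => conv φ f x - f x) 2 (volume : Measure Space) := by
    refine ⟨((conv_contDiff φ f).continuous.aestronglyMeasurable).sub
      (Lp.aestronglyMeasurable f), ?_⟩
    have h := conv_sub_le hφ f (ε := 2 * ‖f‖) fun t _ =>
      (norm_sub_le _ _).trans (by rw [norm_trans]; linarith)
    have e := eLpNorm_nnreal_pow_eq_lintegral (μ := (volume : Measure Space))
      (f := fun x => conv φ f x - f x) (p := 2) (by norm_num)
    simp only [NNReal.coe_ofNat, ENNReal.coe_ofNat, ENNReal.rpow_ofNat] at e
    rw [← e] at h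
    by_contra hc
    rw [not_lt, top_le_iff] at hc
    rw [hc] at h
    exact absurd h (by rw [ENNReal.top_pow two_ne_zero, not_le]; exact ENNReal.pow_lt_top ENNReal.ofReal_lt_top)
  have := h1.add (Lp.memLp f)
  refine this.ae_eq (Eventually.of_forall fun x => ?_)
  simp

/-- Mollification as an element of `L²`. -/
def cv {φ : Test} (hφ : Mollifier φ) (f : L2) : L2 := (conv_memLp hφ f).toLp _

theorem coe_cv {φ : Test} (hφ : Mollifier φ) (f : L2) : (cv hφ f : Space → ℝ) =ᵐ[volume] conv φ f :=
  MemLp.coeFn_toLp _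

theorem norm_cv_sub_le {φ : Test} (hφ : Mollifier φ) (f : L2) {ε : ℝ} (hε : 0 ≤ ε)
    (h : ∀ t, φ t ≠ 0 → ‖trans (-t) f - f‖ ≤ ε) : ‖cv hφ f - f‖ ≤ ε := by
  have h1 := conv_sub_le hφ f h
  have e := eLpNorm_nnreal_pow_eq_lintegral (μ := (volume : Measure Space))
      (f := (cv hφ f - f : L2)) (p := 2) (by norm_num)
  simp only [NNReal.coe_ofNat, ENNReal.coe_ofNat, ENNReal.rpow_ofNat] at e
  have e2 : ∫⁻ x, ‖(cv hφ f - f : L2) x‖ₑ ^ 2 = ∫⁻ x, ‖conv φ f x - f x‖ₑ ^ 2 := by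
    refine lintegral_congr_ae ?_
    filter_upwards [coe_cv hφ f, Lp.coeFn_sub (cv hφ f) f] with x a b
    rw [b, Pi.sub_apply, a]
  rw [← e2, ← e, ← Lp.enorm_def, ← ofReal_norm] at h1
  have := (ENNReal.pow_le_pow_left_iff two_ne_zero).1 h1
  exact (ENNReal.ofReal_le_ofReal_iff hε).1 this

theorem IsD.cv {φ : Test} (hφ : Mollifier φ) {i : Fin 3} {f g : L2} (h : IsD i f g) :
    IsD i (cv hφ f) (cv hφ g) := by
  intro ψ
  rw [L2.inner_test, L2.inner_test]
  have := integral_mul_fderiv_basisVec (contDiff_infty.1 (conv_contDiff φ f) 1)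
    (contDiff_infty.1 ψ.smooth 1) ψ.compact i
  simp only [conv_fderiv h] at this
  calc _ = _ := by
        refine integral_congr_ae ?_
        filter_upwards [coe_cv hφ f] with x hx
        rw [hx]; rfl
    _ = _ := this
    _ = _ := by
        congr 1
        refine integral_congr_ae ?_
        filter_upwards [coe_cv hφ g] with x hx
        rw [hx]

theorem cv_mem {φ : Test} (hφ : Mollifier φ) {m : ℕ} {f : L2} (h : f ∈ Hs m) : cv hφ f ∈ Hs m := by
  induction m generalizing f with
  | zero => simp
  | succ m ih => exact fun i => ⟨_, ih (D_mem h i), (isD_of_mem (Hs_mono (by omega) h) i).cv hφ⟩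

theorem tendsto_nm_cv {φ : ℕ → Test} (hφ : ∀ n, Mollifier (φ n))
    (hs : ∀ r > 0, ∀ᶠ n in atTop, ∀ t, φ n t ≠ 0 → ‖t‖ < r) {m : ℕ} {f : L2} (hf : f ∈ Hs m) :
    Tendsto (fun n => nm m (cv (hφ n) f - f)) atTop (𝓝 0) := by
  have base : ∀ f : L2, Tendsto (fun n => ‖cv (hφ n) f - f‖) atTop (𝓝 0) := by
    intro f
    rw [Metric.tendsto_nhds]
    intro ε hε
    have hc := Metric.continuousAt_iff.1 ((continuous_trans f).continuousAt (x := (0 : Space)))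
      (ε / 2) (half_pos hε)
    obtain ⟨r, hr, H⟩ := hc
    filter_upwards [hs r hr] with n hn
    rw [dist_zero_right, norm_norm]
    refine lt_of_le_of_lt (norm_cv_sub_le (hφ n) f (half_pos hε).le fun t ht => ?_) (half_lt_self hε)
    have h2 := H (x := -t) (by simpa using hn t ht)
    rw [trans_zero, dist_eq_norm] at h2
    exact h2.le
  induction m generalizing f with
  | zero => exact base f
  | succ m ih =>
    have h1 : f ∈ Hs 1 := Hs_mono (by omega) hf
    have h2 := (base f).add (tendsto_finsetSum Finset.univ fun (i : Fin 3) _ => ih (D_mem hf i))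
    simp only [Finset.sum_const_zero, add_zero] at h2
    refine h2.congr fun n => ?_
    rw [nm_succ]
    congr 1
    refine Finset.sum_congr rfl fun i _ => ?_
    rw [D_sub (cv_mem (hφ n) h1) h1, ((isD_of_mem h1 i).cv (hφ n)).eq]

/-! ### Cut-off -/

/-- `x ↦ φ(s x)`. -/
def Test.scale (s : ℝ) (hs : s ≠ 0) (φ : Test) : Test :=
  ⟨fun x => φ (s • x), φ.smooth.comp (contDiff_id.const_smul s),
    φ.compact.comp_homeomorph (Homeomorph.smulOfNeZero s hs)⟩

theorem Test.scale_d (s : ℝ) (hs : s ≠ 0) (φ : Test) (i : Fin 3) :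
    ((φ.scale s hs).d i).L = s • ((φ.d i).scale s hs).L := by
  apply Lp.ext
  filter_upwards [((φ.scale s hs).d i).coe_L, ((φ.d i).scale s hs).coe_L,
    Lp.coeFn_smul s ((φ.d i).scale s hs).L] with x h1 h2 h3
  rw [h1, h3, Pi.smul_apply, h2]
  change fderiv ℝ (fun y => φ (s • y)) x (basisVec i) = s • fderiv ℝ φ (s • x) (basisVec i)
  rw [fderiv_comp_smul]
  rfl

theorem Mu_test_mem (φ : Test) {m : ℕ} {f : L2} (hf : f ∈ Hs m) : Mu φ.L f ∈ Hs m := by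
  induction m generalizing f φ with
  | zero => simp
  | succ m ih =>
    exact fun i => ⟨_, (Hs m).add_mem (ih φ (D_mem hf i)) (ih (φ.d i) (Hs_mono_succ hf)),
      φ.isD_Mu (isD_of_mem (Hs_mono (by omega) hf) i)⟩

theorem tendsto_nm_cutoff {s : ℕ → ℝ} (hs : ∀ n, s n ≠ 0) (hs0 : Tendsto s atTop (𝓝 0)) (φ : Test)
    {m : ℕ} {f : L2} (hf : f ∈ Hs m) :
    Tendsto (fun n => nm m (Mu (φ.scale (s n) (hs n)).L f - φ 0 • f)) atTop (𝓝 0) := by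
  have base : ∀ (φ : Test) (f : L2),
      Tendsto (fun n => ‖Mu (φ.scale (s n) (hs n)).L f - φ 0 • f‖) atTop (𝓝 0) := by
    intro φ f
    obtain ⟨K, hK, _⟩ := φ.exists_bdd
    have hint : Integrable (fun x => f x * f x) (volume : Measure Space) := by
      simpa [pow_two] using L2.integrable_inner (𝕜 := ℝ) f f
    have key : Tendsto (fun n => ∫ x, (φ (s n • x) - φ 0) ^ 2 * (f x * f x)) atTop
        (𝓝 (∫ _ : Space, (0 : ℝ))) := by
      refine tendsto_integral_of_dominated_convergence (fun x => (K + K) ^ 2 * (f x * f x)) ?_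
        (hint.const_mul _) ?_ ?_
      · intro n
        have : Continuous fun x : Space => (φ (s n • x) - φ 0) ^ 2 :=
          ((φ.continuous.comp (continuous_const_smul _)).sub continuous_const).pow 2
        exact this.aestronglyMeasurable.mul hint.1
      · intro n
        refine Eventually.of_forall fun x => ?_
        rw [norm_mul, Real.norm_eq_abs, Real.norm_eq_abs, abs_mul_self, abs_pow]
        have h1 : |φ (s n • x) - φ 0| ≤ K + K :=
          (abs_sub _ _).trans (add_le_add (hK _) (hK _))
        have h2 := mul_self_nonneg (f x)
        gcongr
      · refine Eventually.of_forall fun x => ?_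
        have h1 : Tendsto (fun n => φ (s n • x)) atTop (𝓝 (φ 0)) := by
          have := (φ.continuous.tendsto ((0 : ℝ) • x)).comp (hs0.smul_const x)
          rw [zero_smul] at this
          exact this
        have h2 := ((h1.sub_const (φ 0)).pow 2).mul_const (f x * f x)
        simpa using h2
    simp only [integral_zero] at key
    have e : ∀ n, ‖Mu (φ.scale (s n) (hs n)).L f - φ 0 • f‖ ^ 2
        = ∫ x, (φ (s n • x) - φ 0) ^ 2 * (f x * f x) := by
      intro n
      rw [← real_inner_self_eq_norm_sq, L2.inner_eq]
      refine integral_congr_ae ?_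
      filter_upwards [Test.coe_Mu (φ.scale (s n) (hs n)) f, Lp.coeFn_smul (φ 0) f,
        Lp.coeFn_sub (Mu (φ.scale (s n) (hs n)).L f) (φ 0 • f)] with x h1 h2 h3
      rw [h3, Pi.sub_apply, h1, h2]
      simp only [Pi.smul_apply, smul_eq_mul]
      change (φ (s n • x) * f x - φ 0 * f x) * (φ (s n • x) * f x - φ 0 * f x) = _
      ring
    simp only [← e] at key
    have := key.sqrt
    simpa [Real.sqrt_sq (norm_nonneg _)] using this
  induction m generalizing f φ with
  | zero => exact base φ f
  | succ m ih =>
    have hf1 : f ∈ Hs 1 := Hs_mono (by omega) hf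
    have hfm : f ∈ Hs m := Hs_mono_succ hf
    have h1 : ∀ i : Fin 3, Tendsto (fun n => nm m (D i (Mu (φ.scale (s n) (hs n)).L f - φ 0 • f)))
        atTop (𝓝 0) := by
      intro i
      have a := ih φ (D_mem hf i)
      have b := ih (φ.d i) hfm
      have c : Tendsto (fun n => |s n| * (nm m (Mu ((φ.d i).scale (s n) (hs n)).L f - (φ.d i) 0 • f)
          + nm m ((φ.d i) 0 • f))) atTop (𝓝 0) := by
        have := hs0.abs.mul (b.add_const (nm m ((φ.d i) 0 • f)))
        simpa using this
      have d := a.add c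
      rw [add_zero] at d
      refine squeeze_zero (fun n => nm_nonneg _ _) (fun n => ?_) d
      have e : D i (Mu (φ.scale (s n) (hs n)).L f - φ 0 • f)
          = (Mu (φ.scale (s n) (hs n)).L (D i f) - φ 0 • D i f)
            + s n • ((Mu ((φ.d i).scale (s n) (hs n)).L f - (φ.d i) 0 • f) + (φ.d i) 0 • f) := by
        obtain ⟨K, _, hK⟩ := ((φ.d i).scale (s n) (hs n)).exists_bdd
        rw [D_sub (Mu_test_mem _ hf1) ((Hs 1).smul_mem _ hf1), D_smul hf1,
          (Test.isD_Mu _ (isD_of_mem hf1 i)).eq, Test.scale_d, Mu_smul_left hK]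
        simp only [sub_add_cancel]
        abel
      have m1 : Mu ((φ.d i).scale (s n) (hs n)).L f - (φ.d i) 0 • f ∈ Hs m :=
        (Hs m).sub_mem (Mu_test_mem _ hfm) ((Hs m).smul_mem _ hfm)
      have m2 : (φ.d i) 0 • f ∈ Hs m := (Hs m).smul_mem _ hfm
      have m3 : Mu (φ.scale (s n) (hs n)).L (D i f) - φ 0 • D i f ∈ Hs m :=
        (Hs m).sub_mem (Mu_test_mem _ (D_mem hf i)) ((Hs m).smul_mem _ (D_mem hf i))
      rw [e]
      refine (nm_add_le m3 ((Hs m).smul_mem _ ((Hs m).add_mem m1 m2))).trans ?_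
      rw [nm_smul ((Hs m).add_mem m1 m2)]
      have := nm_add_le m1 m2
      gcongr
    have h2 := (base φ f).add (tendsto_finsetSum Finset.univ fun (i : Fin 3) _ => h1 i)
    simp only [Finset.sum_const_zero, add_zero] at h2
    exact h2

theorem exists_mollifiers : ∃ φ : ℕ → Test, (∀ n, Mollifier (φ n)) ∧
    ∀ r > 0, ∀ᶠ n in atTop, ∀ t, φ n t ≠ 0 → ‖t‖ < r := by
  have hpos : ∀ n : ℕ, (0 : ℝ) < 1 / (n + 1) := fun n => by positivity
  let b : ∀ n : ℕ, ContDiffBump (0 : Space) := fun n =>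
    ⟨1 / (n + 1) / 2, 1 / (n + 1), half_pos (hpos n), half_lt_self (hpos n)⟩
  refine ⟨fun n => ⟨(b n).normed volume, (b n).contDiff_normed, (b n).hasCompactSupport_normed⟩,
    fun n => ⟨fun x => (b n).nonneg_normed x, (b n).integral_normed⟩, fun r hr => ?_⟩
  have h0 := (tendsto_one_div_add_atTop_nhds_zero_nat (𝕜 := ℝ)).eventually (gt_mem_nhds hr)
  filter_upwards [h0] with n hn t ht
  have : t ∈ Function.support ((b n).normed volume) := ht
  rw [(b n).support_normed_eq] at this
  have h3 : ‖t‖ < 1 / ((n : ℝ) + 1) := by simpa [b] using this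
  exact h3.trans hn

/-- Test functions are dense in `H^m`; the approximation preserves pointwise bounds. -/
theorem exists_test_near {m : ℕ} {f : L2} (hf : f ∈ Hs m) {ε : ℝ} (hε : 0 < ε) :
    ∃ ψ : Test, nm m (ψ.L - f) < ε ∧ ∀ K, Bdd f K → ∀ x, |ψ x| ≤ K := by
  obtain ⟨φ, hφ, hs⟩ := exists_mollifiers
  obtain ⟨n, hn⟩ := ((tendsto_nm_cv hφ hs hf).eventually (gt_mem_nhds (half_pos hε))).exists
  let b : ContDiffBump (0 : Space) := ⟨1, 2, one_pos, one_lt_two⟩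
  let χ : Test := ⟨b, b.contDiff, b.hasCompactSupport⟩
  have hχ0 : χ 0 = 1 := b.one_of_mem_closedBall (by simp [b])
  have hs1 : ∀ n : ℕ, (1 / ((n : ℝ) + 1)) ≠ 0 := fun n => by positivity
  set F := cv (hφ n) f with hF
  have hFm : F ∈ Hs m := cv_mem (hφ n) hf
  obtain ⟨k, hk⟩ := ((tendsto_nm_cutoff hs1 tendsto_one_div_add_atTop_nhds_zero_nat χ
    hFm).eventually (gt_mem_nhds (half_pos hε))).exists
  rw [hχ0, one_smul] at hk
  set χk := χ.scale _ (hs1 k) with hχk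
  let ψ : Test := ⟨fun x => conv (φ n) f x * χk x, (conv_contDiff _ _).mul χk.smooth,
    χk.compact.mul_left⟩
  have hψ : ψ.L = Mu χk.L F := by
    apply Lp.ext
    filter_upwards [ψ.coe_L, χk.coe_Mu F, coe_cv (hφ n) f] with x h1 h2 h3
    rw [h1, h2, h3, mul_comm]
  refine ⟨ψ, ?_, fun K hK x => ?_⟩
  · have e : ψ.L - f = (Mu χk.L F - F) + (F - f) := by rw [hψ]; abel
    rw [e]
    refine (nm_add_le ((Hs m).sub_mem (Mu_test_mem _ hFm) hFm) ((Hs m).sub_mem hFm hf)).trans_lt ?_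
    linarith
  · change |conv (φ n) f x * χ _| ≤ K
    have hK' : ∀ᵐ t, |f (x - t)| ≤ K :=
      (Measure.measurePreserving_sub_left (volume : Measure Space) x).quasiMeasurePreserving.ae hK
    have h1 : |conv (φ n) f x| ≤ K := by
      rw [conv_apply']
      calc ‖∫ t, φ n t * f (x - t)‖ ≤ ∫ t, φ n t * K := by
            refine norm_integral_le_of_norm_le
              (((memLp_one_iff_integrable).1 ((φ n).memLp 1)).mul_const K) ?_
            filter_upwards [hK'] with t ht
            rw [norm_mul, Real.norm_eq_abs, Real.norm_eq_abs, abs_of_nonneg ((hφ n).nonneg t)]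
            exact mul_le_mul_of_nonneg_left ht ((hφ n).nonneg t)
        _ = K := by rw [integral_mul_const, (hφ n).mass, one_mul]
    have h2 : |χ ((1 / ((k : ℝ) + 1)) • x)| ≤ 1 := by
      rw [abs_of_nonneg b.nonneg]; exact b.le_one
    rw [abs_mul]
    calc _ ≤ K * 1 := mul_le_mul h1 h2 (abs_nonneg _) hK.nonneg
      _ = K := mul_one K

theorem exists_test_seq {m : ℕ} {f : L2} (hf : f ∈ Hs m) :
    ∃ ψ : ℕ → Test, Tendsto (fun n => nm m ((ψ n).L - f)) atTop (𝓝 0) ∧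
      ∀ K, Bdd f K → ∀ n x, |ψ n x| ≤ K := by
  choose ψ h1 h2 using fun n : ℕ => exists_test_near hf (ε := 1 / ((n : ℝ) + 1)) (by positivity)
  exact ⟨ψ, squeeze_zero (fun n => nm_nonneg _ _) (fun n => (h1 n).le)
    tendsto_one_div_add_atTop_nhds_zero_nat, fun K hK n => h2 n K hK⟩

theorem tendsto_of_nm {m : ℕ} {ι : Type*} {l : Filter ι} {F : ι → L2} {f : L2}
    (h : Tendsto (fun n => nm m (F n - f)) l (𝓝 0)) : Tendsto F l (𝓝 f) :=
  tendsto_iff_norm_sub_tendsto_zero.2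
    (squeeze_zero (fun _ => norm_nonneg _) (fun _ => norm_le_nm m _) h)

theorem tendsto_D_of_nm {m : ℕ} {ι : Type*} {l : Filter ι} {F : ι → L2} {f : L2}
    (h : Tendsto (fun n => nm (m + 1) (F n - f)) l (𝓝 0)) (hF : ∀ n, F n ∈ Hs 1) (hf : f ∈ Hs 1)
    (i : Fin 3) : Tendsto (fun n => nm m (D i (F n) - D i f)) l (𝓝 0) :=
  squeeze_zero (fun _ => nm_nonneg _ _)
    (fun n => by rw [← D_sub (hF n) hf]; exact nm_D_le _ _ _) h

/-! ### Integration by parts -/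

theorem inner_D_left {f g : L2} (hf : f ∈ Hs 1) (hg : g ∈ Hs 1) (i : Fin 3) :
    inner ℝ (D i f) g = -inner ℝ f (D i g) := by
  obtain ⟨ψ, hψ, _⟩ := exists_test_seq hg
  have h0 := tendsto_of_nm hψ
  have h1 := tendsto_of_nm (tendsto_D_of_nm (m := 0) hψ (fun n => (ψ n).mem_Hs 1) hg i)
  have a : Tendsto (fun n => inner ℝ (D i f) (ψ n).L) atTop (𝓝 (inner ℝ (D i f) g)) :=
    tendsto_const_nhds.inner h0
  have b : Tendsto (fun n => -inner ℝ f (D i (ψ n).L)) atTop (𝓝 (-inner ℝ f (D i g))) :=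
    (tendsto_const_nhds.inner h1).neg
  refine tendsto_nhds_unique a (b.congr fun n => ?_)
  rw [Test.D_L, isD_of_mem hf i (ψ n), neg_neg]

theorem inner_D_D_swap {f g : L2} (hf : f ∈ Hs 1) (hg : g ∈ Hs 1) (i j : Fin 3) :
    inner ℝ (D i f) (D j g) = inner ℝ (D j f) (D i g) := by
  obtain ⟨ψ, hψ, _⟩ := exists_test_seq hg
  have h1 := fun i => tendsto_of_nm (tendsto_D_of_nm (m := 0) hψ (fun n => (ψ n).mem_Hs 1) hg i)
  have a : Tendsto (fun n => inner ℝ (D i f) (D j (ψ n).L)) atTop (𝓝 (inner ℝ (D i f) (D j g))) :=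
    tendsto_const_nhds.inner (h1 j)
  have b : Tendsto (fun n => inner ℝ (D j f) (D i (ψ n).L)) atTop (𝓝 (inner ℝ (D j f) (D i g))) :=
    tendsto_const_nhds.inner (h1 i)
  refine tendsto_nhds_unique a (b.congr fun n => ?_)
  rw [Test.D_L, Test.D_L]
  have e1 := isD_of_mem hf i ((ψ n).d j)
  have e2 := isD_of_mem hf j ((ψ n).d i)
  rw [Test.d_comm] at e1
  linarith

/-- `∑ᵢ ‖∂ᵢ f‖`. -/
def gr (f : L2) : ℝ := ∑ i, ‖D i f‖

theorem gr_nonneg (f : L2) : 0 ≤ gr f := Finset.sum_nonneg fun _ _ => norm_nonneg _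

theorem gr_le_nm (f : L2) : gr f ≤ nm 1 f := by
  rw [nm_succ]; exact le_add_of_nonneg_left (norm_nonneg _)

/-! ### The embedding `H¹ ⊂ L⁶` -/

theorem norm_le_sum_basisVec (A : Space →L[ℝ] ℝ) : ‖A‖ ≤ ∑ i, ‖A (basisVec i)‖ := by
  refine A.opNorm_le_bound (Finset.sum_nonneg fun _ _ => norm_nonneg _) fun x => ?_
  have hx : x = ∑ i, x i • basisVec i := by
    ext j
    simp [Finset.sum_apply, Pi.single_apply]
  calc ‖A x‖ = ‖∑ i, x i • A (basisVec i)‖ := by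
        conv_lhs => rw [hx]
        simp
    _ ≤ ∑ i, ‖x i • A (basisVec i)‖ := norm_sum_le _ _
    _ ≤ ∑ i, ‖A (basisVec i)‖ * ‖x‖ := by
        refine Finset.sum_le_sum fun i _ => ?_
        rw [norm_smul, mul_comm]
        gcongr
        exact PiLp.norm_apply_le x i
    _ = _ := by rw [Finset.sum_mul]

theorem Test.eLpNorm_eq (φ : Test) : eLpNorm φ 2 volume = ENNReal.ofReal ‖φ.L‖ := by
  rw [ofReal_norm, Lp.enorm_def, eLpNorm_congr_ae φ.coe_L]

theorem exists_sobolev_six : ∃ C : ℝ, 1 ≤ C ∧ ∀ f ∈ Hs 1,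
    eLpNorm f 6 (volume : Measure Space) ≤ ENNReal.ofReal (C * gr f) := by
  set C0 := SNormLESNormFDerivOfEqConst ℝ (volume : Measure Space) (2 : NNReal) with hC0
  refine ⟨C0 + 1, by simp, fun f hf => ?_⟩
  have htest : ∀ φ : Test, eLpNorm φ 6 (volume : Measure Space)
      ≤ ENNReal.ofReal ((C0 + 1) * gr φ.L) := by
    intro φ
    have h := eLpNorm_le_eLpNorm_fderiv_of_eq (volume : Measure Space) (F := ℝ)
      (contDiff_infty.1 φ.smooth 1) φ.compact (p := 2) (p' := 6) (by norm_num)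
      (by simp) (by simp; norm_num)
    rw [← hC0] at h
    have h2 : eLpNorm (fderiv ℝ φ) 2 (volume : Measure Space)
        ≤ ∑ i, eLpNorm (φ.d i) 2 (volume : Measure Space) := by
      refine (eLpNorm_mono_real (g := ∑ i, fun x => ‖φ.d i x‖) fun x => ?_).trans ?_
      · simpa [Test.d_apply] using norm_le_sum_basisVec (fderiv ℝ φ x)
      · refine (eLpNorm_sum_le (fun i _ => ((φ.d i).continuous.norm).aestronglyMeasurable)
          (by norm_num)).trans (le_of_eq ?_)
        exact Finset.sum_congr rfl fun i _ => eLpNorm_norm _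
    have h3 : ∑ i, eLpNorm (φ.d i) 2 (volume : Measure Space) = ENNReal.ofReal (gr φ.L) := by
      rw [gr, ENNReal.ofReal_sum_of_nonneg fun _ _ => norm_nonneg _]
      exact Finset.sum_congr rfl fun i _ => by rw [Test.eLpNorm_eq, Test.D_L]
    rw [h3] at h2
    have h' : eLpNorm φ 6 (volume : Measure Space)
        ≤ (C0 : ℝ≥0∞) * eLpNorm (fderiv ℝ φ) 2 (volume : Measure Space) := by exact_mod_cast h
    calc _ ≤ _ := h'
      _ ≤ (C0 : ℝ≥0∞) * ENNReal.ofReal (gr φ.L) := by gcongr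
      _ = ENNReal.ofReal (C0 * gr φ.L) := by
          rw [ENNReal.ofReal_mul C0.coe_nonneg, ENNReal.ofReal_coe_nnreal]
      _ ≤ _ := ENNReal.ofReal_le_ofReal (by
          have := gr_nonneg φ.L
          gcongr; simp)
  obtain ⟨ψ, hψ, _⟩ := exists_test_seq hf
  have h0 := tendsto_of_nm hψ
  have h1 := fun i => tendsto_of_nm (tendsto_D_of_nm (m := 0) hψ (fun n => (ψ n).mem_Hs 1) hf i)
  have hmeas := tendstoInMeasure_of_tendsto_Lp h0
  obtain ⟨ns, hns, hlim⟩ := hmeas.exists_seq_tendsto_ae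
  have h2 := Lp.eLpNorm_lim_le_liminf_eLpNorm (p := 6)
    (fun n => Lp.aestronglyMeasurable (ψ (ns n)).L) f hlim
  have h3 : Tendsto (fun n => ENNReal.ofReal ((C0 + 1) * gr (ψ (ns n)).L)) atTop
      (𝓝 (ENNReal.ofReal ((C0 + 1) * gr f))) := by
    refine ENNReal.tendsto_ofReal (Tendsto.const_mul _ ?_)
    exact tendsto_finsetSum _ fun i _ => ((h1 i).comp hns.tendsto_atTop).norm
  rw [← h3.liminf_eq]
  refine h2.trans (liminf_le_liminf (Eventually.of_forall fun n => ?_))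
  rw [eLpNorm_congr_ae (ψ (ns n)).coe_L]
  exact htest _

theorem exists_mul_bound : ∃ C : ℝ, 1 ≤ C ∧ ∀ f ∈ Hs 1, ∀ g ∈ Hs 1,
    MemLp (fun x => f x * g x) 2 (volume : Measure Space) ∧
      eLpNorm (fun x => f x * g x) 2 (volume : Measure Space) ≤ ENNReal.ofReal (C * nm 1 f * gr g) := by
  obtain ⟨C, hC, H⟩ := exists_sobolev_six
  refine ⟨C ^ 2, by nlinarith, fun f hf g hg => ?_⟩
  have mf := Lp.aestronglyMeasurable f
  have mg := Lp.aestronglyMeasurable g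
  have t1 : ENNReal.HolderTriple 2 2 1 := ⟨by simp [ENNReal.inv_two_add_inv_two]⟩
  have inv_aux : ∀ a b c : NNReal, a ≠ 0 → b ≠ 0 → c ≠ 0 → a⁻¹ + b⁻¹ = c⁻¹ →
      ENNReal.HolderTriple (a : ℝ≥0∞) b c := by
    intro a b c ha hb hc h
    refine ⟨?_⟩
    rw [← ENNReal.coe_inv ha, ← ENNReal.coe_inv hb, ← ENNReal.coe_inv hc]
    exact_mod_cast h
  have t2 : ENNReal.HolderTriple 6 3 2 := by
    have := inv_aux 6 3 2 (by norm_num) (by norm_num) (by norm_num)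
      (by rw [← NNReal.coe_inj]; push_cast; norm_num)
    exact_mod_cast this
  have t3 : ENNReal.HolderTriple 6 6 3 := by
    have := inv_aux 6 6 3 (by norm_num) (by norm_num) (by norm_num)
      (by rw [← NNReal.coe_inj]; push_cast; norm_num)
    exact_mod_cast this
  have e : eLpNorm (fun x => f x * g x) 2 (volume : Measure Space) ^ 2
      = eLpNorm ((f : Space → ℝ) • ((f : Space → ℝ) • ((g : Space → ℝ) • (g : Space → ℝ)))) 1
        volume := by
    have := eLpNorm_nnreal_pow_eq_lintegral (μ := (volume : Measure Space))
      (f := fun x => f x * g x) (p := 2) (by norm_num)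
    simp only [NNReal.coe_ofNat, ENNReal.coe_ofNat, ENNReal.rpow_ofNat] at this
    rw [this, eLpNorm_one_eq_lintegral_enorm]
    refine lintegral_congr fun x => ?_
    rw [← enorm_pow]
    congr 1
    change _ = f x * (f x * (g x * g x))
    ring
  have h : eLpNorm (fun x => f x * g x) 2 (volume : Measure Space) ^ 2
      ≤ ENNReal.ofReal (nm 1 f) * (ENNReal.ofReal (C * nm 1 f) *
        (ENNReal.ofReal (C * gr g) * ENNReal.ofReal (C * gr g))) := by
    rw [e]
    have a1 := eLpNorm_smul_le_mul_eLpNorm (μ := (volume : Measure Space)) (p := 2) (q := 2) (r := 1)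
      (mf.smul (mg.smul mg)) mf
    have a2 := eLpNorm_smul_le_mul_eLpNorm (μ := (volume : Measure Space)) (p := 6) (q := 3) (r := 2)
      (mg.smul mg) mf
    have a3 := eLpNorm_smul_le_mul_eLpNorm (μ := (volume : Measure Space)) (p := 6) (q := 6) (r := 3)
      mg mg
    have b1 : eLpNorm f 2 (volume : Measure Space) ≤ ENNReal.ofReal (nm 1 f) := by
      rw [← Lp.enorm_def, ← ofReal_norm]
      exact ENNReal.ofReal_le_ofReal (norm_le_nm _ _)
    have b2 : eLpNorm f 6 (volume : Measure Space) ≤ ENNReal.ofReal (C * nm 1 f) :=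
      (H f hf).trans (ENNReal.ofReal_le_ofReal (by gcongr; exact gr_le_nm f))
    have b3 := H g hg
    refine a1.trans (mul_le_mul' b1 (a2.trans (mul_le_mul' b2 (a3.trans (mul_le_mul' b3 b3)))))
  have n1 := nm_nonneg 1 f
  have n2 := gr_nonneg g
  have h' : eLpNorm (fun x => f x * g x) 2 (volume : Measure Space) ^ 2
      ≤ ENNReal.ofReal (C ^ 2 * nm 1 f * gr g) ^ 2 := by
    refine h.trans ?_
    rw [← ENNReal.ofReal_mul (by positivity), ← ENNReal.ofReal_mul (by positivity),
      ← ENNReal.ofReal_mul (by positivity), ← ENNReal.ofReal_pow (by positivity)]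
    refine ENNReal.ofReal_le_ofReal ?_
    have : (C ^ 2 * nm 1 f * gr g) ^ 2 = C * (nm 1 f * (C * nm 1 f * (C * gr g * (C * gr g)))) := by
      ring
    rw [this]
    exact le_mul_of_one_le_left (by positivity) hC
  have h'' := (ENNReal.pow_le_pow_left_iff two_ne_zero).1 h'
  exact ⟨⟨mf.mul mg, h''.trans_lt ENNReal.ofReal_lt_top⟩, h''⟩

/-! ### The embedding `H² ⊂ L^∞` -/

open FourierTransform SchwartzMap LineDeriv in
theorem exists_test_sup_bound : ∃ C : ℝ, 0 ≤ C ∧ ∀ (φ : Test) (x : Space), |φ x| ≤ C * nm 2 φ.L := by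
  have hw2 : Integrable (fun ξ : Space => ((1 + ‖ξ‖ ^ 2)⁻¹ : ℝ) ^ (2 : ℝ)) := by
    refine (integrable_rpow_neg_one_add_norm_sq (E := Space) (μ := volume) (r := 4)
      (by simp; norm_num)).congr (Eventually.of_forall fun ξ => ?_)
    have : (0 : ℝ) < 1 + ‖ξ‖ ^ 2 := by positivity
    simp only
    rw [← Real.rpow_neg_one, ← Real.rpow_mul this.le]
    norm_num
  have hwm : MemLp (fun ξ : Space => (1 + ‖ξ‖ ^ 2)⁻¹) (ENNReal.ofReal 2) volume := by
    have hc : Continuous fun ξ : Space => (1 + ‖ξ‖ ^ 2)⁻¹ :=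
      (by fun_prop : Continuous fun ξ : Space => 1 + ‖ξ‖ ^ 2).inv₀ fun ξ => by positivity
    rw [show ENNReal.ofReal 2 = 2 by norm_num]
    rw [memLp_two_iff_integrable_sq hc.aestronglyMeasurable]
    exact_mod_cast hw2
  set W := (∫ ξ : Space, ((1 + ‖ξ‖ ^ 2)⁻¹ : ℝ) ^ (2 : ℝ)) ^ (1 / (2 : ℝ)) with hW
  have hW0 : 0 ≤ W := by positivity
  refine ⟨W, hW0, fun φ x => ?_⟩
  let S : Test → 𝓢(Space, ℂ) := fun φ =>
    HasCompactSupport.toSchwartzMap (f := fun x => ((φ x : ℝ) : ℂ))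
      (φ.compact.comp_left (g := ((↑) : ℝ → ℂ)) Complex.ofReal_zero)
      (Complex.ofRealCLM.contDiff.comp φ.smooth)
  have hS : ∀ φ x, S φ x = ((φ x : ℝ) : ℂ) := fun _ _ => rfl
  have hSd : ∀ φ i, ∂_{basisVec i} (S φ) = S (φ.d i) := by
    intro φ i
    ext x
    rw [lineDerivOp_apply_eq_fderiv, hS]
    have := (Complex.ofRealCLM.hasFDerivAt.comp x (φ.differentiable x).hasFDerivAt).fderiv
    have h2 : fderiv ℝ (S φ) x = _ := this
    rw [h2]
    rfl
  have hF : ∀ φ i ξ, ‖𝓕 (S (φ.d i)) ξ‖ = 2 * Real.pi * |ξ i| * ‖𝓕 (S φ) ξ‖ := by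
    intro φ i ξ
    have ht : (fun y : Space => (inner ℝ y (basisVec i) : ℝ)).HasTemperateGrowth := by fun_prop
    rw [← hSd, fourier_lineDerivOp_eq, _root_.smul_apply, smulLeftCLM_apply_apply ht]
    simp [abs_of_pos Real.pi_pos, mul_assoc, EuclideanSpace.inner_single_right]
  have hL2 : ∀ φ, (∫ ξ, ‖𝓕 (S φ) ξ‖ ^ (2 : ℝ)) ^ (1 / (2 : ℝ)) = ‖φ.L‖ := by
    intro φ
    have h1 := integral_norm_sq_fourier (S φ)
    have h2 : ∫ x, ‖S φ x‖ ^ 2 = ‖φ.L‖ ^ 2 := by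
      rw [← real_inner_self_eq_norm_sq, L2.inner_eq]
      refine integral_congr_ae ?_
      filter_upwards [φ.coe_L] with x hx
      rw [hx, hS, Complex.norm_real, Real.norm_eq_abs, sq_abs, sq]
    simp only [Real.rpow_two]
    rw [h1, h2, ← Real.sqrt_eq_rpow, Real.sqrt_sq (norm_nonneg _)]
  have hCS : ∀ φ, Integrable (fun ξ : Space => (1 + ‖ξ‖ ^ 2)⁻¹ * ‖𝓕 (S φ) ξ‖) ∧
      ∫ ξ : Space, (1 + ‖ξ‖ ^ 2)⁻¹ * ‖𝓕 (S φ) ξ‖ ≤ W * ‖φ.L‖ := by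
    intro φ
    have hm : MemLp (fun ξ => ‖𝓕 (S φ) ξ‖) (ENNReal.ofReal 2) volume := ((𝓕 (S φ)).memLp _).norm
    constructor
    · have : ENNReal.HolderTriple (ENNReal.ofReal 2) (ENNReal.ofReal 2) 1 :=
        ⟨by simp [ENNReal.inv_two_add_inv_two]⟩
      exact hwm.integrable_mul hm
    · rw [← hL2 φ]
      exact integral_mul_le_Lp_mul_Lq_of_nonneg Real.HolderConjugate.two_two
        (Eventually.of_forall fun ξ => by positivity) (Eventually.of_forall fun ξ => norm_nonneg _)
        hwm hm
  have hpt : ∀ ξ, ‖𝓕 (S φ) ξ‖ ≤ (1 + ‖ξ‖ ^ 2)⁻¹ * ‖𝓕 (S φ) ξ‖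
      + ∑ i, (1 + ‖ξ‖ ^ 2)⁻¹ * ‖𝓕 (S ((φ.d i).d i)) ξ‖ := by
    intro ξ
    have hp : (0 : ℝ) < 1 + ‖ξ‖ ^ 2 := by positivity
    have hn : ‖ξ‖ ^ 2 = ∑ i, |ξ i| ^ 2 := by
      rw [EuclideanSpace.norm_sq_eq]; rfl
    rw [← Finset.mul_sum, ← mul_add, inv_mul_eq_div, le_div_iff₀ hp]
    have h1 : ∀ i, |ξ i| ^ 2 * ‖𝓕 (S φ) ξ‖ ≤ ‖𝓕 (S ((φ.d i).d i)) ξ‖ := by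
      intro i
      rw [hF, hF]
      have hpi : 1 ≤ 2 * Real.pi := by linarith [Real.pi_gt_three]
      have h2 : (2 * Real.pi * |ξ i| * (2 * Real.pi * |ξ i| * ‖𝓕 (S φ) ξ‖))
        = (2 * Real.pi) ^ 2 * (|ξ i| ^ 2 * ‖𝓕 (S φ) ξ‖) := by ring
      rw [h2]
      exact le_mul_of_one_le_left (by positivity) (one_le_pow₀ hpi)
    have h2 := Finset.sum_le_sum fun (i : Fin 3) (_ : i ∈ Finset.univ) => h1 i
    rw [← Finset.sum_mul, ← hn] at h2
    linarith
  have hinv : S φ x = ∫ ξ, (Real.fourierChar (inner ℝ ξ x) : ℂ) • 𝓕 (S φ) ξ := by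
    have h1 : 𝓕⁻ (𝓕 (S φ)) = S φ := FourierTransform.fourierInv_fourier_eq (S φ)
    conv_lhs => rw [← h1]
    rw [fourierInv_coe, Real.fourierInv_eq]
    rfl
  have hb : |φ x| ≤ ∫ ξ, ‖𝓕 (S φ) ξ‖ := by
    calc |φ x| = ‖S φ x‖ := by rw [hS, Complex.norm_real, Real.norm_eq_abs]
      _ ≤ ∫ ξ, ‖(Real.fourierChar (inner ℝ ξ x) : ℂ) • 𝓕 (S φ) ξ‖ := by
          rw [hinv]; exact norm_integral_le_integral_norm _
      _ = _ := by simp only [norm_smul, Circle.norm_coe, one_mul]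
  refine hb.trans ?_
  have hint : Integrable (fun ξ : Space => (1 + ‖ξ‖ ^ 2)⁻¹ * ‖𝓕 (S φ) ξ‖
      + ∑ i, (1 + ‖ξ‖ ^ 2)⁻¹ * ‖𝓕 (S ((φ.d i).d i)) ξ‖) :=
    (hCS φ).1.add (integrable_finsetSum _ fun i _ => (hCS _).1)
  refine (integral_mono ((𝓕 (S φ)).integrable.norm) hint hpt).trans ?_
  rw [integral_add (hCS φ).1 (integrable_finsetSum _ fun i _ => (hCS _).1),
    integral_finsetSum _ fun i _ => (hCS _).1]
  calc _ ≤ W * ‖φ.L‖ + ∑ i, W * ‖((φ.d i).d i).L‖ :=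
        add_le_add (hCS φ).2 (Finset.sum_le_sum fun i _ => (hCS _).2)
    _ ≤ W * nm 2 φ.L := by
        rw [← Finset.mul_sum, ← mul_add, nm_succ]
        gcongr with i
        rw [Test.D_L, ← Test.D_L]
        exact norm_D_le 0 _ _

theorem exists_bdd : ∃ C : ℝ, 1 ≤ C ∧ ∀ f ∈ Hs 2, Bdd f (C * nm 2 f) := by
  obtain ⟨C, hC, H⟩ := exists_test_sup_bound
  refine ⟨C + 1, by linarith, fun f hf => ?_⟩
  obtain ⟨ψ, hψ, _⟩ := exists_test_seq hf
  obtain ⟨ns, hns, hlim⟩ := (tendstoInMeasure_of_tendsto_Lp (tendsto_of_nm hψ)).exists_seq_tendsto_ae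
  have hcoe : ∀ᵐ x, ∀ n, (ψ (ns n)).L x = ψ (ns n) x := ae_all_iff.2 fun n => (ψ (ns n)).coe_L
  filter_upwards [hlim, hcoe] with x h1 h2
  have h3 : Tendsto (fun n => C * (nm 2 f + nm 2 ((ψ (ns n)).L - f))) atTop (𝓝 (C * nm 2 f)) := by
    have := ((hψ.comp hns.tendsto_atTop).const_add (nm 2 f)).const_mul C
    simpa using this
  have h4 := le_of_tendsto_of_tendsto h1.abs h3 (Eventually.of_forall fun n => by
    simp only
    rw [h2 n]
    refine (H _ x).trans ?_
    gcongr
    have := nm_add_le hf ((Hs 2).sub_mem ((ψ (ns n)).mem_Hs 2) hf)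
    rwa [add_sub_cancel] at this)
  have := nm_nonneg 2 f
  linarith

/-! ### Products in Sobolev spaces -/

/-- A constant for the Sobolev embeddings. -/
def Csob : ℝ := max exists_mul_bound.choose exists_bdd.choose

theorem one_le_Csob : 1 ≤ Csob := exists_mul_bound.choose_spec.1.trans (le_max_left _ _)

theorem Csob_pos : 0 < Csob := one_pos.trans_le one_le_Csob

theorem bdd_of_mem {f : L2} (hf : f ∈ Hs 2) : Bdd f (Csob * nm 2 f) :=
  (exists_bdd.choose_spec.2 f hf).mono
    (mul_le_mul_of_nonneg_right (le_max_right _ _) (nm_nonneg _ _))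

open Classical in
/-- The product of two functions (and `0` if it is not square integrable). -/
def pr (f g : L2) : L2 :=
  if h : MemLp (fun x => f x * g x) 2 (volume : Measure Space) then h.toLp _ else 0

theorem coe_pr {f g : L2} (hf : f ∈ Hs 1) (hg : g ∈ Hs 1) :
    (pr f g : Space → ℝ) =ᵐ[volume] fun x => f x * g x := by
  have h := (exists_mul_bound.choose_spec.2 f hf g hg).1
  rw [pr, dif_pos h]
  exact h.coeFn_toLp

theorem norm_pr_le {f g : L2} (hf : f ∈ Hs 1) (hg : g ∈ Hs 1) :
    ‖pr f g‖ ≤ Csob * nm 1 f * gr g := by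
  have h := (exists_mul_bound.choose_spec.2 f hf g hg).2
  rw [← eLpNorm_congr_ae (coe_pr hf hg), ← Lp.enorm_def, ← ofReal_norm] at h
  have hC : 0 ≤ exists_mul_bound.choose := zero_le_one.trans exists_mul_bound.choose_spec.1
  have n1 := nm_nonneg 1 f
  have n2 := gr_nonneg g
  refine ((ENNReal.ofReal_le_ofReal_iff (by positivity)).1 h).trans ?_
  gcongr
  exact le_max_left _ _

theorem pr_eq_Mu {f g : L2} {K : ℝ} (hf : f ∈ Hs 1) (hg : g ∈ Hs 1) (hb : Bdd f K) :
    pr f g = Mu f g := by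
  apply Lp.ext
  filter_upwards [coe_pr hf hg, coe_Mu hb g] with x h1 h2
  rw [h1, h2]

theorem pr_comm (f g : L2) : pr f g = pr g f := by
  classical
  have h : ∀ a b : Space → ℝ, a = b → (if h : MemLp a 2 (volume : Measure Space) then h.toLp a else 0)
      = (if h : MemLp b 2 (volume : Measure Space) then h.toLp b else 0) := by
    rintro a _ rfl; rfl
  simpa only [pr] using h _ _ (funext fun x => mul_comm (f x) (g x))

theorem pr_sub {f g h : L2} (hf : f ∈ Hs 1) (hg : g ∈ Hs 1) (hh : h ∈ Hs 1) :
    pr f (g - h) = pr f g - pr f h := by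
  apply Lp.ext
  filter_upwards [coe_pr hf hg, coe_pr hf hh, coe_pr hf ((Hs 1).sub_mem hg hh), Lp.coeFn_sub g h,
    Lp.coeFn_sub (pr f g) (pr f h)] with x h1 h2 h3 h4 h5
  rw [h3, h5, Pi.sub_apply, h1, h2, h4, Pi.sub_apply, mul_sub]

theorem norm_Mu_le_low {f g : L2} (hf : f ∈ Hs 2) (hg : g ∈ Hs 1) :
    ‖Mu f g‖ ≤ Csob * nm 1 f * gr g := by
  rw [← pr_eq_Mu (Hs_mono_succ hf) hg (bdd_of_mem hf)]
  exact norm_pr_le (Hs_mono_succ hf) hg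

theorem norm_Mu_le_of_mem {f : L2} (hf : f ∈ Hs 2) (g : L2) : ‖Mu f g‖ ≤ Csob * nm 2 f * ‖g‖ :=
  norm_Mu_le (bdd_of_mem hf) g

theorem Mu_comm_of_mem {f g : L2} (hf : f ∈ Hs 2) (hg : g ∈ Hs 2) : Mu f g = Mu g f :=
  Mu_comm (bdd_of_mem hf) (bdd_of_mem hg)

theorem isD_Mu_pr {f g : L2} (hf : f ∈ Hs 2) (hg : g ∈ Hs 1) (i : Fin 3) :
    IsD i (Mu f g) (Mu f (D i g) + pr (D i f) g) := by
  obtain ⟨ψ, hψ, _⟩ := exists_test_seq hg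
  have hψm := fun n => (ψ n).mem_Hs 1
  have h0 := tendsto_of_nm hψ
  have h1 := tendsto_of_nm (tendsto_D_of_nm (m := 0) hψ hψm hg i)
  have hDf : D i f ∈ Hs 1 := D_mem hf i
  have h2 : Tendsto (fun n => pr (D i f) (ψ n).L) atTop (𝓝 (pr (D i f) g)) := by
    rw [tendsto_iff_norm_sub_tendsto_zero]
    have : Tendsto (fun n => Csob * nm 1 (D i f) * nm 1 ((ψ n).L - g)) atTop (𝓝 0) := by
      simpa using hψ.const_mul (Csob * nm 1 (D i f))
    refine squeeze_zero (fun _ => norm_nonneg _) (fun n => ?_) this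
    rw [← pr_sub hDf (hψm n) hg]
    refine (norm_pr_le hDf ((Hs 1).sub_mem (hψm n) hg)).trans ?_
    have := nm_nonneg 1 (D i f)
    have := Csob_pos
    gcongr
    exact gr_le_nm _
  refine IsD.of_tendsto (((Mu f).continuous.tendsto g).comp h0)
    ((((Mu f).continuous.tendsto (D i g)).comp h1).add h2) fun n => ?_
  have h3 := (ψ n).isD_Mu (isD_of_mem (Hs_mono_succ hf) i)
  have e1 : Mu (ψ n).L f = Mu f (ψ n).L := Mu_comm_of_mem ((ψ n).mem_Hs 2) hf
  have e2 : Mu ((ψ n).d i).L f = Mu f ((ψ n).d i).L := Mu_comm_of_mem (((ψ n).d i).mem_Hs 2) hf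
  have e3 : Mu (ψ n).L (D i f) = pr (D i f) (ψ n).L := by
    rw [pr_comm, pr_eq_Mu (hψm n) hDf (bdd_of_mem ((ψ n).mem_Hs 2))]
  rw [e1, e2, e3, ← Test.D_L, add_comm] at h3
  exact h3

/-- `∑ᵢ ‖∂ᵢ f‖_{H^m}`. -/
def gm (m : ℕ) (f : L2) : ℝ := ∑ i, nm m (D i f)

theorem gm_nonneg (m : ℕ) (f : L2) : 0 ≤ gm m f := Finset.sum_nonneg fun _ _ => nm_nonneg _ _

theorem nm_succ' (m : ℕ) (f : L2) : nm (m + 1) f = ‖f‖ + gm m f := rfl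

theorem gm_le_nm (m : ℕ) (f : L2) : gm m f ≤ nm (m + 1) f := by
  rw [nm_succ']; exact le_add_of_nonneg_left (norm_nonneg _)

theorem nm_D_le_gm (m : ℕ) (f : L2) (i : Fin 3) : nm m (D i f) ≤ gm m f :=
  Finset.single_le_sum (f := fun i => nm m (D i f)) (fun _ _ => nm_nonneg _ _) (Finset.mem_univ i)

theorem gm_mono_succ (m : ℕ) (f : L2) : gm m f ≤ gm (m + 1) f :=
  Finset.sum_le_sum fun _ _ => nm_mono_succ _ _

theorem gm_mono {m n : ℕ} (h : m ≤ n) (f : L2) : gm m f ≤ gm n f :=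
  Finset.sum_le_sum fun _ _ => nm_mono h _

theorem gr_le_gm (m : ℕ) (f : L2) : gr f ≤ gm m f :=
  Finset.sum_le_sum fun _ _ => norm_le_nm _ _

theorem norm_D_le_gm (m : ℕ) (f : L2) (i : Fin 3) : ‖D i f‖ ≤ gm m f :=
  (norm_le_nm m _).trans (nm_D_le_gm m f i)

theorem norm_DD_le_gm (m : ℕ) (f : L2) (i j : Fin 3) : ‖D i (D j f)‖ ≤ gm (m + 1) f :=
  (norm_D_le m _ i).trans (nm_D_le_gm (m + 1) f j)

theorem norm_DDD_le_gm (m : ℕ) (f : L2) (i j k : Fin 3) : ‖D i (D j (D k f))‖ ≤ gm (m + 2) f :=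
  ((norm_D_le m _ i).trans (nm_D_le (m + 1) _ j)).trans (nm_D_le_gm (m + 2) f k)

theorem Mu_mem_one {f g : L2} (hf : f ∈ Hs 2) (hg : g ∈ Hs 1) : Mu f g ∈ Hs 1 :=
  fun i => ⟨_, by simp, isD_Mu_pr hf hg i⟩

/-- The product rule for `f ∈ H³`, `g ∈ H¹`. -/
theorem D_Mu {f g : L2} (hf : f ∈ Hs 3) (hg : g ∈ Hs 1) (i : Fin 3) :
    D i (Mu f g) = Mu f (D i g) + Mu (D i f) g := by
  rw [(isD_Mu_pr (Hs_mono_succ hf) hg i).eq,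
    pr_eq_Mu (Hs_mono (by norm_num) (D_mem hf i)) hg (bdd_of_mem (D_mem hf i))]

/-- The product rule for `f, g ∈ H²`. -/
theorem D_Mu' {f g : L2} (hf : f ∈ Hs 2) (hg : g ∈ Hs 2) (i : Fin 3) :
    D i (Mu f g) = Mu f (D i g) + Mu g (D i f) := by
  rw [(isD_Mu_pr hf (Hs_mono_succ hg) i).eq, pr_comm,
    pr_eq_Mu (Hs_mono_succ hg) (D_mem hf i) (bdd_of_mem hg)]

theorem nm_Mu_one {f g : L2} (hf : f ∈ Hs 2) (hg : g ∈ Hs 1) :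
    nm 1 (Mu f g) ≤ 4 * Csob * nm 2 f * nm 1 g := by
  have hC := Csob_pos
  have hn := nm_nonneg 2 f
  have hn' := nm_nonneg 1 g
  have h0 := norm_Mu_le_of_mem hf g
  have h1 : ∀ i, nm 0 (D i (Mu f g)) ≤ Csob * nm 2 f * ‖D i g‖ + Csob * nm 1 (D i f) * nm 1 g := by
    intro i
    rw [(isD_Mu_pr hf hg i).eq]
    refine (norm_add_le _ _).trans (add_le_add (norm_Mu_le_of_mem hf _) ?_)
    refine (norm_pr_le (D_mem hf i) hg).trans ?_
    have := nm_nonneg 1 (D i f)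
    gcongr
    exact gr_le_nm g
  have h2 := Finset.sum_le_sum fun (i : Fin 3) (_ : i ∈ Finset.univ) => h1 i
  rw [Finset.sum_add_distrib, ← Finset.mul_sum, ← Finset.sum_mul, ← Finset.mul_sum] at h2
  have h3 : ∑ i, nm 1 (D i f) ≤ nm 2 f := gm_le_nm 1 f
  have h4 : ‖g‖ + ∑ i, ‖D i g‖ = nm 1 g := rfl
  rw [nm_succ]
  have h5 : Csob * (∑ i, nm 1 (D i f)) * nm 1 g ≤ Csob * nm 2 f * nm 1 g := by gcongr
  have h6 : 0 ≤ Csob * nm 2 f * nm 1 g := by positivity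
  have h7 : Csob * nm 2 f * nm 1 g = Csob * nm 2 f * ‖g‖ + Csob * nm 2 f * ∑ i, ‖D i g‖ := by
    rw [← h4]; ring
  linarith

theorem Mu_mem_two {f g : L2} (hf : f ∈ Hs 2) (hg : g ∈ Hs 2) : Mu f g ∈ Hs 2 := by
  refine mem_Hs_of_D (Mu_mem_one hf (Hs_mono_succ hg)) fun i => ?_
  rw [D_Mu' hf hg]
  exact (Hs 1).add_mem (Mu_mem_one hf (D_mem hg i)) (Mu_mem_one hg (D_mem hf i))

theorem nm_Mu_two {f g : L2} (hf : f ∈ Hs 2) (hg : g ∈ Hs 2) :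
    nm 2 (Mu f g) ≤ 9 * Csob * nm 2 f * nm 2 g := by
  have hC := Csob_pos
  have hn := nm_nonneg 2 f
  have hn' := nm_nonneg 2 g
  have h0 : ‖Mu f g‖ ≤ Csob * nm 2 f * nm 2 g :=
    (norm_Mu_le_of_mem hf g).trans (by gcongr; exact norm_le_nm _ _)
  have h1 : ∀ i, nm 1 (D i (Mu f g))
      ≤ 4 * Csob * nm 2 f * nm 1 (D i g) + 4 * Csob * nm 2 g * nm 1 (D i f) := by
    intro i
    rw [D_Mu' hf hg]
    exact (nm_add_le (Mu_mem_one hf (D_mem hg i)) (Mu_mem_one hg (D_mem hf i))).trans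
      (add_le_add (nm_Mu_one hf (D_mem hg i)) (nm_Mu_one hg (D_mem hf i)))
  have h2 := Finset.sum_le_sum fun (i : Fin 3) (_ : i ∈ Finset.univ) => h1 i
  rw [Finset.sum_add_distrib, ← Finset.mul_sum, ← Finset.mul_sum] at h2
  have h3 : ∑ i, nm 1 (D i f) ≤ nm 2 f := gm_le_nm 1 f
  have h4 : ∑ i, nm 1 (D i g) ≤ nm 2 g := gm_le_nm 1 g
  have h5 : 4 * Csob * nm 2 f * ∑ i, nm 1 (D i g) ≤ 4 * Csob * nm 2 f * nm 2 g := by gcongr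
  have h6 : 4 * Csob * nm 2 g * ∑ i, nm 1 (D i f) ≤ 4 * Csob * nm 2 g * nm 2 f := by gcongr
  rw [nm_succ]
  linarith

theorem Mu_mem_three {f g : L2} (hf : f ∈ Hs 3) (hg : g ∈ Hs 3) : Mu f g ∈ Hs 3 := by
  have hf2 := Hs_mono_succ hf
  have hg2 := Hs_mono_succ hg
  refine mem_Hs_of_D (Mu_mem_one hf2 (Hs_mono_succ hg2)) fun i => ?_
  rw [D_Mu' hf2 hg2]
  exact (Hs 2).add_mem (Mu_mem_two hf2 (D_mem hg i)) (Mu_mem_two hg2 (D_mem hf i))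

theorem gm_Mu {f g : L2} (hf : f ∈ Hs 3) (hg : g ∈ Hs 3) :
    gm 2 (Mu f g) ≤ 9 * Csob * (nm 2 f * gm 2 g + nm 2 g * gm 2 f) := by
  have hf2 := Hs_mono_succ hf
  have hg2 := Hs_mono_succ hg
  have h1 : ∀ i, nm 2 (D i (Mu f g))
      ≤ 9 * Csob * nm 2 f * nm 2 (D i g) + 9 * Csob * nm 2 g * nm 2 (D i f) := by
    intro i
    rw [D_Mu' hf2 hg2]
    exact (nm_add_le (Mu_mem_two hf2 (D_mem hg i)) (Mu_mem_two hg2 (D_mem hf i))).trans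
      (add_le_add (nm_Mu_two hf2 (D_mem hg i)) (nm_Mu_two hg2 (D_mem hf i)))
  have h2 := Finset.sum_le_sum fun (i : Fin 3) (_ : i ∈ Finset.univ) => h1 i
  rw [Finset.sum_add_distrib, ← Finset.mul_sum, ← Finset.mul_sum] at h2
  refine h2.trans (le_of_eq ?_)
  simp only [gm]
  ring

theorem nm_Mu_three {f g : L2} (hf : f ∈ Hs 3) (hg : g ∈ Hs 3) :
    nm 3 (Mu f g) ≤ 19 * Csob * nm 3 f * nm 3 g := by
  have hC := Csob_pos
  have h := gm_Mu hf hg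
  have h0 := norm_Mu_le_of_mem (Hs_mono_succ hf) g
  have a1 := nm_mono_succ 2 f
  have a2 := nm_mono_succ 2 g
  have a3 := gm_le_nm 2 f
  have a4 := gm_le_nm 2 g
  have a5 := norm_le_nm 3 g
  have b1 := nm_nonneg 2 f
  have b2 := nm_nonneg 2 g
  have b3 := gm_nonneg 2 f
  have b4 := gm_nonneg 2 g
  have c1 : nm 2 f * gm 2 g ≤ nm 3 f * nm 3 g := mul_le_mul a1 a4 b4 (b1.trans a1)
  have c2 : nm 2 g * gm 2 f ≤ nm 3 g * nm 3 f := mul_le_mul a2 a3 b3 (b2.trans a2)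
  have c3 : nm 2 f * ‖g‖ ≤ nm 3 f * nm 3 g := mul_le_mul a1 a5 (norm_nonneg _) (b1.trans a1)
  rw [nm_succ']
  have h0' : ‖Mu f g‖ ≤ Csob * (nm 3 f * nm 3 g) :=
    h0.trans (by rw [mul_assoc]; gcongr)
  have h' : gm 2 (Mu f g) ≤ 9 * Csob * (nm 3 f * nm 3 g + nm 3 g * nm 3 f) :=
    h.trans (by gcongr)
  linarith

/-- The commutator of two derivatives with multiplication by `f`. -/
def comm₂ (j k : Fin 3) (f G : L2) : L2 := Mu (D j f) (D k G) + D j (Mu (D k f) G)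

theorem D_D_Mu {f G : L2} (hf : f ∈ Hs 3) (hG : G ∈ Hs 2) (j k : Fin 3) :
    D j (D k (Mu f G)) = Mu f (D j (D k G)) + comm₂ j k f G := by
  have hf2 := Hs_mono_succ hf
  have hG1 := Hs_mono_succ hG
  rw [D_Mu hf hG1, D_add (Mu_mem_one hf2 (D_mem hG k))
    (Mu_mem_one (D_mem hf k) hG1), D_Mu hf (D_mem hG k), comm₂, add_assoc]

theorem comm₂_mem {f G : L2} (hf : f ∈ Hs 3) (hG : G ∈ Hs 2) (j k : Fin 3) :
    comm₂ j k f G ∈ Hs 1 :=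
  (Hs 1).add_mem (Mu_mem_one (D_mem hf j) (D_mem hG k)) (D_mem (Mu_mem_two (D_mem hf k) hG) j)

theorem nm_comm₂_le {f G : L2} (hf : f ∈ Hs 3) (hG : G ∈ Hs 2) (j k : Fin 3) :
    nm 1 (comm₂ j k f G) ≤ 13 * Csob * gm 2 f * nm 2 G := by
  have hC := Csob_pos
  have h1 := nm_Mu_one (D_mem hf j) (D_mem hG k)
  have h2 := (nm_D_le 1 _ j).trans (nm_Mu_two (D_mem hf k) hG)
  have h3 := nm_add_le (Mu_mem_one (D_mem hf j) (D_mem hG k))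
    (D_mem (Mu_mem_two (D_mem hf k) hG) j)
  have a1 := nm_D_le_gm 2 f j
  have a2 := nm_D_le_gm 2 f k
  have a3 := nm_D_le 1 G k
  have b1 := nm_nonneg 1 (D k G)
  have b2 := nm_nonneg 2 G
  have b3 := gm_nonneg 2 f
  have c1 : 4 * Csob * nm 2 (D j f) * nm 1 (D k G) ≤ 4 * Csob * gm 2 f * nm 2 G := by gcongr
  have c2 : 9 * Csob * nm 2 (D k f) * nm 2 G ≤ 9 * Csob * gm 2 f * nm 2 G := by gcongr
  rw [comm₂]
  linarith

theorem inner_Mu_D_D_D {q e w : L2} (hq : q ∈ Hs 3) (he : e ∈ Hs 1) (hw : w ∈ Hs 2) (i m : Fin 3) :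
    inner ℝ (Mu q (D m e)) (D i (D i w)) = inner ℝ (Mu q (D i e)) (D i (D m w))
      + inner ℝ (Mu (D m q) (D i e)) (D i w) - inner ℝ (Mu (D i q) (D m e)) (D i w) := by
  have hq2 := Hs_mono_succ hq
  have hE : Mu q e ∈ Hs 1 := Mu_mem_one hq2 he
  have hwi := D_mem hw i
  have e1 : Mu q (D m e) = D m (Mu q e) - Mu (D m q) e := by rw [D_Mu hq he]; abel
  have e2 : Mu q (D i e) = D i (Mu q e) - Mu (D i q) e := by rw [D_Mu hq he]; abel
  have s1 := inner_D_D_swap hE hwi m i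
  have s2 := inner_D_left (Mu_mem_one (D_mem hq i) he) hwi m
  have s3 := inner_D_left (Mu_mem_one (D_mem hq m) he) hwi i
  rw [(isD_Mu_pr (D_mem hq i) he m).eq, inner_add_left] at s2
  rw [(isD_Mu_pr (D_mem hq m) he i).eq, D_comm hq2, inner_add_left] at s3
  rw [e1, inner_sub_left, s1, e2, inner_sub_left, D_comm hw i m]
  linarith

/-- The main term of a product `f ∂ₘE` in the energy estimate of order three. -/
theorem abs_inner_D_D_Mu_sub_le {f E w : L2} (hf : f ∈ Hs 3) (hE : E ∈ Hs 3) (hw : w ∈ Hs 4)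
    (i j k m : Fin 3) :
    |inner ℝ (D j (D k (Mu f (D m E)))) (D i (D i (D j (D k w))))
      - inner ℝ (Mu f (D i (D j (D k E)))) (D i (D m (D j (D k w))))|
      ≤ 15 * Csob * gm 2 f * gm 2 E * gm 2 w := by
  have hC := Csob_pos
  have he : D j (D k E) ∈ Hs 1 := D_mem (D_mem hE k) j
  have hw' : D j (D k w) ∈ Hs 2 := D_mem (D_mem hw k) j
  have hDE := D_mem hE m
  have hc : D j (D k (D m E)) = D m (D j (D k E)) := by
    rw [D_comm (Hs_mono_succ hE) k m, D_comm (D_mem hE k) j m]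
  have hK := comm₂_mem hf hDE j k
  have s := inner_D_left hK (D_mem hw' i) i
  have v := inner_Mu_D_D_D hf he hw' i m
  rw [D_D_Mu hf hDE, inner_add_left, hc, v]
  set W := ‖D i (D j (D k w))‖ with hW
  have hWle : W ≤ gm 2 w := norm_DDD_le_gm 0 w i j k
  have t1 : |inner ℝ (Mu (D m f) (D i (D j (D k E)))) (D i (D j (D k w)))|
      ≤ Csob * gm 2 f * gm 2 E * gm 2 w := by
    refine (abs_real_inner_le_norm _ _).trans ?_
    have a1 := norm_Mu_le_of_mem (D_mem hf m) (D i (D j (D k E)))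
    have a2 := nm_D_le_gm 2 f m
    have a3 := norm_DDD_le_gm 0 E i j k
    have b1 := nm_nonneg 2 (D m f)
    have b2 := gm_nonneg 2 f
    have b3 := gm_nonneg 2 E
    calc _ ≤ (Csob * nm 2 (D m f) * ‖D i (D j (D k E))‖) * W := by gcongr
      _ ≤ _ := by gcongr
  have t2 : |inner ℝ (Mu (D i f) (D m (D j (D k E)))) (D i (D j (D k w)))|
      ≤ Csob * gm 2 f * gm 2 E * gm 2 w := by
    refine (abs_real_inner_le_norm _ _).trans ?_
    have a1 := norm_Mu_le_of_mem (D_mem hf i) (D m (D j (D k E)))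
    have a2 := nm_D_le_gm 2 f i
    have a3 := norm_DDD_le_gm 0 E m j k
    have b1 := nm_nonneg 2 (D i f)
    have b2 := gm_nonneg 2 f
    have b3 := gm_nonneg 2 E
    calc _ ≤ (Csob * nm 2 (D i f) * ‖D m (D j (D k E))‖) * W := by gcongr
      _ ≤ _ := by gcongr
  have t3 : |inner ℝ (comm₂ j k f (D m E)) (D i (D i (D j (D k w))))|
      ≤ 13 * Csob * gm 2 f * gm 2 E * gm 2 w := by
    have e : inner ℝ (comm₂ j k f (D m E)) (D i (D i (D j (D k w))))
        = -inner ℝ (D i (comm₂ j k f (D m E))) (D i (D j (D k w))) := by linarith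
    rw [e, abs_neg]
    refine (abs_real_inner_le_norm _ _).trans ?_
    have a1 := (norm_D_le 0 _ i).trans (nm_comm₂_le hf hDE j k)
    have a2 := nm_D_le_gm 2 E m
    have b2 := gm_nonneg 2 f
    have b3 := gm_nonneg 2 E
    calc _ ≤ (13 * Csob * gm 2 f * nm 2 (D m E)) * W := by gcongr
      _ ≤ _ := by gcongr
  rw [abs_le] at t1 t2 t3 ⊢
  constructor <;> linarith [t1.1, t1.2, t2.1, t2.2, t3.1, t3.2]

/-! ### Composition with smooth functions -/

/-- A smooth function vanishing at `0`. -/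
structure Smooth₀ (Φ : ℝ → ℝ) : Prop where
  smooth : ContDiff ℝ ∞ Φ
  zero : Φ 0 = 0

/-- `Φ' - Φ'(0)`. -/
def dshift (Φ : ℝ → ℝ) : ℝ → ℝ := fun s => deriv Φ s - deriv Φ 0

theorem Smooth₀.dshift {Φ : ℝ → ℝ} (h : Smooth₀ Φ) : Smooth₀ (dshift Φ) :=
  ⟨((contDiff_infty_iff_deriv.1 h.smooth).2).sub contDiff_const, sub_self _⟩

theorem Smooth₀.differentiable {Φ : ℝ → ℝ} (h : Smooth₀ Φ) : Differentiable ℝ Φ :=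
  h.smooth.differentiable (by simp)

theorem Smooth₀.lip {Φ : ℝ → ℝ} (h : Smooth₀ Φ) (R : ℝ) :
    ∃ K, 0 ≤ K ∧ ∀ s t, |s| ≤ R → |t| ≤ R → |Φ s - Φ t| ≤ K * |s - t| := by
  have hc : Continuous (deriv Φ) := h.smooth.continuous_deriv (by simp)
  obtain ⟨K, hK⟩ := (isCompact_Icc (a := -R) (b := R)).exists_bound_of_continuousOn hc.continuousOn
  refine ⟨max K 0, le_max_right _ _, fun s t hs ht => ?_⟩
  have := (convex_Icc (-R) R).norm_image_sub_le_of_norm_deriv_le (f := Φ) (C := max K 0)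
    (fun x _ => h.differentiable x) (fun x hx => (hK x hx).trans (le_max_left _ _))
    (abs_le.1 ht) (abs_le.1 hs)
  simpa using this

theorem Smooth₀.bound {Φ : ℝ → ℝ} (h : Smooth₀ Φ) (R : ℝ) :
    ∃ K, 0 ≤ K ∧ ∀ s, |s| ≤ R → |Φ s| ≤ K * |s| := by
  obtain ⟨K, hK0, hK⟩ := h.lip R
  refine ⟨K, hK0, fun s hs => ?_⟩
  have := hK s 0 hs (by simpa using (abs_nonneg s).trans hs)
  simpa [h.zero] using this

open Classical in
/-- The composition `Φ ∘ f` (and `0` if it is not square integrable). -/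
def cmp (Φ : ℝ → ℝ) (f : L2) : L2 :=
  if h : MemLp (fun x => Φ (f x)) 2 (volume : Measure Space) then h.toLp _ else 0

theorem coe_cmp {Φ : ℝ → ℝ} (h : Smooth₀ Φ) {f : L2} {R : ℝ} (hf : Bdd f R) :
    (cmp Φ f : Space → ℝ) =ᵐ[volume] fun x => Φ (f x) := by
  obtain ⟨K, _, hK⟩ := h.bound R
  have hm : MemLp (fun x => Φ (f x)) 2 (volume : Measure Space) := by
    refine MemLp.of_le_mul (c := K) (Lp.memLp f)
      (h.smooth.continuous.comp_aestronglyMeasurable (Lp.aestronglyMeasurable f)) ?_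
    filter_upwards [hf] with x hx
    exact hK _ hx
  rw [cmp, dif_pos hm]
  exact hm.coeFn_toLp

/-- Composition of a test function with a smooth function. -/
def Test.cmp (Φ : ℝ → ℝ) (h : Smooth₀ Φ) (ψ : Test) : Test :=
  ⟨fun x => Φ (ψ x), h.smooth.comp ψ.smooth, ψ.compact.comp_left h.zero⟩

theorem Test.cmp_d {Φ : ℝ → ℝ} (h : Smooth₀ Φ) (ψ : Test) (i : Fin 3) :
    ((ψ.cmp Φ h).d i).L = deriv Φ 0 • (ψ.d i).L + Mu (ψ.cmp _ h.dshift).L (ψ.d i).L := by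
  apply Lp.ext
  filter_upwards [((ψ.cmp Φ h).d i).coe_L, (ψ.d i).coe_L, (ψ.cmp _ h.dshift).coe_Mu (ψ.d i).L,
    Lp.coeFn_smul (deriv Φ 0) (ψ.d i).L,
    Lp.coeFn_add (deriv Φ 0 • (ψ.d i).L) (Mu (ψ.cmp _ h.dshift).L (ψ.d i).L)] with x h1 h2 h3 h4 h5
  rw [h1, h5, Pi.add_apply, h4, Pi.smul_apply, h3, h2]
  have := ((h.differentiable (ψ x)).hasDerivAt.comp_hasFDerivAt x
    (ψ.differentiable x).hasFDerivAt).fderiv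
  have h6 : (ψ.cmp Φ h).d i x = deriv Φ (ψ x) * ψ.d i x := by
    change fderiv ℝ (Φ ∘ ψ) x (basisVec i) = _
    rw [this]; rfl
  rw [h6]
  change _ = deriv Φ 0 * ψ.d i x + (deriv Φ (ψ x) - deriv Φ 0) * ψ.d i x
  ring

theorem norm_cmp_sub_le {Φ : ℝ → ℝ} (h : Smooth₀ Φ) (R : ℝ) :
    ∃ K, 0 ≤ K ∧ ∀ f g : L2, Bdd f R → Bdd g R → ‖cmp Φ f - cmp Φ g‖ ≤ K * ‖f - g‖ := by
  obtain ⟨K, hK0, hK⟩ := h.lip R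
  refine ⟨K, hK0, fun f g hf hg => ?_⟩
  refine Lp.norm_le_mul_norm_of_ae_le_mul ?_
  filter_upwards [coe_cmp h hf, coe_cmp h hg, hf, hg, Lp.coeFn_sub f g,
    Lp.coeFn_sub (cmp Φ f) (cmp Φ g)] with x h1 h2 h3 h4 h5 h6
  rw [h6, h5, Pi.sub_apply, Pi.sub_apply, h1, h2]
  exact hK _ _ h3 h4

theorem norm_cmp_le {Φ : ℝ → ℝ} (h : Smooth₀ Φ) (R : ℝ) :
    ∃ K, 0 ≤ K ∧ ∀ f : L2, Bdd f R → ‖cmp Φ f‖ ≤ K * ‖f‖ ∧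
      ∀ r, Bdd f r → Bdd (cmp Φ f) (K * r) := by
  obtain ⟨K, hK0, hK⟩ := h.bound R
  refine ⟨K, hK0, fun f hf => ⟨?_, fun r hr => ?_⟩⟩
  · refine Lp.norm_le_mul_norm_of_ae_le_mul ?_
    filter_upwards [coe_cmp h hf, hf] with x h1 h2
    rw [h1]
    exact hK _ h2
  · filter_upwards [coe_cmp h hf, hf, hr] with x h1 h2 h3
    rw [h1]
    exact (hK _ h2).trans (by gcongr)

/-- The chain rule for weak derivatives. -/
theorem isD_cmp {Φ : ℝ → ℝ} (h : Smooth₀ Φ) {f : L2} {R : ℝ} (hf : f ∈ Hs 1) (hR : Bdd f R)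
    (i : Fin 3) : IsD i (cmp Φ f) (deriv Φ 0 • D i f + Mu (cmp (dshift Φ) f) (D i f)) := by
  obtain ⟨ψ, hψ, hψR⟩ := exists_test_seq hf
  have hψR' : ∀ n, Bdd (ψ n).L R := fun n => by
    filter_upwards [(ψ n).coe_L] with x hx
    rw [hx]; exact hψR R hR n x
  have h0 := tendsto_of_nm hψ
  have h1 := tendsto_of_nm (tendsto_D_of_nm (m := 0) hψ (fun n => (ψ n).mem_Hs 1) hf i)
  have hL : ∀ {Θ : ℝ → ℝ} (hΘ : Smooth₀ Θ),
      Tendsto (fun n => ((ψ n).cmp Θ hΘ).L) atTop (𝓝 (cmp Θ f)) := by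
    intro Θ hΘ
    have e : ∀ n, ((ψ n).cmp Θ hΘ).L = cmp Θ (ψ n).L := by
      intro n
      apply Lp.ext
      filter_upwards [((ψ n).cmp Θ hΘ).coe_L, coe_cmp hΘ (hψR' n), (ψ n).coe_L] with x a b c
      rw [a, b, c]; rfl
    obtain ⟨K, _, hK⟩ := norm_cmp_sub_le hΘ R
    rw [tendsto_iff_norm_sub_tendsto_zero]
    have h2 : Tendsto (fun n => K * ‖(ψ n).L - f‖) atTop (𝓝 0) := by
      simpa using (tendsto_iff_norm_sub_tendsto_zero.1 h0).const_mul K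
    refine squeeze_zero (fun _ => norm_nonneg _) (fun n => ?_) h2
    rw [e]
    exact hK _ _ (hψR' n) hR
  intro φ
  obtain ⟨Kφ, _, hKφ⟩ := φ.exists_bdd
  obtain ⟨K', _, hK'⟩ := norm_cmp_le h.dshift R
  have a : Tendsto (fun n => inner ℝ ((ψ n).cmp Φ h).L (φ.d i).L) atTop
      (𝓝 (inner ℝ (cmp Φ f) (φ.d i).L)) := (hL h).inner tendsto_const_nhds
  have b : Tendsto (fun n => -(deriv Φ 0 * inner ℝ (D i (ψ n).L) φ.L
      + inner ℝ (D i (ψ n).L) (Mu φ.L ((ψ n).cmp _ h.dshift).L))) atTop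
      (𝓝 (-(deriv Φ 0 * inner ℝ (D i f) φ.L + inner ℝ (D i f) (Mu φ.L (cmp (dshift Φ) f))))) :=
    (((h1.inner tendsto_const_nhds).const_mul _).add
      (h1.inner (((Mu φ.L).continuous.tendsto _).comp (hL h.dshift)))).neg
  have e : inner ℝ (deriv Φ 0 • D i f + Mu (cmp (dshift Φ) f) (D i f)) φ.L
      = deriv Φ 0 * inner ℝ (D i f) φ.L + inner ℝ (D i f) (Mu φ.L (cmp (dshift Φ) f)) := by
    rw [inner_add_left, real_inner_smul_left, inner_Mu, Mu_comm ((hK' f hR).2 R hR) hKφ]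
  rw [e]
  refine tendsto_nhds_unique a (b.congr fun n => ?_)
  obtain ⟨Kn, _, hKn⟩ := ((ψ n).cmp _ h.dshift).exists_bdd
  rw [Test.isD _ i φ, Test.cmp_d, inner_add_left, real_inner_smul_left, inner_Mu,
    Mu_comm hKn hKφ, Test.D_L]

theorem D_cmp {Φ : ℝ → ℝ} (h : Smooth₀ Φ) {f : L2} {R : ℝ} (hf : f ∈ Hs 1) (hR : Bdd f R)
    (i : Fin 3) : D i (cmp Φ f) = deriv Φ 0 • D i f + Mu (cmp (dshift Φ) f) (D i f) :=
  (isD_cmp h hf hR i).eq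

theorem cmp_mem_one {Φ : ℝ → ℝ} (h : Smooth₀ Φ) {f : L2} {R : ℝ} (hf : f ∈ Hs 1) (hR : Bdd f R) :
    cmp Φ f ∈ Hs 1 := fun i => ⟨_, by simp, isD_cmp h hf hR i⟩

theorem nm_cmp_one {Φ : ℝ → ℝ} (h : Smooth₀ Φ) (R : ℝ) :
    ∃ K, 0 ≤ K ∧ ∀ f ∈ Hs 1, Bdd f R → nm 1 (cmp Φ f) ≤ K * nm 1 f := by
  obtain ⟨K, hK0, hK⟩ := norm_cmp_le h R
  obtain ⟨K', hK0', hK'⟩ := norm_cmp_le h.dshift R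
  refine ⟨K + |deriv Φ 0| + K' * |R|, by positivity, fun f hf hR => ?_⟩
  have h1 : ∀ i, ‖D i (cmp Φ f)‖ ≤ (|deriv Φ 0| + K' * |R|) * ‖D i f‖ := by
    intro i
    rw [D_cmp h hf hR, add_mul]
    refine (norm_add_le _ _).trans (add_le_add ?_ ?_)
    · rw [norm_smul, Real.norm_eq_abs]
    · exact (norm_Mu_le ((hK' f hR).2 R hR) _).trans (by gcongr; exact le_abs_self R)
  have h2 := Finset.sum_le_sum fun (i : Fin 3) (_ : i ∈ Finset.univ) => h1 i
  rw [← Finset.mul_sum] at h2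
  have h3 : nm 1 f = ‖f‖ + ∑ i, ‖D i f‖ := rfl
  have h4 : nm 1 (cmp Φ f) = ‖cmp Φ f‖ + ∑ i, ‖D i (cmp Φ f)‖ := rfl
  have h5 := (hK f hR).1
  have h6 : 0 ≤ K * ∑ i, ‖D i f‖ := by positivity
  have h7 : 0 ≤ (|deriv Φ 0| + K' * |R|) * ‖f‖ := by positivity
  rw [h3, h4]
  linarith

theorem bdd_of_nm_three {f : L2} {R : ℝ} (hf : f ∈ Hs 3) (hR : nm 3 f ≤ R) : Bdd f (Csob * R) :=
  (bdd_of_mem (Hs_mono_succ hf)).mono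
    (mul_le_mul_of_nonneg_left ((nm_mono_succ 2 f).trans hR) Csob_pos.le)

theorem cmp_two {Φ : ℝ → ℝ} (h : Smooth₀ Φ) (R : ℝ) :
    ∃ K, 0 ≤ K ∧ ∀ f ∈ Hs 3, nm 3 f ≤ R → cmp Φ f ∈ Hs 2 ∧ nm 2 (cmp Φ f) ≤ K * nm 3 f := by
  obtain ⟨K, hK0, hK⟩ := norm_cmp_le h (Csob * R)
  obtain ⟨K', hK0', hK'⟩ := nm_cmp_one h.dshift (Csob * R)
  have hC := Csob_pos
  refine ⟨K + 1 * (|deriv Φ 0| + 4 * Csob * (K' * |R|)), by positivity, fun f hf hR => ?_⟩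
  have hb := bdd_of_nm_three hf hR
  have hf1 : f ∈ Hs 1 := Hs_mono (by norm_num) hf
  have hm : cmp (dshift Φ) f ∈ Hs 1 := cmp_mem_one h.dshift hf1 hb
  obtain ⟨K2, _, hK2⟩ := norm_cmp_le h.dshift (Csob * R)
  have e : ∀ i, D i (cmp Φ f) = deriv Φ 0 • D i f + Mu (D i f) (cmp (dshift Φ) f) := fun i => by
    rw [D_cmp h hf1 hb, Mu_comm ((hK2 f hb).2 _ hb) (bdd_of_mem (D_mem hf i))]
  have m1 : ∀ i, deriv Φ 0 • D i f ∈ Hs 1 := fun i =>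
    (Hs 1).smul_mem _ (Hs_mono_succ (D_mem hf i))
  have m2 : ∀ i, Mu (D i f) (cmp (dshift Φ) f) ∈ Hs 1 := fun i => Mu_mem_one (D_mem hf i) hm
  refine ⟨mem_Hs_of_D (cmp_mem_one h hf1 hb) fun i => ?_, ?_⟩
  · rw [e]
    exact (Hs 1).add_mem (m1 i) (m2 i)
  · have h1 : ∀ i, nm 1 (D i (cmp Φ f)) ≤ (|deriv Φ 0| + 4 * Csob * (K' * |R|)) * nm 2 (D i f) := by
      intro i
      rw [e, add_mul]
      refine (nm_add_le (m1 i) (m2 i)).trans (add_le_add ?_ ?_)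
      · rw [nm_smul (Hs_mono_succ (D_mem hf i))]
        gcongr
        exact nm_mono_succ _ _
      · have h2 := nm_Mu_one (D_mem hf i) hm
        have h3 : nm 1 (cmp (dshift Φ) f) ≤ K' * |R| := by
          refine (hK' f hf1 hb).trans ?_
          gcongr
          exact (nm_mono (by norm_num) f).trans (hR.trans (le_abs_self R))
        have := nm_nonneg 2 (D i f)
        calc _ ≤ _ := h2
          _ ≤ 4 * Csob * nm 2 (D i f) * (K' * |R|) := by gcongr
          _ = _ := by ring
    have h2 := Finset.sum_le_sum fun (i : Fin 3) (_ : i ∈ Finset.univ) => h1 i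
    rw [← Finset.mul_sum] at h2
    have h4 : ∑ i, nm 2 (D i f) ≤ nm 3 f := gm_le_nm 2 f
    have h5 := (hK f hb).1
    have h6 := norm_le_nm 3 f
    rw [nm_succ]
    have h7 : K * ‖f‖ ≤ K * nm 3 f := by gcongr
    have h8 : (|deriv Φ 0| + 4 * Csob * (K' * |R|)) * ∑ i, nm 2 (D i f)
      ≤ (|deriv Φ 0| + 4 * Csob * (K' * |R|)) * nm 3 f := by gcongr
    linarith

/-- Composition with a smooth function in `H³`. -/
theorem exists_cmp_bound {Φ : ℝ → ℝ} (h : Smooth₀ Φ) (R : ℝ) :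
    ∃ K, 0 ≤ K ∧ ∀ f ∈ Hs 3, nm 3 f ≤ R → cmp Φ f ∈ Hs 3 ∧ nm 3 (cmp Φ f) ≤ K * nm 3 f ∧
      gm 2 (cmp Φ f) ≤ K * gm 2 f := by
  obtain ⟨K, hK0, hK⟩ := norm_cmp_le h (Csob * R)
  obtain ⟨K', hK0', hK'⟩ := cmp_two h.dshift R
  have hC := Csob_pos
  set A := |deriv Φ 0| + 9 * Csob * (K' * |R|) with hA
  have hA0 : 0 ≤ A := by positivity
  refine ⟨K + A, by positivity, fun f hf hR => ?_⟩
  have hb := bdd_of_nm_three hf hR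
  have hf1 : f ∈ Hs 1 := Hs_mono (by norm_num) hf
  obtain ⟨hm, hm2⟩ := hK' f hf hR
  have m1 : ∀ i, deriv Φ 0 • D i f ∈ Hs 2 := fun i => (Hs 2).smul_mem _ (D_mem hf i)
  have m2 : ∀ i, Mu (cmp (dshift Φ) f) (D i f) ∈ Hs 2 := fun i => Mu_mem_two hm (D_mem hf i)
  have h1 : ∀ i, nm 2 (D i (cmp Φ f)) ≤ A * nm 2 (D i f) := by
    intro i
    rw [D_cmp h hf1 hb, hA, add_mul]
    refine (nm_add_le (m1 i) (m2 i)).trans (add_le_add ?_ ?_)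
    · rw [nm_smul (D_mem hf i)]
    · have h2 := nm_Mu_two hm (D_mem hf i)
      have h3 : nm 2 (cmp (dshift Φ) f) ≤ K' * |R| := by
        refine hm2.trans ?_
        gcongr
        exact hR.trans (le_abs_self R)
      have := nm_nonneg 2 (D i f)
      calc _ ≤ _ := h2
        _ ≤ 9 * Csob * (K' * |R|) * nm 2 (D i f) := by gcongr
  have h2 := Finset.sum_le_sum fun (i : Fin 3) (_ : i ∈ Finset.univ) => h1 i
  rw [← Finset.mul_sum] at h2
  have g0 := gm_nonneg 2 f
  have h3 : gm 2 (cmp Φ f) ≤ A * gm 2 f := h2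
  refine ⟨mem_Hs_of_D (cmp_mem_one h hf1 hb) fun i => ?_, ?_, ?_⟩
  · rw [D_cmp h hf1 hb]
    exact (Hs 2).add_mem (m1 i) (m2 i)
  · have h5 := (hK f hb).1
    rw [nm_succ', nm_succ' 2 f]
    have : 0 ≤ K * gm 2 f := by positivity
    have : 0 ≤ A * ‖f‖ := by positivity
    linarith
  · have : 0 ≤ K * gm 2 f := by positivity
    linarith

/-! ### Convergence of difference quotients -/

theorem Test.hasDerivAt_trans_zero (φ : Test) (i : Fin 3) :
    HasDerivAt (fun s : ℝ => trans (s • basisVec i) φ.L) (φ.d i).L 0 := by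
  rw [hasDerivAt_iff_tendsto_slope_zero]
  have hlip : ∃ K, 0 ≤ K ∧ ∀ x y : Space, |φ x - φ y| ≤ K * ‖x - y‖ := by
    obtain ⟨K, hK⟩ := (φ.compact.fderiv ℝ).exists_bound_of_continuous
      (φ.smooth.continuous_fderiv (by simp))
    refine ⟨max K 0, le_max_right _ _, fun x y => ?_⟩
    have := convex_univ.norm_image_sub_le_of_norm_fderiv_le (𝕜 := ℝ) (f := φ) (C := max K 0)
      (fun x _ => φ.differentiable x) (fun x _ => (hK x).trans (le_max_left _ _))
      (mem_univ y) (mem_univ x)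
    simpa using this
  obtain ⟨K, hK0, hK⟩ := hlip
  obtain ⟨K', hK'⟩ := (φ.d i).compact.exists_bound_of_continuous (φ.d i).continuous
  have hK'0 : 0 ≤ K' := (norm_nonneg _).trans (hK' 0)
  set S : Set Space := Metric.cthickening 1 (tsupport φ) with hS
  have hSc : IsCompact S := φ.compact.isCompact.cthickening
  set q : ℝ → Space → ℝ := fun t x => (t⁻¹ * (φ (x + t • basisVec i) - φ x) - φ.d i x) ^ 2 with hq
  have hlim : Tendsto (fun t => ∫ x, q t x) (𝓝[≠] 0) (𝓝 (∫ _ : Space, (0 : ℝ))) := by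
    have hev : ∀ᶠ t : ℝ in 𝓝[≠] 0, t ≠ 0 ∧ |t| ≤ 1 := by
      refine eventually_mem_nhdsWithin.and (mem_nhdsWithin_of_mem_nhds ?_)
      filter_upwards [Metric.closedBall_mem_nhds (0 : ℝ) one_pos] with t ht
      simpa using ht
    refine tendsto_integral_filter_of_dominated_convergence
      (S.indicator fun _ => (K + K') ^ 2) ?_ ?_ ?_ ?_
    · refine Eventually.of_forall fun t => Continuous.aestronglyMeasurable ?_
      have h1 := φ.continuous
      have h2 := (φ.d i).continuous
      have h3 : Continuous fun x : Space => φ (x + t • basisVec i) :=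
        h1.comp (continuous_id.add continuous_const)
      exact ((continuous_const.mul (h3.sub h1)).sub h2).pow 2
    · filter_upwards [hev] with t ht
      refine Eventually.of_forall fun x => ?_
      by_cases hx : x ∈ S
      · rw [indicator_of_mem hx, Real.norm_eq_abs, abs_pow]
        have h1 : |t⁻¹ * (φ (x + t • basisVec i) - φ x)| ≤ K := by
          have h2 := hK (x + t • basisVec i) x
          rw [add_sub_cancel_left, norm_smul, PiLp.norm_single, norm_one, mul_one,
            Real.norm_eq_abs] at h2
          rw [abs_mul, abs_inv, inv_mul_le_iff₀ (abs_pos.2 ht.1), mul_comm]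
          exact h2
        have h2 : |φ.d i x| ≤ K' := hK' x
        gcongr
        exact (abs_sub _ _).trans (add_le_add h1 h2)
      · rw [indicator_of_notMem hx]
        have hx0 : x ∉ tsupport φ := fun h => hx (Metric.self_subset_cthickening _ h)
        have h1 : φ x = 0 := image_eq_zero_of_notMem_tsupport hx0
        have h2 : φ (x + t • basisVec i) = 0 := by
          refine image_eq_zero_of_notMem_tsupport fun h => hx ?_
          refine Metric.mem_cthickening_of_dist_le x _ 1 _ h ?_
          rw [dist_eq_norm, sub_add_cancel_left, norm_neg, norm_smul, PiLp.norm_single,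
            norm_one, mul_one]
          exact ht.2
        have h3 : φ.d i x = 0 := by
          rw [Test.d_apply]
          have : fderiv ℝ φ x = 0 :=
            image_eq_zero_of_notMem_tsupport fun h => hx0 (tsupport_fderiv_subset ℝ h)
          rw [this]; rfl
        simp [hq, h1, h2, h3]
    · exact (integrable_indicator_iff hSc.measurableSet).2
        (integrableOn_const hSc.measure_lt_top.ne)
    · refine Eventually.of_forall fun x => ?_
      have h1 : HasDerivAt (fun t : ℝ => φ (x + t • basisVec i)) (φ.d i x) 0 := by
        have h2 : HasDerivAt (fun t : ℝ => x + t • basisVec i) (basisVec i) 0 := by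
          simpa using ((hasDerivAt_id (0 : ℝ)).smul_const (basisVec i)).const_add x
        have h3 : HasFDerivAt φ (fderiv ℝ φ x) (x + (0 : ℝ) • basisVec i) := by
          simpa using (φ.differentiable x).hasFDerivAt
        exact h3.comp_hasDerivAt 0 h2
      rw [hasDerivAt_iff_tendsto_slope_zero] at h1
      have h2 := (h1.sub_const (φ.d i x)).pow 2
      simp only [zero_add, zero_smul, add_zero, smul_eq_mul, sub_self, ne_eq, OfNat.ofNat_ne_zero,
        not_false_eq_true, zero_pow] at h2
      exact h2
  rw [tendsto_iff_norm_sub_tendsto_zero]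
  have e : ∀ t : ℝ, ‖t⁻¹ • (trans ((0 + t) • basisVec i) φ.L - trans ((0 : ℝ) • basisVec i) φ.L)
      - (φ.d i).L‖ ^ 2 = ∫ x, q t x := by
    intro t
    rw [zero_add, zero_smul, trans_zero, ← real_inner_self_eq_norm_sq, L2.inner_eq, Test.trans_L]
    refine integral_congr_ae ?_
    filter_upwards [(φ.shift (t • basisVec i)).coe_L, φ.coe_L, (φ.d i).coe_L,
      Lp.coeFn_sub (φ.shift (t • basisVec i)).L φ.L,
      Lp.coeFn_smul t⁻¹ ((φ.shift (t • basisVec i)).L - φ.L),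
      Lp.coeFn_sub (t⁻¹ • ((φ.shift (t • basisVec i)).L - φ.L)) (φ.d i).L] with x h1 h2 h3 h4 h5 h6
    rw [h6, Pi.sub_apply, h5, Pi.smul_apply, h4, Pi.sub_apply, h1, h2, h3, hq, ← sq]
    rfl
  simp only [integral_zero, ← e] at hlim
  have := hlim.sqrt
  simpa [Real.sqrt_sq (norm_nonneg _)] using this

theorem Test.hasDerivAt_trans (φ : Test) (i : Fin 3) (s : ℝ) :
    HasDerivAt (fun s : ℝ => trans (s • basisVec i) φ.L) (trans (s • basisVec i) (φ.d i).L) s := by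
  have h := (φ.shift (s • basisVec i)).hasDerivAt_trans_zero i
  rw [Test.shift_d, ← Test.trans_L, ← Test.trans_L] at h
  have h2 : HasDerivAt (fun t : ℝ => t - s) 1 s := (hasDerivAt_id s).sub_const s
  have h3 : HasDerivAt (fun t : ℝ => trans (t • basisVec i) (trans (s • basisVec i) φ.L))
      (trans (s • basisVec i) (φ.d i).L) (s - s) := by rwa [sub_self]
  have h4 := HasDerivAt.scomp (h := fun t : ℝ => t - s) s h3 h2
  rw [one_smul] at h4
  refine h4.congr_of_eventuallyEq (Eventually.of_forall fun t => ?_)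
  simp only [Function.comp, trans_trans, ← add_smul, sub_add_cancel]

theorem norm_dq_le {f : L2} (hf : f ∈ Hs 1) (i : Fin 3) (h : ℝ) : ‖dq i h f‖ ≤ ‖D i f‖ := by
  have htest : ∀ φ : Test, ‖dq i h φ.L‖ ≤ ‖(φ.d i).L‖ := by
    intro φ
    rcases eq_or_ne h 0 with rfl | hh
    · simp [dq_apply]
    have := convex_univ.norm_image_sub_le_of_norm_hasDerivWithin_le
      (f := fun s : ℝ => trans (s • basisVec i) φ.L) (C := ‖(φ.d i).L‖)
      (fun s _ => (φ.hasDerivAt_trans i s).hasDerivWithinAt)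
      (fun s _ => (norm_trans _ _).le) (mem_univ 0) (mem_univ h)
    simp only [zero_smul, trans_zero, sub_zero, Real.norm_eq_abs] at this
    rw [dq_apply, norm_smul, norm_inv, Real.norm_eq_abs, inv_mul_le_iff₀ (abs_pos.2 hh), mul_comm]
    exact this
  obtain ⟨ψ, hψ, _⟩ := exists_test_seq hf
  have h0 := tendsto_of_nm hψ
  have h1 := tendsto_of_nm (tendsto_D_of_nm (m := 0) hψ (fun n => (ψ n).mem_Hs 1) hf i)
  exact le_of_tendsto_of_tendsto (((dq i h).continuous.tendsto f).comp h0).norm h1.norm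
    (Eventually.of_forall fun n => by
      simp only [Function.comp]
      rw [Test.D_L]
      exact htest _)

theorem tendsto_dq {f : L2} (hf : f ∈ Hs 1) (i : Fin 3) :
    Tendsto (fun h => dq i h f) (𝓝[≠] 0) (𝓝 (D i f)) := by
  rw [Metric.tendsto_nhds]
  intro ε hε
  obtain ⟨ψ, hψ, _⟩ := exists_test_near hf (show 0 < ε / 3 by positivity)
  have hm := (Hs 1).sub_mem (ψ.mem_Hs 1) hf
  have h1 : ‖D i (ψ.L - f)‖ < ε / 3 := (norm_D_le 0 _ i).trans_lt hψ
  have h2 := ψ.hasDerivAt_trans_zero i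
  rw [hasDerivAt_iff_tendsto_slope_zero, Metric.tendsto_nhds] at h2
  filter_upwards [h2 (ε / 3) (by positivity)] with h hh
  rw [zero_add, zero_smul, trans_zero] at hh
  change dist (dq i h ψ.L) (ψ.d i).L < ε / 3 at hh
  have h3 := norm_dq_le hm i h
  rw [D_sub (ψ.mem_Hs 1) hf, Test.D_L] at h1 h3
  rw [map_sub] at h3
  calc dist (dq i h f) (D i f) ≤ dist (dq i h f) (dq i h ψ.L) + dist (dq i h ψ.L) (ψ.d i).L
        + dist (ψ.d i).L (D i f) := dist_triangle4 _ _ _ _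
    _ < ε / 3 + ε / 3 + ε / 3 := by
        have h4 : dist (dq i h f) (dq i h ψ.L) < ε / 3 := by
          rw [dist_comm, dist_eq_norm]; exact h3.trans_lt h1
        have h5 : dist (ψ.d i).L (D i f) < ε / 3 := by rw [dist_eq_norm]; exact h1
        linarith
    _ = ε := by ring

theorem tendsto_dq_of_tendsto {ι : Type*} {l : Filter ι} {h : ι → ℝ} (hh : Tendsto h l (𝓝[≠] 0))
    {F : ι → L2} {f : L2} (hF : ∀ n, F n ∈ Hs 1) (hf : f ∈ Hs 1) {i : Fin 3}
    (hlim : Tendsto (fun n => D i (F n)) l (𝓝 (D i f))) :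
    Tendsto (fun n => dq i (h n) (F n)) l (𝓝 (D i f)) := by
  have h1 : Tendsto (fun n => dq i (h n) (F n - f)) l (𝓝 0) := by
    refine squeeze_zero_norm (fun n => norm_dq_le ((Hs 1).sub_mem (hF n) hf) i (h n)) ?_
    have := (tendsto_iff_norm_sub_tendsto_zero.1 hlim)
    exact this.congr fun n => by rw [D_sub (hF n) hf]
  have h2 := h1.add ((tendsto_dq hf i).comp hh)
  rw [zero_add] at h2
  exact h2.congr fun n => by simp

/-! ### Iterated derivatives and difference quotients -/

/-- Iterated weak derivative. -/
def DL : List (Fin 3) → L2 → L2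
  | [], f => f
  | i :: l, f => D i (DL l f)

/-- Iterated difference quotient. -/
def dqL (h : ℝ) : List (Fin 3) → L2 →L[ℝ] L2
  | [] => ContinuousLinearMap.id ℝ L2
  | i :: l => (dq i h).comp (dqL h l)

theorem dqL_cons (h : ℝ) (i : Fin 3) (l : List (Fin 3)) (f : L2) :
    dqL h (i :: l) f = dq i h (dqL h l f) := rfl

theorem DL_mem {l : List (Fin 3)} {m : ℕ} {f : L2} (hf : f ∈ Hs (m + l.length)) : DL l f ∈ Hs m := by
  induction l generalizing m with
  | nil => exact hf
  | cons i l ih =>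
    refine D_mem (ih ?_) i
    rw [List.length_cons] at hf
    rwa [show m + 1 + l.length = m + (l.length + 1) by ring]

theorem DL_D {l : List (Fin 3)} {f : L2} (hf : f ∈ Hs (1 + l.length)) (i : Fin 3) :
    DL l (D i f) = D i (DL l f) := by
  induction l with
  | nil => rfl
  | cons j l ih =>
    rw [List.length_cons] at hf
    have hf1 : f ∈ Hs (1 + l.length) := Hs_mono (by omega) hf
    have hf2 : DL l f ∈ Hs 2 := DL_mem (by rwa [show 2 + l.length = 1 + (l.length + 1) by ring])
    change D j (DL l (D i f)) = D i (D j (DL l f))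
    rw [ih hf1, D_comm hf2]

theorem dqL_mem {l : List (Fin 3)} {m : ℕ} {f : L2} (hf : f ∈ Hs m) (h : ℝ) : dqL h l f ∈ Hs m := by
  induction l with
  | nil => exact hf
  | cons i l ih => exact dq_mem ih i h

theorem D_dqL {l : List (Fin 3)} {f : L2} (hf : f ∈ Hs 1) (i : Fin 3) (h : ℝ) :
    D i (dqL h l f) = dqL h l (D i f) := by
  induction l with
  | nil => rfl
  | cons j l ih => rw [dqL_cons, dqL_cons, D_dq (dqL_mem hf h), ih]

theorem norm_dqL_le {l : List (Fin 3)} {f : L2} (hf : f ∈ Hs l.length) (h : ℝ) :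
    ‖dqL h l f‖ ≤ ‖DL l f‖ := by
  induction l generalizing f with
  | nil => exact le_rfl
  | cons i l ih =>
    rw [List.length_cons] at hf
    have hf1 : f ∈ Hs 1 := Hs_mono (by omega) hf
    rw [dqL_cons]
    refine (norm_dq_le (dqL_mem hf1 h) i h).trans ?_
    rw [D_dqL hf1]
    refine (ih (D_mem hf i)).trans (le_of_eq ?_)
    rw [DL_D (by rwa [add_comm])]
    rfl

theorem tendsto_dqL {l : List (Fin 3)} {ι : Type*} {L : Filter ι} {h : ι → ℝ}
    (hh : Tendsto h L (𝓝[≠] 0)) {f : L2} (hf : f ∈ Hs l.length) :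
    Tendsto (fun n => dqL (h n) l f) L (𝓝 (DL l f)) := by
  induction l generalizing f with
  | nil => exact tendsto_const_nhds
  | cons i l ih =>
    rw [List.length_cons] at hf
    have hf1 : f ∈ Hs 1 := Hs_mono (by omega) hf
    refine tendsto_dq_of_tendsto hh (fun n => dqL_mem hf1 _)
      (DL_mem (by rwa [add_comm])) ?_
    simp only [D_dqL hf1]
    rw [← DL_D (by rwa [add_comm])]
    exact ih (D_mem hf i)

/-! ### Derivatives in time -/

/-- `f` is differentiable on `[0,T]` as an `L²`-valued function, with derivative `g`. -/
def DerivOn (T : ℝ) (f g : ℝ → L2) : Prop :=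
  ∀ t ∈ Icc 0 T, HasDerivWithinAt f (g t) (Icc 0 T) t

theorem DerivOn.clm {T : ℝ} {f g : ℝ → L2} (h : DerivOn T f g) (A : L2 →L[ℝ] L2) :
    DerivOn T (fun t => A (f t)) (fun t => A (g t)) := fun t ht =>
  A.hasFDerivAt.comp_hasDerivWithinAt t (h t ht)

theorem integral_of_tendsto_deriv {T : ℝ} {e e' : ℕ → ℝ → ℝ} {E E' b : ℝ → ℝ}
    (he : ∀ n, ∀ t ∈ Icc 0 T, HasDerivWithinAt (e n) (e' n t) (Icc 0 T) t)
    (hb : ∀ n, ∀ᵐ t ∂(volume.restrict (Ioo 0 T)), |e' n t| ≤ b t)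
    (hbi : IntegrableOn b (Ioo 0 T))
    (hE : ∀ t ∈ Icc 0 T, Tendsto (fun n => e n t) atTop (𝓝 (E t)))
    (hE' : ∀ᵐ t ∂(volume.restrict (Ioo 0 T)), Tendsto (fun n => e' n t) atTop (𝓝 (E' t))) :
    IntegrableOn E' (Ioo 0 T) ∧ ∀ t ∈ Icc 0 T, E t = E 0 + ∫ s in Ioo 0 t, E' s := by
  have hd : ∀ n, ∀ t ∈ Ioo 0 T, HasDerivAt (e n) (e' n t) t := fun n t ht =>
    (he n t (Ioo_subset_Icc_self ht)).hasDerivAt (Icc_mem_nhds ht.1 ht.2)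
  have hm : ∀ n, AEStronglyMeasurable (e' n) (volume.restrict (Ioo 0 T)) := by
    intro n
    refine (measurable_deriv (e n)).aestronglyMeasurable.congr ?_
    filter_upwards [ae_restrict_mem measurableSet_Ioo] with t ht
    exact (hd n t ht).deriv
  have hi : ∀ n, IntegrableOn (e' n) (Ioo 0 T) := fun n =>
    Integrable.mono' hbi (hm n) (hb n)
  have hEi : IntegrableOn E' (Ioo 0 T) := by
    refine Integrable.mono' hbi (aestronglyMeasurable_of_tendsto_ae atTop hm hE') ?_
    filter_upwards [hE', ae_all_iff.2 hb] with t h1 h2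
    exact le_of_tendsto h1.abs (Eventually.of_forall h2)
  refine ⟨hEi, fun t ht => ?_⟩
  have hsub : Ioo 0 t ⊆ Ioo 0 T := Ioo_subset_Ioo_right ht.2
  have hftc : ∀ n, e n t = e n 0 + ∫ s in Ioo 0 t, e' n s := by
    intro n
    have h1 : ∫ s in (0 : ℝ)..t, e' n s = e n t - e n 0 := by
      refine intervalIntegral.integral_eq_sub_of_hasDerivAt_of_le ht.1 ?_
        (fun s hs => hd n s (hsub hs)) ?_
      · exact fun s hs => ((he n s ⟨hs.1, hs.2.trans ht.2⟩).continuousWithinAt).mono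
          (Icc_subset_Icc_right ht.2)
      · rw [intervalIntegrable_iff_integrableOn_Ioo_of_le ht.1]
        exact (hi n).mono_set hsub
    rw [intervalIntegral.integral_of_le ht.1, integral_Ioc_eq_integral_Ioo] at h1
    linarith
  have hlim : Tendsto (fun n => ∫ s in Ioo 0 t, e' n s) atTop (𝓝 (∫ s in Ioo 0 t, E' s)) :=
    tendsto_integral_of_dominated_convergence b (fun n => (hm n).mono_measure
        (Measure.restrict_mono hsub le_rfl)) (hbi.mono_set hsub)
      (fun n => ae_restrict_of_ae_restrict_of_subset hsub (hb n))
      (ae_restrict_of_ae_restrict_of_subset hsub hE')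
  have h0 : (0 : ℝ) ∈ Icc 0 T := ⟨le_rfl, ht.1.trans ht.2⟩
  exact tendsto_nhds_unique (hE t ht) (((hE 0 h0).add hlim).congr fun n => (hftc n).symm)

/-- A sequence of steps tending to zero. -/
def step (n : ℕ) : ℝ := 1 / ((n : ℝ) + 1)

theorem tendsto_step : Tendsto step atTop (𝓝[≠] 0) :=
  tendsto_nhdsWithin_iff.2 ⟨tendsto_one_div_add_atTop_nhds_zero_nat,
    Eventually.of_forall fun n => by
      have : (0 : ℝ) < step n := by unfold step; positivity
      exact this.ne'⟩

theorem tendsto_neg_step : Tendsto (fun n => -step n) atTop (𝓝[≠] 0) :=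
  tendsto_nhdsWithin_iff.2 ⟨by
    simpa using (tendsto_nhdsWithin_iff.1 tendsto_step).1.neg, by
    filter_upwards [(tendsto_nhdsWithin_iff.1 tendsto_step).2] with n hn
    simpa using hn⟩

/-- Evolution of `⟨D^β f, ∂ₘ D^β g⟩`. -/
theorem cross_evolution {T : ℝ} {f f' g g' : ℝ → L2} {b : ℝ → ℝ} (hf : DerivOn T f f')
    (hg : DerivOn T g g') (l : List (Fin 3)) (m : Fin 3)
    (hfm : ∀ t ∈ Icc 0 T, f t ∈ Hs (l.length + 1)) (hgm : ∀ t ∈ Icc 0 T, g t ∈ Hs (l.length + 1))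
    (hfm' : ∀ᵐ t ∂(volume.restrict (Ioo 0 T)), f' t ∈ Hs l.length)
    (hgm' : ∀ᵐ t ∂(volume.restrict (Ioo 0 T)), g' t ∈ Hs l.length)
    (hb : ∀ᵐ t ∂(volume.restrict (Ioo 0 T)), ‖DL l (f' t)‖ * ‖D m (DL l (g t))‖
      + ‖D m (DL l (f t))‖ * ‖DL l (g' t)‖ ≤ b t)
    (hbi : IntegrableOn b (Ioo 0 T)) :
    IntegrableOn (fun t => inner ℝ (DL l (f' t)) (D m (DL l (g t)))
        - inner ℝ (D m (DL l (f t))) (DL l (g' t))) (Ioo 0 T) ∧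
      ∀ t ∈ Icc 0 T, inner ℝ (DL l (f t)) (D m (DL l (g t))) = inner ℝ (DL l (f 0)) (D m (DL l (g 0)))
        + ∫ s in Ioo 0 t, (inner ℝ (DL l (f' s)) (D m (DL l (g s)))
          - inner ℝ (D m (DL l (f s))) (DL l (g' s))) := by
  refine integral_of_tendsto_deriv (b := b)
    (e := fun n t => inner ℝ (dqL (step n) l (f t)) (dqL (step n) (m :: l) (g t)))
    (e' := fun n t => inner ℝ (dqL (step n) l (f' t)) (dqL (step n) (m :: l) (g t))
      - inner ℝ (dq m (-step n) (dqL (step n) l (f t))) (dqL (step n) l (g' t)))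
    (E := fun t => inner ℝ (DL l (f t)) (D m (DL l (g t)))) ?_ ?_ hbi ?_ ?_
  · intro n t ht
    have h := (hf.clm (dqL (step n) l) t ht).inner ℝ (hg.clm (dqL (step n) (m :: l)) t ht)
    refine h.congr_deriv ?_
    change inner ℝ (dqL (step n) l (f t)) (dq m (step n) (dqL (step n) l (g' t)))
      + inner ℝ (dqL (step n) l (f' t)) (dqL (step n) (m :: l) (g t)) = _
    rw [inner_dq, neg_neg]
    ring
  · intro n
    filter_upwards [hb, hfm', hgm', ae_restrict_mem measurableSet_Ioo] with t h1 h2 h3 ht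
    have ht' := Ioo_subset_Icc_self ht
    have hf1 := hfm t ht'
    have hg1 := hgm t ht'
    have hf0 : f t ∈ Hs 1 := Hs_mono (by omega) hf1
    refine (abs_sub _ _).trans (le_trans (add_le_add ?_ ?_) h1)
    · refine (abs_real_inner_le_norm _ _).trans ?_
      have a1 := norm_dqL_le h2 (step n)
      have a2 := norm_dqL_le (l := m :: l) hg1 (step n)
      exact mul_le_mul a1 a2 (norm_nonneg _) (norm_nonneg _)
    · refine (abs_real_inner_le_norm _ _).trans ?_
      have a1 := norm_dqL_le h3 (step n)
      have a2 := norm_dq_le (dqL_mem (l := l) hf0 (step n)) m (-step n)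
      rw [D_dqL hf0] at a2
      have a3 := norm_dqL_le (D_mem hf1 m) (step n)
      rw [DL_D (by rwa [add_comm])] at a3
      exact mul_le_mul (a2.trans a3) a1 (norm_nonneg _) (norm_nonneg _)
  · intro t ht
    exact (tendsto_dqL tendsto_step (Hs_mono (by omega) (hfm t ht))).inner
      (tendsto_dqL (l := m :: l) tendsto_step (hgm t ht))
  · filter_upwards [hfm', hgm', ae_restrict_mem measurableSet_Ioo] with t h2 h3 ht
    have ht' := Ioo_subset_Icc_self ht
    have hf1 := hfm t ht'
    have hf0 : f t ∈ Hs 1 := Hs_mono (by omega) hf1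
    refine ((tendsto_dqL tendsto_step h2).inner
      (tendsto_dqL (l := m :: l) tendsto_step (hgm t ht'))).sub
        (Tendsto.inner ?_ (tendsto_dqL tendsto_step h3))
    refine tendsto_dq_of_tendsto tendsto_neg_step (fun n => dqL_mem hf0 _)
      (DL_mem (by rwa [add_comm])) ?_
    simp only [D_dqL hf0]
    rw [← DL_D (by rwa [add_comm])]
    exact tendsto_dqL tendsto_step (D_mem hf1 m)

/-- Evolution of `‖∂ᵢ D^β f‖²` when `f ∈ H^{|β|+2}` at almost every time. -/
theorem energy_evolution {T : ℝ} {f f' : ℝ → L2} {b : ℝ → ℝ} (hf : DerivOn T f f')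
    (l : List (Fin 3)) (i : Fin 3) (hfm : ∀ t ∈ Icc 0 T, f t ∈ Hs (l.length + 1))
    (hfm2 : ∀ᵐ t ∂(volume.restrict (Ioo 0 T)), f t ∈ Hs (l.length + 2))
    (hfm' : ∀ᵐ t ∂(volume.restrict (Ioo 0 T)), f' t ∈ Hs l.length)
    (hb : ∀ᵐ t ∂(volume.restrict (Ioo 0 T)),
      2 * (‖DL l (f' t)‖ * ‖D i (D i (DL l (f t)))‖) ≤ b t)
    (hbi : IntegrableOn b (Ioo 0 T)) :
    IntegrableOn (fun t => -2 * inner ℝ (DL l (f' t)) (D i (D i (DL l (f t))))) (Ioo 0 T) ∧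
      ∀ t ∈ Icc 0 T, ‖D i (DL l (f t))‖ ^ 2 = ‖D i (DL l (f 0))‖ ^ 2
        + ∫ s in Ioo 0 t, -2 * inner ℝ (DL l (f' s)) (D i (D i (DL l (f s)))) := by
  refine integral_of_tendsto_deriv (b := b)
    (e := fun n t => ‖dqL (step n) (i :: l) (f t)‖ ^ 2)
    (e' := fun n t => -2 * inner ℝ (dqL (step n) l (f' t))
      (dq i (-step n) (dqL (step n) (i :: l) (f t))))
    (E := fun t => ‖D i (DL l (f t))‖ ^ 2) ?_ ?_ hbi ?_ ?_
  · intro n t ht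
    have h := (hf.clm (dqL (step n) (i :: l)) t ht).norm_sq
    refine h.congr_deriv ?_
    change 2 * inner ℝ (dqL (step n) (i :: l) (f t)) (dq i (step n) (dqL (step n) l (f' t))) = _
    rw [real_inner_comm, inner_dq]
    ring
  · intro n
    filter_upwards [hb, hfm2, hfm', ae_restrict_mem measurableSet_Ioo] with t h1 h2 h3 ht
    have hf0 : f t ∈ Hs 1 := Hs_mono (by omega) h2
    rw [abs_mul, abs_neg, abs_two]
    refine le_trans ?_ h1
    gcongr
    refine (abs_real_inner_le_norm _ _).trans ?_
    have a1 := norm_dqL_le h3 (step n)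
    have a2 := norm_dq_le (dqL_mem (l := i :: l) hf0 (step n)) i (-step n)
    rw [D_dqL hf0] at a2
    have a3 := norm_dqL_le (l := i :: l) (D_mem h2 i) (step n)
    rw [DL_D (l := i :: l) (by rwa [List.length_cons, show 1 + (l.length + 1) = l.length + 2 by ring])]
      at a3
    exact mul_le_mul a1 (a2.trans a3) (norm_nonneg _) (norm_nonneg _)
  · intro t ht
    exact (tendsto_dqL (l := i :: l) tendsto_step (hfm t ht)).norm.pow 2
  · filter_upwards [hfm2, hfm', ae_restrict_mem measurableSet_Ioo] with t h2 h3 ht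
    have hf0 : f t ∈ Hs 1 := Hs_mono (by omega) h2
    refine Tendsto.const_mul _ ((tendsto_dqL tendsto_step h3).inner ?_)
    have hl : f t ∈ Hs (1 + (i :: l).length) := by
      rwa [List.length_cons, show 1 + (l.length + 1) = l.length + 2 by ring]
    refine tendsto_dq_of_tendsto tendsto_neg_step (fun n => dqL_mem hf0 _)
      (DL_mem (l := i :: l) hl) ?_
    simp only [D_dqL hf0]
    rw [← DL_D hl]
    exact tendsto_dqL tendsto_step (D_mem h2 i)

/-! ### Evolution of functionals -/

/-- `E` is absolutely continuous on `[0,T]` with derivative `E'`. -/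
def Evol (T : ℝ) (E E' : ℝ → ℝ) : Prop :=
  IntegrableOn E' (Ioo 0 T) ∧ ∀ t ∈ Icc 0 T, E t = E 0 + ∫ s in Ioo 0 t, E' s

theorem Evol.integrableOn {T : ℝ} {E E' : ℝ → ℝ} (h : Evol T E E') {t : ℝ} (ht : t ∈ Icc 0 T) :
    IntegrableOn E' (Ioo 0 t) := h.1.mono_set (Ioo_subset_Ioo_right ht.2)

theorem Evol.add {T : ℝ} {E E' F F' : ℝ → ℝ} (h : Evol T E E') (k : Evol T F F') :
    Evol T (fun t => E t + F t) (fun t => E' t + F' t) := by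
  refine ⟨h.1.add k.1, fun t ht => ?_⟩
  rw [integral_add (h.integrableOn ht) (k.integrableOn ht)]
  beta_reduce
  rw [h.2 t ht, k.2 t ht]
  ring

theorem Evol.const_mul {T : ℝ} {E E' : ℝ → ℝ} (c : ℝ) (h : Evol T E E') :
    Evol T (fun t => c * E t) (fun t => c * E' t) := by
  refine ⟨Integrable.const_mul h.1 c, fun t ht => ?_⟩
  rw [integral_const_mul]
  beta_reduce
  rw [h.2 t ht]
  ring

theorem Evol.zero (T : ℝ) : Evol T (fun _ => 0) (fun _ => 0) := by
  refine ⟨integrableOn_zero, fun t _ => by simp⟩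

theorem Evol.sum {T : ℝ} {ι : Type*} (s : Finset ι) {E E' : ι → ℝ → ℝ}
    (h : ∀ i ∈ s, Evol T (E i) (E' i)) :
    Evol T (fun t => ∑ i ∈ s, E i t) (fun t => ∑ i ∈ s, E' i t) := by
  classical
  induction s using Finset.induction_on with
  | empty => simpa using Evol.zero T
  | insert a s ha ih =>
    simp only [Finset.sum_insert ha]
    exact (h a (Finset.mem_insert_self a s)).add
      (ih fun i hi => h i (Finset.mem_insert_of_mem hi))

theorem Evol.lintegral_le {T : ℝ} {E E' : ℝ → ℝ} (h : Evol T E E') {X : ℝ → ℝ≥0∞}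
    (hX : ∀ᵐ s ∂(volume.restrict (Ioo 0 T)), X s ≤ ENNReal.ofReal (-E' s))
    (h0 : ∀ᵐ s ∂(volume.restrict (Ioo 0 T)), E' s ≤ 0) {t : ℝ} (ht : t ∈ Icc 0 T) :
    ∫⁻ s in Ioo 0 t, X s ≤ ENNReal.ofReal (E 0 - E t) := by
  have hsub : Ioo 0 t ⊆ Ioo 0 T := Ioo_subset_Ioo_right ht.2
  refine (lintegral_mono_ae (ae_restrict_of_ae_restrict_of_subset hsub hX)).trans ?_
  rw [← ofReal_integral_eq_lintegral_ofReal (f := fun s => -E' s) (h.integrableOn ht).neg,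
    integral_neg]
  · refine ENNReal.ofReal_le_ofReal ?_
    rw [h.2 t ht]
    linarith
  · filter_upwards [ae_restrict_of_ae_restrict_of_subset hsub h0] with s hs
    simpa using hs

theorem evol_norm_sq {T K : ℝ} {f f' : ℝ → L2} (hf : DerivOn T f f')
    (h0 : ∀ t ∈ Icc 0 T, ‖f t‖ ≤ K) (h1 : ∀ t ∈ Icc 0 T, ‖f' t‖ ≤ K) :
    Evol T (fun t => ‖f t‖ ^ 2) (fun t => 2 * inner ℝ (f' t) (f t)) := by
  refine integral_of_tendsto_deriv (b := fun _ => 2 * (K * K)) (e := fun _ t => ‖f t‖ ^ 2)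
    (e' := fun _ t => 2 * inner ℝ (f' t) (f t)) ?_ ?_
    (integrableOn_const measure_Ioo_lt_top.ne) ?_ ?_
  · intro _ t ht
    refine (hf t ht).norm_sq.congr_deriv ?_
    rw [real_inner_comm]
  · intro _
    filter_upwards [ae_restrict_mem measurableSet_Ioo] with t ht
    have ht' := Ioo_subset_Icc_self ht
    rw [abs_mul, abs_two]
    gcongr
    exact (abs_real_inner_le_norm _ _).trans (mul_le_mul (h1 t ht') (h0 t ht') (norm_nonneg _)
      ((norm_nonneg _).trans (h0 t ht')))
  · exact fun _ _ => tendsto_const_nhds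
  · exact Eventually.of_forall fun _ => tendsto_const_nhds

/-! ### Difference quotients in Sobolev spaces -/

theorem nm_dq_le {m : ℕ} {f : L2} (hf : f ∈ Hs (m + 1)) (i : Fin 3) (h : ℝ) :
    nm m (dq i h f) ≤ nm m (D i f) := by
  induction m generalizing f with
  | zero => exact norm_dq_le hf i h
  | succ m ih =>
    have hf1 : f ∈ Hs 1 := Hs_mono (by omega) hf
    have hf2 : f ∈ Hs 2 := Hs_mono (by omega) hf
    rw [nm_succ, nm_succ]
    refine add_le_add (norm_dq_le hf1 i h) (Finset.sum_le_sum fun j _ => ?_)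
    rw [D_dq hf1, D_comm hf2]
    exact ih (D_mem hf j)

theorem tendsto_nm_dq {m : ℕ} {f : L2} (hf : f ∈ Hs (m + 1)) (i : Fin 3) {ι : Type*} {L : Filter ι}
    {h : ι → ℝ} (hh : Tendsto h L (𝓝[≠] 0)) :
    Tendsto (fun n => nm m (dq i (h n) f - D i f)) L (𝓝 0) := by
  have h0 : ∀ {f : L2}, f ∈ Hs 1 → Tendsto (fun n => ‖dq i (h n) f - D i f‖) L (𝓝 0) :=
    fun hf => tendsto_iff_norm_sub_tendsto_zero.1 ((tendsto_dq hf i).comp hh)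
  induction m generalizing f with
  | zero => exact h0 hf
  | succ m ih =>
    have hf1 : f ∈ Hs 1 := Hs_mono (by omega) hf
    have hf2 : f ∈ Hs 2 := Hs_mono (by omega) hf
    simp only [nm_succ]
    rw [show (0 : ℝ) = 0 + ∑ _j : Fin 3, 0 by simp]
    refine (h0 hf1).add (tendsto_finsetSum _ fun j _ => ?_)
    simp only [D_sub (dq_mem hf1 _ _) (D_mem hf2 i), D_dq hf1, D_comm hf2 j i]
    exact ih (D_mem hf j)

theorem Bdd.trans {a : L2} {K : ℝ} (h : Bdd a K) (v : Space) : Bdd (trans v a) K := by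
  have h1 := (measurePreserving_add_right volume v).quasiMeasurePreserving.ae h
  filter_upwards [coe_trans v a, h1] with x hx h2
  rw [hx]
  exact h2

theorem trans_Mu {a : L2} {K : ℝ} (h : Bdd a K) (v : Space) (f : L2) :
    trans v (Mu a f) = Mu (trans v a) (trans v f) := by
  refine Lp.ext ?_
  have h1 := (measurePreserving_add_right volume v).quasiMeasurePreserving.ae (coe_Mu h f)
  filter_upwards [coe_trans v a, coe_trans v f, coe_trans v (Mu a f),
    coe_Mu (h.trans v) (trans v f), h1] with x h2 h3 h4 h5 h6
  rw [h4, h5, h2, h3]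
  exact h6

theorem dq_Mu {a : L2} {K : ℝ} (ha : Bdd a K) (i : Fin 3) (h : ℝ) (f : L2) :
    dq i h (Mu a f) = Mu a (dq i h f) + Mu (dq i h a) (trans (h • basisVec i) f) := by
  have h1 : Mu (dq i h a) (trans (h • basisVec i) f)
      = h⁻¹ • (Mu (trans (h • basisVec i) a) (trans (h • basisVec i) f)
        - Mu a (trans (h • basisVec i) f)) := by
    have hb := ha.trans (h • basisVec i)
    have e : dq i h a = h⁻¹ • (trans (h • basisVec i) a + (-1 : ℝ) • a) := by
      rw [dq_apply]; congr 1; module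
    rw [e, Mu_smul_left (hb.add (ha.smul _)), Mu_add_left hb (ha.smul _), Mu_smul_left ha]
    congr 1; module
  rw [h1, dq_apply, dq_apply, trans_Mu ha, map_smul, map_sub]
  module

theorem inner_Mu_D_self {a w : L2} (ha : a ∈ Hs 3) (hw : w ∈ Hs 1) (l : Fin 3) :
    2 * inner ℝ (Mu a w) (D l w) = -inner ℝ (Mu (D l a) w) w := by
  have h := inner_D_left (Mu_mem_one (Hs_mono (by omega) ha) hw) hw l
  rw [D_Mu ha hw, inner_add_left, inner_Mu, real_inner_comm] at h
  linarith

theorem inner_weighted_transport {ϖ ϖ' F F' A : L2} {v : Fin 3 → L2} (hϖ : ϖ ∈ Hs 3)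
    (hv : ∀ l, v l ∈ Hs 3) (hF : F ∈ Hs 1) (h : F' = A - ∑ l, Mu (v l) (D l F)) :
    inner ℝ (F + Mu ϖ F) F' + inner ℝ (F' + (Mu ϖ' F + Mu ϖ F')) F
      = inner ℝ (Mu ϖ' F) F + 2 * inner ℝ (F + Mu ϖ F) A
        + ∑ l, inner ℝ (Mu (D l (v l + Mu ϖ (v l))) F) F := by
  have b2 := bdd_of_mem (Hs_mono (by omega : 2 ≤ 3) hϖ)
  have e2 : ∀ l, 2 * inner ℝ (F + Mu ϖ F) (Mu (v l) (D l F))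
      = -inner ℝ (Mu (D l (v l + Mu ϖ (v l))) F) F := by
    intro l
    have b1 := bdd_of_mem (Hs_mono (by omega : 2 ≤ 3) (hv l))
    rw [← inner_Mu_D_self ((Hs 3).add_mem (hv l) (Mu_mem_three hϖ (hv l))) hF l, ← inner_Mu,
      Mu_add_left b1 (b2.Mu b1), Mu_Mu b2 b1, map_add, Mu_Mu_comm]
  have e3 : ∑ l, inner ℝ (Mu (D l (v l + Mu ϖ (v l))) F) F
      = -(2 * inner ℝ (F + Mu ϖ F) (∑ l, Mu (v l) (D l F))) := by
    rw [inner_sum, Finset.mul_sum, ← Finset.sum_neg_distrib]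
    exact Finset.sum_congr rfl fun l _ => by rw [e2, neg_neg]
  have e4 : inner ℝ (F' + (Mu ϖ' F + Mu ϖ F')) F
      = inner ℝ (F + Mu ϖ F) F' + inner ℝ (Mu ϖ' F) F := by
    rw [inner_add_left, inner_add_left, inner_Mu ϖ F' F, inner_add_left,
      real_inner_comm F' F, real_inner_comm F' (Mu ϖ F)]
    ring
  rw [e3, e4, h, inner_sub_right]
  ring

theorem dq_transport {f f' B : L2} {v : Fin 3 → L2} (hv : ∀ l, v l ∈ Hs 3) (hf : f ∈ Hs 1)
    (h : f' = B - ∑ l, Mu (v l) (D l f)) (i : Fin 3) (s : ℝ) :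
    dq i s f' = (dq i s B - ∑ l, Mu (dq i s (v l)) (trans (s • basisVec i) (D l f)))
      - ∑ l, Mu (v l) (D l (dq i s f)) := by
  have h1 : ∀ l, dq i s (Mu (v l) (D l f)) = Mu (dq i s (v l)) (trans (s • basisVec i) (D l f))
      + Mu (v l) (D l (dq i s f)) := by
    intro l
    have hb := bdd_of_mem (Hs_mono (by omega : 2 ≤ 3) (hv l))
    rw [dq_Mu hb, D_dq hf, add_comm]
  rw [h, map_sub, map_sum, sub_sub, ← Finset.sum_add_distrib]
  simp only [h1]

/-- Evolution of the weighted energy `⟨(1 + ϖ) ∂ᵢ f, ∂ᵢ f⟩` of a transported function. -/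
theorem weighted_transport_evolution {T K : ℝ} {f f' B ϖ ϖ' : ℝ → L2} {v : Fin 3 → ℝ → L2}
    {b : ℝ → ℝ} (i : Fin 3) (hf : DerivOn T f f') (hf1 : ∀ t ∈ Icc 0 T, f t ∈ Hs 1)
    (hϖ : ∀ t ∈ Icc 0 T, HasDerivWithinAt (fun s => Mu (ϖ s)) (Mu (ϖ' t)) (Icc 0 T) t)
    (hϖ3 : ∀ t ∈ Icc 0 T, ϖ t ∈ Hs 3) (hv : ∀ t ∈ Icc 0 T, ∀ l, v l t ∈ Hs 3)
    (heq : ∀ t ∈ Icc 0 T, f' t = B t - ∑ l, Mu (v l t) (D l (f t)))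
    (hB : ∀ᵐ t ∂(volume.restrict (Ioo 0 T)), B t ∈ Hs 1)
    (hKf : ∀ t ∈ Icc 0 T, ∀ l, ‖D l (f t)‖ ≤ K) (hKv : ∀ t ∈ Icc 0 T, ∀ l, nm 3 (v l t) ≤ K)
    (hKϖ : ∀ t ∈ Icc 0 T, nm 3 (ϖ t) ≤ K) (hKϖ' : ∀ t ∈ Icc 0 T, ‖Mu (ϖ' t)‖ ≤ K)
    (hb : ∀ᵐ t ∂(volume.restrict (Ioo 0 T)), ‖D i (B t)‖ ≤ b t)
    (hbi : IntegrableOn b (Ioo 0 T)) :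
    Evol T (fun t => inner ℝ (D i (f t) + Mu (ϖ t) (D i (f t))) (D i (f t)))
      (fun t => inner ℝ (Mu (ϖ' t) (D i (f t))) (D i (f t))
        + 2 * inner ℝ (D i (f t) + Mu (ϖ t) (D i (f t)))
            (D i (B t) - ∑ l, Mu (D i (v l t)) (D l (f t)))
        + ∑ l, inner ℝ (Mu (D l (v l t + Mu (ϖ t) (v l t))) (D i (f t))) (D i (f t))) := by
  set F : ℕ → ℝ → L2 := fun n t => dq i (step n) (f t) with hF
  have hC := one_le_Csob
  have hcoef : ∀ t ∈ Icc 0 T, ∀ l, v l t + Mu (ϖ t) (v l t) ∈ Hs 3 := fun t ht l =>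
    (Hs 3).add_mem (hv t ht l) (Mu_mem_three (hϖ3 t ht) (hv t ht l))
  refine integral_of_tendsto_deriv
    (b := fun t => K * K * K + 2 * ((K + Csob * K * K) * (b t + ∑ _l : Fin 3, Csob * K * K))
        + ∑ _l : Fin 3, Csob * (K + 19 * Csob * K * K) * K * K)
    (e := fun n t => inner ℝ (F n t + Mu (ϖ t) (F n t)) (F n t))
    (e' := fun n t => inner ℝ (Mu (ϖ' t) (F n t)) (F n t)
        + 2 * inner ℝ (F n t + Mu (ϖ t) (F n t)) (dq i (step n) (B t)
            - ∑ l, Mu (dq i (step n) (v l t)) (trans (step n • basisVec i) (D l (f t))))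
        + ∑ l, inner ℝ (Mu (D l (v l t + Mu (ϖ t) (v l t))) (F n t)) (F n t))
    ?_ ?_ ?_ ?_ ?_
  · intro n t ht
    have hF' : HasDerivWithinAt (F n) (dq i (step n) (f' t)) (Icc 0 T) t :=
      hf.clm (dq i (step n)) t ht
    have h1 := (hF'.add ((hϖ t ht).clm_apply hF')).inner ℝ hF'
    refine h1.congr_deriv ?_
    exact inner_weighted_transport (hϖ3 t ht) (hv t ht) (dq_mem (hf1 t ht) _ _)
      (dq_transport (hv t ht) (hf1 t ht) (heq t ht) i (step n))
  · intro n
    filter_upwards [hb, hB, ae_restrict_mem measurableSet_Ioo] with t h1 h2 ht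
    have ht' := Ioo_subset_Icc_self ht
    have hK0 : 0 ≤ K := (norm_nonneg _).trans (hKf t ht' 0)
    have hFn : ‖F n t‖ ≤ K := (norm_dq_le (hf1 t ht') _ _).trans (hKf t ht' i)
    have hϖn : ‖Mu (ϖ t) (F n t)‖ ≤ Csob * K * K := by
      refine (norm_Mu_le_of_mem (Hs_mono (by omega) (hϖ3 t ht')) _).trans ?_
      gcongr
      exact (nm_mono (by omega) _).trans (hKϖ t ht')
    refine (abs_add_le _ _).trans (add_le_add ((abs_add_le _ _).trans (add_le_add ?_ ?_)) ?_)
    · refine (abs_real_inner_le_norm _ _).trans ?_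
      have := ((Mu (ϖ' t)).le_opNorm (F n t))
      have h3 : ‖Mu (ϖ' t) (F n t)‖ ≤ K * K :=
        this.trans (mul_le_mul (hKϖ' t ht') hFn (norm_nonneg _) hK0)
      exact mul_le_mul h3 hFn (norm_nonneg _) (by positivity)
    · rw [abs_mul, abs_two]
      refine mul_le_mul_of_nonneg_left ?_ zero_le_two
      refine (abs_real_inner_le_norm _ _).trans ?_
      refine mul_le_mul ((norm_add_le _ _).trans (add_le_add hFn hϖn)) ?_ (norm_nonneg _)
        (by positivity)
      refine (norm_sub_le _ _).trans (add_le_add ((norm_dq_le h2 _ _).trans h1) ?_)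
      refine (norm_sum_le _ _).trans (Finset.sum_le_sum fun l _ => ?_)
      have h3 : v l t ∈ Hs 3 := hv t ht' l
      refine (norm_Mu_le_of_mem (dq_mem (Hs_mono (by omega) h3) _ _) _).trans ?_
      rw [norm_trans]
      have h4 := (nm_dq_le h3 i (step n)).trans ((nm_D_le 2 _ i).trans (hKv t ht' l))
      exact mul_le_mul (mul_le_mul_of_nonneg_left h4 Csob_pos.le) (hKf t ht' l) (norm_nonneg _)
        (by positivity)
    · refine (Finset.abs_sum_le_sum_abs _ _).trans (Finset.sum_le_sum fun l _ => ?_)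
      refine (abs_real_inner_le_norm _ _).trans ?_
      have h3 := hcoef t ht' l
      have h4 : nm 2 (D l (v l t + Mu (ϖ t) (v l t))) ≤ K + 19 * Csob * K * K := by
        refine (nm_D_le 2 _ l).trans ((nm_add_le (hv t ht' l)
          (Mu_mem_three (hϖ3 t ht') (hv t ht' l))).trans (add_le_add (hKv t ht' l) ?_))
        refine (nm_Mu_three (hϖ3 t ht') (hv t ht' l)).trans ?_
        have := hKϖ t ht'
        have := hKv t ht' l
        have := nm_nonneg 3 (v l t)
        gcongr
      have h5 : ‖Mu (D l (v l t + Mu (ϖ t) (v l t))) (F n t)‖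
          ≤ Csob * (K + 19 * Csob * K * K) * K :=
        (norm_Mu_le_of_mem (D_mem h3 l) _).trans (mul_le_mul
          (mul_le_mul_of_nonneg_left h4 Csob_pos.le) hFn (norm_nonneg _) (by positivity))
      exact mul_le_mul h5 hFn (norm_nonneg _) (by positivity)
  · have h1 : ∀ c : ℝ, IntegrableOn (fun _ : ℝ => c) (Ioo 0 T) := fun c =>
      integrableOn_const measure_Ioo_lt_top.ne
    exact ((h1 _).add (((hbi.add (h1 _)).const_mul _).const_mul _)).add (h1 _)
  · intro t ht
    have h1 : Tendsto (fun n => F n t) atTop (𝓝 (D i (f t))) :=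
      (tendsto_dq (hf1 t ht) i).comp tendsto_step
    exact (h1.add (((Mu (ϖ t)).continuous.tendsto _).comp h1)).inner h1
  · filter_upwards [hB, ae_restrict_mem measurableSet_Ioo] with t h2 ht
    have ht' := Ioo_subset_Icc_self ht
    have h1 : Tendsto (fun n => F n t) atTop (𝓝 (D i (f t))) :=
      (tendsto_dq (hf1 t ht') i).comp tendsto_step
    have hM : ∀ a : L2, Tendsto (fun n => Mu a (F n t)) atTop (𝓝 (Mu a (D i (f t)))) :=
      fun a => ((Mu a).continuous.tendsto _).comp h1
    refine (((hM _).inner h1).add (((h1.add (hM _)).inner (((tendsto_dq h2 i).comp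
      tendsto_step).sub (tendsto_finsetSum _ fun l _ => ?_))).const_mul _)).add
      (tendsto_finsetSum _ fun l _ => (hM _).inner h1)
    have hv3 : v l t ∈ Hs 3 := hv t ht' l
    have h3 : Tendsto (fun n => trans (step n • basisVec i) (D l (f t))) atTop (𝓝 (D l (f t))) := by
      have h4 := (continuous_trans (D l (f t))).tendsto 0
      rw [trans_zero] at h4
      refine h4.comp ?_
      simpa using (tendsto_nhdsWithin_iff.1 tendsto_step).1.smul_const (basisVec i)
    have h5 : Tendsto (fun n => Mu (dq i (step n) (v l t) - D i (v l t))
        (trans (step n • basisVec i) (D l (f t)))) atTop (𝓝 0) := by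
      refine squeeze_zero_norm (fun n => (norm_Mu_le_of_mem ((Hs 2).sub_mem
        (dq_mem (Hs_mono (by omega) hv3) _ _) (D_mem hv3 i)) _)) ?_
      simp only [norm_trans]
      simpa using ((tendsto_nm_dq hv3 i tendsto_step).const_mul Csob).mul_const ‖D l (f t)‖
    have h6 := h5.add (((Mu (D i (v l t))).continuous.tendsto _).comp h3)
    rw [zero_add] at h6
    refine h6.congr fun n => ?_
    have b1 := bdd_of_mem ((Hs 2).sub_mem
        (dq_mem (Hs_mono (by omega : 2 ≤ 3) hv3) i (step n)) (D_mem hv3 i))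
    rw [Function.comp_apply, ← Mu_add_left b1 (bdd_of_mem (D_mem hv3 i)), sub_add_cancel]

/-! ### Differentiability in time of multiplication operators -/

theorem Smooth₀.taylor {Φ : ℝ → ℝ} (h : Smooth₀ Φ) (R : ℝ) :
    ∃ K, 0 ≤ K ∧ ∀ s t, |s| ≤ R → |t| ≤ R → |Φ s - Φ t - deriv Φ t * (s - t)| ≤ K * |s - t| ^ 2 := by
  obtain ⟨K, hK0, hK⟩ := h.dshift.lip R
  refine ⟨K, hK0, fun s t hs ht => ?_⟩
  have hd : ∀ x, HasDerivAt (fun x => Φ x - deriv Φ t * x) (deriv Φ x - deriv Φ t) x := fun x => by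
    have := (h.differentiable x).hasDerivAt.fun_sub ((hasDerivAt_id x).const_mul (deriv Φ t))
    rwa [mul_one] at this
  have hb : ∀ x ∈ uIcc t s, ‖deriv Φ x - deriv Φ t‖ ≤ K * |s - t| := by
    intro x hx
    have hxR : |x| ≤ R := by
      have hsub : uIcc t s ⊆ Icc (-R) R := uIcc_subset_Icc (abs_le.1 ht) (abs_le.1 hs)
      exact abs_le.2 (hsub hx)
    have h1 := hK x t hxR ht
    simp only [OldroydB.dshift, sub_sub_sub_cancel_right] at h1
    refine h1.trans (mul_le_mul_of_nonneg_left ?_ hK0)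
    exact abs_sub_left_of_mem_uIcc hx
  have h1 := (convex_uIcc t s).norm_image_sub_le_of_norm_hasDerivWithin_le
    (fun x _ => (hd x).hasDerivWithinAt) hb left_mem_uIcc right_mem_uIcc
  rw [Real.norm_eq_abs, Real.norm_eq_abs] at h1
  calc _ = |Φ s - deriv Φ t * s - (Φ t - deriv Φ t * t)| := by congr 1; ring
    _ ≤ _ := h1
    _ = _ := by ring

theorem opNorm_Mu_le {a : L2} {K : ℝ} (h : Bdd a K) : ‖Mu a‖ ≤ K :=
  (Mu a).opNorm_le_bound h.nonneg (norm_Mu_le h)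

theorem Bdd.sub {a b : L2} {K K' : ℝ} (ha : Bdd a K) (hb : Bdd b K') : Bdd (a - b) (K + K') := by
  have := ha.add (hb.smul (-1))
  rw [abs_neg, abs_one, one_mul] at this
  convert this using 1
  module

theorem Mu_sub_left {a b : L2} {K K' : ℝ} (ha : Bdd a K) (hb : Bdd b K') (f : L2) :
    Mu (a - b) f = Mu a f - Mu b f := by
  have e : a - b = a + (-1 : ℝ) • b := by module
  rw [e, Mu_add_left ha (hb.smul _), Mu_smul_left hb]
  module

theorem Mu_add {a b : L2} {K K' : ℝ} (ha : Bdd a K) (hb : Bdd b K') : Mu (a + b) = Mu a + Mu b :=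
  ContinuousLinearMap.ext fun f => Mu_add_left ha hb f

theorem Mu_sub {a b : L2} {K K' : ℝ} (ha : Bdd a K) (hb : Bdd b K') : Mu (a - b) = Mu a - Mu b :=
  ContinuousLinearMap.ext fun f => Mu_sub_left ha hb f

theorem Mu_smul {a : L2} {K : ℝ} (ha : Bdd a K) (c : ℝ) : Mu (c • a) = c • Mu a :=
  ContinuousLinearMap.ext fun f => Mu_smul_left ha c f

theorem Mu_comp {a b : L2} {K K' : ℝ} (ha : Bdd a K) (hb : Bdd b K') :
    Mu (Mu a b) = (Mu a).comp (Mu b) :=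
  ContinuousLinearMap.ext fun f => Mu_Mu ha hb f

theorem slope_identity {E : Type*} [NormedAddCommGroup E] [NormedSpace ℝ E]
    {MA MB Mδ Mp Mg M₁ M₂ M₃ : E →L[ℝ] E} (r c : ℝ)
    (h₁ : M₁ = c • Mp + Mg.comp Mp) (h₂ : M₂ = MA - MB - (c • Mδ + Mg.comp Mδ))
    (h₃ : M₃ = r • Mδ - Mp) :
    r • (MA - MB) - M₁ = r • M₂ + (c • M₃ + Mg.comp M₃) := by
  rw [h₁, h₂, h₃, ContinuousLinearMap.comp_sub, ContinuousLinearMap.comp_smul]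
  module

theorem norm_smul_add_comp_le {E : Type*} [NormedAddCommGroup E] [NormedSpace ℝ E]
    {A B C : E →L[ℝ] E} {r a b c k : ℝ} (hA : ‖A‖ ≤ a) (hB : ‖B‖ ≤ b) (hC : ‖C‖ ≤ c) :
    ‖r • A + (k • B + C.comp B)‖ ≤ |r| * a + (|k| + c) * b := by
  refine (norm_add_le _ _).trans (add_le_add ?_ ((norm_add_le _ _).trans ?_))
  · rw [norm_smul]; exact mul_le_mul_of_nonneg_left hA (abs_nonneg _)
  · rw [norm_smul, add_mul]
    exact add_le_add (mul_le_mul_of_nonneg_left hB (abs_nonneg _))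
      ((ContinuousLinearMap.opNorm_comp_le _ _).trans
        (mul_le_mul hC hB (norm_nonneg _) ((norm_nonneg _).trans hC)))

theorem Mu_slope_identity {A B δ g p : L2} {K₁ K₂ K₃ K₄ K₅ : ℝ} (hA : Bdd A K₁) (hB : Bdd B K₂)
    (hδ : Bdd δ K₃) (hg : Bdd g K₄) (hp : Bdd p K₅) (r c : ℝ) :
    r • (Mu A - Mu B) - Mu (c • p + Mu g p)
      = r • Mu (A - B - (c • δ + Mu g δ)) + (c • Mu (r • δ - p) + (Mu g).comp (Mu (r • δ - p))) := by
  have h₁ : Mu (c • p + Mu g p) = c • Mu p + (Mu g).comp (Mu p) :=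
    (Mu_add (hp.smul c) (hg.Mu hp)).trans (congrArg₂ (· + ·) (Mu_smul hp c) (Mu_comp hg hp))
  have h₂ : Mu (c • δ + Mu g δ) = c • Mu δ + (Mu g).comp (Mu δ) :=
    (Mu_add (hδ.smul c) (hg.Mu hδ)).trans (congrArg₂ (· + ·) (Mu_smul hδ c) (Mu_comp hg hδ))
  have h₃ : Mu (A - B - (c • δ + Mu g δ)) = Mu A - Mu B - (c • Mu δ + (Mu g).comp (Mu δ)) :=
    (Mu_sub (hA.sub hB) ((hδ.smul c).add (hg.Mu hδ))).trans (congrArg₂ (· - ·) (Mu_sub hA hB) h₂)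
  have h₄ : Mu (r • δ - p) = r • Mu δ - Mu p :=
    (Mu_sub (hδ.smul r) hp).trans (congrArg (· - Mu p) (Mu_smul hδ r))
  exact slope_identity r c h₁ h₃ h₄

/-- The derivative of `t ↦ Φ(f(t))`, given `f` and `f'` at a time `t`. -/
def dcmp (Φ : ℝ → ℝ) (f f' : L2) : L2 := deriv Φ 0 • f' + Mu (cmp (dshift Φ) f) f'

theorem bdd_taylor {Φ : ℝ → ℝ} (h : Smooth₀ Φ) (R : ℝ) :
    ∃ K, 0 ≤ K ∧ ∀ (f g : L2) (r : ℝ), Bdd f R → Bdd g R → Bdd (f - g) r →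
      Bdd (cmp Φ f - cmp Φ g - dcmp Φ g (f - g)) (K * r ^ 2) := by
  obtain ⟨K, hK0, hK⟩ := h.taylor R
  obtain ⟨K', _, hK'⟩ := norm_cmp_le h.dshift R
  refine ⟨K, hK0, fun f g r hf hg hr => ?_⟩
  have hb := (hK' g hg).2 R hg
  filter_upwards [coe_cmp h hf, coe_cmp h hg, coe_cmp h.dshift hg, coe_Mu hb (f - g),
    Lp.coeFn_sub f g, Lp.coeFn_smul (deriv Φ 0) (f - g),
    Lp.coeFn_add (deriv Φ 0 • (f - g)) (Mu (cmp (dshift Φ) g) (f - g)),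
    Lp.coeFn_sub (cmp Φ f) (cmp Φ g), Lp.coeFn_sub (cmp Φ f - cmp Φ g) (dcmp Φ g (f - g)),
    hf, hg, hr] with x h1 h2 h3 h4 h5 h6 h7 h8 h9 h10 h11 h12
  have h13 : (dcmp Φ g (f - g) : L2) x = deriv Φ (g x) * (f x - g x) := by
    unfold dcmp
    rw [h7, Pi.add_apply, h6, h4, Pi.smul_apply, h3, h5, Pi.sub_apply]
    simp only [OldroydB.dshift, smul_eq_mul]
    ring
  rw [h9, Pi.sub_apply, h8, Pi.sub_apply, h13, h1, h2]
  refine (hK _ _ h10 h11).trans (mul_le_mul_of_nonneg_left ?_ hK0)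
  rw [h5] at h12
  exact pow_le_pow_left₀ (abs_nonneg _) h12 2

theorem hasDerivWithinAt_Mu_cmp {Φ : ℝ → ℝ} (h : Smooth₀ Φ) {S : Set ℝ} {R t : ℝ} {f : ℝ → L2}
    {f' : L2} (ht : t ∈ S) (hf : ∀ s ∈ S, f s ∈ Hs 2) (hf' : f' ∈ Hs 2) (hR : ∀ s ∈ S, Bdd (f s) R)
    (hd : Tendsto (fun s => nm 2 ((s - t)⁻¹ • (f s - f t) - f')) (𝓝[S \ {t}] t) (𝓝 0)) :
    HasDerivWithinAt (fun s => Mu (cmp Φ (f s))) (Mu (dcmp Φ (f t) f')) S t := by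
  obtain ⟨K, hK0, hK⟩ := bdd_taylor h R
  obtain ⟨K₁, hK₁0, hK₁⟩ := norm_cmp_le h.dshift R
  obtain ⟨K₂, _, hK₂⟩ := norm_cmp_le h R
  have hb : Bdd (cmp (dshift Φ) (f t)) (K₁ * R) := (hK₁ _ (hR t ht)).2 R (hR t ht)
  rw [hasDerivWithinAt_iff_tendsto_slope, tendsto_iff_norm_sub_tendsto_zero]
  set q : ℝ → L2 := fun s => (s - t)⁻¹ • (f s - f t) with hq
  have hlim : Tendsto (fun s => K * Csob ^ 2 * (|s - t| * (nm 2 (q s - f') + nm 2 f') ^ 2)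
      + (|deriv Φ 0| + K₁ * R) * (Csob * nm 2 (q s - f'))) (𝓝[S \ {t}] t) (𝓝 0) := by
    have h1 : Tendsto (fun s => |s - t|) (𝓝[S \ {t}] t) (𝓝 0) := by
      have : Tendsto (fun s => |s - t|) (𝓝 t) (𝓝 |t - t|) :=
        (continuous_abs.comp (continuous_sub_right t)).tendsto t
      rw [sub_self, abs_zero] at this
      exact this.mono_left nhdsWithin_le_nhds
    have h2 := (((h1.mul ((hd.add_const (nm 2 f')).pow 2)).const_mul (K * Csob ^ 2)).add
      ((hd.const_mul Csob).const_mul (|deriv Φ 0| + K₁ * R)))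
    simpa using h2
  refine squeeze_zero' (Eventually.of_forall fun _ => norm_nonneg _) ?_ hlim
  filter_upwards [self_mem_nhdsWithin] with s hs
  have hst : s - t ≠ 0 := sub_ne_zero.2 hs.2
  have hδ : f s - f t ∈ Hs 2 := (Hs 2).sub_mem (hf s hs.1) (hf t ht)
  have hqm : q s ∈ Hs 2 := (Hs 2).smul_mem _ hδ
  have hqd : q s - f' ∈ Hs 2 := (Hs 2).sub_mem hqm hf'
  have b1 := hK (f s) (f t) _ (hR s hs.1) (hR t ht) (bdd_of_mem hδ)
  have b2 := (hK₂ _ (hR s hs.1)).2 R (hR s hs.1)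
  have b3 := (hK₂ _ (hR t ht)).2 R (hR t ht)
  have b4 := bdd_of_mem hδ
  have b5 := bdd_of_mem hf'
  have b6 := bdd_of_mem hqd
  set a := cmp Φ (f s) - cmp Φ (f t) - dcmp Φ (f t) (f s - f t) with ha
  have e : slope (fun s => Mu (cmp Φ (f s))) t s - Mu (dcmp Φ (f t) f')
      = (s - t)⁻¹ • Mu a + (deriv Φ 0 • Mu (q s - f')
        + (Mu (cmp (dshift Φ) (f t))).comp (Mu (q s - f'))) := by
    exact Mu_slope_identity b2 b3 b4 hb b5 _ _
  rw [e]
  have n1 : nm 2 (f s - f t) = |s - t| * nm 2 (q s) := by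
    rw [hq, nm_smul hδ, abs_inv, mul_inv_cancel_left₀ (abs_ne_zero.2 hst)]
  have n2 : nm 2 (q s) ≤ nm 2 (q s - f') + nm 2 f' := by
    simpa using nm_add_le hqd hf'
  refine (norm_smul_add_comp_le (opNorm_Mu_le b1) (opNorm_Mu_le b6) (opNorm_Mu_le hb)).trans
    (add_le_add ?_ le_rfl)
  rw [abs_inv, inv_mul_le_iff₀ (abs_pos.2 hst), n1]
  calc K * (Csob * (|s - t| * nm 2 (q s))) ^ 2
      = K * Csob ^ 2 * |s - t| ^ 2 * nm 2 (q s) ^ 2 := by ring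
    _ ≤ K * Csob ^ 2 * |s - t| ^ 2 * (nm 2 (q s - f') + nm 2 f') ^ 2 := by
      have := nm_nonneg 2 (q s)
      gcongr
    _ = _ := by ring

/-! ### Sobolev norms as sums of squares -/

/-- The squared `H^m` norm. -/
def nsq : ℕ → L2 → ℝ
  | 0, f => ‖f‖ ^ 2
  | m + 1, f => ‖f‖ ^ 2 + ∑ i, nsq m (D i f)

theorem nsq_succ (m : ℕ) (f : L2) : nsq (m + 1) f = ‖f‖ ^ 2 + ∑ i, nsq m (D i f) := rfl

theorem nsq_nonneg (m : ℕ) (f : L2) : 0 ≤ nsq m f := by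
  induction m generalizing f with
  | zero => exact sq_nonneg _
  | succ m ih => exact add_nonneg (sq_nonneg _) (Finset.sum_nonneg fun i _ => ih _)

theorem nsq_le_nm_sq (m : ℕ) (f : L2) : nsq m f ≤ nm m f ^ 2 := by
  induction m generalizing f with
  | zero => exact le_rfl
  | succ m ih =>
    rw [nsq_succ, nm_succ, Fin.sum_univ_three, Fin.sum_univ_three]
    have := ih (D 0 f); have := ih (D 1 f); have := ih (D 2 f)
    have h0 := nm_nonneg m (D 0 f); have h1 := nm_nonneg m (D 1 f); have h2 := nm_nonneg m (D 2 f)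
    have h3 := norm_nonneg f
    nlinarith [mul_nonneg h3 h0, mul_nonneg h3 h1, mul_nonneg h3 h2, mul_nonneg h0 h1,
      mul_nonneg h0 h2, mul_nonneg h1 h2]

theorem nm_sq_le_nsq (m : ℕ) (f : L2) : nm m f ^ 2 ≤ 4 ^ m * nsq m f := by
  induction m generalizing f with
  | zero => simp [nm, nsq]
  | succ m ih =>
    rw [nsq_succ, nm_succ, Fin.sum_univ_three, Fin.sum_univ_three]
    have i0 := ih (D 0 f); have i1 := ih (D 1 f); have i2 := ih (D 2 f)
    set a := nm m (D 0 f); set b := nm m (D 1 f); set c := nm m (D 2 f)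
    set x := ‖f‖
    have h1 : (1 : ℝ) ≤ 4 ^ m := one_le_pow₀ (by norm_num)
    have h2 : (x + (a + b + c)) ^ 2 ≤ 4 * (x ^ 2 + a ^ 2 + b ^ 2 + c ^ 2) := by
      nlinarith [sq_nonneg (x - a), sq_nonneg (x - b), sq_nonneg (x - c), sq_nonneg (a - b),
        sq_nonneg (a - c), sq_nonneg (b - c)]
    have h3 := mul_le_mul_of_nonneg_right h1 (sq_nonneg x)
    calc _ ≤ _ := h2
      _ ≤ 4 * (4 ^ m * x ^ 2 + 4 ^ m * nsq m (D 0 f) + 4 ^ m * nsq m (D 1 f)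
          + 4 ^ m * nsq m (D 2 f)) := by linarith
      _ = _ := by ring

/-! ### Existence of derivatives from bounded difference quotients -/

theorem mem_Hs_one_of_norm_dq_le {f : L2} {c : ℝ} (h : ∀ i n, ‖dq i (step n) f‖ ≤ c) :
    f ∈ Hs 1 := by
  refine mem_Hs_succ.2 fun i => ?_
  set u : ℕ → WeakDual ℝ L2 := fun n =>
    StrongDual.toWeakDual (InnerProductSpace.toDual ℝ L2 (dq i (step n) f)) with hu
  have hK : IsCompact ((WeakDual.toStrongDual : WeakDual ℝ L2 → StrongDual ℝ L2) ⁻¹'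
      Metric.closedBall 0 c) := WeakDual.isCompact_closedBall (𝕜 := ℝ) (E := L2) 0 c
  have hle : ((hyperfilter ℕ).map u : Filter (WeakDual ℝ L2)) ≤ 𝓟 ((WeakDual.toStrongDual :
      WeakDual ℝ L2 → StrongDual ℝ L2) ⁻¹' Metric.closedBall 0 c) := by
    rw [le_principal_iff]
    change u ⁻¹' _ ∈ hyperfilter ℕ
    refine univ_mem' fun n => ?_
    simp only [mem_preimage, Metric.mem_closedBall, dist_zero_right]
    have : ‖InnerProductSpace.toDual ℝ L2 (dq i (step n) f)‖ ≤ c := by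
      rw [LinearIsometryEquiv.norm_map]; exact h i n
    exact this
  obtain ⟨x, -, hx⟩ := hK.ultrafilter_le_nhds ((hyperfilter ℕ).map u) hle
  refine ⟨(InnerProductSpace.toDual ℝ L2).symm (WeakDual.toStrongDual x), trivial, fun φ => ?_⟩
  have h1 : Tendsto (fun n => u n φ.L) (hyperfilter ℕ : Filter ℕ) (𝓝 (x φ.L)) :=
    (WeakDual.eval_continuous φ.L).continuousAt.tendsto.comp hx
  have h2 : Tendsto (fun n => u n φ.L) (hyperfilter ℕ : Filter ℕ)
      (𝓝 (-inner ℝ f (φ.d i).L)) := by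
    have h3 : ∀ n, u n φ.L = -inner ℝ f (dq i (-step n) φ.L) := fun n => by
      rw [← inner_dq]; rfl
    simp only [h3]
    have h4 : Tendsto (fun n => dq i (-step n) φ.L) atTop (𝓝 (φ.d i).L) := by
      rw [← Test.D_L]
      exact (tendsto_dq (φ.mem_Hs 1) i).comp tendsto_neg_step
    exact ((tendsto_const_nhds.inner h4).neg).mono_left Nat.hyperfilter_le_atTop
  have h5 := tendsto_nhds_unique h1 h2
  have h6 : inner ℝ ((InnerProductSpace.toDual ℝ L2).symm (WeakDual.toStrongDual x)) φ.L
      = x φ.L := InnerProductSpace.toDual_symm_apply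
  rw [h6, h5, neg_neg]

/-! ### The linear part of the system -/

/-- The Laplacian. -/
def lap (f : L2) : L2 := ∑ i, D i (D i f)

/-- The divergence. -/
def dv (v : Fin 3 → L2) : L2 := ∑ m, D m (v m)

/-- `‖∇f‖²`. -/
def gq (f : L2) : ℝ := ∑ i, ‖D i f‖ ^ 2

/-- `‖∇²f‖²`. -/
def hq (f : L2) : ℝ := ∑ l, gq (D l f)

theorem gq_nonneg (f : L2) : 0 ≤ gq f := Finset.sum_nonneg fun _ _ => sq_nonneg _

theorem inner_D_lap {e v : L2} (he : e ∈ Hs 1) (hv : v ∈ Hs 2) (m : Fin 3) :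
    inner ℝ (D m e) (lap v) = ∑ i, inner ℝ (D i e) (D i (D m v)) := by
  rw [lap, inner_sum]
  refine Finset.sum_congr rfl fun i _ => ?_
  rw [inner_D_D_swap he (D_mem hv i), D_comm hv m i]

theorem inner_lap_right {f g : L2} (hf : f ∈ Hs 1) (hg : g ∈ Hs 2) :
    inner ℝ f (lap g) = -∑ i, inner ℝ (D i f) (D i g) := by
  rw [lap, inner_sum, ← Finset.sum_neg_distrib]
  refine Finset.sum_congr rfl fun i _ => ?_
  rw [inner_D_left hf (D_mem hg i), neg_neg]

theorem inner_lap_self {f : L2} (hf : f ∈ Hs 2) : inner ℝ f (lap f) = -gq f := by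
  rw [inner_lap_right (Hs_mono (by omega) hf) hf, gq]
  simp only [real_inner_self_eq_norm_sq]

theorem norm_lap_sq {f : L2} (hf : f ∈ Hs 2) : ‖lap f‖ ^ 2 = hq f := by
  rw [← real_inner_self_eq_norm_sq]
  nth_rewrite 1 [lap]
  rw [sum_inner, hq]
  refine Finset.sum_congr rfl fun l _ => ?_
  rw [inner_D_lap (D_mem hf l) hf, gq]
  simp only [real_inner_self_eq_norm_sq]

theorem D_dv {v : Fin 3 → L2} (hv : ∀ m, v m ∈ Hs 2) (i : Fin 3) :
    D i (dv v) = ∑ m, D i (D m (v m)) := D_sum _ (fun m _ => D_mem (hv m) m) i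

theorem dv_mem {k : ℕ} {v : Fin 3 → L2} (hv : ∀ m, v m ∈ Hs (k + 1)) : dv v ∈ Hs k :=
  (Hs k).sum_mem fun m _ => D_mem (hv m) m

theorem sum_inner_D_lap {e : L2} {v : Fin 3 → L2} (he : e ∈ Hs 1) (hv : ∀ m, v m ∈ Hs 2) :
    ∑ m, inner ℝ (D m e) (lap (v m)) = ∑ i, inner ℝ (D i e) (D i (dv v)) := by
  simp only [inner_D_lap he (hv _), D_dv hv, inner_sum]
  exact Finset.sum_comm

theorem sum_inner_D {e : L2} {v : Fin 3 → L2} (he : e ∈ Hs 1) (hv : ∀ m, v m ∈ Hs 1) :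
    ∑ m, inner ℝ (D m e) (v m) = -inner ℝ e (dv v) := by
  simp only [inner_D_left he (hv _), dv, inner_sum, Finset.sum_neg_distrib]

/-- The coefficients of the linear part. -/
structure Coef where
  r₁ : ℝ
  r₂ : ℝ
  r₃ : ℝ
  μ₁ : ℝ
  μ₂ : ℝ
  b : ℝ
  ε : ℝ
  a : ℝ
  c : ℝ

namespace Coef

variable (K : Coef) (r : L2) (v : Fin 3 → L2) (e : L2) (s : Fin 3 → Fin 3 → L2)

def linR : L2 := -K.r₁ • dv v

def linU (m : Fin 3) : L2 :=
  -K.r₁ • D m r - K.r₂ • D m e + K.r₃ • dv (s m) + K.μ₁ • lap (v m) + K.μ₂ • D m (dv v)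

def linE : L2 := -K.b • dv v + K.ε • lap e

def linS (m n : Fin 3) : L2 :=
  -K.a • s m n + K.ε • lap (s m n) + K.c • (D n (v m) + D m (v n))

end Coef

section Linear

variable {K : Coef} {r : L2} {v : Fin 3 → L2} {e : L2} {s : Fin 3 → Fin 3 → L2} {w w' : ℝ}

theorem sum_symm_inner (hs : ∀ m n, s m n = s n m) {f : L2 → L2} :
    ∑ m, ∑ n, inner ℝ (D n (v m) + D m (v n)) (f (s m n))
      = 2 * ∑ m, ∑ n, inner ℝ (D n (v m)) (f (s m n)) := by
  simp only [inner_add_left, Finset.sum_add_distrib]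
  rw [two_mul]
  congr 1
  rw [Finset.sum_comm]
  exact Finset.sum_congr rfl fun m _ => Finset.sum_congr rfl fun n _ => by rw [hs]

/-- Energy identity for the highest derivatives. -/
theorem linear_energy_top (hr : r ∈ Hs 1) (hv : ∀ m, v m ∈ Hs 2) (he : e ∈ Hs 2)
    (hs : ∀ m n, s m n ∈ Hs 2) (hsym : ∀ m n, s m n = s n m) (hw : K.r₂ = w * K.b)
    (hw' : K.r₃ = 2 * w' * K.c) :
    -(∑ m, inner ℝ (K.linU r v e s m) (lap (v m))) - w * inner ℝ (K.linE v e) (lap e)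
        - w' * ∑ m, ∑ n, inner ℝ (K.linS v s m n) (lap (s m n))
      = K.r₁ * ∑ i, inner ℝ (D i r) (D i (dv v)) - K.μ₁ * ∑ m, hq (v m) - K.μ₂ * gq (dv v)
        - w * K.ε * hq e - w' * K.a * ∑ m, ∑ n, gq (s m n) - w' * K.ε * ∑ m, ∑ n, hq (s m n) := by
  have he1 : e ∈ Hs 1 := Hs_mono (by omega) he
  have hd : dv v ∈ Hs 1 := dv_mem hv
  have h1 : ∑ m, inner ℝ (K.linU r v e s m) (lap (v m))
      = -K.r₁ * ∑ i, inner ℝ (D i r) (D i (dv v)) - K.r₂ * ∑ i, inner ℝ (D i e) (D i (dv v))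
        + K.r₃ * ∑ m, ∑ n, inner ℝ (D n (s m n)) (lap (v m)) + K.μ₁ * ∑ m, hq (v m)
        + K.μ₂ * gq (dv v) := by
    simp only [Coef.linU, inner_add_left, inner_sub_left, real_inner_smul_left,
      Finset.sum_add_distrib, Finset.sum_sub_distrib, ← Finset.mul_sum]
    rw [sum_inner_D_lap hr hv, sum_inner_D_lap he1 hv, sum_inner_D_lap hd hv]
    simp only [dv, sum_inner, real_inner_self_eq_norm_sq, norm_lap_sq (hv _), gq]
  have h2 : inner ℝ (K.linE v e) (lap e)
      = K.b * ∑ i, inner ℝ (D i e) (D i (dv v)) + K.ε * hq e := by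
    simp only [Coef.linE, inner_add_left, real_inner_smul_left]
    rw [inner_lap_right hd he, real_inner_self_eq_norm_sq, norm_lap_sq he]
    simp only [real_inner_comm]
    ring
  have h3 : ∑ m, ∑ n, inner ℝ (K.linS v s m n) (lap (s m n))
      = K.a * ∑ m, ∑ n, gq (s m n) + K.ε * ∑ m, ∑ n, hq (s m n)
        + K.c * (2 * ∑ m, ∑ n, inner ℝ (D n (v m)) (lap (s m n))) := by
    rw [← sum_symm_inner hsym]
    simp only [Coef.linS, inner_add_left, real_inner_smul_left, inner_lap_self (hs _ _),
      Finset.sum_add_distrib, ← Finset.mul_sum, real_inner_self_eq_norm_sq, norm_lap_sq (hs _ _),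
      Finset.sum_neg_distrib]
    ring
  have h4 : ∑ m, ∑ n, inner ℝ (D n (v m)) (lap (s m n))
      = -∑ m, ∑ n, inner ℝ (D n (s m n)) (lap (v m)) := by
    simp only [← Finset.sum_neg_distrib]
    refine Finset.sum_congr rfl fun m _ => Finset.sum_congr rfl fun n _ => ?_
    rw [inner_lap_right (D_mem (hv m) n) (hs m n),
      inner_D_lap (Hs_mono (by omega) (hs m n)) (hv m)]
    simp only [real_inner_comm]
  rw [h1, h2, h3, h4, hw, hw']
  ring

/-- Energy identity without derivatives. -/
theorem linear_energy_zero (hr : r ∈ Hs 1) (hv : ∀ m, v m ∈ Hs 2) (he : e ∈ Hs 2)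
    (hs : ∀ m n, s m n ∈ Hs 2) (hsym : ∀ m n, s m n = s n m) (hw : K.r₂ = w * K.b)
    (hw' : K.r₃ = 2 * w' * K.c) :
    inner ℝ (K.linR v) r + (∑ m, inner ℝ (K.linU r v e s m) (v m)) + w * inner ℝ (K.linE v e) e
        + w' * ∑ m, ∑ n, inner ℝ (K.linS v s m n) (s m n)
      = -K.μ₁ * ∑ m, gq (v m) - K.μ₂ * ‖dv v‖ ^ 2
        - w * K.ε * gq e - w' * K.a * ∑ m, ∑ n, ‖s m n‖ ^ 2 - w' * K.ε * ∑ m, ∑ n, gq (s m n) := by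
  have he1 : e ∈ Hs 1 := Hs_mono (by omega) he
  have hv1 : ∀ m, v m ∈ Hs 1 := fun m => Hs_mono (by omega) (hv m)
  have hd : dv v ∈ Hs 1 := dv_mem hv
  have h1 : ∑ m, inner ℝ (K.linU r v e s m) (v m)
      = K.r₁ * inner ℝ r (dv v) + K.r₂ * inner ℝ e (dv v)
        + K.r₃ * ∑ m, ∑ n, inner ℝ (D n (s m n)) (v m) - K.μ₁ * ∑ m, gq (v m)
        - K.μ₂ * ‖dv v‖ ^ 2 := by
    simp only [Coef.linU, inner_add_left, inner_sub_left, real_inner_smul_left,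
      Finset.sum_add_distrib, Finset.sum_sub_distrib, ← Finset.mul_sum]
    rw [sum_inner_D hr hv1, sum_inner_D he1 hv1, sum_inner_D hd hv1, real_inner_self_eq_norm_sq]
    simp only [real_inner_comm _ (lap _), inner_lap_self (hv _), Finset.sum_neg_distrib]
    rw [show ∑ m, inner ℝ (dv (s m)) (v m) = ∑ m, ∑ n, inner ℝ (D n (s m n)) (v m) by
      simp only [dv, sum_inner]]
    ring
  have h2 : inner ℝ (K.linE v e) e = -K.b * inner ℝ e (dv v) - K.ε * gq e := by
    simp only [Coef.linE, inner_add_left, real_inner_smul_left]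
    rw [real_inner_comm e (lap e), inner_lap_self he, real_inner_comm]
    ring
  have h3 : ∑ m, ∑ n, inner ℝ (K.linS v s m n) (s m n)
      = -K.a * ∑ m, ∑ n, ‖s m n‖ ^ 2 - K.ε * ∑ m, ∑ n, gq (s m n)
        + K.c * (2 * ∑ m, ∑ n, inner ℝ (D n (v m)) (s m n)) := by
    have h0 := sum_symm_inner (v := v) (f := id) hsym
    simp only [id] at h0
    rw [← h0]
    simp only [Coef.linS, inner_add_left, real_inner_smul_left, real_inner_comm _ (lap _),
      inner_lap_self (hs _ _),
      Finset.sum_add_distrib, ← Finset.mul_sum, real_inner_self_eq_norm_sq,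
      Finset.sum_neg_distrib]
    ring
  have h4 : ∑ m, ∑ n, inner ℝ (D n (v m)) (s m n)
      = -∑ m, ∑ n, inner ℝ (D n (s m n)) (v m) := by
    simp only [← Finset.sum_neg_distrib]
    refine Finset.sum_congr rfl fun m _ => Finset.sum_congr rfl fun n _ => ?_
    rw [inner_D_left (hv1 m) (Hs_mono (by omega) (hs m n)), real_inner_comm]
  have h5 : inner ℝ (K.linR v) r = -K.r₁ * inner ℝ r (dv v) := by
    rw [Coef.linR, real_inner_smul_left, real_inner_comm]
  rw [h1, h2, h3, h4, h5, hw, hw']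
  ring

theorem inner_le_young (x y : L2) {t : ℝ} (ht : 0 < t) (k : ℝ) :
    k * inner ℝ x y ≤ t * ‖y‖ ^ 2 + k ^ 2 / (4 * t) * ‖x‖ ^ 2 := by
  have h1 : k * inner ℝ x y ≤ |k| * (‖x‖ * ‖y‖) := by
    refine (le_abs_self _).trans ?_
    rw [abs_mul]
    exact mul_le_mul_of_nonneg_left (abs_real_inner_le_norm _ _) (abs_nonneg _)
  refine h1.trans ?_
  have h2 : 0 ≤ t * (‖y‖ - |k| / (2 * t) * ‖x‖) ^ 2 := by positivity
  have h3 : t * (‖y‖ - |k| / (2 * t) * ‖x‖) ^ 2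
      = t * ‖y‖ ^ 2 + |k| ^ 2 / (4 * t) * ‖x‖ ^ 2 - |k| * (‖x‖ * ‖y‖) := by
    field_simp
    ring
  rw [sq_abs] at h3
  linarith

theorem sum_inner_D_swap {v : Fin 3 → L2} (hv : ∀ m, v m ∈ Hs 1) :
    ∑ m, ∑ n, inner ℝ (D m (v n)) (D n (v m)) = ‖dv v‖ ^ 2 := by
  rw [← real_inner_self_eq_norm_sq, dv, sum_inner, Finset.sum_comm]
  simp only [inner_sum, inner_D_D_swap (hv _) (hv _)]

theorem norm_dv_sq_le (v : Fin 3 → L2) : ‖dv v‖ ^ 2 ≤ 3 * ∑ m, gq (v m) := by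
  have h1 : ‖dv v‖ ≤ ∑ m, ‖D m (v m)‖ := norm_sum_le _ _
  have h2 : ∀ m, ‖D m (v m)‖ ^ 2 ≤ gq (v m) := fun m =>
    Finset.single_le_sum (f := fun i => ‖D i (v m)‖ ^ 2) (fun _ _ => sq_nonneg _) (Finset.mem_univ m)
  have h3 : ‖dv v‖ ^ 2 ≤ (∑ m, ‖D m (v m)‖) ^ 2 := pow_le_pow_left₀ (norm_nonneg _) h1 2
  have h5 : (∑ m, ‖D m (v m)‖) ^ 2 ≤ 3 * ∑ m, ‖D m (v m)‖ ^ 2 := by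
    simpa using sq_sum_le_card_mul_sum_sq (s := Finset.univ) (f := fun m => ‖D m (v m)‖)
  have h6 := Finset.sum_le_sum fun m (_ : m ∈ Finset.univ) => h2 m
  linarith

theorem linear_cross_density (hr₁ : 0 < K.r₁) (hv : ∀ m, v m ∈ Hs 2) :
    (∑ m, inner ℝ (K.linU r v e s m) (D m r)) - inner ℝ (dv v) (K.linR v)
      ≤ -(K.r₁ / 2) * gq r + 2 * K.r₂ ^ 2 / K.r₁ * gq e + 2 * K.r₃ ^ 2 / K.r₁ * ∑ m, ‖dv (s m)‖ ^ 2
        + 2 * K.μ₁ ^ 2 / K.r₁ * ∑ m, hq (v m) + 2 * K.μ₂ ^ 2 / K.r₁ * gq (dv v)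
        + K.r₁ * ‖dv v‖ ^ 2 := by
  have h : ∀ m, inner ℝ (K.linU r v e s m) (D m r) ≤ -(K.r₁ / 2) * ‖D m r‖ ^ 2
      + 2 * K.r₂ ^ 2 / K.r₁ * ‖D m e‖ ^ 2 + 2 * K.r₃ ^ 2 / K.r₁ * ‖dv (s m)‖ ^ 2
      + 2 * K.μ₁ ^ 2 / K.r₁ * hq (v m) + 2 * K.μ₂ ^ 2 / K.r₁ * ‖D m (dv v)‖ ^ 2 := by
    intro m
    have ht : 0 < K.r₁ / 8 := by positivity
    have h1 := inner_le_young (D m e) (D m r) ht (-K.r₂)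
    have h2 := inner_le_young (dv (s m)) (D m r) ht K.r₃
    have h3 := inner_le_young (lap (v m)) (D m r) ht K.μ₁
    have h4 := inner_le_young (D m (dv v)) (D m r) ht K.μ₂
    rw [norm_lap_sq (hv m)] at h3
    have e1 : ∀ k : ℝ, k ^ 2 / (4 * (K.r₁ / 8)) = 2 * k ^ 2 / K.r₁ := fun k => by
      field_simp; ring
    simp only [e1, neg_sq] at h1 h2 h3 h4
    simp only [Coef.linU, inner_add_left, inner_sub_left, real_inner_smul_left,
      real_inner_self_eq_norm_sq]
    linarith
  have h5 := Finset.sum_le_sum fun m (_ : m ∈ Finset.univ) => h m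
  simp only [Finset.sum_add_distrib, ← Finset.mul_sum] at h5
  have h6 : inner ℝ (dv v) (K.linR v) = -K.r₁ * ‖dv v‖ ^ 2 := by
    rw [Coef.linR, real_inner_smul_right, real_inner_self_eq_norm_sq]
  rw [h6]
  simp only [gq] at h5 ⊢
  linarith

theorem linear_cross_stress (hc : 0 < K.c) (hv : ∀ m, v m ∈ Hs 2) (hs : ∀ m n, s m n ∈ Hs 2)
    {ζ : ℝ} (hζ : 0 < ζ) :
    -(∑ m, ∑ n, inner ℝ (K.linS v s m n) (D n (v m))) + ∑ m, inner ℝ (dv (s m)) (K.linU r v e s m)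
      ≤ -(K.c / 2) * ∑ m, gq (v m) + K.a ^ 2 / K.c * ∑ m, ∑ n, ‖s m n‖ ^ 2
        + K.ε ^ 2 / K.c * ∑ m, ∑ n, hq (s m n) + ζ * gq r
        + (K.r₁ ^ 2 / (4 * ζ) + 3 + K.r₃) * ∑ m, ‖dv (s m)‖ ^ 2 + K.r₂ ^ 2 / 4 * gq e
        + K.μ₁ ^ 2 / 4 * ∑ m, hq (v m) + K.μ₂ ^ 2 / 4 * gq (dv v) := by
  have h : ∀ m n, -inner ℝ (K.linS v s m n) (D n (v m)) ≤ -(K.c / 2) * ‖D n (v m)‖ ^ 2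
      + K.a ^ 2 / K.c * ‖s m n‖ ^ 2 + K.ε ^ 2 / K.c * hq (s m n)
      - K.c * inner ℝ (D m (v n)) (D n (v m)) := by
    intro m n
    have ht : 0 < K.c / 4 := by positivity
    have h1 := inner_le_young (s m n) (D n (v m)) ht K.a
    have h2 := inner_le_young (lap (s m n)) (D n (v m)) ht (-K.ε)
    rw [norm_lap_sq (hs m n)] at h2
    have e1 : ∀ k : ℝ, k ^ 2 / (4 * (K.c / 4)) = k ^ 2 / K.c := fun k => by
      rw [mul_div_cancel₀ _ (by norm_num)]
    simp only [e1, neg_sq] at h1 h2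
    simp only [Coef.linS, inner_add_left, real_inner_smul_left,
      real_inner_self_eq_norm_sq]
    linarith
  have h' : ∀ m, inner ℝ (dv (s m)) (K.linU r v e s m) ≤ ζ * ‖D m r‖ ^ 2
      + (K.r₁ ^ 2 / (4 * ζ) + 3 + K.r₃) * ‖dv (s m)‖ ^ 2 + K.r₂ ^ 2 / 4 * ‖D m e‖ ^ 2
      + K.μ₁ ^ 2 / 4 * hq (v m) + K.μ₂ ^ 2 / 4 * ‖D m (dv v)‖ ^ 2 := by
    intro m
    have h0 := inner_le_young (dv (s m)) (D m r) hζ (-K.r₁)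
    have h1 := inner_le_young (D m e) (dv (s m)) one_pos (-K.r₂)
    have h2 := inner_le_young (lap (v m)) (dv (s m)) one_pos K.μ₁
    have h3 := inner_le_young (D m (dv v)) (dv (s m)) one_pos K.μ₂
    rw [norm_lap_sq (hv m)] at h2
    simp only [neg_sq, mul_one] at h0 h1 h2 h3
    rw [real_inner_comm] at h1 h2 h3
    simp only [Coef.linU, inner_add_right, inner_sub_right, real_inner_smul_right,
      real_inner_self_eq_norm_sq]
    linarith
  have h5 := Finset.sum_le_sum fun m (_ : m ∈ Finset.univ) => h' m
  have h6 := Finset.sum_le_sum fun m (_ : m ∈ Finset.univ) =>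
    Finset.sum_le_sum fun n (_ : n ∈ Finset.univ) => h m n
  simp only [Finset.sum_add_distrib, Finset.sum_sub_distrib, ← Finset.mul_sum,
    Finset.sum_neg_distrib] at h5 h6
  rw [sum_inner_D_swap fun m => Hs_mono (by omega) (hv m)] at h6
  have h7 := mul_nonneg hc.le (sq_nonneg ‖dv v‖)
  simp only [gq] at h5 h6 ⊢
  linarith

theorem linear_polymer_zero (hε : 0 < K.ε) (hr : r ∈ Hs 1) (he : e ∈ Hs 2) {p : ℝ}
    (hp : p * K.r₁ = K.b) :
    2 * inner ℝ (K.linE v e - p • K.linR v) (e - p • r)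
      ≤ -K.ε * gq e + K.ε * p ^ 2 * gq r := by
  have h1 : K.linE v e - p • K.linR v = K.ε • lap e := by
    rw [Coef.linE, Coef.linR, ← hp]
    module
  have h2 : ∀ i, 2 * K.ε * p * inner ℝ (D i r) (D i e)
      ≤ K.ε * ‖D i e‖ ^ 2 + K.ε * p ^ 2 * ‖D i r‖ ^ 2 := by
    intro i
    have := inner_le_young (D i r) (D i e) hε (2 * K.ε * p)
    rwa [show (2 * K.ε * p) ^ 2 / (4 * K.ε) = K.ε * p ^ 2 by field_simp; ring] at this
  have h3 := Finset.sum_le_sum fun i (_ : i ∈ Finset.univ) => h2 i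
  simp only [Finset.sum_add_distrib, ← Finset.mul_sum] at h3
  rw [h1, real_inner_smul_left, inner_sub_right, real_inner_smul_right, real_inner_comm e,
    inner_lap_self he, real_inner_comm r, inner_lap_right hr he]
  simp only [gq] at h3 ⊢
  linarith

theorem linear_polymer_top (hε : 0 < K.ε) (he : e ∈ Hs 2) :
    -2 * inner ℝ (K.linE v e) (lap e) ≤ -K.ε * hq e + K.b ^ 2 / K.ε * ‖dv v‖ ^ 2 := by
  have h1 := inner_le_young (dv v) (lap e) hε (2 * K.b)
  rw [show (2 * K.b) ^ 2 / (4 * K.ε) = K.b ^ 2 / K.ε by field_simp; ring, norm_lap_sq he] at h1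
  rw [Coef.linE, inner_add_left, real_inner_smul_left, real_inner_smul_left,
    real_inner_self_eq_norm_sq, norm_lap_sq he]
  linarith

end Linear

/-! ### Differentiating the linear part -/

theorem DL_add {l : List (Fin 3)} {f g : L2} (hf : f ∈ Hs l.length) (hg : g ∈ Hs l.length) :
    DL l (f + g) = DL l f + DL l g := by
  induction l with
  | nil => rfl
  | cons i l ih =>
    rw [List.length_cons] at hf hg
    change D i (DL l (f + g)) = D i (DL l f) + D i (DL l g)
    rw [ih (Hs_mono_succ hf) (Hs_mono_succ hg), D_add (DL_mem (by rwa [add_comm]))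
      (DL_mem (by rwa [add_comm]))]

theorem DL_smul {l : List (Fin 3)} {f : L2} (hf : f ∈ Hs l.length) (c : ℝ) :
    DL l (c • f) = c • DL l f := by
  induction l with
  | nil => rfl
  | cons i l ih =>
    rw [List.length_cons] at hf
    change D i (DL l (c • f)) = c • D i (DL l f)
    rw [ih (Hs_mono_succ hf), D_smul (DL_mem (by rwa [add_comm]))]

theorem DL_sub {l : List (Fin 3)} {f g : L2} (hf : f ∈ Hs l.length) (hg : g ∈ Hs l.length) :
    DL l (f - g) = DL l f - DL l g := by
  have e : ∀ a b : L2, a - b = a + (-1 : ℝ) • b := fun a b => by module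
  rw [e, DL_add hf ((Hs _).smul_mem _ hg), DL_smul hg, ← e]

theorem DL_sum {l : List (Fin 3)} {ι : Type*} (s : Finset ι) {f : ι → L2}
    (hf : ∀ k ∈ s, f k ∈ Hs l.length) : DL l (∑ k ∈ s, f k) = ∑ k ∈ s, DL l (f k) := by
  classical
  induction s using Finset.induction_on with
  | empty =>
    have := DL_smul (l := l) (f := 0) (Hs _).zero_mem 0
    simpa using this
  | insert a s ha ih =>
    rw [Finset.sum_insert ha, Finset.sum_insert ha, DL_add (hf a (Finset.mem_insert_self a s))
      ((Hs _).sum_mem fun k hk => hf k (Finset.mem_insert_of_mem hk)),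
      ih fun k hk => hf k (Finset.mem_insert_of_mem hk)]

section DLlinear

variable {l : List (Fin 3)} {r : L2} {v : Fin 3 → L2} {e : L2} {s : Fin 3 → Fin 3 → L2}

theorem lap_mem {m : ℕ} {f : L2} (hf : f ∈ Hs (m + 2)) : lap f ∈ Hs m :=
  (Hs m).sum_mem fun i _ => D_mem (D_mem hf i) i

theorem DL_lap {f : L2} (hf : f ∈ Hs (l.length + 2)) : DL l (lap f) = lap (DL l f) := by
  rw [lap, DL_sum _ fun i _ => D_mem (D_mem hf i) i, lap]
  refine Finset.sum_congr rfl fun i _ => ?_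
  rw [DL_D (by rw [add_comm]; exact D_mem hf i), DL_D (by rw [add_comm]; exact Hs_mono_succ hf)]

theorem DL_dv (hv : ∀ m, v m ∈ Hs (l.length + 1)) : DL l (dv v) = dv fun m => DL l (v m) := by
  rw [dv, DL_sum _ fun i _ => D_mem (hv i) i, dv]
  refine Finset.sum_congr rfl fun i _ => ?_
  rw [DL_D (by rw [add_comm]; exact hv i)]

variable (K : Coef)

theorem DL_linR (hv : ∀ m, v m ∈ Hs (l.length + 1)) :
    DL l (K.linR v) = K.linR fun m => DL l (v m) := by
  rw [Coef.linR, DL_smul (dv_mem hv), DL_dv hv, Coef.linR]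

theorem DL_linE (hv : ∀ m, v m ∈ Hs (l.length + 1)) (he : e ∈ Hs (l.length + 2)) :
    DL l (K.linE v e) = K.linE (fun m => DL l (v m)) (DL l e) := by
  have hd : dv v ∈ Hs l.length := dv_mem hv
  rw [Coef.linE, DL_add ((Hs _).smul_mem _ hd) ((Hs _).smul_mem _ (lap_mem he)), DL_smul hd,
    DL_smul (lap_mem he), DL_lap he, DL_dv hv, Coef.linE]

theorem DL_linS (hv : ∀ m, v m ∈ Hs (l.length + 1)) (hs : ∀ m n, s m n ∈ Hs (l.length + 2))
    (m n : Fin 3) :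
    DL l (K.linS v s m n) = K.linS (fun m => DL l (v m)) (fun m n => DL l (s m n)) m n := by
  have h1 : s m n ∈ Hs l.length := Hs_mono (by omega) (hs m n)
  have h2 : D n (v m) ∈ Hs l.length := D_mem (hv m) n
  have h3 : D m (v n) ∈ Hs l.length := D_mem (hv n) m
  have h4 := lap_mem (hs m n)
  rw [Coef.linS, DL_add ((Hs _).add_mem ((Hs _).smul_mem _ h1) ((Hs _).smul_mem _ h4))
    ((Hs _).smul_mem _ ((Hs _).add_mem h2 h3)), DL_add ((Hs _).smul_mem _ h1)
    ((Hs _).smul_mem _ h4), DL_smul h1, DL_smul h4, DL_smul ((Hs _).add_mem h2 h3), DL_add h2 h3,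
    DL_lap (hs m n), DL_D (by rw [add_comm]; exact hv m), DL_D (by rw [add_comm]; exact hv n),
    Coef.linS]

theorem DL_linU (hr : r ∈ Hs (l.length + 1)) (hv : ∀ m, v m ∈ Hs (l.length + 2))
    (he : e ∈ Hs (l.length + 1)) (hs : ∀ m n, s m n ∈ Hs (l.length + 1)) (m : Fin 3) :
    DL l (K.linU r v e s m) = K.linU (DL l r) (fun m => DL l (v m)) (DL l e)
      (fun m n => DL l (s m n)) m := by
  have h1 : D m r ∈ Hs l.length := D_mem hr m
  have h2 : D m e ∈ Hs l.length := D_mem he m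
  have h3 : dv (s m) ∈ Hs l.length := dv_mem (hs m)
  have h4 := lap_mem (hv m)
  have h5 : dv v ∈ Hs (l.length + 1) := dv_mem hv
  have h6 : D m (dv v) ∈ Hs l.length := D_mem h5 m
  have hv1 : ∀ m, v m ∈ Hs (l.length + 1) := fun m => Hs_mono_succ (hv m)
  have sm : ∀ (c : ℝ) {f : L2}, f ∈ Hs l.length → c • f ∈ Hs l.length := fun c _ hf =>
    (Hs _).smul_mem c hf
  have a1 := (Hs _).sub_mem (sm (-K.r₁) h1) (sm K.r₂ h2)
  have a2 := (Hs _).add_mem a1 (sm K.r₃ h3)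
  have a3 := (Hs _).add_mem a2 (sm K.μ₁ h4)
  rw [Coef.linU, DL_add a3 (sm _ h6), DL_add a2 (sm _ h4), DL_add a1 (sm _ h3),
    DL_sub (sm _ h1) (sm _ h2), DL_smul h1, DL_smul h2, DL_smul h3, DL_smul h4, DL_smul h6,
    DL_D (by rwa [add_comm]), DL_D (by rwa [add_comm]), DL_D (by rwa [add_comm]), DL_lap (hv m),
    DL_dv hv1, DL_dv (hs m), Coef.linU]

end DLlinear

/-! ### Nonlinear terms -/

theorem norm_DL_le (l : List (Fin 3)) (f : L2) (k : ℕ) : nm k (DL l f) ≤ nm (k + l.length) f := by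
  induction l generalizing k with
  | nil => exact le_rfl
  | cons i l ih =>
    refine (nm_D_le k _ i).trans ((ih (k + 1)).trans (le_of_eq ?_))
    rw [List.length_cons]
    congr 1
    ring

/-- A nonlinear term of size `c`: it is of size `M Z` in `H²` and its products with
functions of size `M` are of size `M Z²`. -/
structure NL (c M Z : ℝ) (X : L2) : Prop where
  mem : X ∈ Hs 2
  le : nm 2 X ≤ c * (M * Z)
  pair : ∀ A ∈ Hs 2, nm 1 A ≤ M → |inner ℝ X A| ≤ c * (M * Z ^ 2)

namespace NL

variable {c c' M Z : ℝ} {X Y : L2}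

theorem add (h : NL c M Z X) (h' : NL c' M Z Y) : NL (c + c') M Z (X + Y) where
  mem := (Hs 2).add_mem h.mem h'.mem
  le := by
    rw [add_mul]
    exact (nm_add_le h.mem h'.mem).trans (add_le_add h.le h'.le)
  pair A hA hM := by
    rw [add_mul, inner_add_left]
    exact (abs_add_le _ _).trans (add_le_add (h.pair A hA hM) (h'.pair A hA hM))

theorem smul (h : NL c M Z X) (k : ℝ) : NL (|k| * c) M Z (k • X) where
  mem := (Hs 2).smul_mem _ h.mem
  le := by
    rw [nm_smul h.mem, mul_assoc]
    exact mul_le_mul_of_nonneg_left h.le (abs_nonneg k)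
  pair A hA hM := by
    rw [real_inner_smul_left, abs_mul, mul_assoc]
    exact mul_le_mul_of_nonneg_left (h.pair A hA hM) (abs_nonneg k)

theorem sum {c : ℝ} {X : Fin 3 → L2} (h : ∀ i, NL c M Z (X i)) : NL (3 * c) M Z (∑ i, X i) := by
  rw [Fin.sum_univ_three, show 3 * c = c + c + c by ring]
  exact ((h 0).add (h 1)).add (h 2)

theorem mono (h : NL c M Z X) (hc : c ≤ c') (hM : 0 ≤ M) (hZ : 0 ≤ Z) : NL c' M Z X where
  mem := h.mem
  le := h.le.trans (by gcongr)
  pair A hA h' := (h.pair A hA h').trans (by gcongr)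

theorem sub (h : NL c M Z X) (h' : NL c' M Z Y) : NL (c + c') M Z (X - Y) := by
  have h1 := h'.smul (-1)
  rw [abs_neg, abs_one, one_mul] at h1
  have e : X - Y = X + (-1 : ℝ) • Y := by module
  rw [e]
  exact h.add h1

theorem norm_DL_le (h : NL c M Z X) {l : List (Fin 3)} (hl : l.length ≤ 2) :
    ‖DL l X‖ ≤ c * (M * Z) :=
  (OldroydB.norm_DL_le l X 0).trans ((nm_mono (by omega) X).trans h.le)

end NL

theorem NL_Mu_D {M Z : ℝ} {f E : L2} (hf : f ∈ Hs 3) (hE : E ∈ Hs 3) (hfM : nm 3 f ≤ M)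
    (hfZ : gm 2 f ≤ Z) (hEZ : gm 2 E ≤ Z) (p : Fin 3) : NL (9 * Csob) M Z (Mu f (D p E)) := by
  have hM := (nm_nonneg 3 f).trans hfM
  have hZ := (gm_nonneg 2 f).trans hfZ
  have hC := Csob_pos
  have hf2 : f ∈ Hs 2 := Hs_mono_succ hf
  refine ⟨Mu_mem_two hf2 (D_mem hE p), ?_, fun A hA hAM => ?_⟩
  · refine (nm_Mu_two hf2 (D_mem hE p)).trans ?_
    rw [mul_assoc]
    refine mul_le_mul_of_nonneg_left (mul_le_mul ((nm_mono (by omega) f).trans hfM)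
      ((nm_D_le_gm 2 E p).trans hEZ) (nm_nonneg _ _) hM) (by positivity)
  · have h1 : inner ℝ (Mu f (D p E)) A = inner ℝ (D p E) (Mu A f) := by
      rw [inner_Mu, Mu_comm_of_mem hf2 hA]
    rw [h1]
    refine (abs_real_inner_le_norm _ _).trans ?_
    have h2 : ‖Mu A f‖ ≤ Csob * M * Z := by
      refine (norm_Mu_le_low hA (Hs_mono (by omega) hf)).trans ?_
      have := gr_nonneg f
      have := (gr_le_gm 2 f).trans hfZ
      gcongr
    have h3 : ‖D p E‖ ≤ Z := (norm_D_le_gm 2 E p).trans hEZ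
    calc ‖D p E‖ * ‖Mu A f‖ ≤ Z * (Csob * M * Z) := by gcongr
      _ = Csob * (M * Z ^ 2) := by ring
      _ ≤ 9 * Csob * (M * Z ^ 2) := by
        have : 0 ≤ Csob * (M * Z ^ 2) := by positivity
        linarith

/-- The case of a coefficient `k` that compensates for the missing bound on `∂_p E` in `H²`. -/
theorem NL_smul_Mu_D {M Z k : ℝ} {f E : L2} (hf : f ∈ Hs 3) (hE : E ∈ Hs 3) (hfM : nm 3 f ≤ M)
    (hfZ : gm 2 f ≤ Z) (p : Fin 3) (h1 : |k| * ‖D p E‖ ≤ 2 * Z)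
    (h2 : |k| * nm 2 (D p E) ≤ 2 * Z) : NL (18 * Csob) M Z (k • Mu f (D p E)) := by
  have hM := (nm_nonneg 3 f).trans hfM
  have hZ := (gm_nonneg 2 f).trans hfZ
  have hC := Csob_pos
  have hf2 : f ∈ Hs 2 := Hs_mono_succ hf
  have hm := Mu_mem_two hf2 (D_mem hE p)
  refine ⟨(Hs 2).smul_mem _ hm, ?_, fun A hA hAM => ?_⟩
  · rw [nm_smul hm]
    calc |k| * nm 2 (Mu f (D p E)) ≤ |k| * (9 * Csob * nm 2 f * nm 2 (D p E)) := by
          gcongr; exact nm_Mu_two hf2 (D_mem hE p)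
      _ = 9 * Csob * nm 2 f * (|k| * nm 2 (D p E)) := by ring
      _ ≤ 9 * Csob * M * (2 * Z) := by
          have := nm_nonneg 2 f
          have := (nm_mono (by omega : 2 ≤ 3) f).trans hfM
          have := nm_nonneg 2 (D p E)
          gcongr
      _ = _ := by ring
  · rw [real_inner_smul_left, inner_Mu, Mu_comm_of_mem hf2 hA, abs_mul]
    have h3 : ‖Mu A f‖ ≤ Csob * M * Z := by
      refine (norm_Mu_le_low hA (Hs_mono (by omega) hf)).trans ?_
      have := gr_nonneg f
      have := (gr_le_gm 2 f).trans hfZ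
      gcongr
    calc |k| * |inner ℝ (D p E) (Mu A f)| ≤ |k| * (‖D p E‖ * ‖Mu A f‖) := by
          gcongr; exact abs_real_inner_le_norm _ _
      _ = |k| * ‖D p E‖ * ‖Mu A f‖ := by ring
      _ ≤ 2 * Z * (Csob * M * Z) := by gcongr
      _ = 2 * Csob * (M * Z ^ 2) := by ring
      _ ≤ 18 * Csob * (M * Z ^ 2) := by
        have : 0 ≤ Csob * (M * Z ^ 2) := by positivity
        linarith

theorem NL_Mu_dv {M Z : ℝ} {f : L2} (hf : f ∈ Hs 3) (hfM : nm 3 f ≤ M) (hfZ : gm 2 f ≤ Z)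
    {v : Fin 3 → L2} (hv : ∀ i, v i ∈ Hs 3) (hvZ : ∀ i, gm 2 (v i) ≤ Z) :
    NL (27 * Csob) M Z (Mu f (dv v)) := by
  rw [dv, map_sum, show 27 * Csob = 3 * (9 * Csob) by ring]
  exact NL.sum fun i => NL_Mu_D hf (hv i) hfM hfZ (hvZ i) i

/-- The unknowns as elements of `L²`. -/
structure Fields where
  ρ : L2
  u : Fin 3 → L2
  η : L2
  τ : Fin 3 → Fin 3 → L2

/-- The bounds under which the nonlinear terms are estimated. `H`, `G` and `A` are the
coefficients of `∇ρ`, of `div τ` and the viscous terms, and of `∇η`. -/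
structure Bounds (U : Fields) (H G A : L2) (M Z μ κ : ℝ) : Prop where
  ρ_mem : U.ρ ∈ Hs 3
  u_mem : ∀ i, U.u i ∈ Hs 4
  η_mem : U.η ∈ Hs 4
  τ_mem : ∀ i j, U.τ i j ∈ Hs 4
  H_mem : H ∈ Hs 3
  G_mem : G ∈ Hs 3
  A_mem : A ∈ Hs 3
  ρ_le : nm 3 U.ρ ≤ M
  u_le : ∀ i, nm 3 (U.u i) ≤ M
  η_le : nm 3 U.η ≤ M
  τ_le : ∀ i j, nm 3 (U.τ i j) ≤ M
  H_le : nm 3 H ≤ M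
  G_le : nm 3 G ≤ M
  A_le : nm 3 A ≤ M
  M_le : M ≤ 1
  ρ_gm : gm 2 U.ρ ≤ Z
  u_gm : ∀ i, gm 2 (U.u i) ≤ Z
  η_gm : gm 3 U.η ≤ Z
  τ_gm : ∀ i j, gm 3 (U.τ i j) ≤ Z
  H_gm : gm 2 H ≤ Z
  G_gm : gm 2 G ≤ Z
  A_gm : gm 2 A ≤ Z
  μ_nonneg : 0 ≤ μ
  μ_le : μ ≤ 1
  κ_nonneg : 0 ≤ κ
  κ_le : κ ≤ 2
  μ_gm : ∀ i, μ * gm 3 (U.u i) ^ 2 ≤ Z ^ 2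
  κ_nm : κ * nm 3 (dv U.u) ^ 2 ≤ Z ^ 2

/-- The coefficients of the nonlinear terms. -/
structure NCoef where
  β : ℝ
  k : ℝ
  μ : ℝ
  κ : ℝ

namespace NCoef

variable (N : NCoef) (U : Fields) (H G A : L2)

def nlR : L2 := -N.β • (Mu U.ρ (dv U.u) + ∑ l, Mu (U.u l) (D l U.ρ))

def nlE : L2 := -N.β • (Mu U.η (dv U.u) + ∑ l, Mu (U.u l) (D l U.η))

def transport (i : Fin 3) : L2 := ∑ j, Mu (U.u j) (D j (U.u i))

def forcing (i : Fin 3) : L2 := Mu A (D i U.η) - Mu G (dv (U.τ i))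

def nlU (i : Fin 3) : L2 :=
  -N.β • transport U i + Mu H (D i U.ρ) + forcing U G A i
    - (N.μ * N.β) • Mu G (lap (U.u i)) - (N.κ * N.β) • Mu G (D i (dv U.u))

def nlS (i j : Fin 3) : L2 :=
  -N.β • (Mu (U.τ i j) (dv U.u) + ∑ l, Mu (U.u l) (D l (U.τ i j)))
    + N.β • (∑ l, (Mu (U.τ l j) (D l (U.u i)) + Mu (U.τ i l) (D l (U.u j))))
    + (N.β * N.k) • (Mu U.η (D j (U.u i)) + Mu U.η (D i (U.u j)))

end NCoef

section Nonlinear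

variable {N : NCoef} {U : Fields} {H G A : L2} {M Z : ℝ}

namespace Bounds

variable (B : Bounds U H G A M Z N.μ N.κ)
include B

theorem M_nonneg : 0 ≤ M := (nm_nonneg 3 _).trans B.ρ_le

theorem Z_nonneg : 0 ≤ Z := (gm_nonneg 2 _).trans B.ρ_gm

theorem u_mem' (i : Fin 3) : U.u i ∈ Hs 3 := Hs_mono_succ (B.u_mem i)

theorem η_mem' : U.η ∈ Hs 3 := Hs_mono_succ B.η_mem

theorem τ_mem' (i j : Fin 3) : U.τ i j ∈ Hs 3 := Hs_mono_succ (B.τ_mem i j)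

theorem η_gm' : gm 2 U.η ≤ Z := (gm_mono_succ 2 _).trans B.η_gm

theorem τ_gm' (i j : Fin 3) : gm 2 (U.τ i j) ≤ Z := (gm_mono_succ 2 _).trans (B.τ_gm i j)

theorem dv_mem : dv U.u ∈ Hs 3 := OldroydB.dv_mem B.u_mem

theorem NL_convection {E : L2} (hE : E ∈ Hs 3) (hEZ : gm 2 E ≤ Z) :
    NL (27 * Csob) M Z (∑ l, Mu (U.u l) (D l E)) := by
  rw [show 27 * Csob = 3 * (9 * Csob) by ring]
  exact NL.sum fun i => NL_Mu_D (B.u_mem' i) hE (B.u_le i) (B.u_gm i) hEZ i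

theorem nlR : NL (|N.β| * (54 * Csob)) M Z (N.nlR U) := by
  have h := ((NL_Mu_dv B.ρ_mem B.ρ_le B.ρ_gm B.u_mem' B.u_gm).add
    (B.NL_convection B.ρ_mem B.ρ_gm)).smul (-N.β)
  rw [abs_neg, show 27 * Csob + 27 * Csob = 54 * Csob by ring] at h
  exact h

theorem nlE : NL (|N.β| * (54 * Csob)) M Z (N.nlE U) := by
  have h := ((NL_Mu_dv B.η_mem' B.η_le B.η_gm' B.u_mem' B.u_gm).add
    (B.NL_convection B.η_mem' B.η_gm')).smul (-N.β)
  rw [abs_neg, show 27 * Csob + 27 * Csob = 54 * Csob by ring] at h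
  exact h

theorem nlS (i j : Fin 3) :
    NL (|N.β| * (108 * Csob) + |N.β * N.k| * (18 * Csob)) M Z (N.nlS U i j) := by
  have h1 := ((NL_Mu_dv (B.τ_mem' i j) (B.τ_le i j) (B.τ_gm' i j) B.u_mem' B.u_gm).add
    (B.NL_convection (B.τ_mem' i j) (B.τ_gm' i j))).smul (-N.β)
  have h2 := (NL.sum fun l => (NL_Mu_D (B.τ_mem' l j) (B.u_mem' i) (B.τ_le l j) (B.τ_gm' l j)
    (B.u_gm i) l).add (NL_Mu_D (B.τ_mem' i l) (B.u_mem' j) (B.τ_le i l) (B.τ_gm' i l)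
    (B.u_gm j) l)).smul N.β
  have h3 := ((NL_Mu_D B.η_mem' (B.u_mem' i) B.η_le B.η_gm' (B.u_gm i) j).add
    (NL_Mu_D B.η_mem' (B.u_mem' j) B.η_le B.η_gm' (B.u_gm j) i)).smul (N.β * N.k)
  have h := (h1.add h2).add h3
  rw [abs_neg, show |N.β| * (27 * Csob + 27 * Csob) + |N.β| * (3 * (9 * Csob + 9 * Csob))
    + |N.β * N.k| * (9 * Csob + 9 * Csob) = |N.β| * (108 * Csob) + |N.β * N.k| * (18 * Csob) by
      ring] at h
  exact h

theorem μ_mul_gm_le (i : Fin 3) : N.μ * gm 3 (U.u i) ≤ Z := by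
  refine abs_le_of_sq_le_sq' ?_ B.Z_nonneg |>.2
  have h1 := B.μ_gm i
  have h2 := mul_le_mul_of_nonneg_right B.μ_le
    (mul_nonneg B.μ_nonneg (sq_nonneg (gm 3 (U.u i))))
  nlinarith

theorem κ_mul_nm_le : N.κ * nm 3 (dv U.u) ≤ 2 * Z := by
  refine abs_le_of_sq_le_sq' ?_ (by have := B.Z_nonneg; positivity) |>.2
  have h1 := B.κ_nm
  have h2 := mul_le_mul_of_nonneg_right B.κ_le
    (mul_nonneg B.κ_nonneg (sq_nonneg (nm 3 (dv U.u))))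
  nlinarith [sq_nonneg Z]

theorem NL_viscous (i : Fin 3) : NL (54 * Csob) M Z (N.μ • Mu G (lap (U.u i))) := by
  have e : N.μ • Mu G (lap (U.u i)) = ∑ p, N.μ • Mu G (D p (D p (U.u i))) := by
    rw [lap, map_sum, Finset.smul_sum]
  rw [e, show 54 * Csob = 3 * (18 * Csob) by ring]
  have hZ := B.Z_nonneg
  have h0 := B.μ_nonneg
  refine NL.sum fun p => NL_smul_Mu_D B.G_mem (D_mem (B.u_mem i) p) B.G_le B.G_gm p ?_ ?_
  all_goals
    rw [abs_of_nonneg h0]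
    refine le_trans (mul_le_mul_of_nonneg_left ?_ h0)
      ((B.μ_mul_gm_le i).trans (by linarith))
  · exact (norm_DD_le_gm 2 (U.u i) p p)
  · exact (nm_D_le 2 _ p).trans (nm_D_le_gm 3 _ p)

theorem NL_bulk_viscous (i : Fin 3) : NL (18 * Csob) M Z (N.κ • Mu G (D i (dv U.u))) := by
  have h0 := B.κ_nonneg
  refine NL_smul_Mu_D B.G_mem B.dv_mem B.G_le B.G_gm i ?_ ?_
  all_goals
    rw [abs_of_nonneg h0]
    refine le_trans (mul_le_mul_of_nonneg_left ?_ h0) B.κ_mul_nm_le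
  · exact norm_D_le 2 _ i
  · exact nm_D_le 2 _ i

theorem nlU (i : Fin 3) : NL (|N.β| * (99 * Csob) + 45 * Csob) M Z (N.nlU U H G A i) := by
  have h1 := (B.NL_convection (B.u_mem' i) (B.u_gm i)).smul (-N.β)
  have h2 := NL_Mu_D B.H_mem B.ρ_mem B.H_le B.H_gm B.ρ_gm i
  have h3 := (NL_Mu_D B.A_mem B.η_mem' B.A_le B.A_gm B.η_gm' i).sub
    (NL_Mu_dv B.G_mem B.G_le B.G_gm (B.τ_mem' i) (B.τ_gm' i))
  have h4 := (B.NL_viscous i).smul N.β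
  have h5 := (B.NL_bulk_viscous i).smul N.β
  rw [smul_smul, mul_comm N.β] at h4 h5
  have h := (((h1.add h2).add h3).sub h4).sub h5
  refine h.mono (le_of_eq ?_) B.M_nonneg B.Z_nonneg
  rw [abs_neg]
  ring

theorem forcing_mem (i : Fin 3) : NCoef.forcing U G A i ∈ Hs 3 :=
  (Hs 3).sub_mem (Mu_mem_three B.A_mem (D_mem B.η_mem i))
    (Mu_mem_three B.G_mem (OldroydB.dv_mem (B.τ_mem i)))

theorem nm_forcing (i : Fin 3) : nm 3 (NCoef.forcing U G A i) ≤ 76 * Csob * (M * Z) := by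
  have hM := B.M_nonneg
  have hC := Csob_pos
  have h1 : nm 3 (Mu A (D i U.η)) ≤ 19 * Csob * (M * Z) := by
    refine (nm_Mu_three B.A_mem (D_mem B.η_mem i)).trans ?_
    rw [mul_assoc]
    exact mul_le_mul_of_nonneg_left (mul_le_mul B.A_le ((nm_D_le_gm 3 _ i).trans B.η_gm)
      (nm_nonneg _ _) hM) (by positivity)
  have h2 : nm 3 (dv (U.τ i)) ≤ 3 * Z := by
    refine (nm_sum_le _ fun n _ => D_mem (B.τ_mem i n) n).trans ?_
    refine (Finset.sum_le_sum fun n _ => (nm_D_le_gm 3 _ n).trans (B.τ_gm i n)).trans ?_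
    simp
  have h3 : nm 3 (Mu G (dv (U.τ i))) ≤ 57 * Csob * (M * Z) := by
    refine (nm_Mu_three B.G_mem (OldroydB.dv_mem (B.τ_mem i))).trans ?_
    calc 19 * Csob * nm 3 G * nm 3 (dv (U.τ i)) ≤ 19 * Csob * M * (3 * Z) := by
          have := nm_nonneg 3 G
          have := B.G_le
          have := nm_nonneg 3 (dv (U.τ i))
          gcongr
      _ = _ := by ring
  have h4 := nm_sub_le (Mu_mem_three B.A_mem (D_mem B.η_mem i))
    (Mu_mem_three B.G_mem (OldroydB.dv_mem (B.τ_mem i)))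
  rw [NCoef.forcing]
  linarith

end Bounds

theorem norm_DDDD_le_gm (f : L2) (h i j k : Fin 3) : ‖D h (D i (D j (D k f)))‖ ≤ gm 3 f :=
  (norm_DDD_le_gm 0 (D k f) h i j).trans ((gm_le_nm 2 _).trans (nm_D_le_gm 3 f k))

theorem norm_lap_le {f : L2} {c : ℝ} (h : ∀ i, ‖D i (D i f)‖ ≤ c) : ‖lap f‖ ≤ 3 * c := by
  refine (norm_sum_le _ _).trans ((Finset.sum_le_sum fun i _ => h i).trans ?_)
  simp

theorem DL_comb {l : List (Fin 3)} {f₁ f₂ f₃ f₄ f₅ : L2} (m1 : f₁ ∈ Hs l.length)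
    (m2 : f₂ ∈ Hs l.length) (m3 : f₃ ∈ Hs l.length) (m4 : f₄ ∈ Hs l.length)
    (m5 : f₅ ∈ Hs l.length) (a b c : ℝ) :
    DL l (a • f₁ + f₂ + f₃ - b • f₄ - c • f₅)
      = a • DL l f₁ + DL l f₂ + DL l f₃ - b • DL l f₄ - c • DL l f₅ := by
  have sm : ∀ (c : ℝ) {f : L2}, f ∈ Hs l.length → c • f ∈ Hs l.length := fun c _ hf =>
    (Hs _).smul_mem c hf
  have a1 := (Hs _).add_mem (sm a m1) m2
  have a2 := (Hs _).add_mem a1 m3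
  have a3 := (Hs _).sub_mem a2 (sm b m4)
  rw [DL_sub a3 (sm _ m5), DL_sub a2 (sm _ m4), DL_add a1 m3, DL_add (sm _ m1) m2, DL_smul m1,
    DL_smul m4, DL_smul m5]

theorem abs_comb_le {t₁ t₂ t₃ t₄ t₅ t₆ μ κ c₁ c₂ c₃ c₄ c₅ : ℝ} (β : ℝ) (h₁ : |t₁| ≤ c₁)
    (h₂ : |t₂ - t₆| ≤ c₂) (h₃ : |t₃| ≤ c₃) (h₄ : |μ * t₄| ≤ c₄) (h₅ : |κ * t₅| ≤ c₅) :
    |-β * t₁ + t₂ + t₃ - μ * β * t₄ - κ * β * t₅ - t₆|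
      ≤ |β| * c₁ + c₂ + c₃ + |β| * c₄ + |β| * c₅ := by
  have hb : ∀ x y : ℝ, |x| ≤ y → |-β * x| ≤ |β| * y := fun x y h => by
    rw [abs_mul, abs_neg]
    exact mul_le_mul_of_nonneg_left h (abs_nonneg _)
  rw [show -β * t₁ + t₂ + t₃ - μ * β * t₄ - κ * β * t₅ - t₆
      = (-β) * t₁ + (t₂ - t₆) + t₃ + (-β) * (μ * t₄) + (-β) * (κ * t₅) by ring]
  exact (abs_add_le _ _).trans (add_le_add ((abs_add_le _ _).trans (add_le_add
    ((abs_add_le _ _).trans (add_le_add ((abs_add_le _ _).trans (add_le_add (hb _ _ h₁) h₂)) h₃))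
    (hb _ _ h₄))) (hb _ _ h₅))

theorem abs_inner_Mu_D_lap_sub_le {f E w : L2} (hf : f ∈ Hs 3) (hE : E ∈ Hs 3) (hw : w ∈ Hs 4)
    (j k m : Fin 3) :
    |inner ℝ (DL [j, k] (Mu f (D m E))) (lap (DL [j, k] w))
      - ∑ i, inner ℝ (Mu f (D i (DL [j, k] E))) (D i (D m (DL [j, k] w)))|
      ≤ 45 * Csob * (gm 2 f * gm 2 E * gm 2 w) := by
  rw [lap, inner_sum, ← Finset.sum_sub_distrib]
  refine (Finset.abs_sum_le_sum_abs _ _).trans ?_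
  refine (Finset.sum_le_sum fun i _ => abs_inner_D_D_Mu_sub_le hf hE hw i j k m).trans ?_
  rw [Finset.sum_const, Finset.card_univ, Fintype.card_fin, nsmul_eq_mul]
  exact le_of_eq (by push_cast; ring)

namespace Bounds

variable (B : Bounds U H G A M Z N.μ N.κ)
include B

theorem top_transport (j k m : Fin 3) :
    |inner ℝ (DL [j, k] (NCoef.transport U m)) (lap (DL [j, k] (U.u m)))|
      ≤ 144 * Csob * (M * Z ^ 2) := by
  have hM := B.M_nonneg
  have hZ := B.Z_nonneg
  have hC := Csob_pos
  have hmem : ∀ p, Mu (U.u p) (D p (U.u m)) ∈ Hs 2 := fun p =>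
    Mu_mem_two (Hs_mono_succ (B.u_mem' p)) (D_mem (B.u_mem' m) p)
  have key : ∀ p, |inner ℝ (DL [j, k] (Mu (U.u p) (D p (U.u m)))) (lap (DL [j, k] (U.u m)))|
      ≤ 48 * Csob * (M * Z ^ 2) := by
    intro p
    have h1 := abs_inner_Mu_D_lap_sub_le (B.u_mem' p) (B.u_mem' m) (B.u_mem m) j k p
    have h2 : gm 2 (U.u p) * gm 2 (U.u m) * gm 2 (U.u m) ≤ M * Z ^ 2 := by
      rw [mul_assoc, ← sq]
      have := gm_nonneg 2 (U.u m)
      exact mul_le_mul ((gm_le_nm 2 _).trans (B.u_le p))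
        (pow_le_pow_left₀ this (B.u_gm m) 2) (by positivity) hM
    have h3 : ∀ i, |inner ℝ (Mu (U.u p) (D i (DL [j, k] (U.u m)))) (D i (D p (DL [j, k] (U.u m))))|
        ≤ Csob * (M * Z ^ 2) := by
      intro i
      have hw2 : DL [j, k] (U.u m) ∈ Hs 2 := DL_mem (B.u_mem m)
      rw [D_comm hw2]
      have h4 := inner_Mu_D_self (B.u_mem' p) (D_mem hw2 i) p
      have h5 : ‖D i (DL [j, k] (U.u m))‖ ≤ Z := (norm_DDD_le_gm 0 _ i j k).trans (B.u_gm m)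
      have h6 : |inner ℝ (Mu (D p (U.u p)) (D i (DL [j, k] (U.u m)))) (D i (DL [j, k] (U.u m)))|
          ≤ Csob * M * Z * Z := by
        refine (abs_real_inner_le_norm _ _).trans ?_
        refine mul_le_mul ?_ h5 (norm_nonneg _) (by positivity)
        refine (norm_Mu_le_of_mem (D_mem (B.u_mem' p) p) _).trans ?_
        have := (nm_D_le 2 _ p).trans (B.u_le p)
        gcongr
      rw [show inner ℝ (Mu (U.u p) (D i (DL [j, k] (U.u m)))) (D p (D i (DL [j, k] (U.u m))))
        = -(1 / 2) * inner ℝ (Mu (D p (U.u p)) (D i (DL [j, k] (U.u m)))) (D i (DL [j, k] (U.u m)))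
        by linarith, abs_mul]
      have h7 : 0 ≤ Csob * M * Z * Z := by positivity
      rw [show |(-(1 / 2) : ℝ)| = 1 / 2 by norm_num]
      linarith
    have h4 := (Finset.abs_sum_le_sum_abs (fun i => inner ℝ (Mu (U.u p) (D i (DL [j, k] (U.u m))))
      (D i (D p (DL [j, k] (U.u m))))) Finset.univ).trans (Finset.sum_le_sum fun i _ => h3 i)
    rw [Finset.sum_const, Finset.card_univ, Fintype.card_fin, nsmul_eq_mul] at h4
    push_cast at h4
    have h5 := mul_le_mul_of_nonneg_left h2 (by positivity : 0 ≤ 45 * Csob)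
    rw [abs_le] at h1 h4 ⊢
    constructor <;> linarith [h1.1, h1.2, h4.1, h4.2]
  rw [NCoef.transport, DL_sum _ fun p _ => hmem p, sum_inner]
  refine (Finset.abs_sum_le_sum_abs _ _).trans ((Finset.sum_le_sum fun p _ => key p).trans ?_)
  rw [Finset.sum_const, Finset.card_univ, Fintype.card_fin, nsmul_eq_mul]
  exact le_of_eq (by push_cast; ring)

theorem top_forcing (j k m : Fin 3) :
    |inner ℝ (DL [j, k] (NCoef.forcing U G A m)) (lap (DL [j, k] (U.u m)))|
      ≤ 228 * Csob * (M * Z ^ 2) := by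
  have hZ := B.Z_nonneg
  have hM := B.M_nonneg
  have hC := Csob_pos
  rw [inner_lap_right (DL_mem (B.forcing_mem m)) (DL_mem (B.u_mem m)), abs_neg]
  refine (Finset.abs_sum_le_sum_abs _ _).trans ?_
  have key : ∀ i, |inner ℝ (D i (DL [j, k] (NCoef.forcing U G A m))) (D i (DL [j, k] (U.u m)))|
      ≤ 76 * Csob * (M * Z) * Z := by
    intro i
    refine (abs_real_inner_le_norm _ _).trans (mul_le_mul ?_
      ((norm_DDD_le_gm 0 _ i j k).trans (B.u_gm m)) (norm_nonneg _) (by positivity))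
    exact (norm_DDD_le_gm 0 _ i j k).trans ((gm_le_nm 2 _).trans (B.nm_forcing m))
  refine (Finset.sum_le_sum fun i _ => key i).trans ?_
  rw [Finset.sum_const, Finset.card_univ, Fintype.card_fin, nsmul_eq_mul]
  exact le_of_eq (by push_cast; ring)

theorem top_viscous (j k m : Fin 3) :
    |N.μ * inner ℝ (DL [j, k] (Mu G (lap (U.u m)))) (lap (DL [j, k] (U.u m)))|
      ≤ 81 * Csob * (M * Z ^ 2) := by
  have hM := B.M_nonneg
  have hC := Csob_pos
  have h0 := B.μ_nonneg
  have hl : lap (U.u m) ∈ Hs 2 := lap_mem (B.u_mem m)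
  set x := gm 3 (U.u m)
  have hx : 0 ≤ x := gm_nonneg 3 _
  have h1 : nm 2 (lap (U.u m)) ≤ 3 * x := by
    refine (nm_sum_le _ fun p _ => D_mem (D_mem (B.u_mem m) p) p).trans ?_
    refine (Finset.sum_le_sum fun p _ => (nm_D_le 2 _ p).trans (nm_D_le_gm 3 _ p)).trans ?_
    simp [x]
  have h2 : ‖DL [j, k] (Mu G (lap (U.u m)))‖ ≤ 27 * Csob * M * x := by
    refine (norm_DL_le [j, k] _ 0).trans ((nm_Mu_two (Hs_mono_succ B.G_mem) hl).trans ?_)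
    calc 9 * Csob * nm 2 G * nm 2 (lap (U.u m)) ≤ 9 * Csob * M * (3 * x) := by
          have := nm_nonneg 2 G
          have := nm_nonneg 2 (lap (U.u m))
          have := (nm_mono (by omega : 2 ≤ 3) G).trans B.G_le
          gcongr
      _ = _ := by ring
  have h3 : ‖lap (DL [j, k] (U.u m))‖ ≤ 3 * x := norm_lap_le fun i => norm_DDDD_le_gm _ i i j k
  rw [abs_mul, abs_of_nonneg h0]
  have h4 : |inner ℝ (DL [j, k] (Mu G (lap (U.u m)))) (lap (DL [j, k] (U.u m)))|
      ≤ 27 * Csob * M * x * (3 * x) :=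
    (abs_real_inner_le_norm _ _).trans (mul_le_mul h2 h3 (norm_nonneg _) (by positivity))
  calc _ ≤ N.μ * (27 * Csob * M * x * (3 * x)) := by gcongr
    _ = 81 * Csob * M * (N.μ * x ^ 2) := by ring
    _ ≤ 81 * Csob * M * Z ^ 2 := by
      have := B.μ_gm m
      gcongr
    _ = _ := by ring

theorem top_bulk_viscous (j k : Fin 3) :
    |N.κ * ∑ m, inner ℝ (DL [j, k] (Mu G (D m (dv U.u)))) (lap (DL [j, k] (U.u m)))|
      ≤ 273 * Csob * (M * Z ^ 2) := by
  have hM := B.M_nonneg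
  have hZ := B.Z_nonneg
  have hC := Csob_pos
  have h0 := B.κ_nonneg
  set y := nm 3 (dv U.u)
  have hy : 0 ≤ y := nm_nonneg 3 _
  have hW : ∀ m, DL [j, k] (U.u m) ∈ Hs 2 := fun m => DL_mem (B.u_mem m)
  have h1 : ∀ m, |inner ℝ (DL [j, k] (Mu G (D m (dv U.u)))) (lap (DL [j, k] (U.u m)))
      - ∑ i, inner ℝ (Mu G (D i (DL [j, k] (dv U.u)))) (D i (D m (DL [j, k] (U.u m))))|
      ≤ 45 * Csob * (M * y * Z) := by
    intro m
    refine (abs_inner_Mu_D_lap_sub_le B.G_mem B.dv_mem (B.u_mem m) j k m).trans ?_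
    have h2 := (gm_le_nm 2 G).trans B.G_le
    have h3 := gm_le_nm 2 (dv U.u)
    have h4 := B.u_gm m
    have := gm_nonneg 2 G
    have := gm_nonneg 2 (dv U.u)
    have := gm_nonneg 2 (U.u m)
    gcongr
  have h2 : ∑ m, ∑ i, inner ℝ (Mu G (D i (DL [j, k] (dv U.u)))) (D i (D m (DL [j, k] (U.u m))))
      = ∑ i, inner ℝ (Mu G (D i (DL [j, k] (dv U.u)))) (D i (DL [j, k] (dv U.u))) := by
    rw [Finset.sum_comm]
    refine Finset.sum_congr rfl fun i _ => ?_
    have e : DL [j, k] (dv U.u) = dv fun m => DL [j, k] (U.u m) := DL_dv (l := [j, k]) B.u_mem'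
    have e' : ∑ m, D i (D m (DL [j, k] (U.u m))) = D i (DL [j, k] (dv U.u)) := by
      rw [e, D_dv hW]
    rw [← inner_sum, e']
  have h3 : |∑ i, inner ℝ (Mu G (D i (DL [j, k] (dv U.u)))) (D i (DL [j, k] (dv U.u)))|
      ≤ 3 * (Csob * M * y * y) := by
    refine (Finset.abs_sum_le_sum_abs _ _).trans ?_
    have key : ∀ i, |inner ℝ (Mu G (D i (DL [j, k] (dv U.u)))) (D i (DL [j, k] (dv U.u)))|
        ≤ Csob * M * y * y := by
      intro i
      have h4 : ‖D i (DL [j, k] (dv U.u))‖ ≤ y :=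
        (norm_DDD_le_gm 0 (dv U.u) i j k).trans (gm_le_nm 2 _)
      refine (abs_real_inner_le_norm _ _).trans (mul_le_mul ?_ h4 (norm_nonneg _) (by positivity))
      refine (norm_Mu_le_of_mem (Hs_mono_succ B.G_mem) _).trans ?_
      have := nm_nonneg 2 G
      have := (nm_mono (by omega : 2 ≤ 3) G).trans B.G_le
      gcongr
    refine (Finset.sum_le_sum fun i _ => key i).trans ?_
    simp
  have h4 : |∑ m, inner ℝ (DL [j, k] (Mu G (D m (dv U.u)))) (lap (DL [j, k] (U.u m)))
      - ∑ i, inner ℝ (Mu G (D i (DL [j, k] (dv U.u)))) (D i (DL [j, k] (dv U.u)))|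
      ≤ 3 * (45 * Csob * (M * y * Z)) := by
    rw [← h2, ← Finset.sum_sub_distrib]
    refine (Finset.abs_sum_le_sum_abs _ _).trans ((Finset.sum_le_sum fun m _ => h1 m).trans ?_)
    simp
  have h5 : |∑ m, inner ℝ (DL [j, k] (Mu G (D m (dv U.u)))) (lap (DL [j, k] (U.u m)))|
      ≤ 3 * (45 * Csob * (M * y * Z)) + 3 * (Csob * M * y * y) := by
    rw [abs_le] at h3 h4 ⊢
    constructor <;> linarith [h3.1, h3.2, h4.1, h4.2]
  rw [abs_mul, abs_of_nonneg h0]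
  calc _ ≤ N.κ * (3 * (45 * Csob * (M * y * Z)) + 3 * (Csob * M * y * y)) := by gcongr
    _ = 135 * Csob * M * Z * (N.κ * y) + 3 * Csob * M * (N.κ * y ^ 2) := by ring
    _ ≤ 135 * Csob * M * Z * (2 * Z) + 3 * Csob * M * Z ^ 2 := by
      have := B.κ_mul_nm_le
      have := B.κ_nm
      gcongr
    _ = _ := by ring

theorem top_pressure (j k : Fin 3) :
    |∑ m, inner ℝ (DL [j, k] (Mu H (D m U.ρ))) (lap (DL [j, k] (U.u m)))
      - ∑ i, inner ℝ (Mu H (D i (DL [j, k] U.ρ))) (D i (dv fun m => DL [j, k] (U.u m)))|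
      ≤ 135 * Csob * (M * Z ^ 2) := by
  have hM := B.M_nonneg
  have hZ := B.Z_nonneg
  have hC := Csob_pos
  have hW : ∀ m, DL [j, k] (U.u m) ∈ Hs 2 := fun m => DL_mem (B.u_mem m)
  have h2 : ∑ i, inner ℝ (Mu H (D i (DL [j, k] U.ρ))) (D i (dv fun m => DL [j, k] (U.u m)))
      = ∑ m, ∑ i, inner ℝ (Mu H (D i (DL [j, k] U.ρ))) (D i (D m (DL [j, k] (U.u m)))) := by
    rw [Finset.sum_comm]
    simp only [D_dv hW, inner_sum]
  rw [h2, ← Finset.sum_sub_distrib]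
  refine (Finset.abs_sum_le_sum_abs _ _).trans ?_
  have h3 : ∀ m, gm 2 H * gm 2 U.ρ * gm 2 (U.u m) ≤ M * Z ^ 2 := by
    intro m
    rw [mul_assoc, sq]
    exact mul_le_mul ((gm_le_nm 2 _).trans B.H_le) (mul_le_mul B.ρ_gm (B.u_gm m)
      (gm_nonneg _ _) hZ) (mul_nonneg (gm_nonneg _ _) (gm_nonneg _ _)) hM
  refine (Finset.sum_le_sum fun m _ => (abs_inner_Mu_D_lap_sub_le B.H_mem B.ρ_mem (B.u_mem m)
    j k m).trans (mul_le_mul_of_nonneg_left (h3 m) (by positivity))).trans ?_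
  rw [Finset.sum_const, Finset.card_univ, Fintype.card_fin, nsmul_eq_mul]
  exact le_of_eq (by push_cast; ring)
theorem DL_nlU (j k m : Fin 3) : DL [j, k] (N.nlU U H G A m) =
    -N.β • DL [j, k] (NCoef.transport U m)
      + DL [j, k] (Mu H (D m U.ρ)) + DL [j, k] (NCoef.forcing U G A m)
      - (N.μ * N.β) • DL [j, k] (Mu G (lap (U.u m)))
      - (N.κ * N.β) • DL [j, k] (Mu G (D m (dv U.u))) := by
  have hG2 : G ∈ Hs 2 := Hs_mono_succ B.G_mem
  have m1 : NCoef.transport U m ∈ Hs 2 := (B.NL_convection (B.u_mem' m) (B.u_gm m)).mem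
  have m2 : Mu H (D m U.ρ) ∈ Hs 2 := Mu_mem_two (Hs_mono_succ B.H_mem) (D_mem B.ρ_mem m)
  have m3 : NCoef.forcing U G A m ∈ Hs 2 := Hs_mono_succ (B.forcing_mem m)
  have m4 : Mu G (lap (U.u m)) ∈ Hs 2 := Mu_mem_two hG2 (lap_mem (B.u_mem m))
  have m5 : Mu G (D m (dv U.u)) ∈ Hs 2 := Mu_mem_two hG2 (D_mem B.dv_mem m)
  exact DL_comb (l := [j, k]) m1 m2 m3 m4 m5 _ _ _

/-- The nonlinear terms of the velocity equation, at the highest order. -/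
theorem top_velocity (j k : Fin 3) :
    |∑ m, inner ℝ (DL [j, k] (N.nlU U H G A m)) (lap (DL [j, k] (U.u m)))
      - ∑ i, inner ℝ (Mu H (D i (DL [j, k] U.ρ))) (D i (dv fun m => DL [j, k] (U.u m)))|
      ≤ (|N.β| * (948 * Csob) + 819 * Csob) * (M * Z ^ 2) := by
  have hM := B.M_nonneg
  have hZ := B.Z_nonneg
  have hC := Csob_pos
  have sum3 : ∀ {F : Fin 3 → ℝ} {c : ℝ}, (∀ m, |F m| ≤ c) → |∑ m, F m| ≤ 3 * c := by
    intro F c h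
    refine (Finset.abs_sum_le_sum_abs _ _).trans ((Finset.sum_le_sum fun m _ => h m).trans ?_)
    simp
  have hT := sum3 (B.top_transport j k)
  have hF := sum3 (B.top_forcing j k)
  have hV := sum3 (B.top_viscous j k)
  have hB := B.top_bulk_viscous j k
  rw [← Finset.mul_sum] at hV
  have e : ∑ m, inner ℝ (DL [j, k] (N.nlU U H G A m)) (lap (DL [j, k] (U.u m)))
      = -N.β * (∑ m, inner ℝ (DL [j, k] (NCoef.transport U m)) (lap (DL [j, k] (U.u m))))
      + (∑ m, inner ℝ (DL [j, k] (Mu H (D m U.ρ))) (lap (DL [j, k] (U.u m))))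
      + (∑ m, inner ℝ (DL [j, k] (NCoef.forcing U G A m)) (lap (DL [j, k] (U.u m))))
      - N.μ * N.β * (∑ m, inner ℝ (DL [j, k] (Mu G (lap (U.u m)))) (lap (DL [j, k] (U.u m))))
      - N.κ * N.β * (∑ m, inner ℝ (DL [j, k] (Mu G (D m (dv U.u)))) (lap (DL [j, k] (U.u m)))) := by
    simp only [B.DL_nlU, inner_add_left, inner_sub_left, real_inner_smul_left,
      Finset.sum_add_distrib, Finset.sum_sub_distrib, ← Finset.mul_sum]
  rw [e]
  refine (abs_comb_le _ hT (B.top_pressure j k) hF hV hB).trans (le_of_eq ?_)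
  ring

end Bounds

end Nonlinear

/-! ### The continuity equation at the highest order -/

theorem Mu_weight {ϖ ρ H : L2} {r β K₁ K₂ : ℝ} (bϖ : Bdd ϖ K₁) (bρ : Bdd ρ K₂)
    (hH : H = -(r • ϖ + β • ρ + β • Mu ϖ ρ)) (F : L2) :
    Mu H F = -(r • Mu ϖ F + β • Mu ρ F + β • Mu ϖ (Mu ρ F)) := by
  have b1 := bϖ.smul r
  have b2 := bρ.smul β
  have b3 := (bϖ.Mu bρ).smul β
  have h1 : Mu (r • ϖ + β • ρ + β • Mu ϖ ρ) F = r • Mu ϖ F + β • Mu ρ F + β • Mu ϖ (Mu ρ F) :=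
    (Mu_add_left (b1.add b2) b3 F).trans (congrArg₂ (· + ·) ((Mu_add_left b1 b2 F).trans
      (congrArg₂ (· + ·) (Mu_smul_left bϖ r F) (Mu_smul_left bρ β F)))
      ((Mu_smul_left (bϖ.Mu bρ) β F).trans (congrArg (β • ·) (Mu_Mu bϖ bρ F))))
  rw [hH, ← neg_one_smul ℝ, Mu_smul_left ((b1.add b2).add b3), h1, neg_one_smul]

theorem inner_weight_cancel {ϖ ρ H : L2} {r β K₁ K₂ : ℝ} (bϖ : Bdd ϖ K₁) (bρ : Bdd ρ K₂)
    (hH : H = -(r • ϖ + β • ρ + β • Mu ϖ ρ)) (F d : L2) :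
    inner ℝ (F + Mu ϖ F) (-r • d - β • Mu ρ d) = -(r * inner ℝ F d - inner ℝ (Mu H F) d) := by
  rw [Mu_weight bϖ bρ hH]
  simp only [inner_add_left, inner_sub_right, inner_neg_left, real_inner_smul_left,
    real_inner_smul_right]
  have h1 : inner ℝ (Mu ϖ F) (Mu ρ d) = inner ℝ (Mu ϖ (Mu ρ F)) d := by
    rw [← inner_Mu, Mu_Mu_comm]
  rw [h1, ← inner_Mu ρ F d]
  ring

section Density

variable {K : Coef} {N : NCoef} {U : Fields} {H G A : L2} {M Z : ℝ}

/-- The part of `∂ⱼ∂ₖ ρ_t` that is not transport. -/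
def densitySource (K : Coef) (N : NCoef) (U : Fields) (j k : Fin 3) : L2 :=
  -K.r₁ • DL [j, k] (dv U.u) - N.β • Mu U.ρ (DL [j, k] (dv U.u))
    - N.β • (comm₂ j k U.ρ (dv U.u) + ∑ l, comm₂ j k (U.u l) (D l U.ρ))

theorem DL_density_rate (hρ : U.ρ ∈ Hs 3) (hu : ∀ i, U.u i ∈ Hs 3) (j k : Fin 3) :
    DL [j, k] (K.linR U.u + N.nlR U) = densitySource K N U j k
      - ∑ l, Mu (N.β • U.u l) (D l (DL [j, k] U.ρ)) := by
  have hd : dv U.u ∈ Hs 2 := OldroydB.dv_mem hu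
  have h1 : Mu U.ρ (dv U.u) ∈ Hs 2 := Mu_mem_two (Hs_mono_succ hρ) hd
  have h2 : ∀ l, Mu (U.u l) (D l U.ρ) ∈ Hs 2 := fun l =>
    Mu_mem_two (Hs_mono_succ (hu l)) (D_mem hρ l)
  have h3 : ∑ l, Mu (U.u l) (D l U.ρ) ∈ Hs 2 := (Hs 2).sum_mem fun l _ => h2 l
  have e1 : DL [j, k] (Mu U.ρ (dv U.u)) = Mu U.ρ (DL [j, k] (dv U.u)) + comm₂ j k U.ρ (dv U.u) :=
    D_D_Mu hρ hd j k
  have e2 : ∀ l, DL [j, k] (Mu (U.u l) (D l U.ρ))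
      = Mu (U.u l) (D l (DL [j, k] U.ρ)) + comm₂ j k (U.u l) (D l U.ρ) := by
    intro l
    rw [← DL_D (l := [j, k]) hρ]
    exact D_D_Mu (hu l) (D_mem hρ l) j k
  have e3 : ∀ l, Mu (N.β • U.u l) (D l (DL [j, k] U.ρ))
      = N.β • Mu (U.u l) (D l (DL [j, k] U.ρ)) := fun l =>
    Mu_smul_left (bdd_of_mem (Hs_mono_succ (hu l))) _ _
  have e4 : DL [j, k] (K.linR U.u) = -K.r₁ • DL [j, k] (dv U.u) := DL_smul (l := [j, k]) hd _
  have e5 : DL [j, k] (N.nlR U) = -N.β • (DL [j, k] (Mu U.ρ (dv U.u))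
      + ∑ l, DL [j, k] (Mu (U.u l) (D l U.ρ))) := by
    rw [NCoef.nlR, DL_smul (l := [j, k]) ((Hs 2).add_mem h1 h3), DL_add (l := [j, k]) h1 h3,
      DL_sum (l := [j, k]) _ fun l _ => h2 l]
  have h4 : N.nlR U ∈ Hs 2 := (Hs 2).smul_mem _ ((Hs 2).add_mem h1 h3)
  have h5 : K.linR U.u ∈ Hs 2 := (Hs 2).smul_mem _ hd
  rw [DL_add (l := [j, k]) h5 h4, e4, e5, e1, densitySource]
  simp only [e2, e3, Finset.sum_add_distrib, ← Finset.smul_sum]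
  module

/-- The lower order part of `∂ᵢ∂ⱼ∂ₖ ρ_t`. -/
def densityRemainder (U : Fields) (i j k : Fin 3) : L2 :=
  Mu (D i U.ρ) (DL [j, k] (dv U.u)) + (D i (comm₂ j k U.ρ (dv U.u))
    + ∑ l, D i (comm₂ j k (U.u l) (D l U.ρ)))

namespace Bounds

variable (B : Bounds U H G A M Z N.μ N.κ)
include B

theorem norm_DL_dv (j k : Fin 3) : ‖DL [j, k] (dv U.u)‖ ≤ 3 * Z := by
  rw [DL_dv (l := [j, k]) B.u_mem']
  refine (norm_sum_le _ _).trans ((Finset.sum_le_sum fun m _ =>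
    (norm_DDD_le_gm 0 (U.u m) m j k).trans (B.u_gm m)).trans ?_)
  simp

theorem nm_dv : nm 2 (dv U.u) ≤ 3 * Z := by
  refine (nm_sum_le _ fun m _ => D_mem (B.u_mem' m) m).trans ?_
  refine (Finset.sum_le_sum fun m _ => (nm_D_le_gm 2 _ m).trans (B.u_gm m)).trans ?_
  simp

theorem densitySource_mem (j k : Fin 3) : densitySource K N U j k ∈ Hs 1 := by
  have h1 : DL [j, k] (dv U.u) ∈ Hs 1 := DL_mem B.dv_mem
  refine (Hs 1).sub_mem ((Hs 1).sub_mem ((Hs 1).smul_mem _ h1) ((Hs 1).smul_mem _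
    (Mu_mem_one (Hs_mono_succ B.ρ_mem) h1))) ((Hs 1).smul_mem _ ((Hs 1).add_mem
    (comm₂_mem B.ρ_mem (Hs_mono_succ B.dv_mem) j k) ((Hs 1).sum_mem fun l _ =>
      comm₂_mem (B.u_mem' l) (D_mem B.ρ_mem l) j k)))

theorem D_densitySource (i j k : Fin 3) :
    D i (densitySource K N U j k) = -K.r₁ • D i (DL [j, k] (dv U.u))
      - N.β • Mu U.ρ (D i (DL [j, k] (dv U.u))) - N.β • densityRemainder U i j k := by
  have h1 : DL [j, k] (dv U.u) ∈ Hs 1 := DL_mem B.dv_mem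
  have h2 := Mu_mem_one (Hs_mono_succ B.ρ_mem) h1
  have h3 := comm₂_mem B.ρ_mem (Hs_mono_succ B.dv_mem) j k
  have h4 : ∀ l, comm₂ j k (U.u l) (D l U.ρ) ∈ Hs 1 := fun l =>
    comm₂_mem (B.u_mem' l) (D_mem B.ρ_mem l) j k
  have h5 : ∑ l, comm₂ j k (U.u l) (D l U.ρ) ∈ Hs 1 := (Hs 1).sum_mem fun l _ => h4 l
  have sm : ∀ (c : ℝ) {f : L2}, f ∈ Hs 1 → c • f ∈ Hs 1 := fun c _ hf => (Hs _).smul_mem c hf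
  rw [densitySource, D_sub ((Hs 1).sub_mem (sm _ h1) (sm _ h2)) (sm _ ((Hs 1).add_mem h3 h5)),
    D_sub (sm _ h1) (sm _ h2), D_smul h1, D_smul h2, D_smul ((Hs 1).add_mem h3 h5), D_add h3 h5,
    D_sum _ fun l _ => h4 l, D_Mu B.ρ_mem h1, densityRemainder]
  module

theorem norm_densityRemainder (i j k : Fin 3) :
    ‖densityRemainder U i j k‖ ≤ 81 * Csob * (M * Z) := by
  have hM := B.M_nonneg
  have hZ := B.Z_nonneg
  have hC := Csob_pos
  have h1 : ‖Mu (D i U.ρ) (DL [j, k] (dv U.u))‖ ≤ Csob * M * (3 * Z) := by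
    refine (norm_Mu_le_of_mem (D_mem B.ρ_mem i) _).trans ?_
    have := (nm_D_le 2 _ i).trans B.ρ_le
    have := B.norm_DL_dv j k
    gcongr
  have h2 : ‖D i (comm₂ j k U.ρ (dv U.u))‖ ≤ 13 * Csob * M * (3 * Z) := by
    refine (norm_D_le 0 _ i).trans ((nm_comm₂_le B.ρ_mem (Hs_mono_succ B.dv_mem) j k).trans ?_)
    have := (gm_le_nm 2 _).trans B.ρ_le
    have := B.nm_dv
    have := nm_nonneg 2 (dv U.u)
    have := gm_nonneg 2 U.ρ
    gcongr
  have h3 : ∀ l, ‖D i (comm₂ j k (U.u l) (D l U.ρ))‖ ≤ 13 * Csob * M * Z := by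
    intro l
    refine (norm_D_le 0 _ i).trans ((nm_comm₂_le (B.u_mem' l) (D_mem B.ρ_mem l) j k).trans ?_)
    have := (gm_le_nm 2 _).trans (B.u_le l)
    have := (nm_D_le_gm 2 _ l).trans B.ρ_gm
    have := nm_nonneg 2 (D l U.ρ)
    have := gm_nonneg 2 (U.u l)
    gcongr
  have h4 : ‖∑ l, D i (comm₂ j k (U.u l) (D l U.ρ))‖ ≤ 39 * Csob * M * Z := by
    refine (norm_sum_le _ _).trans ((Finset.sum_le_sum fun l _ => h3 l).trans (le_of_eq ?_))
    rw [Finset.sum_const, Finset.card_univ, Fintype.card_fin, nsmul_eq_mul]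
    push_cast; ring
  refine (norm_add_le _ _).trans ((add_le_add h1 ((norm_add_le _ _).trans
    (add_le_add h2 h4))).trans (le_of_eq ?_))
  ring

theorem norm_D_densitySource (i j k : Fin 3) :
    ‖D i (densitySource K N U j k)‖
      ≤ (|K.r₁| + |N.β| * Csob) * nm 3 (dv U.u) + |N.β| * (81 * Csob * Z) := by
  have hM := B.M_nonneg
  have hZ := B.Z_nonneg
  have hC := Csob_pos
  have h0 : ‖D i (DL [j, k] (dv U.u))‖ ≤ nm 3 (dv U.u) :=
    (norm_DDD_le_gm 0 (dv U.u) i j k).trans (gm_le_nm 2 _)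
  have h1 : ‖Mu U.ρ (D i (DL [j, k] (dv U.u)))‖ ≤ Csob * nm 3 (dv U.u) := by
    refine (norm_Mu_le_of_mem (Hs_mono_succ B.ρ_mem) _).trans ?_
    have h2 : nm 2 U.ρ ≤ 1 := ((nm_mono (by omega) _).trans B.ρ_le).trans B.M_le
    calc Csob * nm 2 U.ρ * ‖D i (DL [j, k] (dv U.u))‖ ≤ Csob * 1 * nm 3 (dv U.u) := by gcongr
      _ = _ := by ring
  have h2 : ‖densityRemainder U i j k‖ ≤ 81 * Csob * Z := by
    refine (B.norm_densityRemainder i j k).trans ?_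
    have := B.M_le
    calc 81 * Csob * (M * Z) ≤ 81 * Csob * (1 * Z) := by gcongr
      _ = _ := by ring
  rw [B.D_densitySource]
  refine (norm_sub_le _ _).trans (add_le_add ((norm_sub_le _ _).trans ?_) ?_)
  · rw [norm_smul, norm_smul, norm_neg, Real.norm_eq_abs, Real.norm_eq_abs, add_mul, mul_assoc]
    gcongr
  · rw [norm_smul, Real.norm_eq_abs]
    gcongr

/-- The weighted energy of the density at the highest order: the terms with four derivatives
of `u` are those that cancel against the velocity equation. -/
theorem top_density {ϖ ϖ' : L2} {M' : ℝ} (hϖ : ϖ ∈ Hs 3) (hϖM : nm 3 ϖ ≤ M)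
    (hϖ' : ‖Mu ϖ'‖ ≤ M') (hH : H = -(K.r₁ • ϖ + N.β • U.ρ + N.β • Mu ϖ U.ρ)) (i j k : Fin 3) :
    |inner ℝ (Mu ϖ' (D i (DL [j, k] U.ρ))) (D i (DL [j, k] U.ρ))
        + 2 * inner ℝ (D i (DL [j, k] U.ρ) + Mu ϖ (D i (DL [j, k] U.ρ)))
            (D i (densitySource K N U j k) - ∑ l, Mu (D i (N.β • U.u l)) (D l (DL [j, k] U.ρ)))
        + ∑ l, inner ℝ (Mu (D l (N.β • U.u l + Mu ϖ (N.β • U.u l))) (D i (DL [j, k] U.ρ)))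
            (D i (DL [j, k] U.ρ))
      + 2 * (K.r₁ * inner ℝ (D i (DL [j, k] U.ρ)) (D i (DL [j, k] (dv U.u)))
        - inner ℝ (Mu H (D i (DL [j, k] U.ρ))) (D i (DL [j, k] (dv U.u))))|
      ≤ M' * Z ^ 2 + |N.β| * (168 * Csob + 228 * Csob ^ 2) * (M * Z ^ 2) := by
  have hM := B.M_nonneg
  have hZ := B.Z_nonneg
  have hC := Csob_pos
  have hC1 := one_le_Csob
  set F := D i (DL [j, k] U.ρ) with hF
  set d := D i (DL [j, k] (dv U.u)) with hd
  have hFZ : ‖F‖ ≤ Z := (norm_DDD_le_gm 0 U.ρ i j k).trans B.ρ_gm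
  have bϖ := bdd_of_mem (Hs_mono_succ hϖ)
  have bρ := bdd_of_mem (Hs_mono_succ B.ρ_mem)
  have main := inner_weight_cancel bϖ bρ hH F d
  have hβ : ∀ l, N.β • U.u l ∈ Hs 3 := fun l => (Hs 3).smul_mem _ (B.u_mem' l)
  have nβ : ∀ l, nm 3 (N.β • U.u l) ≤ |N.β| * M := fun l => by
    rw [nm_smul (B.u_mem' l)]
    exact mul_le_mul_of_nonneg_left (B.u_le l) (abs_nonneg _)
  set R := N.β • densityRemainder U i j k + ∑ l, Mu (D i (N.β • U.u l)) (D l (DL [j, k] U.ρ))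
    with hR
  have e2 : D i (densitySource K N U j k) - ∑ l, Mu (D i (N.β • U.u l)) (D l (DL [j, k] U.ρ))
      = (-K.r₁ • d - N.β • Mu U.ρ d) - R := by
    rw [B.D_densitySource]
    exact sub_sub _ _ _
  have hRn : ‖R‖ ≤ |N.β| * (84 * Csob * (M * Z)) := by
    have h1 : ∀ l, ‖Mu (D i (N.β • U.u l)) (D l (DL [j, k] U.ρ))‖ ≤ Csob * (|N.β| * M) * Z := by
      intro l
      refine (norm_Mu_le_of_mem (D_mem (hβ l) i) _).trans ?_
      have h2 := (nm_D_le 2 _ i).trans (nβ l)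
      have h3 : ‖D l (DL [j, k] U.ρ)‖ ≤ Z := (norm_DDD_le_gm 0 U.ρ l j k).trans B.ρ_gm
      gcongr
    have h2 : ‖∑ l, Mu (D i (N.β • U.u l)) (D l (DL [j, k] U.ρ))‖
        ≤ 3 * (Csob * (|N.β| * M) * Z) := by
      refine (norm_sum_le _ _).trans ((Finset.sum_le_sum fun l _ => h1 l).trans (le_of_eq ?_))
      rw [Finset.sum_const, Finset.card_univ, Fintype.card_fin, nsmul_eq_mul]
      push_cast; ring
    have h3 : ‖N.β • densityRemainder U i j k‖ ≤ |N.β| * (81 * Csob * (M * Z)) := by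
      rw [norm_smul, Real.norm_eq_abs]
      exact mul_le_mul_of_nonneg_left (B.norm_densityRemainder i j k) (abs_nonneg _)
    refine (norm_add_le _ _).trans ((add_le_add h3 h2).trans (le_of_eq ?_))
    ring
  have hFϖ : ‖F + Mu ϖ F‖ ≤ (1 + Csob) * Z := by
    refine (norm_add_le _ _).trans ?_
    have h1 : ‖Mu ϖ F‖ ≤ Csob * 1 * Z := by
      refine (norm_Mu_le_of_mem (Hs_mono_succ hϖ) _).trans ?_
      have := ((nm_mono (by omega : 2 ≤ 3) _).trans hϖM).trans B.M_le
      gcongr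
    linarith
  have t1 : |inner ℝ (Mu ϖ' F) F| ≤ M' * Z ^ 2 := by
    have hM' : 0 ≤ M' := (norm_nonneg _).trans hϖ'
    refine (abs_real_inner_le_norm _ _).trans ?_
    have h1 : ‖Mu ϖ' F‖ ≤ M' * Z := ((Mu ϖ').le_opNorm F).trans (by gcongr)
    calc ‖Mu ϖ' F‖ * ‖F‖ ≤ M' * Z * Z := by gcongr
      _ = _ := by ring
  have t2 : |inner ℝ (F + Mu ϖ F) R| ≤ (1 + Csob) * Z * (|N.β| * (84 * Csob * (M * Z))) :=
    (abs_real_inner_le_norm _ _).trans (mul_le_mul hFϖ hRn (norm_nonneg _) (by positivity))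
  have t3 : |∑ l, inner ℝ (Mu (D l (N.β • U.u l + Mu ϖ (N.β • U.u l))) F) F|
      ≤ 3 * (Csob * (|N.β| * (20 * Csob * M)) * Z * Z) := by
    have h1 : ∀ l, |inner ℝ (Mu (D l (N.β • U.u l + Mu ϖ (N.β • U.u l))) F) F|
        ≤ Csob * (|N.β| * (20 * Csob * M)) * Z * Z := by
      intro l
      have hm := Mu_mem_three hϖ (hβ l)
      refine (abs_real_inner_le_norm _ _).trans (mul_le_mul ?_ hFZ (norm_nonneg _) (by positivity))
      refine (norm_Mu_le_of_mem (D_mem ((Hs 3).add_mem (hβ l) hm) l) _).trans ?_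
      have h2 : nm 2 (D l (N.β • U.u l + Mu ϖ (N.β • U.u l))) ≤ |N.β| * (20 * Csob * M) := by
        refine (nm_D_le 2 _ l).trans ((nm_add_le (hβ l) hm).trans ?_)
        have h3 : nm 3 (Mu ϖ (N.β • U.u l)) ≤ 19 * Csob * 1 * (|N.β| * M) := by
          refine (nm_Mu_three hϖ (hβ l)).trans ?_
          have := hϖM.trans B.M_le
          have := nβ l
          have := nm_nonneg 3 (N.β • U.u l)
          gcongr
        have h4 := nβ l
        have h5 : |N.β| * M ≤ Csob * (|N.β| * M) :=
          le_mul_of_one_le_left (by positivity) hC1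
        linarith
      gcongr
    refine (Finset.abs_sum_le_sum_abs _ _).trans ((Finset.sum_le_sum fun l _ => h1 l).trans ?_)
    simp
  rw [e2, inner_sub_right, main]
  rw [abs_le] at t1 t2 t3 ⊢
  constructor <;> linarith [t1.1, t1.2, t2.1, t2.2, t3.1, t3.2]

end Bounds

end Density

/-! ### Homogeneous Sobolev norms -/

/-- `‖∇ⁿf‖²`. -/
def hom : ℕ → L2 → ℝ
  | 0, f => ‖f‖ ^ 2
  | n + 1, f => ∑ i, hom n (D i f)

theorem hom_succ (n : ℕ) (f : L2) : hom (n + 1) f = ∑ i, hom n (D i f) := rfl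

theorem hom_nonneg (n : ℕ) (f : L2) : 0 ≤ hom n f := by
  induction n generalizing f with
  | zero => exact sq_nonneg _
  | succ n ih => exact Finset.sum_nonneg fun i _ => ih _

theorem hom_one (f : L2) : hom 1 f = gq f := rfl

theorem sum_norm_DL (f : L2) : ∑ j, ∑ k, ‖DL [j, k] f‖ ^ 2 = hom 2 f := by
  rw [Finset.sum_comm]; rfl

theorem sum_gq_DL (f : L2) : ∑ j, ∑ k, gq (DL [j, k] f) = hom 3 f := by
  rw [Finset.sum_comm]; rfl

theorem sum_hq_DL (f : L2) : ∑ j, ∑ k, hq (DL [j, k] f) = hom 4 f := by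
  rw [Finset.sum_comm]; rfl

theorem gq_le {f : L2} (hf : f ∈ Hs 2) : gq f ≤ (1 / 2) * (‖f‖ ^ 2 + hq f) := by
  have h1 := inner_lap_self hf
  have h2 : -inner ℝ f (lap f) ≤ ‖f‖ * ‖lap f‖ :=
    (neg_le_abs _).trans (abs_real_inner_le_norm _ _)
  rw [← norm_lap_sq hf]
  nlinarith [sq_nonneg (‖f‖ - ‖lap f‖)]

theorem hom_interp {n : ℕ} {f : L2} (hf : f ∈ Hs (n + 2)) :
    hom (n + 1) f ≤ (1 / 2) * (hom n f + hom (n + 2) f) := by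
  induction n generalizing f with
  | zero => exact gq_le hf
  | succ n ih =>
    rw [hom_succ, hom_succ n, hom_succ (n + 2), ← Finset.sum_add_distrib, Finset.mul_sum]
    exact Finset.sum_le_sum fun i _ => ih (D_mem hf i)

theorem hom_two_le {f : L2} (hf : f ∈ Hs 3) : hom 2 f ≤ hom 1 f + hom 3 f := by
  have := hom_interp (n := 1) hf
  have := hom_nonneg 1 f
  have := hom_nonneg 3 f
  linarith

theorem hom_mid_le {f : L2} (hf : f ∈ Hs 4) : hom 2 f + hom 3 f ≤ hom 1 f + hom 4 f := by
  have := hom_interp (n := 1) (f := f) (Hs_mono_succ hf)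
  have := hom_interp (n := 2) hf
  linarith

theorem hom_one_le {f : L2} (hf : f ∈ Hs 3) : hom 1 f + hom 2 f ≤ hom 0 f + hom 3 f := by
  have := hom_interp (n := 0) (f := f) (Hs_mono_succ hf)
  have := hom_interp (n := 1) hf
  linarith

theorem nsq_eq_sum (m : ℕ) (f : L2) : nsq m f = ∑ n ∈ Finset.range (m + 1), hom n f := by
  induction m generalizing f with
  | zero => simp [nsq, hom]
  | succ m ih =>
    rw [nsq_succ, Finset.sum_range_succ', add_comm]
    simp only [ih, hom_succ]
    rw [Finset.sum_comm]
    rfl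

theorem gm_sq_le (m : ℕ) (f : L2) : gm m f ^ 2 ≤ 3 * 4 ^ m * ∑ i, nsq m (D i f) := by
  have h1 : gm m f ^ 2 ≤ 3 * ∑ i, nm m (D i f) ^ 2 := by
    rw [gm]
    simpa using sq_sum_le_card_mul_sum_sq (s := Finset.univ) (f := fun i => nm m (D i f))
  have h2 := Finset.sum_le_sum fun i (_ : i ∈ Finset.univ) => nm_sq_le_nsq m (D i f)
  rw [← Finset.mul_sum] at h2
  linarith

theorem gm_two_sq_le {f : L2} (hf : f ∈ Hs 3) : gm 2 f ^ 2 ≤ 96 * (hom 1 f + hom 3 f) := by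
  have h1 := gm_sq_le 2 f
  simp only [nsq_eq_sum, Finset.sum_range_succ, Finset.sum_range_zero, Finset.sum_add_distrib,
    ← hom_succ] at h1
  have h2 := hom_two_le hf
  simp only [Finset.sum_const_zero] at h1
  linarith

theorem gm_three_sq_le {f : L2} (hf : f ∈ Hs 4) : gm 3 f ^ 2 ≤ 384 * (hom 1 f + hom 4 f) := by
  have h1 := gm_sq_le 3 f
  simp only [nsq_eq_sum, Finset.sum_range_succ, Finset.sum_range_zero, Finset.sum_add_distrib,
    ← hom_succ] at h1
  have h2 := hom_mid_le hf
  simp only [Finset.sum_const_zero] at h1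
  linarith

theorem nsq_three_le {f : L2} (hf : f ∈ Hs 3) : nsq 3 f ≤ 2 * (hom 0 f + hom 3 f) := by
  rw [nsq_eq_sum]
  simp only [Finset.sum_range_succ, Finset.sum_range_zero]
  have := hom_one_le hf
  linarith

theorem nm_three_sq_le {f : L2} (hf : f ∈ Hs 3) : nm 3 f ^ 2 ≤ 128 * (hom 0 f + hom 3 f) := by
  have h1 := nm_sq_le_nsq 3 f
  have h2 := nsq_three_le hf
  linarith

/-! ### Rates of change of the energies -/

/-- The system of equations as identities in `L²`. -/
structure Solves (K : Coef) (N : NCoef) (U V : Fields) (H G A : L2) : Prop where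
  ρ : V.ρ = K.linR U.u + N.nlR U
  u : ∀ m, V.u m = K.linU U.ρ U.u U.η U.τ m + N.nlU U H G A m
  η : V.η = K.linE U.u U.η + N.nlE U
  τ : ∀ m n, V.τ m n = K.linS U.u U.τ m n + N.nlS U m n

/-- A common constant for the nonlinear terms. -/
def NCoef.size (N : NCoef) : ℝ := |N.β| * (108 * Csob) + |N.β * N.k| * (18 * Csob) + 45 * Csob

section Rates

variable {K : Coef} {N : NCoef} {U V : Fields} {H G A ϖ ϖ' : L2} {M M' Z w w' p : ℝ}

theorem NCoef.size_nonneg (N : NCoef) : 0 ≤ N.size := by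
  have := Csob_pos
  unfold NCoef.size
  positivity

namespace Bounds

variable (B : Bounds U H G A M Z N.μ N.κ)
include B

theorem NLR : NL N.size M Z (N.nlR U) := by
  refine B.nlR.mono ?_ B.M_nonneg B.Z_nonneg
  have := Csob_pos
  have : 0 ≤ |N.β| * (54 * Csob) := by positivity
  have : 0 ≤ |N.β * N.k| * (18 * Csob) := by positivity
  unfold NCoef.size
  linarith

theorem NLE : NL N.size M Z (N.nlE U) := by
  refine B.nlE.mono ?_ B.M_nonneg B.Z_nonneg
  have := Csob_pos
  have : 0 ≤ |N.β| * (54 * Csob) := by positivity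
  have : 0 ≤ |N.β * N.k| * (18 * Csob) := by positivity
  unfold NCoef.size
  linarith

theorem NLU (m : Fin 3) : NL N.size M Z (N.nlU U H G A m) := by
  refine (B.nlU m).mono ?_ B.M_nonneg B.Z_nonneg
  have := Csob_pos
  have : 0 ≤ |N.β| * (9 * Csob) := by positivity
  have : 0 ≤ |N.β * N.k| * (18 * Csob) := by positivity
  unfold NCoef.size
  linarith

theorem NLS (m n : Fin 3) : NL N.size M Z (N.nlS U m n) := by
  refine (B.nlS m n).mono ?_ B.M_nonneg B.Z_nonneg
  have := Csob_pos
  unfold NCoef.size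
  linarith

end Bounds

theorem sum_le_three {F : Fin 3 → ℝ} {c : ℝ} (h : ∀ i, F i ≤ c) : ∑ i, F i ≤ 3 * c :=
  (Finset.sum_le_sum fun i _ => h i).trans (by simp)

/-- Rate of change of the basic energy. -/
def rateZero (U V : Fields) (w w' : ℝ) : ℝ :=
  2 * inner ℝ V.ρ U.ρ + ∑ m, 2 * inner ℝ (V.u m) (U.u m) + w * (2 * inner ℝ V.η U.η)
    + w' * ∑ m, ∑ n, 2 * inner ℝ (V.τ m n) (U.τ m n)

theorem rateZero_le (B : Bounds U H G A M Z N.μ N.κ) (S : Solves K N U V H G A)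
    (hsym : ∀ m n, U.τ m n = U.τ n m) (hw : K.r₂ = w * K.b) (hw' : K.r₃ = 2 * w' * K.c)
    (hw0 : 0 ≤ w) (hw0' : 0 ≤ w') :
    rateZero U V w w' ≤ -2 * (K.μ₁ * ∑ m, hom 1 (U.u m) + K.μ₂ * hom 0 (dv U.u)
        + w * K.ε * hom 1 U.η + w' * K.a * ∑ m, ∑ n, hom 0 (U.τ m n)
        + w' * K.ε * ∑ m, ∑ n, hom 1 (U.τ m n))
      + 2 * (4 + w + 9 * w') * N.size * (M * Z ^ 2) := by
  have h2 : ∀ {f : L2}, f ∈ Hs 3 → f ∈ Hs 2 := fun h => Hs_mono_succ h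
  have hL := linear_energy_zero (K := K) (Hs_mono (by omega) B.ρ_mem)
    (fun m => h2 (B.u_mem' m)) (h2 B.η_mem') (fun m n => h2 (B.τ_mem' m n)) hsym hw hw'
  have n1 : ∀ {f : L2}, nm 3 f ≤ M → nm 1 f ≤ M := fun h => (nm_mono (by omega) _).trans h
  have t1 := (abs_le.1 (B.NLR.pair U.ρ (h2 B.ρ_mem) (n1 B.ρ_le))).2
  have t2 := sum_le_three fun m => (abs_le.1 ((B.NLU m).pair (U.u m) (h2 (B.u_mem' m))
    (n1 (B.u_le m)))).2
  have t3 := mul_le_mul_of_nonneg_left (abs_le.1 (B.NLE.pair U.η (h2 B.η_mem') (n1 B.η_le))).2 hw0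
  have t4 := mul_le_mul_of_nonneg_left (sum_le_three fun m => sum_le_three fun n =>
    (abs_le.1 ((B.NLS m n).pair (U.τ m n) (h2 (B.τ_mem' m n)) (n1 (B.τ_le m n)))).2) hw0'
  simp only [rateZero, S.ρ, S.u, S.η, S.τ, inner_add_left, mul_add, Finset.sum_add_distrib,
    ← Finset.mul_sum, hom_one]
  change _ ≤ -2 * (K.μ₁ * ∑ m, gq (U.u m)) + -2 * (K.μ₂ * ‖dv U.u‖ ^ 2) + _
    + -2 * (w' * K.a * ∑ m, ∑ n, ‖U.τ m n‖ ^ 2) + _ + _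
  linarith

/-- Rate of change of `∑ᵢ ‖∂ᵢ D^l f‖²`. -/
def rateHigh (l : List (Fin 3)) (f f' : L2) : ℝ :=
  ∑ i, -2 * inner ℝ (DL l f') (D i (D i (DL l f)))

theorem rateHigh_eq (l : List (Fin 3)) (f f' : L2) :
    rateHigh l f f' = -2 * inner ℝ (DL l f') (lap (DL l f)) := by
  rw [rateHigh, lap, inner_sum, Finset.mul_sum]

/-- Rate of change of the weighted norm of `∂ᵢ∂ⱼ∂ₖ ρ`. -/
def rateDensity (K : Coef) (N : NCoef) (U : Fields) (ϖ ϖ' : L2) (j k i : Fin 3) : ℝ :=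
  inner ℝ (Mu ϖ' (D i (DL [j, k] U.ρ))) (D i (DL [j, k] U.ρ))
    + 2 * inner ℝ (D i (DL [j, k] U.ρ) + Mu ϖ (D i (DL [j, k] U.ρ)))
        (D i (densitySource K N U j k) - ∑ l, Mu (D i (N.β • U.u l)) (D l (DL [j, k] U.ρ)))
    + ∑ l, inner ℝ (Mu (D l (N.β • U.u l + Mu ϖ (N.β • U.u l))) (D i (DL [j, k] U.ρ)))
        (D i (DL [j, k] U.ρ))

/-- Rate of change of the energy of the derivatives of order three. -/
def rateTop (K : Coef) (N : NCoef) (U V : Fields) (ϖ ϖ' : L2) (w w' : ℝ) (j k : Fin 3) : ℝ :=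
  ∑ i, rateDensity K N U ϖ ϖ' j k i + ∑ m, rateHigh [j, k] (U.u m) (V.u m)
    + w * rateHigh [j, k] U.η V.η + w' * ∑ m, ∑ n, rateHigh [j, k] (U.τ m n) (V.τ m n)

theorem abs_inner_top_le (hM : 0 ≤ M) (hZ : 0 ≤ Z) {X f : L2} (hX : NL N.size M Z X)
    (hf : gm 3 f ≤ Z) (j k : Fin 3) :
    |inner ℝ (DL [j, k] X) (lap (DL [j, k] f))| ≤ 3 * N.size * (M * Z ^ 2) := by
  have h1 := hX.norm_DL_le (l := [j, k]) le_rfl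
  have h2 : ‖lap (DL [j, k] f)‖ ≤ 3 * Z :=
    norm_lap_le fun i => (norm_DDDD_le_gm f i i j k).trans hf
  have := N.size_nonneg
  refine (abs_real_inner_le_norm _ _).trans ((mul_le_mul h1 h2 (norm_nonneg _)
    (by positivity)).trans (le_of_eq ?_))
  ring

theorem rateTop_le (B : Bounds U H G A M Z N.μ N.κ) (S : Solves K N U V H G A)
    (hsym : ∀ m n, U.τ m n = U.τ n m) (hw : K.r₂ = w * K.b) (hw' : K.r₃ = 2 * w' * K.c)
    (hw0 : 0 ≤ w) (hw0' : 0 ≤ w') (ha : 0 ≤ K.a) (hϖ : ϖ ∈ Hs 3) (hϖM : nm 3 ϖ ≤ M)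
    (hϖ' : ‖Mu ϖ'‖ ≤ M') (hH : H = -(K.r₁ • ϖ + N.β • U.ρ + N.β • Mu ϖ U.ρ)) (j k : Fin 3) :
    rateTop K N U V ϖ ϖ' w w' j k ≤ -2 * (K.μ₁ * ∑ m, hq (DL [j, k] (U.u m))
        + K.μ₂ * gq (DL [j, k] (dv U.u)) + w * K.ε * hq (DL [j, k] U.η)
        + w' * K.ε * ∑ m, ∑ n, hq (DL [j, k] (U.τ m n)))
      + 3 * M' * Z ^ 2 + (3 * (|N.β| * (168 * Csob + 228 * Csob ^ 2))
        + 2 * (|N.β| * (948 * Csob) + 819 * Csob) + 6 * (w + 9 * w') * N.size) * (M * Z ^ 2) := by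
  have hM := B.M_nonneg
  have hZ := B.Z_nonneg
  have hd : DL [j, k] (dv U.u) = dv fun m => DL [j, k] (U.u m) := DL_dv (l := [j, k]) B.u_mem'
  have mu : ∀ m, DL [j, k] (U.u m) ∈ Hs 2 := fun m => DL_mem (B.u_mem m)
  have hL := linear_energy_top (K := K) (r := DL [j, k] U.ρ) (v := fun m => DL [j, k] (U.u m))
    (e := DL [j, k] U.η) (s := fun m n => DL [j, k] (U.τ m n)) (DL_mem B.ρ_mem) mu
    (DL_mem B.η_mem) (fun m n => DL_mem (B.τ_mem m n)) (fun m n => by rw [hsym]) hw hw'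
  have eu : ∀ m, DL [j, k] (V.u m) = K.linU (DL [j, k] U.ρ) (fun m => DL [j, k] (U.u m))
      (DL [j, k] U.η) (fun m n => DL [j, k] (U.τ m n)) m + DL [j, k] (N.nlU U H G A m) := by
    intro m
    have h0 := DL_linU (l := [j, k]) K B.ρ_mem B.u_mem B.η_mem' B.τ_mem' m
    have h1 : K.linU U.ρ U.u U.η U.τ m ∈ Hs 2 := by
      have sm : ∀ (c : ℝ) {f : L2}, f ∈ Hs 2 → c • f ∈ Hs 2 := fun c _ hf => (Hs _).smul_mem c hf
      exact (Hs 2).add_mem ((Hs 2).add_mem ((Hs 2).add_mem ((Hs 2).sub_mem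
        (sm _ (D_mem B.ρ_mem m)) (sm _ (D_mem B.η_mem' m)))
        (sm _ (OldroydB.dv_mem (B.τ_mem' m)))) (sm _ (lap_mem (B.u_mem m))))
        (sm _ (D_mem B.dv_mem m))
    rw [S.u, DL_add (l := [j, k]) h1 (B.NLU m).mem, h0]
  have ee : DL [j, k] V.η = K.linE (fun m => DL [j, k] (U.u m)) (DL [j, k] U.η)
      + DL [j, k] (N.nlE U) := by
    have h0 := DL_linE (l := [j, k]) K B.u_mem' B.η_mem
    have h1 : K.linE U.u U.η ∈ Hs 2 := (Hs 2).add_mem ((Hs 2).smul_mem _ (Hs_mono_succ B.dv_mem))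
      ((Hs 2).smul_mem _ (lap_mem B.η_mem))
    rw [S.η, DL_add (l := [j, k]) h1 B.NLE.mem, h0]
  have es : ∀ m n, DL [j, k] (V.τ m n) = K.linS (fun m => DL [j, k] (U.u m))
      (fun m n => DL [j, k] (U.τ m n)) m n + DL [j, k] (N.nlS U m n) := by
    intro m n
    have h0 := DL_linS (l := [j, k]) K B.u_mem' B.τ_mem m n
    have h1 : K.linS U.u U.τ m n ∈ Hs 2 := (Hs 2).add_mem ((Hs 2).add_mem
      ((Hs 2).smul_mem _ (Hs_mono_succ (B.τ_mem' m n))) ((Hs 2).smul_mem _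
      (lap_mem (B.τ_mem m n)))) ((Hs 2).smul_mem _ ((Hs 2).add_mem (D_mem (B.u_mem' m) n)
      (D_mem (B.u_mem' n) m)))
    rw [S.τ, DL_add (l := [j, k]) h1 (B.NLS m n).mem, h0]
  have t1 := sum_le_three fun i => (abs_le.1 (B.top_density hϖ hϖM hϖ' hH i j k)).2
  have t2 := (abs_le.1 (B.top_velocity j k)).1
  have t3 := mul_le_mul_of_nonneg_left (abs_le.1 (abs_inner_top_le hM hZ B.NLE B.η_gm j k)).1 hw0
  have t4 := mul_le_mul_of_nonneg_left (sum_le_three fun m => sum_le_three fun n =>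
    neg_le.1 (abs_le.1 (abs_inner_top_le hM hZ (B.NLS m n) (B.τ_gm m n) j k)).1) hw0'
  have t5 : 0 ≤ w' * K.a * ∑ m, ∑ n, gq (DL [j, k] (U.τ m n)) :=
    mul_nonneg (mul_nonneg hw0' ha) (Finset.sum_nonneg fun _ _ => Finset.sum_nonneg fun _ _ =>
      gq_nonneg _)
  simp only [rateTop, rateHigh_eq, eu, ee, es, inner_add_left]
  simp only [Finset.sum_add_distrib, ← Finset.mul_sum, mul_add, Finset.sum_sub_distrib, mul_sub,
    Finset.sum_neg_distrib] at t1 t4 ⊢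
  simp only [← hd] at t2 hL ⊢
  simp only [rateDensity, Finset.sum_add_distrib, ← Finset.mul_sum]
  linarith

end Rates

section CrossRates

variable {K : Coef} {N : NCoef} {U V : Fields} {H G A : L2} {M Z w w' p ζ : ℝ}

theorem norm_D_DL_le {f : L2} (hf : f ∈ Hs 3) {l : List (Fin 3)} (hl : l.length ≤ 2) (m : Fin 3) :
    ‖D m (DL l f)‖ ≤ gm 2 f := by
  rw [← DL_D (Hs_mono (by omega) hf)]
  exact (norm_DL_le l _ 0).trans ((nm_mono (by omega) _).trans (nm_D_le_gm 2 f m))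

theorem sum_norm_dv_sq_le (s : Fin 3 → Fin 3 → L2) :
    ∑ m, ‖dv (s m)‖ ^ 2 ≤ 3 * ∑ m, ∑ n, gq (s m n) := by
  rw [Finset.mul_sum]
  exact Finset.sum_le_sum fun m _ => norm_dv_sq_le (s m)

/-- Rate of change of `∑ₘ ⟨D^l uₘ, ∂ₘ D^l ρ⟩`. -/
def rateX (l : List (Fin 3)) (U V : Fields) : ℝ :=
  ∑ m, (inner ℝ (DL l (V.u m)) (D m (DL l U.ρ)) - inner ℝ (D m (DL l (U.u m))) (DL l V.ρ))

/-- Rate of change of `∑ₘₙ ⟨D^l τₘₙ, ∂ₙ D^l uₘ⟩`. -/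
def rateY (l : List (Fin 3)) (U V : Fields) : ℝ :=
  ∑ m, ∑ n, (inner ℝ (DL l (V.τ m n)) (D n (DL l (U.u m)))
    - inner ℝ (D n (DL l (U.τ m n))) (DL l (V.u m)))

namespace Bounds

variable (B : Bounds U H G A M Z N.μ N.κ) (S : Solves K N U V H G A)
include B S

theorem DL_u {l : List (Fin 3)} (hl : l.length ≤ 2) (m : Fin 3) :
    DL l (V.u m) = K.linU (DL l U.ρ) (fun m => DL l (U.u m)) (DL l U.η)
      (fun m n => DL l (U.τ m n)) m + DL l (N.nlU U H G A m) := by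
  have h0 := DL_linU (l := l) K (Hs_mono (by omega) B.ρ_mem) (fun m => Hs_mono (by omega) (B.u_mem m))
    (Hs_mono (by omega) B.η_mem') (fun m n => Hs_mono (by omega) (B.τ_mem' m n)) m
  have h1 : K.linU U.ρ U.u U.η U.τ m ∈ Hs 2 := by
    have sm : ∀ (c : ℝ) {f : L2}, f ∈ Hs 2 → c • f ∈ Hs 2 := fun c _ hf => (Hs _).smul_mem c hf
    exact (Hs 2).add_mem ((Hs 2).add_mem ((Hs 2).add_mem ((Hs 2).sub_mem
      (sm _ (D_mem B.ρ_mem m)) (sm _ (D_mem B.η_mem' m)))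
      (sm _ (OldroydB.dv_mem (B.τ_mem' m)))) (sm _ (lap_mem (B.u_mem m))))
      (sm _ (D_mem B.dv_mem m))
  rw [S.u, DL_add (Hs_mono hl h1) (Hs_mono hl (B.NLU m).mem), h0]

theorem DL_ρ {l : List (Fin 3)} (hl : l.length ≤ 2) :
    DL l V.ρ = K.linR (fun m => DL l (U.u m)) + DL l (N.nlR U) := by
  have h1 : K.linR U.u ∈ Hs 2 := (Hs 2).smul_mem _ (Hs_mono_succ B.dv_mem)
  rw [S.ρ, DL_add (Hs_mono hl h1) (Hs_mono hl B.NLR.mem),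
    DL_linR K fun m => Hs_mono (by omega) (B.u_mem m)]

theorem DL_η {l : List (Fin 3)} (hl : l.length ≤ 2) :
    DL l V.η = K.linE (fun m => DL l (U.u m)) (DL l U.η) + DL l (N.nlE U) := by
  have h1 : K.linE U.u U.η ∈ Hs 2 := (Hs 2).add_mem ((Hs 2).smul_mem _ (Hs_mono_succ B.dv_mem))
    ((Hs 2).smul_mem _ (lap_mem B.η_mem))
  rw [S.η, DL_add (Hs_mono hl h1) (Hs_mono hl B.NLE.mem),
    DL_linE K (fun m => Hs_mono (by omega) (B.u_mem m)) (Hs_mono (by omega) B.η_mem)]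

theorem DL_τ {l : List (Fin 3)} (hl : l.length ≤ 2) (m n : Fin 3) :
    DL l (V.τ m n) = K.linS (fun m => DL l (U.u m)) (fun m n => DL l (U.τ m n)) m n
      + DL l (N.nlS U m n) := by
  have h1 : K.linS U.u U.τ m n ∈ Hs 2 := (Hs 2).add_mem ((Hs 2).add_mem
    ((Hs 2).smul_mem _ (Hs_mono_succ (B.τ_mem' m n))) ((Hs 2).smul_mem _
    (lap_mem (B.τ_mem m n)))) ((Hs 2).smul_mem _ ((Hs 2).add_mem (D_mem (B.u_mem' m) n)
    (D_mem (B.u_mem' n) m)))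
  rw [S.τ, DL_add (Hs_mono hl h1) (Hs_mono hl (B.NLS m n).mem),
    DL_linS K (fun m => Hs_mono (by omega) (B.u_mem m))
      (fun m n => Hs_mono (by omega) (B.τ_mem m n))]

theorem rateX_le (hr₁ : 0 < K.r₁) {l : List (Fin 3)} (hl : l.length ≤ 2) :
    rateX l U V ≤ -(K.r₁ / 2) * gq (DL l U.ρ) + 2 * K.r₂ ^ 2 / K.r₁ * gq (DL l U.η)
      + 2 * K.r₃ ^ 2 / K.r₁ * (3 * ∑ m, ∑ n, gq (DL l (U.τ m n)))
      + 2 * K.μ₁ ^ 2 / K.r₁ * ∑ m, hq (DL l (U.u m)) + 2 * K.μ₂ ^ 2 / K.r₁ * gq (DL l (dv U.u))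
      + K.r₁ * ‖DL l (dv U.u)‖ ^ 2 + 6 * N.size * (M * Z ^ 2) := by
  have hM := B.M_nonneg
  have hZ := B.Z_nonneg
  have hN := N.size_nonneg
  have hd : DL l (dv U.u) = dv fun m => DL l (U.u m) :=
    DL_dv fun m => Hs_mono (by omega) (B.u_mem m)
  have h1 := linear_cross_density (K := K) (r := DL l U.ρ) (v := fun m => DL l (U.u m))
    (e := DL l U.η) (s := fun m n => DL l (U.τ m n)) hr₁
    (fun m => DL_mem (Hs_mono (by omega) (B.u_mem m)))
  have h2 := mul_le_mul_of_nonneg_left (sum_norm_dv_sq_le fun m n => DL l (U.τ m n))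
    (by positivity : 0 ≤ 2 * K.r₃ ^ 2 / K.r₁)
  have h3 : ∀ m, inner ℝ (DL l (N.nlU U H G A m)) (D m (DL l U.ρ)) ≤ N.size * (M * Z) * Z := fun m =>
    (real_inner_le_norm _ _).trans (mul_le_mul ((B.NLU m).norm_DL_le hl)
      ((norm_D_DL_le B.ρ_mem hl m).trans B.ρ_gm) (norm_nonneg _) (by positivity))
  have h4 : ∀ m, -inner ℝ (D m (DL l (U.u m))) (DL l (N.nlR U)) ≤ N.size * (M * Z) * Z := fun m =>
    (neg_le_abs _).trans ((abs_real_inner_le_norm _ _).trans (by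
      rw [mul_comm]
      exact mul_le_mul (B.NLR.norm_DL_le hl)
        ((norm_D_DL_le (B.u_mem' m) hl m).trans (B.u_gm m)) (norm_nonneg _) (by positivity)))
  have h5 := sum_le_three h3
  have h6 := sum_le_three h4
  have h7 : ∑ m, inner ℝ (D m (DL l (U.u m))) (K.linR fun m => DL l (U.u m))
      = inner ℝ (dv fun m => DL l (U.u m)) (K.linR fun m => DL l (U.u m)) := by
    rw [dv, sum_inner]
  simp only [rateX, B.DL_u S hl, B.DL_ρ S hl, inner_add_left, inner_add_right,
    Finset.sum_add_distrib, Finset.sum_sub_distrib, Finset.sum_neg_distrib] at h6 ⊢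
  rw [h7]
  simp only [← hd] at h1 ⊢
  linarith

theorem rateY_le (hc : 0 < K.c) (hr₃ : 0 ≤ K.r₃) (hζ : 0 < ζ) {l : List (Fin 3)}
    (hl : l.length ≤ 2) :
    -rateY l U V ≤ -(K.c / 2) * ∑ m, gq (DL l (U.u m)) + K.a ^ 2 / K.c * ∑ m, ∑ n, ‖DL l (U.τ m n)‖ ^ 2
        + K.ε ^ 2 / K.c * ∑ m, ∑ n, hq (DL l (U.τ m n)) + ζ * gq (DL l U.ρ)
        + (K.r₁ ^ 2 / (4 * ζ) + 3 + K.r₃) * (3 * ∑ m, ∑ n, gq (DL l (U.τ m n)))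
        + K.r₂ ^ 2 / 4 * gq (DL l U.η)
        + K.μ₁ ^ 2 / 4 * ∑ m, hq (DL l (U.u m)) + K.μ₂ ^ 2 / 4 * gq (DL l (dv U.u))
        + 18 * N.size * (M * Z ^ 2) := by
  have hM := B.M_nonneg
  have hZ := B.Z_nonneg
  have hN := N.size_nonneg
  have hd : DL l (dv U.u) = dv fun m => DL l (U.u m) :=
    DL_dv fun m => Hs_mono (by omega) (B.u_mem m)
  have h1 := linear_cross_stress (K := K) (r := DL l U.ρ) (v := fun m => DL l (U.u m))
    (e := DL l U.η) (s := fun m n => DL l (U.τ m n)) hc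
    (fun m => DL_mem (Hs_mono (by omega) (B.u_mem m)))
    (fun m n => DL_mem (Hs_mono (by omega) (B.τ_mem m n))) hζ
  have h2 := mul_le_mul_of_nonneg_left (sum_norm_dv_sq_le fun m n => DL l (U.τ m n))
    (by positivity : 0 ≤ K.r₁ ^ 2 / (4 * ζ) + 3 + K.r₃)
  have h3 : ∀ m n, -inner ℝ (DL l (N.nlS U m n)) (D n (DL l (U.u m))) ≤ N.size * (M * Z) * Z :=
    fun m n => (neg_le_abs _).trans ((abs_real_inner_le_norm _ _).trans
      (mul_le_mul ((B.NLS m n).norm_DL_le hl)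
        ((norm_D_DL_le (B.u_mem' m) hl n).trans (B.u_gm m)) (norm_nonneg _) (by positivity)))
  have h4 : ∀ m n, inner ℝ (D n (DL l (U.τ m n))) (DL l (N.nlU U H G A m)) ≤ N.size * (M * Z) * Z :=
    fun m n => (real_inner_le_norm _ _).trans (by
      rw [mul_comm]
      exact mul_le_mul ((B.NLU m).norm_DL_le hl)
        ((norm_D_DL_le (B.τ_mem' m n) hl n).trans (B.τ_gm' m n)) (norm_nonneg _) (by positivity))
  have h5 := sum_le_three fun m => sum_le_three fun n => h3 m n
  have h6 := sum_le_three fun m => sum_le_three fun n => h4 m n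
  have h7 : ∀ m X, inner ℝ (dv ((fun m n => DL l (U.τ m n)) m)) X
      = ∑ n, inner ℝ (D n (DL l (U.τ m n))) X := by
    intro m X
    rw [dv, sum_inner]
  simp only [h7] at h1
  simp only [rateY, B.DL_u S hl, B.DL_τ S hl, inner_add_left, inner_add_right,
    Finset.sum_add_distrib, Finset.sum_sub_distrib, Finset.sum_neg_distrib] at h5 h6 ⊢
  simp only [← hd] at h1 ⊢
  linarith

/-- Rate of change of `‖η - p ρ‖²`. -/
theorem polymer_zero_le (hε : 0 < K.ε) (hp : p * K.r₁ = K.b) :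
    2 * inner ℝ (V.η - p • V.ρ) (U.η - p • U.ρ)
      ≤ -K.ε * hom 1 U.η + K.ε * p ^ 2 * hom 1 U.ρ + 2 * (1 + |p|) ^ 2 * N.size * (M * Z ^ 2) := by
  have hρ2 : U.ρ ∈ Hs 2 := Hs_mono_succ B.ρ_mem
  have hη2 : U.η ∈ Hs 2 := Hs_mono_succ B.η_mem'
  have h1 := linear_polymer_zero (K := K) (v := U.u) hε (Hs_mono_succ hρ2) hη2 hp
  have n1 : ∀ {f : L2}, nm 3 f ≤ M → nm 1 f ≤ M := fun h => (nm_mono (by omega) _).trans h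
  have a1 := B.NLE.pair _ hη2 (n1 B.η_le)
  have a2 := B.NLE.pair _ hρ2 (n1 B.ρ_le)
  have a3 := B.NLR.pair _ hη2 (n1 B.η_le)
  have a4 := B.NLR.pair _ hρ2 (n1 B.ρ_le)
  have e : V.η - p • V.ρ = (K.linE U.u U.η - p • K.linR U.u) + (N.nlE U - p • N.nlR U) := by
    rw [S.η, S.ρ]; module
  have h2 : inner ℝ (N.nlE U - p • N.nlR U) (U.η - p • U.ρ)
      ≤ (1 + |p|) ^ 2 * (N.size * (M * Z ^ 2)) := by
    set c := N.size * (M * Z ^ 2)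
    simp only [inner_sub_left, inner_sub_right, real_inner_smul_left, real_inner_smul_right]
    have b2 : -(p * inner ℝ (N.nlE U) U.ρ) ≤ |p| * c := (neg_le_abs _).trans (by
      rw [abs_mul]; gcongr)
    have b3 : -(p * inner ℝ (N.nlR U) U.η) ≤ |p| * c := (neg_le_abs _).trans (by
      rw [abs_mul]; gcongr)
    have b4 : p * (p * inner ℝ (N.nlR U) U.ρ) ≤ |p| * (|p| * c) := (le_abs_self _).trans (by
      rw [abs_mul, abs_mul]; gcongr)
    have b1 := (abs_le.1 a1).2
    linarith
  rw [e, inner_add_left, mul_add]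
  change _ ≤ -K.ε * gq U.η + K.ε * p ^ 2 * gq U.ρ + _
  linarith

theorem polymer_top_le (hε : 0 < K.ε) (j k : Fin 3) :
    rateHigh [j, k] U.η V.η ≤ -K.ε * hq (DL [j, k] U.η) + K.b ^ 2 / K.ε * ‖DL [j, k] (dv U.u)‖ ^ 2
      + 6 * N.size * (M * Z ^ 2) := by
  have hd : DL [j, k] (dv U.u) = dv fun m => DL [j, k] (U.u m) := DL_dv (l := [j, k]) B.u_mem'
  have h1 := linear_polymer_top (K := K) (v := fun m => DL [j, k] (U.u m)) hε
    (DL_mem B.η_mem : DL [j, k] U.η ∈ Hs 2)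
  have h2 := (abs_le.1 (abs_inner_top_le B.M_nonneg B.Z_nonneg B.NLE B.η_gm j k)).1
  rw [rateHigh_eq, B.DL_η S (l := [j, k]) le_rfl, inner_add_left, hd]
  linarith

end Bounds

end CrossRates

/-! ### Summation over the derivatives -/

/-- `‖∇ρ‖² + ‖∇³ρ‖²`. -/
def Fields.dR (U : Fields) : ℝ := hom 1 U.ρ + hom 3 U.ρ

/-- `‖∇u‖² + ‖∇³u‖²`. -/
def Fields.dU (U : Fields) : ℝ := ∑ m, (hom 1 (U.u m) + hom 3 (U.u m))

/-- `‖∇η‖² + ‖∇⁴η‖²`. -/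
def Fields.dE (U : Fields) : ℝ := hom 1 U.η + hom 4 U.η

/-- `‖τ‖² + ‖∇τ‖² + ‖∇⁴τ‖²`. -/
def Fields.dS (U : Fields) : ℝ := ∑ m, ∑ n, (hom 0 (U.τ m n) + hom 1 (U.τ m n) + hom 4 (U.τ m n))

/-- `‖∇u‖² + ‖∇⁴u‖²`. -/
def Fields.dW (U : Fields) : ℝ := ∑ m, (hom 1 (U.u m) + hom 4 (U.u m))

/-- `‖div u‖² + ‖∇³ div u‖²`. -/
def Fields.dD (U : Fields) : ℝ := hom 0 (dv U.u) + hom 3 (dv U.u)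

section Sums

variable {K : Coef} {N : NCoef} {U V : Fields} {H G A ϖ ϖ' : L2} {M M' Z w w' p ζ : ℝ}

theorem Fields.dR_nonneg (U : Fields) : 0 ≤ U.dR := add_nonneg (hom_nonneg _ _) (hom_nonneg _ _)

theorem Fields.dE_nonneg (U : Fields) : 0 ≤ U.dE := add_nonneg (hom_nonneg _ _) (hom_nonneg _ _)

theorem Fields.dD_nonneg (U : Fields) : 0 ≤ U.dD := add_nonneg (hom_nonneg _ _) (hom_nonneg _ _)

theorem Fields.dU_nonneg (U : Fields) : 0 ≤ U.dU :=
  Finset.sum_nonneg fun _ _ => add_nonneg (hom_nonneg _ _) (hom_nonneg _ _)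

theorem Fields.dW_nonneg (U : Fields) : 0 ≤ U.dW :=
  Finset.sum_nonneg fun _ _ => add_nonneg (hom_nonneg _ _) (hom_nonneg _ _)

theorem Fields.dS_nonneg (U : Fields) : 0 ≤ U.dS :=
  Finset.sum_nonneg fun _ _ => Finset.sum_nonneg fun _ _ =>
    add_nonneg (add_nonneg (hom_nonneg _ _) (hom_nonneg _ _)) (hom_nonneg _ _)

theorem sum_comm_three (F : Fin 3 → Fin 3 → Fin 3 → ℝ) :
    ∑ j, ∑ k, ∑ m, F j k m = ∑ m, ∑ j, ∑ k, F j k m := by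
  simp only [Fin.sum_univ_three]
  ring

theorem sum_DL_fam {F : L2 → ℝ} {n : ℕ} (hF : ∀ f, ∑ j, ∑ k, F (DL [j, k] f) = hom n f)
    (v : Fin 3 → L2) : ∑ j, ∑ k, ∑ m, F (DL [j, k] (v m)) = ∑ m, hom n (v m) := by
  rw [sum_comm_three]
  exact Finset.sum_congr rfl fun m _ => hF _

theorem sum_DL_mat {F : L2 → ℝ} {n : ℕ} (hF : ∀ f, ∑ j, ∑ k, F (DL [j, k] f) = hom n f)
    (s : Fin 3 → Fin 3 → L2) :
    ∑ j, ∑ k, ∑ m, ∑ l, F (DL [j, k] (s m l)) = ∑ m, ∑ l, hom n (s m l) := by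
  rw [sum_comm_three]
  exact Finset.sum_congr rfl fun m _ => sum_DL_fam hF _

/-- Rate of change of the principal part of the energy. -/
def rateMain (K : Coef) (N : NCoef) (U V : Fields) (ϖ ϖ' : L2) (w w' : ℝ) : ℝ :=
  rateZero U V w w' + ∑ j, ∑ k, rateTop K N U V ϖ ϖ' w w' j k

theorem rateMain_le (B : Bounds U H G A M Z N.μ N.κ) (S : Solves K N U V H G A)
    (hsym : ∀ m n, U.τ m n = U.τ n m) (hw : K.r₂ = w * K.b) (hw' : K.r₃ = 2 * w' * K.c)
    (hw0 : 0 ≤ w) (hw0' : 0 ≤ w') {c₁ : ℝ} (ha : 0 ≤ K.a) (hca : c₁ ≤ w' * K.a)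
    (hcε : c₁ ≤ w' * K.ε) (hϖ : ϖ ∈ Hs 3) (hϖM : nm 3 ϖ ≤ M)
    (hϖ' : ‖Mu ϖ'‖ ≤ M') (hH : H = -(K.r₁ • ϖ + N.β • U.ρ + N.β • Mu ϖ U.ρ)) :
    rateMain K N U V ϖ ϖ' w w' ≤ -2 * (K.μ₁ * U.dW + K.μ₂ * U.dD + w * K.ε * U.dE + c₁ * U.dS)
      + 27 * M' * Z ^ 2 + (2 * (4 + w + 9 * w') * N.size
        + 9 * (3 * (|N.β| * (168 * Csob + 228 * Csob ^ 2))
        + 2 * (|N.β| * (948 * Csob) + 819 * Csob) + 6 * (w + 9 * w') * N.size)) * (M * Z ^ 2) := by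
  have h0 := rateZero_le B S hsym hw hw' hw0 hw0'
  have h1 : ∀ j, ∑ k, _ ≤ _ := fun j => Finset.sum_le_sum fun k (_ : k ∈ Finset.univ) =>
    rateTop_le B S hsym hw hw' hw0 hw0' ha hϖ hϖM hϖ' hH j k
  have h2 := Finset.sum_le_sum fun j (_ : j ∈ Finset.univ) => h1 j
  simp only [Finset.sum_add_distrib, ← Finset.mul_sum, sum_DL_fam sum_hq_DL, sum_DL_mat sum_hq_DL,
    sum_hq_DL, sum_gq_DL, Finset.sum_const, Finset.card_univ, Fintype.card_fin, nsmul_eq_mul] at h2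
  have p0 : 0 ≤ ∑ m, ∑ n, hom 0 (U.τ m n) := Finset.sum_nonneg fun _ _ =>
    Finset.sum_nonneg fun _ _ => hom_nonneg _ _
  have p1 : 0 ≤ ∑ m, ∑ n, hom 1 (U.τ m n) := Finset.sum_nonneg fun _ _ =>
    Finset.sum_nonneg fun _ _ => hom_nonneg _ _
  have p4 : 0 ≤ ∑ m, ∑ n, hom 4 (U.τ m n) := Finset.sum_nonneg fun _ _ =>
    Finset.sum_nonneg fun _ _ => hom_nonneg _ _
  have q0 := mul_le_mul_of_nonneg_right hca p0
  have q1 := mul_le_mul_of_nonneg_right hcε p1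
  have q4 := mul_le_mul_of_nonneg_right hcε p4
  simp only [rateMain, Fields.dW, Fields.dS, Fields.dD, Fields.dE, Finset.sum_add_distrib]
  push_cast at h2
  linarith

/-- Rate of change of the density cross term. -/
def rateCrossX (U V : Fields) : ℝ := rateX [] U V + ∑ j, ∑ k, rateX [j, k] U V

/-- Rate of change of the stress cross term. -/
def rateCrossY (U V : Fields) : ℝ := rateY [] U V + ∑ j, ∑ k, rateY [j, k] U V

/-- Rate of change of the polymer term. -/
def ratePolymer (p : ℝ) (U V : Fields) : ℝ :=
  2 * inner ℝ (V.η - p • V.ρ) (U.η - p • U.ρ) + ∑ j, ∑ k, rateHigh [j, k] U.η V.η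

section Comparison

variable (B : Bounds U H G A M Z N.μ N.κ)
include B

theorem Bounds.hom_two_u : ∑ m, hom 2 (U.u m) ≤ U.dW := Finset.sum_le_sum fun m _ => by
  have := hom_mid_le (B.u_mem m)
  have := hom_nonneg 3 (U.u m)
  linarith

theorem Bounds.hom_three_η : hom 3 U.η ≤ U.dE := by
  have := hom_mid_le B.η_mem
  have := hom_nonneg 2 U.η
  unfold Fields.dE
  linarith

theorem Bounds.hom_τ (n : ℕ) (hn : n ≤ 4) : ∑ i, ∑ j, hom n (U.τ i j) ≤ U.dS :=
  Finset.sum_le_sum fun i _ => Finset.sum_le_sum fun j _ => by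
    have := hom_mid_le (B.τ_mem i j)
    have := hom_nonneg 0 (U.τ i j)
    have := hom_nonneg 1 (U.τ i j)
    have := hom_nonneg 2 (U.τ i j)
    have := hom_nonneg 3 (U.τ i j)
    have := hom_nonneg 4 (U.τ i j)
    interval_cases n <;> linarith

theorem Bounds.hom_dv_one : hom 1 (dv U.u) ≤ U.dD := by
  have := hom_one_le B.dv_mem
  have := hom_nonneg 2 (dv U.u)
  unfold Fields.dD
  linarith

theorem Bounds.hom_dv_u : hom 0 (dv U.u) + hom 2 (dv U.u) ≤ 3 * U.dU := by
  have h0 : hom 0 (dv U.u) ≤ 3 * ∑ m, hom 1 (U.u m) := norm_dv_sq_le U.u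
  have h2 := Finset.sum_le_sum fun j (_ : j ∈ Finset.univ) => Finset.sum_le_sum
    fun k (_ : k ∈ Finset.univ) => norm_dv_sq_le fun m => DL [j, k] (U.u m)
  have hd : ∀ j k, DL [j, k] (dv U.u) = dv fun m => DL [j, k] (U.u m) :=
    fun j k => DL_dv (l := [j, k]) B.u_mem'
  simp only [← hd, ← Finset.mul_sum, sum_norm_DL, sum_DL_fam sum_gq_DL] at h2
  simp only [Fields.dU, Finset.sum_add_distrib]
  linarith

theorem Bounds.rateCrossX_le (S : Solves K N U V H G A) (hr₁ : 0 < K.r₁) :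
    rateCrossX U V ≤ -(K.r₁ / 2) * U.dR + 4 * K.r₂ ^ 2 / K.r₁ * U.dE
      + 12 * K.r₃ ^ 2 / K.r₁ * U.dS + 4 * K.μ₁ ^ 2 / K.r₁ * U.dW + 4 * K.μ₂ ^ 2 / K.r₁ * U.dD
      + 3 * K.r₁ * U.dU + 60 * N.size * (M * Z ^ 2) := by
  have h0 := B.rateX_le S hr₁ (l := []) (by simp)
  have h1 : ∀ j, ∑ k, _ ≤ _ := fun j => Finset.sum_le_sum fun k (_ : k ∈ Finset.univ) =>
    B.rateX_le S hr₁ (l := [j, k]) le_rfl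
  have h2 := Finset.sum_le_sum fun j (_ : j ∈ Finset.univ) => h1 j
  simp only [Finset.sum_add_distrib, ← Finset.mul_sum, sum_DL_fam sum_hq_DL, sum_DL_mat sum_gq_DL,
    sum_gq_DL, sum_norm_DL, Finset.sum_const, Finset.card_univ, Fintype.card_fin, nsmul_eq_mul] at h2
  change _ ≤ -(K.r₁ / 2) * hom 1 U.ρ + 2 * K.r₂ ^ 2 / K.r₁ * hom 1 U.η
    + 2 * K.r₃ ^ 2 / K.r₁ * (3 * ∑ m, ∑ n, hom 1 (U.τ m n))
    + 2 * K.μ₁ ^ 2 / K.r₁ * ∑ m, hom 2 (U.u m) + 2 * K.μ₂ ^ 2 / K.r₁ * hom 1 (dv U.u)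
    + K.r₁ * hom 0 (dv U.u) + _ at h0
  have a1 : hom 1 U.η + hom 3 U.η ≤ 2 * U.dE := by
    have := B.hom_three_η
    have := hom_nonneg 4 U.η
    have : U.dE = hom 1 U.η + hom 4 U.η := rfl
    linarith
  have a2 : ∑ m, ∑ n, hom 1 (U.τ m n) + ∑ m, ∑ n, hom 3 (U.τ m n) ≤ 2 * U.dS := by
    have := B.hom_τ 1 (by omega)
    have := B.hom_τ 3 (by omega)
    linarith
  have a3 : ∑ m, hom 2 (U.u m) + ∑ m, hom 4 (U.u m) ≤ 2 * U.dW := by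
    have := B.hom_two_u
    have : ∑ m, hom 4 (U.u m) ≤ U.dW := Finset.sum_le_sum fun m _ =>
      le_add_of_nonneg_left (hom_nonneg 1 _)
    linarith
  have a4 : hom 1 (dv U.u) + hom 3 (dv U.u) ≤ 2 * U.dD := by
    have := B.hom_dv_one
    have := hom_nonneg 0 (dv U.u)
    have : U.dD = hom 0 (dv U.u) + hom 3 (dv U.u) := rfl
    linarith
  have a5 := B.hom_dv_u
  have b1 := mul_le_mul_of_nonneg_left a1 (by positivity : 0 ≤ 2 * K.r₂ ^ 2 / K.r₁)
  have b2 := mul_le_mul_of_nonneg_left a2 (by positivity : 0 ≤ 2 * K.r₃ ^ 2 / K.r₁)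
  have b3 := mul_le_mul_of_nonneg_left a3 (by positivity : 0 ≤ 2 * K.μ₁ ^ 2 / K.r₁)
  have b4 := mul_le_mul_of_nonneg_left a4 (by positivity : 0 ≤ 2 * K.μ₂ ^ 2 / K.r₁)
  have b5 := mul_le_mul_of_nonneg_left a5 hr₁.le
  have e : ∀ x y : ℝ, 4 * x / y = 2 * (2 * x / y) := fun x y => by ring
  have e' : ∀ x y : ℝ, 12 * x / y = 6 * (2 * x / y) := fun x y => by ring
  rw [rateCrossX, e, e, e, e', Fields.dR]
  push_cast at h2
  linarith

theorem Bounds.rateCrossY_le (S : Solves K N U V H G A) (hc : 0 < K.c) (hr₃ : 0 ≤ K.r₃)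
    (hζ : 0 < ζ) :
    -rateCrossY U V ≤ -(K.c / 2) * U.dU + ζ * U.dR
      + (2 * K.a ^ 2 / K.c + 2 * K.ε ^ 2 / K.c + 6 * (K.r₁ ^ 2 / (4 * ζ) + 3 + K.r₃)) * U.dS
      + K.r₂ ^ 2 / 2 * U.dE + K.μ₁ ^ 2 / 2 * U.dW + K.μ₂ ^ 2 / 2 * U.dD
      + 180 * N.size * (M * Z ^ 2) := by
  have h0 := B.rateY_le S hc hr₃ hζ (l := []) (by simp)
  have h1 : ∀ j, ∑ k, _ ≤ _ := fun j => Finset.sum_le_sum fun k (_ : k ∈ Finset.univ) =>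
    B.rateY_le S hc hr₃ hζ (l := [j, k]) le_rfl
  have hτ := sum_DL_mat (F := fun f => ‖f‖ ^ 2) sum_norm_DL U.τ
  have h2 := Finset.sum_le_sum fun j (_ : j ∈ Finset.univ) => h1 j
  simp only [Finset.sum_add_distrib, ← Finset.mul_sum, sum_DL_fam sum_hq_DL, sum_DL_mat sum_gq_DL,
    hτ, sum_DL_mat sum_hq_DL, sum_DL_fam sum_gq_DL, Finset.sum_neg_distrib,
    sum_gq_DL, Finset.sum_const, Finset.card_univ, Fintype.card_fin, nsmul_eq_mul] at h2
  change _ ≤ -(K.c / 2) * ∑ m, hom 1 (U.u m) + K.a ^ 2 / K.c * ∑ m, ∑ n, hom 0 (U.τ m n)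
        + K.ε ^ 2 / K.c * ∑ m, ∑ n, hom 2 (U.τ m n) + ζ * hom 1 U.ρ
        + (K.r₁ ^ 2 / (4 * ζ) + 3 + K.r₃) * (3 * ∑ m, ∑ n, hom 1 (U.τ m n))
        + K.r₂ ^ 2 / 4 * hom 1 U.η
        + K.μ₁ ^ 2 / 4 * ∑ m, hom 2 (U.u m) + K.μ₂ ^ 2 / 4 * hom 1 (dv U.u) + _ at h0
  have a1 : hom 1 U.η + hom 3 U.η ≤ 2 * U.dE := by
    have := B.hom_three_η
    have := hom_nonneg 4 U.η
    have : U.dE = hom 1 U.η + hom 4 U.η := rfl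
    linarith
  have a2 : ∑ m, ∑ n, hom 1 (U.τ m n) + ∑ m, ∑ n, hom 3 (U.τ m n) ≤ 2 * U.dS := by
    have := B.hom_τ 1 (by omega)
    have := B.hom_τ 3 (by omega)
    linarith
  have a6 : ∑ m, ∑ n, hom 0 (U.τ m n) + ∑ m, ∑ n, hom 2 (U.τ m n) ≤ 2 * U.dS := by
    have := B.hom_τ 0 (by omega)
    have := B.hom_τ 2 (by omega)
    linarith
  have a7 : ∑ m, ∑ n, hom 2 (U.τ m n) + ∑ m, ∑ n, hom 4 (U.τ m n) ≤ 2 * U.dS := by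
    have := B.hom_τ 4 (by omega)
    have := B.hom_τ 2 (by omega)
    linarith
  have a3 : ∑ m, hom 2 (U.u m) + ∑ m, hom 4 (U.u m) ≤ 2 * U.dW := by
    have := B.hom_two_u
    have : ∑ m, hom 4 (U.u m) ≤ U.dW := Finset.sum_le_sum fun m _ =>
      le_add_of_nonneg_left (hom_nonneg 1 _)
    linarith
  have a4 : hom 1 (dv U.u) + hom 3 (dv U.u) ≤ 2 * U.dD := by
    have := B.hom_dv_one
    have := hom_nonneg 0 (dv U.u)
    have : U.dD = hom 0 (dv U.u) + hom 3 (dv U.u) := rfl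
    linarith
  have b1 := mul_le_mul_of_nonneg_left a1 (by positivity : 0 ≤ K.r₂ ^ 2 / 4)
  have b2 := mul_le_mul_of_nonneg_left a2 (by positivity : 0 ≤ K.r₁ ^ 2 / (4 * ζ) + 3 + K.r₃)
  have b3 := mul_le_mul_of_nonneg_left a3 (by positivity : 0 ≤ K.μ₁ ^ 2 / 4)
  have b4 := mul_le_mul_of_nonneg_left a4 (by positivity : 0 ≤ K.μ₂ ^ 2 / 4)
  have b6 := mul_le_mul_of_nonneg_left a6 (by positivity : 0 ≤ K.a ^ 2 / K.c)
  have b7 := mul_le_mul_of_nonneg_left a7 (by positivity : 0 ≤ K.ε ^ 2 / K.c)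
  have e : ∀ x y : ℝ, 2 * x / y = 2 * (x / y) := fun x y => by ring
  rw [rateCrossY, Fields.dR, Fields.dU, Finset.sum_add_distrib, e, e]
  push_cast at h2
  linarith

theorem Bounds.ratePolymer_le (S : Solves K N U V H G A) (hε : 0 < K.ε) (hp : p * K.r₁ = K.b) :
    ratePolymer p U V ≤ -K.ε * U.dE + K.ε * p ^ 2 * U.dR + 3 * (K.b ^ 2 / K.ε) * U.dU
      + (2 * (1 + |p|) ^ 2 + 54) * N.size * (M * Z ^ 2) := by
  have h0 := B.polymer_zero_le S hε hp
  have h1 : ∀ j, ∑ k, _ ≤ _ := fun j => Finset.sum_le_sum fun k (_ : k ∈ Finset.univ) =>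
    B.polymer_top_le S hε j k
  have h2 := Finset.sum_le_sum fun j (_ : j ∈ Finset.univ) => h1 j
  simp only [Finset.sum_add_distrib, ← Finset.mul_sum, sum_hq_DL,
    sum_norm_DL, Finset.sum_const, Finset.card_univ, Fintype.card_fin, nsmul_eq_mul] at h2
  have a5 := B.hom_dv_u
  have a0 := hom_nonneg 0 (dv U.u)
  have b5 := mul_le_mul_of_nonneg_left (by linarith : hom 2 (dv U.u) ≤ 3 * U.dU)
    (by positivity : 0 ≤ K.b ^ 2 / K.ε)
  have b6 := mul_nonneg (by positivity : 0 ≤ K.ε * p ^ 2) (hom_nonneg 3 U.ρ)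
  rw [ratePolymer, Fields.dR, Fields.dE]
  push_cast at h2
  linarith

end Comparison

end Sums

/-! ### The combined energy -/

theorem exists_pos_mul_le (K : ℝ) {d : ℝ} (hd : 0 < d) :
    ∃ σ₀ > 0, ∀ σ, 0 ≤ σ → σ ≤ σ₀ → σ * K ≤ d := by
  refine ⟨d / (|K| + 1), by positivity, fun σ h0 h => ?_⟩
  have h1 : σ * K ≤ σ * (|K| + 1) := mul_le_mul_of_nonneg_left (by linarith [le_abs_self K]) h0
  exact h1.trans ((le_div_iff₀ (by positivity)).1 h)

/-- The weights of the terms of the energy. -/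
structure Weights where
  w : ℝ
  w' : ℝ
  p : ℝ
  s : ℝ
  t : ℝ
  σ : ℝ
  w_nonneg : 0 ≤ w
  w'_pos : 0 < w'
  s_pos : 0 < s
  t_pos : 0 < t
  σ_pos : 0 < σ
  σ_le : σ ≤ 1 / 8
  σ_le_w' : σ ≤ w' / 2
  σs_le : σ * s ≤ 1 / 8
  σp_le : σ * (t * p ^ 2) ≤ 1 / 8

theorem exists_weights {r₁ r₂ r₃ b ε a c w w' c₁ m₀ p : ℝ} (hr₁ : 0 < r₁)
    (hε : 0 < ε) (hc : 0 < c) (hw : 0 ≤ w) (hw' : 0 < w')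
    (hc₁ : 0 < c₁) (hm₀ : 0 < m₀) (hrw : r₂ = w * b) :
    ∃ Λ : Weights, Λ.w = w ∧ Λ.w' = w' ∧ Λ.p = p ∧ ∃ ζ > 0, ∃ c₀ > 0,
      ∀ μ₁ μ₂ R U E S W D X₀ X Y X' e₀ e₁ e₂ e₃ : ℝ, 0 ≤ μ₁ → 0 ≤ μ₂ → μ₁ ≤ m₀ → μ₂ ≤ 2 * m₀ →
      0 ≤ R → 0 ≤ U → 0 ≤ E → 0 ≤ S → 0 ≤ W → 0 ≤ D →
      X₀ ≤ -2 * (μ₁ * W + μ₂ * D + w * ε * E + c₁ * S) + e₀ →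
      X ≤ -(r₁ / 2) * R + 4 * r₂ ^ 2 / r₁ * E + 12 * r₃ ^ 2 / r₁ * S + 4 * μ₁ ^ 2 / r₁ * W
        + 4 * μ₂ ^ 2 / r₁ * D + 3 * r₁ * U + e₁ →
      -Y ≤ -(c / 2) * U + ζ * R + (2 * a ^ 2 / c + 2 * ε ^ 2 / c
        + 6 * (r₁ ^ 2 / (4 * ζ) + 3 + r₃)) * S + r₂ ^ 2 / 2 * E + μ₁ ^ 2 / 2 * W
        + μ₂ ^ 2 / 2 * D + e₂ →
      X' ≤ -ε * E + ε * p ^ 2 * R + 3 * (b ^ 2 / ε) * U + e₃ →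
      X₀ + Λ.σ * (Λ.s * X - Y + Λ.t * X') ≤ -c₀ * (R + U + E + S + μ₁ * W + μ₂ * D)
        + (e₀ + Λ.σ * (Λ.s * e₁ + e₂ + Λ.t * e₃)) := by
  set s := c / (24 * r₁) with hs
  have hs0 : 0 < s := by positivity
  have hsr : s * r₁ = c / 24 := by rw [hs]; field_simp
  obtain ⟨t₁, ht₁, H₁⟩ := exists_pos_mul_le (ε * p ^ 2) (by positivity : 0 < s * r₁ / 8)
  obtain ⟨t₂, ht₂, H₂⟩ := exists_pos_mul_le (3 * (b ^ 2 / ε)) (by positivity : 0 < c / 8)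
  obtain ⟨t, ht, htt₁, htt₂⟩ : ∃ t > 0, t ≤ t₁ ∧ t ≤ t₂ :=
    ⟨min t₁ t₂, lt_min ht₁ ht₂, min_le_left _ _, min_le_right _ _⟩
  replace H₁ := H₁ t ht.le htt₁
  replace H₂ := H₂ t ht.le htt₂
  set ζ := s * r₁ / 8 with hζ
  have hζ0 : 0 < ζ := by positivity
  set KW := 4 * s / r₁ + 1 / 2 with hKW
  set KS := s * (12 * r₃ ^ 2 / r₁) + (2 * a ^ 2 / c + 2 * ε ^ 2 / c
    + 6 * (r₁ ^ 2 / (4 * ζ) + 3 + r₃)) with hKS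
  obtain ⟨σ₁, hσ₁, G₁⟩ := exists_pos_mul_le (KW * (r₂ * b)) hε
  obtain ⟨σ₂, hσ₂, G₂⟩ := exists_pos_mul_le KS hc₁
  obtain ⟨σ₃, hσ₃, G₃⟩ := exists_pos_mul_le (2 * m₀ * KW) one_pos
  obtain ⟨σ₄, hσ₄, G₄⟩ := exists_pos_mul_le s (by norm_num : (0 : ℝ) < 1 / 8)
  obtain ⟨σ₅, hσ₅, G₅⟩ := exists_pos_mul_le (t * p ^ 2) (by norm_num : (0 : ℝ) < 1 / 8)
  obtain ⟨σ, hσ, h1, h2, h3, h4, h5, h6, h7⟩ : ∃ σ > 0, σ ≤ σ₁ ∧ σ ≤ σ₂ ∧ σ ≤ σ₃ ∧ σ ≤ σ₄ ∧ σ ≤ σ₅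
      ∧ σ ≤ 1 / 8 ∧ σ ≤ w' / 2 := by
    refine ⟨min σ₁ (min σ₂ (min σ₃ (min σ₄ (min σ₅ (min (1 / 8) (w' / 2)))))), ?_, ?_⟩
    · simp only [gt_iff_lt, lt_min_iff]
      exact ⟨hσ₁, hσ₂, hσ₃, hσ₄, hσ₅, by norm_num, by positivity⟩
    · simp
  replace G₁ := G₁ σ hσ.le h1
  replace G₂ := G₂ σ hσ.le h2
  replace G₃ := G₃ σ hσ.le h3
  set c₀ := min 1 (min c₁ (min (σ * (s * r₁ / 4)) (min (σ * (c / 4)) (σ * (t * ε))))) with hc₀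
  have hc₀0 : 0 < c₀ := by
    simp only [hc₀, lt_min_iff]
    refine ⟨one_pos, hc₁, ?_, ?_, ?_⟩ <;> positivity
  have k1 : c₀ ≤ 1 := by simp [hc₀]
  have k2 : c₀ ≤ c₁ := by simp [hc₀]
  have k3 : c₀ ≤ σ * (s * r₁ / 4) := by simp [hc₀]
  have k4 : c₀ ≤ σ * (c / 4) := by simp [hc₀]
  have k5 : c₀ ≤ σ * (t * ε) := by simp [hc₀]
  have hKW0 : 0 ≤ KW := by positivity
  refine ⟨⟨w, w', p, s, t, σ, hw, hw', hs0, ht, hσ, h6, h7, G₄ σ hσ.le h4, G₅ σ hσ.le h5⟩,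
    rfl, rfl, rfl, ζ, hζ0, c₀, hc₀0, ?_⟩
  intro μ₁ μ₂ R U E S W D X₀ X Y X' e₀ e₁ e₂ e₃ hμ₁ hμ₂ hm₁ hm₂ hR hU hE hS hW hD I₀ I₁ I₂ I₃
  have J₁ := mul_le_mul_of_nonneg_left I₁ hs0.le
  have J₃ := mul_le_mul_of_nonneg_left I₃ ht.le
  have HR := mul_le_mul_of_nonneg_right H₁ hR
  have HU := mul_le_mul_of_nonneg_right H₂ hU
  have J : s * X - Y + t * X' ≤ -(s * r₁ / 4) * R - c / 4 * U - t * ε * E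
      + w * (KW * (r₂ * b)) * E + KS * S + KW * μ₁ ^ 2 * W + KW * μ₂ ^ 2 * D
      + (s * e₁ + e₂ + t * e₃) := by
    have e : w * (KW * (r₂ * b)) = KW * r₂ ^ 2 := by rw [sq]; nth_rw 3 [hrw]; ring
    rw [e]
    have e2 : 3 * (s * r₁) * U = c / 8 * U := by rw [hsr]; ring
    simp only [hKW, hKS]
    have e3 : ζ * R = s * r₁ / 8 * R := by rw [hζ]
    have e4 : ∀ x y : ℝ, 4 * s / r₁ * x * y = s * (4 * x / r₁) * y := fun x y => by ring
    linarith [e4 (r₂ ^ 2) E, e4 (μ₁ ^ 2) W, e4 (μ₂ ^ 2) D]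
  have JJ := mul_le_mul_of_nonneg_left J hσ.le
  have q1 := mul_le_mul_of_nonneg_right G₁ (mul_nonneg hw hE)
  have q2 := mul_le_mul_of_nonneg_right G₂ hS
  have q3 : σ * (KW * μ₁ ^ 2 * W) ≤ μ₁ * W := by
    have : σ * KW * μ₁ ≤ 1 := by
      have := mul_le_mul_of_nonneg_left (by linarith : μ₁ ≤ 2 * m₀) (mul_nonneg hσ.le hKW0)
      linarith
    have := mul_le_mul_of_nonneg_right this (mul_nonneg hμ₁ hW)
    linarith
  have q4 : σ * (KW * μ₂ ^ 2 * D) ≤ μ₂ * D := by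
    have : σ * KW * μ₂ ≤ 1 := by
      have := mul_le_mul_of_nonneg_left hm₂ (mul_nonneg hσ.le hKW0)
      linarith
    have := mul_le_mul_of_nonneg_right this (mul_nonneg hμ₂ hD)
    linarith
  have z1 := mul_le_mul_of_nonneg_right k1 (mul_nonneg hμ₁ hW)
  have z2 := mul_le_mul_of_nonneg_right k1 (mul_nonneg hμ₂ hD)
  have z3 := mul_le_mul_of_nonneg_right k2 hS
  have z4 := mul_le_mul_of_nonneg_right k3 hR
  have z5 := mul_le_mul_of_nonneg_right k4 hU
  have z6 := mul_le_mul_of_nonneg_right k5 hE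
  have z7 := mul_nonneg (mul_nonneg hw hε.le) hE
  show X₀ + σ * (s * X - Y + t * X') ≤ _ + (e₀ + σ * (s * e₁ + e₂ + t * e₃))
  linarith

/-- `∑ₘ ⟨D^l uₘ, ∂ₘ D^l ρ⟩`. -/
def energyX (l : List (Fin 3)) (U : Fields) : ℝ :=
  ∑ m, inner ℝ (DL l (U.u m)) (D m (DL l U.ρ))

/-- `∑ₘₙ ⟨D^l τₘₙ, ∂ₙ D^l uₘ⟩`. -/
def energyY (l : List (Fin 3)) (U : Fields) : ℝ :=
  ∑ m, ∑ n, inner ℝ (DL l (U.τ m n)) (D n (DL l (U.u m)))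

/-- The basic energy. -/
def energyZero (U : Fields) (w w' : ℝ) : ℝ :=
  ‖U.ρ‖ ^ 2 + ∑ m, ‖U.u m‖ ^ 2 + w * ‖U.η‖ ^ 2 + w' * ∑ m, ∑ n, ‖U.τ m n‖ ^ 2

/-- The energy of the derivatives of order three. -/
def energyTop (U : Fields) (ϖ : L2) (w w' : ℝ) (j k : Fin 3) : ℝ :=
  ∑ i, inner ℝ (D i (DL [j, k] U.ρ) + Mu ϖ (D i (DL [j, k] U.ρ))) (D i (DL [j, k] U.ρ))
    + ∑ m, gq (DL [j, k] (U.u m)) + w * gq (DL [j, k] U.η)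
    + w' * ∑ m, ∑ n, gq (DL [j, k] (U.τ m n))

/-- The energy of the polymer density. -/
def energyPolymer (p : ℝ) (U : Fields) : ℝ :=
  ‖U.η - p • U.ρ‖ ^ 2 + ∑ j, ∑ k, gq (DL [j, k] U.η)

/-- The combined energy. -/
def energy (Λ : Weights) (U : Fields) (ϖ : L2) : ℝ :=
  energyZero U Λ.w Λ.w' + ∑ j, ∑ k, energyTop U ϖ Λ.w Λ.w' j k
    + Λ.σ * (Λ.s * (energyX [] U + ∑ j, ∑ k, energyX [j, k] U)
      - (energyY [] U + ∑ j, ∑ k, energyY [j, k] U) + Λ.t * energyPolymer Λ.p U)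

/-- The rate of change of the combined energy. -/
def rate (K : Coef) (N : NCoef) (Λ : Weights) (U V : Fields) (ϖ ϖ' : L2) : ℝ :=
  rateMain K N U V ϖ ϖ' Λ.w Λ.w'
    + Λ.σ * (Λ.s * rateCrossX U V - rateCrossY U V + Λ.t * ratePolymer Λ.p U V)

/-- `‖f‖² + ‖∇³f‖²`. -/
def topq (f : L2) : ℝ := hom 0 f + hom 3 f

theorem topq_nonneg (f : L2) : 0 ≤ topq f := add_nonneg (hom_nonneg _ _) (hom_nonneg _ _)

/-- The sum of the squared norms of all unknowns. -/
def Fields.total (U : Fields) : ℝ :=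
  topq U.ρ + ∑ m, topq (U.u m) + topq U.η + ∑ m, ∑ n, topq (U.τ m n)

theorem abs_inner_le_half {E : Type*} [NormedAddCommGroup E] [InnerProductSpace ℝ E] (x y : E) :
    |inner ℝ x y| ≤ (1 / 2) * ‖x‖ ^ 2 + (1 / 2) * ‖y‖ ^ 2 := by
  have := abs_real_inner_le_norm x y
  nlinarith [sq_nonneg (‖x‖ - ‖y‖)]

section Coercive

variable {U : Fields} {ϖ : L2}

theorem abs_energyX_le (l : List (Fin 3)) :
    |energyX l U| ≤ (1 / 2) * ∑ m, ‖DL l (U.u m)‖ ^ 2 + (1 / 2) * gq (DL l U.ρ) := by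
  refine (Finset.abs_sum_le_sum_abs _ _).trans ((Finset.sum_le_sum fun m _ =>
    abs_inner_le_half _ _).trans (le_of_eq ?_))
  rw [Finset.sum_add_distrib, ← Finset.mul_sum, ← Finset.mul_sum, gq]

theorem abs_energyY_le (l : List (Fin 3)) :
    |energyY l U| ≤ (1 / 2) * ∑ m, ∑ n, ‖DL l (U.τ m n)‖ ^ 2
      + (1 / 2) * ∑ m, gq (DL l (U.u m)) := by
  refine (Finset.abs_sum_le_sum_abs _ _).trans ((Finset.sum_le_sum fun m _ =>
    (Finset.abs_sum_le_sum_abs _ _).trans (Finset.sum_le_sum fun n _ =>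
    abs_inner_le_half _ _)).trans (le_of_eq ?_))
  simp only [Finset.sum_add_distrib, ← Finset.mul_sum, gq]

theorem abs_crossX_le (hρ : U.ρ ∈ Hs 3) (hu : ∀ m, U.u m ∈ Hs 3) :
    |energyX [] U + ∑ j, ∑ k, energyX [j, k] U| ≤ ∑ m, topq (U.u m) + topq U.ρ := by
  have h0 := abs_energyX_le (U := U) []
  have h1 : ∀ j, ∑ k, _ ≤ _ := fun j => Finset.sum_le_sum fun k (_ : k ∈ Finset.univ) =>
    abs_energyX_le (U := U) [j, k]
  have h2 := Finset.sum_le_sum fun j (_ : j ∈ Finset.univ) => h1 j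
  have hu2 := sum_DL_fam (F := fun f => ‖f‖ ^ 2) sum_norm_DL U.u
  simp only [Finset.sum_add_distrib, ← Finset.mul_sum, hu2, sum_gq_DL] at h2
  have h3 : |∑ j, ∑ k, energyX [j, k] U| ≤ ∑ j, ∑ k, |energyX [j, k] U| :=
    (Finset.abs_sum_le_sum_abs _ _).trans (Finset.sum_le_sum fun _ _ =>
      Finset.abs_sum_le_sum_abs _ _)
  change _ ≤ (1 / 2) * ∑ m, hom 0 (U.u m) + (1 / 2) * hom 1 U.ρ at h0
  have h4 : ∑ m, hom 0 (U.u m) + ∑ m, hom 2 (U.u m) ≤ 2 * ∑ m, topq (U.u m) := by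
    rw [← Finset.sum_add_distrib, Finset.mul_sum]
    refine Finset.sum_le_sum fun m _ => ?_
    have := hom_one_le (hu m)
    have := hom_nonneg 1 (U.u m)
    have := hom_nonneg 3 (U.u m)
    unfold topq
    linarith
  have h5 : hom 1 U.ρ + hom 3 U.ρ ≤ 2 * topq U.ρ := by
    have := hom_one_le hρ
    have := hom_nonneg 2 U.ρ
    have := hom_nonneg 0 U.ρ
    unfold topq
    linarith
  exact (abs_add_le _ _).trans (by linarith)

theorem abs_crossY_le (hu : ∀ m, U.u m ∈ Hs 3) (hτ : ∀ m n, U.τ m n ∈ Hs 3) :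
    |energyY [] U + ∑ j, ∑ k, energyY [j, k] U|
      ≤ ∑ m, ∑ n, topq (U.τ m n) + ∑ m, topq (U.u m) := by
  have h0 := abs_energyY_le (U := U) []
  have h1 : ∀ j, ∑ k, _ ≤ _ := fun j => Finset.sum_le_sum fun k (_ : k ∈ Finset.univ) =>
    abs_energyY_le (U := U) [j, k]
  have h2 := Finset.sum_le_sum fun j (_ : j ∈ Finset.univ) => h1 j
  have hτ2 := sum_DL_mat (F := fun f => ‖f‖ ^ 2) sum_norm_DL U.τ
  simp only [Finset.sum_add_distrib, ← Finset.mul_sum, hτ2, sum_DL_fam sum_gq_DL] at h2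
  have h3 : |∑ j, ∑ k, energyY [j, k] U| ≤ ∑ j, ∑ k, |energyY [j, k] U| :=
    (Finset.abs_sum_le_sum_abs _ _).trans (Finset.sum_le_sum fun _ _ =>
      Finset.abs_sum_le_sum_abs _ _)
  change _ ≤ (1 / 2) * ∑ m, ∑ n, hom 0 (U.τ m n) + (1 / 2) * ∑ m, hom 1 (U.u m) at h0
  have h4 : ∑ m, hom 1 (U.u m) + ∑ m, hom 3 (U.u m) ≤ 2 * ∑ m, topq (U.u m) := by
    rw [← Finset.sum_add_distrib, Finset.mul_sum]
    refine Finset.sum_le_sum fun m _ => ?_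
    have := hom_one_le (hu m)
    have := hom_nonneg 2 (U.u m)
    have := hom_nonneg 0 (U.u m)
    unfold topq
    linarith
  have h5 : ∑ m, ∑ n, hom 0 (U.τ m n) + ∑ m, ∑ n, hom 2 (U.τ m n)
      ≤ 2 * ∑ m, ∑ n, topq (U.τ m n) := by
    rw [← Finset.sum_add_distrib, Finset.mul_sum]
    refine Finset.sum_le_sum fun m _ => ?_
    rw [← Finset.sum_add_distrib, Finset.mul_sum]
    refine Finset.sum_le_sum fun n _ => ?_
    have := hom_one_le (hτ m n)
    have := hom_nonneg 1 (U.τ m n)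
    have := hom_nonneg 3 (U.τ m n)
    unfold topq
    linarith
  exact (abs_add_le _ _).trans (by linarith)

theorem energy_eq (Λ : Weights) :
    energy Λ U ϖ = topq U.ρ + ∑ j, ∑ k, ∑ i, inner ℝ (Mu ϖ (D i (DL [j, k] U.ρ))) (D i (DL [j, k] U.ρ))
      + ∑ m, topq (U.u m) + Λ.w * topq U.η + Λ.w' * ∑ m, ∑ n, topq (U.τ m n)
      + Λ.σ * (Λ.s * (energyX [] U + ∑ j, ∑ k, energyX [j, k] U)
      - (energyY [] U + ∑ j, ∑ k, energyY [j, k] U)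
      + Λ.t * (‖U.η - Λ.p • U.ρ‖ ^ 2 + hom 3 U.η)) := by
  have h : ∀ j k, ∑ i, inner ℝ (D i (DL [j, k] U.ρ) + Mu ϖ (D i (DL [j, k] U.ρ)))
      (D i (DL [j, k] U.ρ)) = gq (DL [j, k] U.ρ)
        + ∑ i, inner ℝ (Mu ϖ (D i (DL [j, k] U.ρ))) (D i (DL [j, k] U.ρ)) := fun j k => by
    simp only [inner_add_left, Finset.sum_add_distrib, real_inner_self_eq_norm_sq, gq]
  have hz : ∀ f : L2, ‖f‖ ^ 2 = hom 0 f := fun _ => rfl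
  simp only [energy, energyZero, energyTop, energyPolymer, h, Finset.sum_add_distrib,
    ← Finset.mul_sum, sum_DL_fam sum_gq_DL, sum_DL_mat sum_gq_DL, sum_gq_DL, topq]
  simp only [hz U.ρ, fun m => hz (U.u m), hz U.η, fun m n => hz (U.τ m n)]
  ring

theorem abs_weight_le (hϖ : ‖Mu ϖ‖ ≤ 1 / 2) :
    |∑ j, ∑ k, ∑ i, inner ℝ (Mu ϖ (D i (DL [j, k] U.ρ))) (D i (DL [j, k] U.ρ))|
      ≤ (1 / 2) * hom 3 U.ρ := by
  have h : ∀ j k i, |inner ℝ (Mu ϖ (D i (DL [j, k] U.ρ))) (D i (DL [j, k] U.ρ))|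
      ≤ (1 / 2) * ‖D i (DL [j, k] U.ρ)‖ ^ 2 := fun j k i => by
    refine (abs_real_inner_le_norm _ _).trans ?_
    rw [sq, ← mul_assoc]
    exact mul_le_mul_of_nonneg_right ((Mu ϖ).le_of_opNorm_le hϖ _) (norm_nonneg _)
  refine (Finset.abs_sum_le_sum_abs _ _).trans ((Finset.sum_le_sum fun j _ =>
    (Finset.abs_sum_le_sum_abs _ _).trans (Finset.sum_le_sum fun k _ =>
    (Finset.abs_sum_le_sum_abs _ _).trans (Finset.sum_le_sum fun i _ => h j k i))).trans
    (le_of_eq ?_))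
  rw [← sum_gq_DL]
  simp only [← Finset.mul_sum, gq]

variable (Λ : Weights) (hρ : U.ρ ∈ Hs 3) (hu : ∀ m, U.u m ∈ Hs 3) (hτ : ∀ m n, U.τ m n ∈ Hs 3)
  (hϖ : ‖Mu ϖ‖ ≤ 1 / 2)
include hρ hu hτ hϖ

theorem le_energy :
    min (1 / 4) (min (Λ.w' / 2) (Λ.σ * Λ.t / 2)) * U.total ≤ energy Λ U ϖ := by
  have h1 := (abs_le.1 (abs_crossX_le hρ hu)).1
  have h2 := (abs_le.1 (abs_crossY_le hu hτ)).2
  have h3 := (abs_le.1 (abs_weight_le (U := U) hϖ)).1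
  have h4 : (1 / 2) * hom 0 U.η - Λ.p ^ 2 * hom 0 U.ρ ≤ ‖U.η - Λ.p • U.ρ‖ ^ 2 := by
    have e : ‖U.η‖ ≤ ‖U.η - Λ.p • U.ρ‖ + |Λ.p| * ‖U.ρ‖ := by
      have := norm_add_le (U.η - Λ.p • U.ρ) (Λ.p • U.ρ)
      rwa [sub_add_cancel, norm_smul, Real.norm_eq_abs] at this
    change (1 / 2) * ‖U.η‖ ^ 2 - Λ.p ^ 2 * ‖U.ρ‖ ^ 2 ≤ _
    have e2 := pow_le_pow_left₀ (norm_nonneg _) e 2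
    rw [← sq_abs Λ.p]
    nlinarith [sq_nonneg (‖U.η - Λ.p • U.ρ‖ - |Λ.p| * ‖U.ρ‖)]
  set q := min (1 / 4) (min (Λ.w' / 2) (Λ.σ * Λ.t / 2)) with hq
  have q1 : q ≤ 1 / 4 := by simp [hq]
  have q2 : q ≤ Λ.w' / 2 := by simp [hq]
  have q3 : q ≤ Λ.σ * Λ.t / 2 := by simp [hq]
  have nR := topq_nonneg U.ρ
  have nU : 0 ≤ ∑ m, topq (U.u m) := Finset.sum_nonneg fun _ _ => topq_nonneg _
  have nE := topq_nonneg U.η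
  have nS : 0 ≤ ∑ m, ∑ n, topq (U.τ m n) := Finset.sum_nonneg fun _ _ =>
    Finset.sum_nonneg fun _ _ => topq_nonneg _
  have σ0 := Λ.σ_pos.le
  have n0 := hom_nonneg 0 U.ρ
  have n3 := hom_nonneg 3 U.ρ
  have n0' := hom_nonneg 0 U.η
  have n3' := hom_nonneg 3 U.η
  have eR : topq U.ρ = hom 0 U.ρ + hom 3 U.ρ := rfl
  have eE : topq U.η = hom 0 U.η + hom 3 U.η := rfl
  have k1 := mul_le_mul_of_nonneg_left h1 (mul_nonneg σ0 Λ.s_pos.le)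
  have k2 := mul_le_mul_of_nonneg_left h2 σ0
  have k4 := mul_le_mul_of_nonneg_left h4 (mul_nonneg σ0 Λ.t_pos.le)
  have k5 := mul_le_mul_of_nonneg_right Λ.σs_le (add_nonneg nU nR)
  have k6 := mul_le_mul_of_nonneg_right Λ.σ_le nU
  have k7 := mul_le_mul_of_nonneg_right Λ.σ_le_w' nS
  have k8 := mul_le_mul_of_nonneg_right Λ.σp_le n0
  have k9 := mul_nonneg Λ.w_nonneg nE
  have k10 := mul_nonneg (mul_nonneg σ0 Λ.t_pos.le) n3'
  have z1 := mul_le_mul_of_nonneg_right q1 nR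
  have z2 := mul_le_mul_of_nonneg_right q1 nU
  have z3 := mul_le_mul_of_nonneg_right q3 nE
  have z4 := mul_le_mul_of_nonneg_right q2 nS
  rw [energy_eq, Fields.total]
  rw [eE] at z3 k9 ⊢
  rw [eR] at z1 k5 k1 ⊢
  linarith

theorem energy_le :
    energy Λ U ϖ ≤ (4 + 3 * Λ.w' + Λ.w + 2 * (Λ.σ * Λ.t)) * U.total := by
  have h1 := (abs_le.1 (abs_crossX_le hρ hu)).2
  have h2 := (abs_le.1 (abs_crossY_le hu hτ)).1
  have h3 := (abs_le.1 (abs_weight_le (U := U) hϖ)).2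
  have h4 : ‖U.η - Λ.p • U.ρ‖ ^ 2 ≤ 2 * hom 0 U.η + 2 * (Λ.p ^ 2 * hom 0 U.ρ) := by
    have e := norm_sub_le U.η (Λ.p • U.ρ)
    rw [norm_smul, Real.norm_eq_abs] at e
    change _ ≤ 2 * ‖U.η‖ ^ 2 + 2 * (Λ.p ^ 2 * ‖U.ρ‖ ^ 2)
    have e2 := pow_le_pow_left₀ (norm_nonneg _) e 2
    rw [← sq_abs Λ.p]
    nlinarith [sq_nonneg (‖U.η‖ - |Λ.p| * ‖U.ρ‖)]
  have nR := topq_nonneg U.ρ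
  have nU : 0 ≤ ∑ m, topq (U.u m) := Finset.sum_nonneg fun _ _ => topq_nonneg _
  have nE := topq_nonneg U.η
  have nS : 0 ≤ ∑ m, ∑ n, topq (U.τ m n) := Finset.sum_nonneg fun _ _ =>
    Finset.sum_nonneg fun _ _ => topq_nonneg _
  have σ0 := Λ.σ_pos.le
  have n0 := hom_nonneg 0 U.ρ
  have n3 := hom_nonneg 3 U.ρ
  have n0' := hom_nonneg 0 U.η
  have n3' := hom_nonneg 3 U.η
  have eR : topq U.ρ = hom 0 U.ρ + hom 3 U.ρ := rfl
  have eE : topq U.η = hom 0 U.η + hom 3 U.η := rfl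
  have k1 := mul_le_mul_of_nonneg_left h1 (mul_nonneg σ0 Λ.s_pos.le)
  have k2 := mul_le_mul_of_nonneg_left h2 σ0
  have k4 := mul_le_mul_of_nonneg_left h4 (mul_nonneg σ0 Λ.t_pos.le)
  have k5 := mul_le_mul_of_nonneg_right Λ.σs_le (add_nonneg nU nR)
  have k6 := mul_le_mul_of_nonneg_right Λ.σ_le nU
  have k7 := mul_le_mul_of_nonneg_right Λ.σ_le_w' nS
  have k8 := mul_le_mul_of_nonneg_right Λ.σp_le n0
  have k10 := mul_nonneg (mul_nonneg σ0 Λ.t_pos.le) n3'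
  have m1 := mul_nonneg Λ.w'_pos.le (add_nonneg (add_nonneg nR nU) nE)
  have m2 := mul_nonneg Λ.w_nonneg (add_nonneg (add_nonneg nR nU) nS)
  have m3 := mul_nonneg (mul_nonneg σ0 Λ.t_pos.le) (add_nonneg (add_nonneg nR nU) nS)
  have m4 := mul_nonneg Λ.w'_pos.le nS
  rw [energy_eq, Fields.total]
  rw [eE] at nE m1 ⊢
  rw [eR] at nR m1 m2 m3 k5 k1 ⊢
  linarith

end Coercive

/-! ### Evolution of the combined energy -/

theorem Evol.sub {T : ℝ} {E E' F F' : ℝ → ℝ} (h : Evol T E E') (k : Evol T F F') :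
    Evol T (fun t => E t - F t) (fun t => E' t - F' t) := by
  have := h.add (k.const_mul (-1))
  simpa only [neg_one_mul, ← sub_eq_add_neg] using this

/-- A curve in `H³` with derivative in `H²`; `b` dominates the squares of the norms. -/
structure Mild (T : ℝ) (b : ℝ → ℝ) (f f' : ℝ → L2) : Prop where
  deriv : DerivOn T f f'
  mem : ∀ t ∈ Icc 0 T, f t ∈ Hs 3
  mem' : ∀ᵐ t ∂(volume.restrict (Ioo 0 T)), f' t ∈ Hs 2
  sq : ∀ᵐ t ∂(volume.restrict (Ioo 0 T)), nm 3 (f t) ^ 2 ≤ b t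
  sq' : ∀ᵐ t ∂(volume.restrict (Ioo 0 T)), nm 2 (f' t) ^ 2 ≤ b t
  bounded : ∃ K, ∀ t ∈ Icc 0 T, ‖f t‖ ≤ K ∧ ‖f' t‖ ≤ K

/-- A curve in `H³` which is almost everywhere in `H⁴`. -/
structure Parabolic (T : ℝ) (b : ℝ → ℝ) (f f' : ℝ → L2) : Prop extends Mild T b f f' where
  mem4 : ∀ᵐ t ∂(volume.restrict (Ioo 0 T)), f t ∈ Hs 4
  sq4 : ∀ᵐ t ∂(volume.restrict (Ioo 0 T)), nm 4 (f t) ^ 2 ≤ b t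

section Curves

variable {T : ℝ} {b : ℝ → ℝ} {f f' g g' : ℝ → L2}

theorem Mild.evol_norm (h : Mild T b f f') :
    Evol T (fun t => ‖f t‖ ^ 2) (fun t => 2 * inner ℝ (f' t) (f t)) := by
  obtain ⟨K, hK⟩ := h.bounded
  exact evol_norm_sq h.deriv (fun t ht => (hK t ht).1) (fun t ht => (hK t ht).2)

theorem Mild.evol_norm_sub (h : Mild T b f f') (k : Mild T b g g') (p : ℝ) :
    Evol T (fun t => ‖f t - p • g t‖ ^ 2)
      (fun t => 2 * inner ℝ (f' t - p • g' t) (f t - p • g t)) := by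
  obtain ⟨K, hK⟩ := h.bounded
  obtain ⟨K', hK'⟩ := k.bounded
  have bd : ∀ {x y : L2}, ‖x‖ ≤ K → ‖y‖ ≤ K' → ‖x - p • y‖ ≤ K + |p| * K' := fun hx hy => by
    refine (norm_sub_le _ _).trans (add_le_add hx ?_)
    rw [norm_smul, Real.norm_eq_abs]
    exact mul_le_mul_of_nonneg_left hy (abs_nonneg _)
  exact evol_norm_sq (fun t ht => (h.deriv t ht).sub ((k.deriv t ht).const_smul p))
    (fun t ht => bd (hK t ht).1 (hK' t ht).1) (fun t ht => bd (hK t ht).2 (hK' t ht).2)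

theorem norm_DL_le_nm (f : L2) {l : List (Fin 3)} {m : ℕ} (hl : l.length ≤ m) :
    ‖DL l f‖ ≤ nm m f :=
  (norm_DL_le l f 0).trans (nm_mono (by omega) f)

theorem norm_D_DL_le_nm {f : L2} {l : List (Fin 3)} {m : ℕ} (hl : l.length + 1 ≤ m) (i : Fin 3) :
    ‖D i (DL l f)‖ ≤ nm m f :=
  norm_DL_le_nm (l := i :: l) f hl

theorem Mild.cross (h : Mild T b f f') (k : Mild T b g g') (hb : IntegrableOn b (Ioo 0 T))
    {l : List (Fin 3)} (hl : l.length ≤ 2) (m : Fin 3) :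
    Evol T (fun t => inner ℝ (DL l (f t)) (D m (DL l (g t)))) (fun t =>
      inner ℝ (DL l (f' t)) (D m (DL l (g t))) - inner ℝ (D m (DL l (f t))) (DL l (g' t))) := by
  refine cross_evolution h.deriv k.deriv l m (fun t ht => Hs_mono (by omega) (h.mem t ht))
    (fun t ht => Hs_mono (by omega) (k.mem t ht)) ?_ ?_ (b := fun t => 2 * b t) ?_ (hb.const_mul 2)
  · filter_upwards [h.mem'] with t ht using Hs_mono hl ht
  · filter_upwards [k.mem'] with t ht using Hs_mono hl ht
  · filter_upwards [h.sq, h.sq', k.sq, k.sq'] with t h1 h2 h3 h4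
    have e1 := mul_le_mul (norm_DL_le_nm (f' t) hl) (norm_D_DL_le_nm (f := g t) (l := l)
      (m := 3) (by omega) m) (norm_nonneg _) (nm_nonneg 2 _)
    have e2 := mul_le_mul (norm_D_DL_le_nm (f := f t) (l := l) (m := 3) (by omega) m)
      (norm_DL_le_nm (g' t) hl) (norm_nonneg _) (nm_nonneg 3 _)
    nlinarith [sq_nonneg (nm 2 (f' t) - nm 3 (g t)), sq_nonneg (nm 3 (f t) - nm 2 (g' t))]

theorem Parabolic.high (h : Parabolic T b f f') (hb : IntegrableOn b (Ioo 0 T))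
    {l : List (Fin 3)} (hl : l.length ≤ 2) :
    Evol T (fun t => gq (DL l (f t))) (fun t => rateHigh l (f t) (f' t)) := by
  refine Evol.sum _ fun i _ => ?_
  refine energy_evolution h.deriv l i (fun t ht => Hs_mono (by omega) (h.mem t ht)) ?_ ?_
    (b := fun t => 2 * b t) ?_ (hb.const_mul 2)
  · filter_upwards [h.mem4] with t ht using Hs_mono (by omega) ht
  · filter_upwards [h.mem'] with t ht using Hs_mono hl ht
  · filter_upwards [h.sq4, h.sq'] with t h1 h2
    have e1 := mul_le_mul (norm_DL_le_nm (f' t) hl) (norm_D_DL_le_nm (f := f t) (l := i :: l)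
      (m := 4) (by simp; omega) i) (norm_nonneg _) (nm_nonneg 2 _)
    simp only [DL] at e1
    nlinarith [sq_nonneg (nm 2 (f' t) - nm 4 (f t))]

end Curves

/-- Regularity in time of a solution. -/
structure Regular (T : ℝ) (b : ℝ → ℝ) (U V : ℝ → Fields) : Prop where
  integrable : IntegrableOn b (Ioo 0 T)
  ρ : Mild T b (fun t => (U t).ρ) (fun t => (V t).ρ)
  u : ∀ m, Parabolic T b (fun t => (U t).u m) (fun t => (V t).u m)
  η : Parabolic T b (fun t => (U t).η) (fun t => (V t).η)
  τ : ∀ m n, Parabolic T b (fun t => (U t).τ m n) (fun t => (V t).τ m n)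
  ρ_mem' : ∀ t ∈ Icc 0 T, (V t).ρ ∈ Hs 2
  ρ_slope : ∀ t ∈ Icc 0 T, Tendsto
    (fun s => nm 2 ((s - t)⁻¹ • ((U s).ρ - (U t).ρ) - (V t).ρ)) (𝓝[Icc 0 T \ {t}] t) (𝓝 0)

section System

variable {T : ℝ} {b : ℝ → ℝ} {U V : ℝ → Fields} {w w' p : ℝ}

namespace Regular

variable (R : Regular T b U V)
include R

theorem evol_energyX {l : List (Fin 3)} (hl : l.length ≤ 2) :
    Evol T (fun t => energyX l (U t)) (fun t => rateX l (U t) (V t)) :=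
  Evol.sum _ fun m _ => (R.u m).toMild.cross R.ρ R.integrable hl m

theorem evol_energyY {l : List (Fin 3)} (hl : l.length ≤ 2) :
    Evol T (fun t => energyY l (U t)) (fun t => rateY l (U t) (V t)) :=
  Evol.sum _ fun m _ => Evol.sum _ fun n _ =>
    (R.τ m n).toMild.cross (R.u m).toMild R.integrable hl n

theorem evol_crossX :
    Evol T (fun t => energyX [] (U t) + ∑ j, ∑ k, energyX [j, k] (U t))
      (fun t => rateCrossX (U t) (V t)) :=
  (R.evol_energyX (l := []) (by simp)).add (Evol.sum _ fun _ _ => Evol.sum _ fun _ _ =>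
    R.evol_energyX le_rfl)

theorem evol_crossY :
    Evol T (fun t => energyY [] (U t) + ∑ j, ∑ k, energyY [j, k] (U t))
      (fun t => rateCrossY (U t) (V t)) :=
  (R.evol_energyY (l := []) (by simp)).add (Evol.sum _ fun _ _ => Evol.sum _ fun _ _ =>
    R.evol_energyY le_rfl)

theorem evol_polymer :
    Evol T (fun t => energyPolymer p (U t)) (fun t => ratePolymer p (U t) (V t)) :=
  (R.η.toMild.evol_norm_sub R.ρ p).add (Evol.sum _ fun _ _ => Evol.sum _ fun _ _ =>
    R.η.high R.integrable le_rfl)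

theorem evol_energyZero :
    Evol T (fun t => energyZero (U t) w w') (fun t => rateZero (U t) (V t) w w') :=
  ((R.ρ.evol_norm.add (Evol.sum _ fun m _ => (R.u m).toMild.evol_norm)).add
    (R.η.toMild.evol_norm.const_mul w)).add ((Evol.sum _ fun m _ => Evol.sum _ fun n _ =>
      (R.τ m n).toMild.evol_norm).const_mul w')

theorem derivOn_D_D (j k : Fin 3) :
    DerivOn T (fun t => DL [j, k] (U t).ρ) (fun t => DL [j, k] (V t).ρ) := by
  intro t ht
  rw [hasDerivWithinAt_iff_tendsto_slope]
  refine tendsto_iff_norm_sub_tendsto_zero.2 (squeeze_zero' (Eventually.of_forall fun s =>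
    norm_nonneg _) ?_ (R.ρ_slope t ht))
  filter_upwards [self_mem_nhdsWithin] with s hs
  have m1 : (U s).ρ ∈ Hs 2 := Hs_mono_succ (R.ρ.mem s hs.1)
  have m2 : (U t).ρ ∈ Hs 2 := Hs_mono_succ (R.ρ.mem t ht)
  have e : DL [j, k] ((s - t)⁻¹ • ((U s).ρ - (U t).ρ) - (V t).ρ)
      = (s - t)⁻¹ • (DL [j, k] (U s).ρ - DL [j, k] (U t).ρ) - DL [j, k] (V t).ρ := by
    rw [DL_sub (l := [j, k]) ((Hs 2).smul_mem _ ((Hs 2).sub_mem m1 m2)) (R.ρ_mem' t ht),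
      DL_smul (l := [j, k]) ((Hs 2).sub_mem m1 m2), DL_sub (l := [j, k]) m1 m2]
  rw [slope_def_module, ← e]
  exact norm_DL_le_nm _ le_rfl

end Regular

/-- The weight of the highest derivatives of the density. -/
structure WeightCurve (T M M' : ℝ) (ϖ ϖ' : ℝ → L2) : Prop where
  deriv : ∀ t ∈ Icc 0 T, HasDerivWithinAt (fun s => Mu (ϖ s)) (Mu (ϖ' t)) (Icc 0 T) t
  mem : ∀ t ∈ Icc 0 T, ϖ t ∈ Hs 3
  le : ∀ t ∈ Icc 0 T, nm 3 (ϖ t) ≤ M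
  le' : ∀ t ∈ Icc 0 T, ‖Mu (ϖ' t)‖ ≤ M'

variable {K : Coef} {N : NCoef} {H G A ϖ ϖ' : ℝ → L2} {M M' : ℝ} {Z : ℝ → ℝ}

theorem Regular.evol_density (R : Regular T b U V) (W : WeightCurve T M M' ϖ ϖ')
    (hρM : ∀ t ∈ Icc 0 T, nm 3 (U t).ρ ≤ M) (huM : ∀ t ∈ Icc 0 T, ∀ m, nm 3 ((U t).u m) ≤ M)
    (hB : ∀ᵐ t ∂(volume.restrict (Ioo 0 T)), Bounds (U t) (H t) (G t) (A t) M (Z t) N.μ N.κ)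
    (hZ : ∀ᵐ t ∂(volume.restrict (Ioo 0 T)), Z t ^ 2 ≤ b t)
    (hmass : ∀ t ∈ Icc 0 T, (V t).ρ = K.linR (U t).u + N.nlR (U t)) (j k i : Fin 3) :
    Evol T (fun t => inner ℝ (D i (DL [j, k] (U t).ρ) + Mu (ϖ t) (D i (DL [j, k] (U t).ρ)))
        (D i (DL [j, k] (U t).ρ)))
      (fun t => rateDensity K N (U t) (ϖ t) (ϖ' t) j k i) := by
  have hu3 : ∀ t ∈ Icc 0 T, ∀ m, (U t).u m ∈ Hs 3 := fun t ht m => (R.u m).mem t ht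
  set c := |K.r₁| + |N.β| * Csob with hc
  have hc0 : 0 ≤ c := by have := Csob_pos; positivity
  set c' := |N.β| * (81 * Csob) with hc'
  have hc0' : 0 ≤ c' := by have := Csob_pos; positivity
  refine weighted_transport_evolution (K := max M (max (|N.β| * M) M'))
    (v := fun l t => N.β • (U t).u l) (B := fun t => densitySource K N (U t) j k)
    (b := fun t => c * (3 * (1 + b t)) + c' * (1 + b t)) i (R.derivOn_D_D j k)
    (fun t ht => DL_mem (R.ρ.mem t ht)) W.deriv W.mem
    (fun t ht l => (Hs 3).smul_mem _ (hu3 t ht l)) ?_ ?_ ?_ ?_ ?_ ?_ ?_ ?_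
  · intro t ht
    rw [hmass t ht]
    exact DL_density_rate (R.ρ.mem t ht) (hu3 t ht) j k
  · filter_upwards [hB] with t ht using ht.densitySource_mem j k
  · exact fun t ht l => ((norm_D_DL_le_nm (l := [j, k]) le_rfl l).trans (hρM t ht)).trans
      (le_max_left _ _)
  · intro t ht l
    rw [nm_smul (hu3 t ht l)]
    exact (mul_le_mul_of_nonneg_left (huM t ht l) (abs_nonneg _)).trans
      ((le_max_left _ _).trans (le_max_right _ _))
  · exact fun t ht => (W.le t ht).trans (le_max_left _ _)
  · exact fun t ht => (W.le' t ht).trans ((le_max_right _ _).trans (le_max_right _ _))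
  · filter_upwards [hB, hZ, ae_all_iff.2 fun m => (R.u m).sq4, ae_all_iff.2 fun m => (R.u m).mem4]
      with t ht hz h4 m4
    have h1 : nm 3 (dv (U t).u) ≤ 3 * (1 + b t) := by
      refine (nm_sum_le _ fun l _ => D_mem (m4 l) l).trans (sum_le_three fun l => ?_)
      refine (nm_D_le 3 _ l).trans ?_
      nlinarith [h4 l, sq_nonneg (nm 4 ((U t).u l) - 1)]
    have h2 : Z t ≤ 1 + b t := by nlinarith [sq_nonneg (Z t - 1)]
    refine (ht.norm_D_densitySource i j k).trans (add_le_add (mul_le_mul_of_nonneg_left h1 hc0) ?_)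
    calc |N.β| * (81 * Csob * Z t) = c' * Z t := by rw [hc']; ring
      _ ≤ _ := mul_le_mul_of_nonneg_left h2 hc0'
  · have h1 : IntegrableOn (fun t => 1 + b t) (Ioo 0 T) :=
      (integrableOn_const (by simp)).add R.integrable
    exact ((h1.const_mul 3).const_mul c).add (h1.const_mul c')

theorem Regular.evol_energy (R : Regular T b U V) (W : WeightCurve T M M' ϖ ϖ')
    (hρM : ∀ t ∈ Icc 0 T, nm 3 (U t).ρ ≤ M) (huM : ∀ t ∈ Icc 0 T, ∀ m, nm 3 ((U t).u m) ≤ M)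
    (hB : ∀ᵐ t ∂(volume.restrict (Ioo 0 T)), Bounds (U t) (H t) (G t) (A t) M (Z t) N.μ N.κ)
    (hZ : ∀ᵐ t ∂(volume.restrict (Ioo 0 T)), Z t ^ 2 ≤ b t)
    (hmass : ∀ t ∈ Icc 0 T, (V t).ρ = K.linR (U t).u + N.nlR (U t)) (Λ : Weights) :
    Evol T (fun t => energy Λ (U t) (ϖ t)) (fun t => rate K N Λ (U t) (V t) (ϖ t) (ϖ' t)) := by
  have h1 : ∀ j k, Evol T (fun t => energyTop (U t) (ϖ t) Λ.w Λ.w' j k)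
      (fun t => rateTop K N (U t) (V t) (ϖ t) (ϖ' t) Λ.w Λ.w' j k) := fun j k =>
    (((Evol.sum _ fun i _ => R.evol_density W hρM huM hB hZ hmass j k i).add
      (Evol.sum _ fun m _ => (R.u m).high R.integrable le_rfl)).add
      ((R.η.high R.integrable le_rfl).const_mul Λ.w)).add
      ((Evol.sum _ fun m _ => Evol.sum _ fun n _ =>
        (R.τ m n).high R.integrable le_rfl).const_mul Λ.w')
  exact (R.evol_energyZero.add (Evol.sum _ fun j _ => Evol.sum _ fun k _ => h1 j k)).add
    ((((R.evol_crossX.const_mul Λ.s).sub R.evol_crossY).add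
      (R.evol_polymer.const_mul Λ.t)).const_mul Λ.σ)

end System

/-! ### Size of the nonlinear terms -/

theorem gm_add_le {m : ℕ} {f g : L2} (hf : f ∈ Hs (m + 1)) (hg : g ∈ Hs (m + 1)) :
    gm m (f + g) ≤ gm m f + gm m g := by
  rw [gm, gm, gm, ← Finset.sum_add_distrib]
  refine Finset.sum_le_sum fun i _ => ?_
  rw [D_add (Hs_mono (by omega) hf) (Hs_mono (by omega) hg)]
  exact nm_add_le (D_mem hf i) (D_mem hg i)

theorem gm_smul {m : ℕ} {f : L2} (hf : f ∈ Hs (m + 1)) (c : ℝ) : gm m (c • f) = |c| * gm m f := by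
  rw [gm, gm, Finset.mul_sum]
  refine Finset.sum_congr rfl fun i _ => ?_
  rw [D_smul (Hs_mono (by omega) hf), nm_smul (D_mem hf i)]

/-- The coefficients of the system, without the viscosities. -/
structure Model where
  r₁ : ℝ
  r₂ : ℝ
  r₃ : ℝ
  b : ℝ
  ε : ℝ
  a : ℝ
  c : ℝ
  β : ℝ
  k : ℝ
  α : ℝ
  e₁ : ℝ
  e₂ : ℝ
  d : ℝ
  w : ℝ
  w' : ℝ
  p : ℝ
  R₀ : ℝ
  h : ℝ → ℝ
  g : ℝ → ℝ
  q : ℝ → ℝ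
  r₁_pos : 0 < r₁
  r₃_nonneg : 0 ≤ r₃
  ε_pos : 0 < ε
  a_pos : 0 < a
  c_pos : 0 < c
  d_pos : 0 < d
  R₀_pos : 0 < R₀
  w_nonneg : 0 ≤ w
  w'_pos : 0 < w'
  r₂_eq : r₂ = w * b
  r₃_eq : r₃ = 2 * w' * c
  p_mul : p * r₁ = b
  smooth_h : Smooth₀ h
  smooth_g : Smooth₀ g
  smooth_q : Smooth₀ q
  weight : ∀ s, |s| ≤ R₀ → h s = -(r₁ * q s + β * s + β * (q s * s))

/-- Total dissipation. -/
def Fields.diss (U : Fields) (μ₁ μ₂ : ℝ) : ℝ :=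
  U.dR + U.dU + U.dE + U.dS + μ₁ * U.dW + μ₂ * U.dD

/-- All unknowns are in `H³` with norms bounded by `M`. -/
structure Fields.Small (U : Fields) (M : ℝ) : Prop where
  ρ_mem : U.ρ ∈ Hs 3
  u_mem : ∀ i, U.u i ∈ Hs 3
  η_mem : U.η ∈ Hs 3
  τ_mem : ∀ i j, U.τ i j ∈ Hs 3
  ρ_le : nm 3 U.ρ ≤ M
  u_le : ∀ i, nm 3 (U.u i) ≤ M
  η_le : nm 3 U.η ≤ M
  τ_le : ∀ i j, nm 3 (U.τ i j) ≤ M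

theorem Fields.diss_terms (U : Fields) {μ₁ μ₂ : ℝ} (h₁ : 0 ≤ μ₁) (h₂ : 0 ≤ μ₂) :
    U.dR ≤ U.diss μ₁ μ₂ ∧ U.dU ≤ U.diss μ₁ μ₂ ∧ U.dE ≤ U.diss μ₁ μ₂ ∧ U.dS ≤ U.diss μ₁ μ₂
      ∧ μ₁ * U.dW ≤ U.diss μ₁ μ₂ ∧ μ₂ * U.dD ≤ U.diss μ₁ μ₂ := by
  have := U.dR_nonneg
  have := U.dU_nonneg
  have := U.dE_nonneg
  have := U.dS_nonneg
  have := mul_nonneg h₁ U.dW_nonneg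
  have := mul_nonneg h₂ U.dD_nonneg
  unfold Fields.diss
  refine ⟨?_, ?_, ?_, ?_, ?_, ?_⟩ <;> linarith

namespace Model

variable (m : Model)

/-- The coefficients of the linear part. -/
def coef (μ κ : ℝ) : Coef where
  r₁ := m.r₁
  r₂ := m.r₂
  r₃ := m.r₃
  μ₁ := μ / m.d
  μ₂ := κ / m.d
  b := m.b
  ε := m.ε
  a := m.a
  c := m.c

/-- The coefficients of the nonlinear part. -/
def ncoef (μ κ : ℝ) : NCoef := ⟨m.β, m.k, μ, κ⟩

/-- The coefficient of `∇ρ` in the forcing. -/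
def fH (U : Fields) : L2 := cmp m.h U.ρ

/-- The coefficient of `div τ` in the forcing. -/
def fG (U : Fields) : L2 := cmp m.g U.ρ

/-- The coefficient of `∇η` in the forcing. -/
def fA (U : Fields) : L2 := m.α • m.fG U + m.e₁ • U.η + m.e₂ • Mu (m.fG U) U.η

set_option maxHeartbeats 1000000 in
theorem exists_bounds : ∃ C : ℝ, 1 ≤ C ∧ ∀ (U : Fields) (M₀ M Z μ κ : ℝ), U.Small M₀ →
    C * M₀ ≤ M → M ≤ 1 → 0 ≤ μ → μ ≤ 1 → 0 ≤ κ → κ ≤ 2 →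
    (∀ i, U.u i ∈ Hs 4) → U.η ∈ Hs 4 → (∀ i j, U.τ i j ∈ Hs 4) →
    0 ≤ Z → C ^ 2 * U.diss (μ / m.d) (κ / m.d) ≤ Z ^ 2 →
    Bounds U (m.fH U) (m.fG U) (m.fA U) M Z μ κ := by
  obtain ⟨Kh, hKh, Hh⟩ := exists_cmp_bound m.smooth_h 1
  obtain ⟨Kg, hKg, Hg⟩ := exists_cmp_bound m.smooth_g 1
  have hd := m.d_pos
  have hC := Csob_pos
  obtain ⟨C, hCdef⟩ : ∃ C : ℝ, C = 20 * (1 + Kh + Kg + m.d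
    + (|m.α| * Kg + |m.e₁| + |m.e₂| * (19 * Csob * (2 * Kg + 1)))) := ⟨_, rfl⟩
  have t1 : 0 ≤ |m.α| * Kg := by positivity
  have t2 : 0 ≤ |m.e₂| * (19 * Csob * (2 * Kg + 1)) := by positivity
  have hC1 : 20 ≤ C := by have := abs_nonneg m.e₁; linarith
  have cKh : 20 * Kh ≤ C := by have := abs_nonneg m.e₁; linarith
  have cKg : 20 * Kg ≤ C := by have := abs_nonneg m.e₁; linarith
  have cd : 20 * m.d ≤ C := by have := abs_nonneg m.e₁; linarith
  refine ⟨C, by linarith, ?_⟩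
  intro U M₀ M Z μ κ S hM hM1 hμ hμ1 hκ hκ2 u4 η4 τ4 hZ hdiss
  have M00 : 0 ≤ M₀ := (nm_nonneg _ _).trans S.ρ_le
  have hMM : M₀ ≤ M := (le_mul_of_one_le_left M00 (by linarith)).trans hM
  have hM01 : M₀ ≤ 1 := hMM.trans hM1
  obtain ⟨Hm, Hn, Hgm⟩ := Hh U.ρ S.ρ_mem (S.ρ_le.trans hM01)
  obtain ⟨Gm, Gn, Ggm⟩ := Hg U.ρ S.ρ_mem (S.ρ_le.trans hM01)
  change m.fG U ∈ Hs 3 at Gm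
  change nm 3 (m.fG U) ≤ _ at Gn
  change gm 2 (m.fG U) ≤ _ at Ggm
  have κ0 : 0 ≤ κ / m.d := by positivity
  obtain ⟨dR, dU, dE, dS, dW, dD⟩ := U.diss_terms (by positivity : 0 ≤ μ / m.d) κ0
  obtain ⟨Q, hQ⟩ : ∃ Q, Q = U.diss (μ / m.d) (κ / m.d) := ⟨_, rfl⟩
  rw [← hQ] at dR dU dE dS dW dD hdiss
  have Q0 : 0 ≤ Q := U.dR_nonneg.trans dR
  obtain ⟨z, hz⟩ : ∃ z, z = Z / C := ⟨_, rfl⟩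
  have hz0 : 0 ≤ z := by rw [hz]; positivity
  have hZz : Z = C * z := by rw [hz]; field_simp
  have hQz : Q ≤ z ^ 2 := by
    rw [hZz, mul_pow] at hdiss
    exact le_of_mul_le_mul_left hdiss (by positivity)
  have sq_le : ∀ {x : ℝ}, x ^ 2 ≤ 400 * z ^ 2 → x ≤ 20 * z := fun {x} h =>
    abs_le_of_sq_le_sq' (h.trans (le_of_eq (by ring))) (by positivity) |>.2
  have gρ : gm 2 U.ρ ≤ 20 * z := sq_le (by
    have := gm_two_sq_le S.ρ_mem
    have : U.dR = hom 1 U.ρ + hom 3 U.ρ := rfl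
    linarith [sq_nonneg z])
  have gu : ∀ i, gm 2 (U.u i) ≤ 20 * z := fun i => sq_le (by
    have := gm_two_sq_le (S.u_mem i)
    have : hom 1 (U.u i) + hom 3 (U.u i) ≤ U.dU :=
      Finset.single_le_sum (f := fun i => hom 1 (U.u i) + hom 3 (U.u i))
        (fun i _ => add_nonneg (hom_nonneg _ _) (hom_nonneg _ _)) (Finset.mem_univ i)
    linarith [sq_nonneg z])
  have gη : gm 3 U.η ≤ 20 * z := sq_le (by
    have := gm_three_sq_le η4
    have : U.dE = hom 1 U.η + hom 4 U.η := rfl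
    linarith [sq_nonneg z])
  have gτ : ∀ i j, gm 3 (U.τ i j) ≤ 20 * z := fun i j => sq_le (by
    have := gm_three_sq_le (τ4 i j)
    have h0 := hom_nonneg 0 (U.τ i j)
    have h1 : ∀ i j, 0 ≤ hom 0 (U.τ i j) + hom 1 (U.τ i j) + hom 4 (U.τ i j) := fun i j =>
      add_nonneg (add_nonneg (hom_nonneg _ _) (hom_nonneg _ _)) (hom_nonneg _ _)
    have h2 : hom 0 (U.τ i j) + hom 1 (U.τ i j) + hom 4 (U.τ i j) ≤ U.dS :=
      (Finset.single_le_sum (f := fun j => hom 0 (U.τ i j) + hom 1 (U.τ i j) + hom 4 (U.τ i j))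
        (fun j _ => h1 i j) (Finset.mem_univ j)).trans
      (Finset.single_le_sum (f := fun i => ∑ j, (hom 0 (U.τ i j) + hom 1 (U.τ i j)
        + hom 4 (U.τ i j))) (fun i _ => Finset.sum_nonneg fun j _ => h1 i j) (Finset.mem_univ i))
    linarith [sq_nonneg z])
  have l20 : 20 * z ≤ Z := by rw [hZz]; exact mul_le_mul_of_nonneg_right hC1 hz0
  have μd : μ = m.d * (μ / m.d) := by field_simp
  have κd : κ = m.d * (κ / m.d) := by field_simp
  have big : 384 * (m.d * Q) ≤ Z ^ 2 := by
    have h1 : 384 * m.d ≤ C ^ 2 := by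
      rw [sq]
      exact le_trans (by linarith) (mul_le_mul hC1 cd (by positivity) (by linarith))
    calc 384 * (m.d * Q) = 384 * m.d * Q := by ring
      _ ≤ C ^ 2 * Q := mul_le_mul_of_nonneg_right h1 Q0
      _ ≤ _ := hdiss
  have GηM : Mu (m.fG U) U.η ∈ Hs 3 := Mu_mem_three Gm S.η_mem
  have Gn' : nm 3 (m.fG U) ≤ Kg * M₀ := Gn.trans (mul_le_mul_of_nonneg_left S.ρ_le hKg)
  have m1 : m.α • m.fG U ∈ Hs 3 := (Hs 3).smul_mem _ Gm
  have m2 : m.e₁ • U.η ∈ Hs 3 := (Hs 3).smul_mem _ S.η_mem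
  have m3 : m.e₂ • Mu (m.fG U) U.η ∈ Hs 3 := (Hs 3).smul_mem _ GηM
  have A_le : nm 3 (m.fA U) ≤ M := by
    have e1 : nm 3 (Mu (m.fG U) U.η) ≤ 19 * Csob * (2 * Kg + 1) * M₀ := by
      refine (nm_Mu_three Gm S.η_mem).trans ?_
      have h1 := mul_le_mul Gn' S.η_le (nm_nonneg _ _) (by positivity : 0 ≤ Kg * M₀)
      have h2 : Kg * M₀ * M₀ ≤ (2 * Kg + 1) * M₀ := by
        have : Kg * M₀ * M₀ ≤ Kg * M₀ * 1 := mul_le_mul_of_nonneg_left hM01 (by positivity)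
        linarith [mul_nonneg hKg M00]
      calc 19 * Csob * nm 3 (m.fG U) * nm 3 U.η
          = 19 * Csob * (nm 3 (m.fG U) * nm 3 U.η) := by ring
        _ ≤ 19 * Csob * ((2 * Kg + 1) * M₀) :=
          mul_le_mul_of_nonneg_left (h1.trans h2) (by positivity)
        _ = _ := by ring
    refine (nm_add_le ((Hs 3).add_mem m1 m2) m3).trans
      ((add_le_add_left (nm_add_le m1 m2) _).trans ?_)
    rw [nm_smul Gm, nm_smul S.η_mem, nm_smul GηM]
    have f1 := mul_le_mul_of_nonneg_left Gn' (abs_nonneg m.α)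
    have f2 := mul_le_mul_of_nonneg_left S.η_le (abs_nonneg m.e₁)
    have f3 := mul_le_mul_of_nonneg_left e1 (abs_nonneg m.e₂)
    have f4 : (|m.α| * Kg + |m.e₁| + |m.e₂| * (19 * Csob * (2 * Kg + 1))) * M₀ ≤ C * M₀ :=
      mul_le_mul_of_nonneg_right (by have := abs_nonneg m.e₁; linarith) M00
    linarith
  have gη2 : gm 2 U.η ≤ 20 * z := (gm_mono (by omega) _).trans gη
  have Ggm' : gm 2 (m.fG U) ≤ Kg * (20 * z) := Ggm.trans (mul_le_mul_of_nonneg_left gρ hKg)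
  have A_gm : gm 2 (m.fA U) ≤ Z := by
    have e1 : gm 2 (Mu (m.fG U) U.η) ≤ 19 * Csob * (2 * Kg + 1) * (20 * z) := by
      refine (gm_Mu Gm S.η_mem).trans ?_
      have h1 : nm 2 (m.fG U) * gm 2 U.η ≤ Kg * (20 * z) := by
        refine mul_le_mul ?_ gη2 (gm_nonneg _ _) hKg
        exact (nm_mono (by omega) _).trans (Gn'.trans (mul_le_of_le_one_right hKg hM01))
      have h2 : nm 2 U.η * gm 2 (m.fG U) ≤ 1 * (Kg * (20 * z)) :=
        mul_le_mul ((nm_mono (by omega) _).trans (S.η_le.trans hM01)) Ggm' (gm_nonneg _ _) one_pos.le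
      have h3 := mul_le_mul_of_nonneg_left (add_le_add h1 h2) (by positivity : 0 ≤ 9 * Csob)
      have h4 : 0 ≤ Csob * (20 * z) := by positivity
      have h5 : 0 ≤ Kg * (Csob * (20 * z)) := by positivity
      linarith
    refine (gm_add_le ((Hs 3).add_mem m1 m2) m3).trans
      ((add_le_add_left (gm_add_le m1 m2) _).trans ?_)
    rw [gm_smul Gm, gm_smul S.η_mem, gm_smul GηM]
    have f1 := mul_le_mul_of_nonneg_left Ggm' (abs_nonneg m.α)
    have f2 := mul_le_mul_of_nonneg_left gη2 (abs_nonneg m.e₁)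
    have f3 := mul_le_mul_of_nonneg_left e1 (abs_nonneg m.e₂)
    have f4 : 20 * (|m.α| * Kg + |m.e₁| + |m.e₂| * (19 * Csob * (2 * Kg + 1))) * z ≤ C * z :=
      mul_le_mul_of_nonneg_right (by linarith) hz0
    rw [hZz]
    linarith
  refine ⟨S.ρ_mem, u4, η4, τ4, Hm, Gm, (Hs 3).add_mem ((Hs 3).add_mem m1 m2) m3,
    S.ρ_le.trans hMM, fun i => (S.u_le i).trans hMM, S.η_le.trans hMM,
    fun i j => (S.τ_le i j).trans hMM, ?_, ?_, A_le, hM1, gρ.trans l20, fun i => (gu i).trans l20,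
    gη.trans l20, fun i j => (gτ i j).trans l20, ?_, ?_, A_gm, hμ, hμ1, hκ, hκ2, ?_, ?_⟩
  · refine Hn.trans ((mul_le_mul_of_nonneg_left S.ρ_le hKh).trans (le_trans ?_ hM))
    exact mul_le_mul_of_nonneg_right (by linarith) M00
  · exact Gn'.trans ((mul_le_mul_of_nonneg_right (by linarith) M00).trans hM)
  · refine Hgm.trans ((mul_le_mul_of_nonneg_left gρ hKh).trans ?_)
    rw [hZz]
    linarith [mul_le_mul_of_nonneg_right cKh hz0]
  · rw [hZz]
    linarith [mul_le_mul_of_nonneg_right cKg hz0]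
  · intro i
    have h1 := gm_three_sq_le (u4 i)
    have h2 : hom 1 (U.u i) + hom 4 (U.u i) ≤ U.dW :=
      Finset.single_le_sum (f := fun i => hom 1 (U.u i) + hom 4 (U.u i))
        (fun i _ => add_nonneg (hom_nonneg _ _) (hom_nonneg _ _)) (Finset.mem_univ i)
    have h3 : μ * gm 3 (U.u i) ^ 2 ≤ μ * (384 * U.dW) :=
      mul_le_mul_of_nonneg_left (by linarith) hμ
    have h4 : m.d * (μ / m.d * U.dW) ≤ m.d * Q := mul_le_mul_of_nonneg_left dW hd.le
    have h5 : μ * (384 * U.dW) = 384 * (m.d * (μ / m.d * U.dW)) := by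
      nth_rw 1 [μd]; ring
    linarith
  · have h1 := nm_three_sq_le (f := dv U.u) (OldroydB.dv_mem u4)
    have h3 : κ * nm 3 (dv U.u) ^ 2 ≤ κ * (384 * U.dD) :=
      mul_le_mul_of_nonneg_left (by
        have := U.dD_nonneg
        have : U.dD = hom 0 (dv U.u) + hom 3 (dv U.u) := rfl
        linarith) hκ
    have h4 : m.d * (κ / m.d * U.dD) ≤ m.d * Q := mul_le_mul_of_nonneg_left dD hd.le
    have h5 : κ * (384 * U.dD) = 384 * (m.d * (κ / m.d * U.dD)) := by
      nth_rw 1 [κd]; ring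
    linarith

end Model

namespace Model

variable (m : Model)

/-- The weight of the highest derivatives of the density is `1 + fϖ`. -/
def fϖ (U : Fields) : L2 := cmp m.q U.ρ

/-- The time derivative of the weight. -/
def fϖ' (U V : Fields) : L2 := dcmp m.q U.ρ V.ρ

theorem fH_eq {U : Fields} (hρ : Bdd U.ρ m.R₀) :
    m.fH U = -(m.r₁ • m.fϖ U + m.β • U.ρ + m.β • Mu (m.fϖ U) U.ρ) := by
  obtain ⟨K, _, hK⟩ := norm_cmp_le m.smooth_q m.R₀
  have hb := (hK U.ρ hρ).2 _ hρ
  refine Lp.ext ?_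
  filter_upwards [coe_cmp m.smooth_h hρ, coe_cmp m.smooth_q hρ, hρ, coe_Mu hb U.ρ,
    Lp.coeFn_neg (m.r₁ • m.fϖ U + m.β • U.ρ + m.β • Mu (m.fϖ U) U.ρ),
    Lp.coeFn_add (m.r₁ • m.fϖ U + m.β • U.ρ) (m.β • Mu (m.fϖ U) U.ρ),
    Lp.coeFn_add (m.r₁ • m.fϖ U) (m.β • U.ρ), Lp.coeFn_smul m.r₁ (m.fϖ U),
    Lp.coeFn_smul m.β U.ρ, Lp.coeFn_smul m.β (Mu (m.fϖ U) U.ρ)] with x h1 h2 h3 h4 h5 h6 h7 h8 h9 h10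
  rw [h5, Pi.neg_apply, h6, Pi.add_apply, h7, Pi.add_apply, h8, h9, h10]
  simp only [Pi.smul_apply, smul_eq_mul]
  rw [fH, h1, fϖ, h4, h2, m.weight _ h3]

theorem nm_dv_le {v : Fin 3 → L2} {M : ℝ} (hv : ∀ i, v i ∈ Hs 3) (h : ∀ i, nm 3 (v i) ≤ M) :
    nm 2 (dv v) ≤ 3 * M :=
  (nm_sum_le _ fun l _ => D_mem (hv l) l).trans
    (sum_le_three fun l => (nm_D_le 2 _ l).trans (h l))

/-- The right-hand side of the equation of the density. -/
def rhsρ (U : Fields) : L2 := (m.coef 0 0).linR U.u + (m.ncoef 0 0).nlR U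

theorem rhsρ_mem {U : Fields} {M : ℝ} (S : U.Small M) (hM : M ≤ 1) : m.rhsρ U ∈ Hs 2 ∧
    nm 2 (m.rhsρ U) ≤ (|m.r₁| * 3 + |m.β| * (54 * Csob)) * M := by
  have M0 : 0 ≤ M := (nm_nonneg _ _).trans S.ρ_le
  have hC := Csob_pos
  have d2 : dv U.u ∈ Hs 2 := OldroydB.dv_mem S.u_mem
  have h2 : ∀ {f : L2}, f ∈ Hs 3 → f ∈ Hs 2 := fun h => Hs_mono_succ h
  have nd := nm_dv_le S.u_mem S.u_le
  have p1 : Mu U.ρ (dv U.u) ∈ Hs 2 := Mu_mem_two (h2 S.ρ_mem) d2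
  have p2 : ∀ l, Mu (U.u l) (D l U.ρ) ∈ Hs 2 := fun l =>
    Mu_mem_two (h2 (S.u_mem l)) (D_mem S.ρ_mem l)
  have p3 : ∑ l, Mu (U.u l) (D l U.ρ) ∈ Hs 2 := (Hs 2).sum_mem fun l _ => p2 l
  have n2 : ∀ {f : L2}, nm 3 f ≤ M → nm 2 f ≤ M := fun h => (nm_mono (by omega) _).trans h
  have MM : M * M ≤ M := mul_le_of_le_one_left M0 hM
  have q1 : nm 2 (Mu U.ρ (dv U.u)) ≤ 27 * Csob * M := by
    refine (nm_Mu_two (h2 S.ρ_mem) d2).trans ?_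
    have := mul_le_mul (n2 S.ρ_le) nd (nm_nonneg _ _) M0
    calc 9 * Csob * nm 2 U.ρ * nm 2 (dv U.u) = 9 * Csob * (nm 2 U.ρ * nm 2 (dv U.u)) := by ring
      _ ≤ 9 * Csob * (3 * M) := mul_le_mul_of_nonneg_left (by linarith) (by positivity)
      _ = _ := by ring
  have q2 : ∀ l, nm 2 (Mu (U.u l) (D l U.ρ)) ≤ 9 * Csob * M := fun l => by
    refine (nm_Mu_two (h2 (S.u_mem l)) (D_mem S.ρ_mem l)).trans ?_
    have := mul_le_mul (n2 (S.u_le l)) ((nm_D_le 2 U.ρ l).trans S.ρ_le) (nm_nonneg _ _) M0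
    calc 9 * Csob * nm 2 (U.u l) * nm 2 (D l U.ρ)
        = 9 * Csob * (nm 2 (U.u l) * nm 2 (D l U.ρ)) := by ring
      _ ≤ 9 * Csob * M := mul_le_mul_of_nonneg_left (by linarith) (by positivity)
  have q3 := (nm_sum_le _ fun l (_ : l ∈ Finset.univ) => p2 l).trans (sum_le_three q2)
  have e1 : -m.r₁ • dv U.u ∈ Hs 2 := (Hs 2).smul_mem _ d2
  have e2 : -m.β • (Mu U.ρ (dv U.u) + ∑ l, Mu (U.u l) (D l U.ρ)) ∈ Hs 2 :=
    (Hs 2).smul_mem _ ((Hs 2).add_mem p1 p3)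
  refine ⟨(Hs 2).add_mem e1 e2, (nm_add_le e1 e2).trans ?_⟩
  rw [nm_smul d2, nm_smul ((Hs 2).add_mem p1 p3), abs_neg, abs_neg]
  have f1 := mul_le_mul_of_nonneg_left nd (abs_nonneg m.r₁)
  have f2 := mul_le_mul_of_nonneg_left ((nm_add_le p1 p3).trans (add_le_add q1 q3)) (abs_nonneg m.β)
  linarith

theorem exists_weight_bounds : ∃ C : ℝ, 1 ≤ C ∧ ∀ (U V : Fields) (M₀ M : ℝ), U.Small M₀ →
    C * M₀ ≤ M → M ≤ 1 → V.ρ = m.rhsρ U →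
    Bdd U.ρ m.R₀ ∧ m.fϖ U ∈ Hs 3 ∧ nm 3 (m.fϖ U) ≤ M ∧ ‖Mu (m.fϖ U)‖ ≤ 1 / 2
      ∧ ‖Mu (m.fϖ' U V)‖ ≤ M := by
  obtain ⟨K, hK, H⟩ := exists_cmp_bound m.smooth_q 1
  obtain ⟨K', hK', H'⟩ := exists_cmp_bound m.smooth_q.dshift 1
  have hC := Csob_pos
  have hR := m.R₀_pos
  obtain ⟨k₁, hk₁⟩ : ∃ k₁, k₁ = |m.r₁| * 3 + |m.β| * (54 * Csob) := ⟨_, rfl⟩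
  have hk₁0 : 0 ≤ k₁ := by rw [hk₁]; positivity
  obtain ⟨k₂, hk₂⟩ : ∃ k₂, k₂ = (|deriv m.q 0| + Csob * K') * (Csob * k₁) := ⟨_, rfl⟩
  have hk₂0 : 0 ≤ k₂ := by rw [hk₂]; positivity
  refine ⟨1 + Csob / m.R₀ + K + 2 * Csob * K + k₂, by
    have : 0 ≤ Csob / m.R₀ := by positivity
    have : 0 ≤ 2 * Csob * K := by positivity
    linarith, ?_⟩
  intro U V M₀ M S hM hM1 hV
  have M00 : 0 ≤ M₀ := (nm_nonneg _ _).trans S.ρ_le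
  have a1 : 0 ≤ Csob / m.R₀ * M₀ := by positivity
  have a2 : 0 ≤ K * M₀ := by positivity
  have a3 : 0 ≤ 2 * Csob * K * M₀ := by positivity
  have a4 : 0 ≤ k₂ * M₀ := by positivity
  have hM01 : M₀ ≤ 1 := by linarith
  obtain ⟨c1, c2, -⟩ := H U.ρ S.ρ_mem (S.ρ_le.trans hM01)
  obtain ⟨c3, c4, -⟩ := H' U.ρ S.ρ_mem (S.ρ_le.trans hM01)
  have n1 : nm 3 (cmp m.q U.ρ) ≤ K * M₀ := c2.trans (mul_le_mul_of_nonneg_left S.ρ_le hK)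
  have n2 : nm 3 (cmp (dshift m.q) U.ρ) ≤ K' :=
    c4.trans (mul_le_of_le_one_right hK' (S.ρ_le.trans hM01))
  refine ⟨(bdd_of_nm_three S.ρ_mem S.ρ_le).mono ?_, c1, n1.trans (by linarith),
    (opNorm_Mu_le (bdd_of_nm_three c1 n1)).trans (by linarith), ?_⟩
  · have h : Csob / m.R₀ * M₀ ≤ 1 := by linarith
    rw [div_mul_eq_mul_div, div_le_one hR] at h
    exact h
  · obtain ⟨r1, r2⟩ := m.rhsρ_mem S hM01
    rw [← hk₁, ← hV] at r2
    rw [← hV] at r1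
    have bV := bdd_of_mem r1
    have bV' : ‖Mu V.ρ‖ ≤ Csob * k₁ * M₀ := (opNorm_Mu_le bV).trans (by
      rw [mul_assoc]; exact mul_le_mul_of_nonneg_left r2 hC.le)
    have bd := bdd_of_nm_three c3 n2
    have e : Mu (m.fϖ' U V) = deriv m.q 0 • Mu V.ρ + (Mu (cmp (dshift m.q) U.ρ)).comp (Mu V.ρ) := by
      rw [fϖ', dcmp, Mu_add (bV.smul _) (bd.Mu bV), Mu_smul bV, Mu_comp bd bV]
    rw [e]
    have h0 : 0 ≤ Csob * k₁ * M₀ := by positivity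
    refine (norm_add_le _ _).trans ?_
    have h1 : ‖deriv m.q 0 • Mu V.ρ‖ ≤ |deriv m.q 0| * (Csob * k₁ * M₀) := by
      rw [norm_smul, Real.norm_eq_abs]
      exact mul_le_mul_of_nonneg_left bV' (abs_nonneg _)
    have h2 : ‖(Mu (cmp (dshift m.q) U.ρ)).comp (Mu V.ρ)‖ ≤ Csob * K' * (Csob * k₁ * M₀) :=
      (ContinuousLinearMap.opNorm_comp_le _ _).trans
        (mul_le_mul (opNorm_Mu_le bd) bV' (norm_nonneg _) (by positivity))
    have h3 : |deriv m.q 0| * (Csob * k₁ * M₀) + Csob * K' * (Csob * k₁ * M₀) = k₂ * M₀ := by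
      rw [hk₂]; ring
    linarith

theorem exists_rate : ∃ Λ : Weights, ∃ c > 0, ∃ C : ℝ, ∀ (U V : Fields) (ϖ ϖ' : L2) (M Z μ κ : ℝ),
    Bounds U (m.fH U) (m.fG U) (m.fA U) M Z μ κ →
    Solves (m.coef μ κ) (m.ncoef μ κ) U V (m.fH U) (m.fG U) (m.fA U) →
    (∀ i j, U.τ i j = U.τ j i) → ϖ ∈ Hs 3 → nm 3 ϖ ≤ M → ‖Mu ϖ'‖ ≤ M →
    m.fH U = -(m.r₁ • ϖ + m.β • U.ρ + m.β • Mu ϖ U.ρ) →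
    rate (m.coef μ κ) (m.ncoef μ κ) Λ U V ϖ ϖ'
      ≤ -c * U.diss (μ / m.d) (κ / m.d) + C * (M * Z ^ 2) := by
  have hd := m.d_pos
  obtain ⟨c₁, hc₁, hca, hcε⟩ : ∃ c₁ > 0, c₁ ≤ m.w' * m.a ∧ c₁ ≤ m.w' * m.ε :=
    ⟨min (m.w' * m.a) (m.w' * m.ε), lt_min (mul_pos m.w'_pos m.a_pos) (mul_pos m.w'_pos m.ε_pos),
      min_le_left _ _, min_le_right _ _⟩
  obtain ⟨Λ, hw, hw', hp, ζ, hζ, c₀, hc₀, H⟩ := exists_weights (p := m.p) (a := m.a) (r₃ := m.r₃)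
    (m₀ := 1 / m.d) m.r₁_pos m.ε_pos m.c_pos m.w_nonneg m.w'_pos hc₁ (by positivity) m.r₂_eq
  obtain ⟨n, hn⟩ : ∃ n, n = (m.ncoef 0 0).size := ⟨_, rfl⟩
  obtain ⟨k₀, hk₀⟩ : ∃ k₀, k₀ = 2 * (4 + m.w + 9 * m.w') * n
        + 9 * (3 * (|m.β| * (168 * Csob + 228 * Csob ^ 2))
        + 2 * (|m.β| * (948 * Csob) + 819 * Csob) + 6 * (m.w + 9 * m.w') * n) := ⟨_, rfl⟩
  refine ⟨Λ, c₀, hc₀, 27 + k₀ + Λ.σ * (Λ.s * (60 * n) + 180 * n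
    + Λ.t * ((2 * (1 + |m.p|) ^ 2 + 54) * n)), ?_⟩
  intro U V ϖ ϖ' M Z μ κ B S hsym hϖ hϖM hϖ' hH
  have sz : (m.ncoef μ κ).size = n := hn.symm
  have h0 := rateMain_le (c₁ := c₁) B S hsym m.r₂_eq m.r₃_eq m.w_nonneg m.w'_pos.le m.a_pos.le hca
    hcε hϖ hϖM hϖ' hH
  have h1 := B.rateCrossX_le S m.r₁_pos
  have h2 := B.rateCrossY_le S m.c_pos m.r₃_nonneg hζ
  have h3 := B.ratePolymer_le S m.ε_pos m.p_mul
  rw [sz] at h0 h1 h2 h3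
  have h0' : rateMain (m.coef μ κ) (m.ncoef μ κ) U V ϖ ϖ' m.w m.w'
      ≤ -2 * (μ / m.d * U.dW + κ / m.d * U.dD + m.w * m.ε * U.dE + c₁ * U.dS)
        + (27 + k₀) * (M * Z ^ 2) := by
    refine h0.trans (le_of_eq ?_)
    rw [hk₀]
    change -2 * (μ / m.d * U.dW + κ / m.d * U.dD + m.w * m.ε * U.dE + c₁ * U.dS) + 27 * M * Z ^ 2
      + (2 * (4 + m.w + 9 * m.w') * n
        + 9 * (3 * (|m.β| * (168 * Csob + 228 * Csob ^ 2))
        + 2 * (|m.β| * (948 * Csob) + 819 * Csob) + 6 * (m.w + 9 * m.w') * n)) * (M * Z ^ 2) = _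
    ring
  have hκ : κ / m.d ≤ 2 * (1 / m.d) := by
    rw [← mul_div_assoc, mul_one]
    exact div_le_div_of_nonneg_right B.κ_le hd.le
  have := H (μ / m.d) (κ / m.d) U.dR U.dU U.dE U.dS U.dW U.dD _ _ _ _ _ _ _ _
    (div_nonneg B.μ_nonneg hd.le) (div_nonneg B.κ_nonneg hd.le)
    (div_le_div_of_nonneg_right B.μ_le hd.le) hκ U.dR_nonneg U.dU_nonneg U.dE_nonneg U.dS_nonneg
    U.dW_nonneg U.dD_nonneg h0' h1 h2 h3
  rw [rate, hw, hw', hp]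
  refine this.trans (le_of_eq ?_)
  rw [Fields.diss]
  ring

end Model

/-! ### Curves with square integrable norms -/

theorem exists_norm_le {T : ℝ} {F : ℝ → L2} (h : ContinuousOn F (Icc 0 T)) :
    ∃ K, ∀ t ∈ Icc 0 T, ‖F t‖ ≤ K := by
  obtain ⟨K, hK⟩ := (isCompact_Icc.image_of_continuousOn h).isBounded.exists_norm_le
  exact ⟨K, fun t ht => hK _ (mem_image_of_mem F ht)⟩

theorem sq_add_sum_le (x : ℝ) (y : Fin 3 → ℝ) :
    (x + ∑ i, y i) ^ 2 ≤ 4 * (x ^ 2 + ∑ i, y i ^ 2) := by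
  simp only [Fin.sum_univ_three]
  nlinarith [sq_nonneg (x - y 0), sq_nonneg (x - y 1), sq_nonneg (x - y 2),
    sq_nonneg (y 0 - y 1), sq_nonneg (y 0 - y 2), sq_nonneg (y 1 - y 2)]

theorem norm_D_sq_le_nsq (f : L2) (i : Fin 3) : ‖D i f‖ ^ 2 ≤ nsq 1 f := by
  have h : nsq 1 f = ‖f‖ ^ 2 + ∑ i, ‖D i f‖ ^ 2 := rfl
  have := Finset.single_le_sum (f := fun i => ‖D i f‖ ^ 2) (fun i _ => sq_nonneg _)
    (Finset.mem_univ i)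
  rw [h]
  linarith [sq_nonneg ‖f‖]

theorem ae_mem_one {T : ℝ} {F : ℝ → L2} (hF : ContinuousOn F (Icc 0 T)) {X : ℝ → ℝ≥0∞}
    (hX : ∫⁻ t in Ioo 0 T, X t < ⊤)
    (hXF : ∀ t ∈ Icc 0 T, X t < ⊤ → F t ∈ Hs 1 ∧ ENNReal.ofReal (nsq 1 (F t)) ≤ X t) :
    ∃ b : ℝ → ℝ, IntegrableOn b (Ioo 0 T) ∧
      ∀ᵐ t ∂(volume.restrict (Ioo 0 T)), F t ∈ Hs 1 ∧ nm 1 (F t) ^ 2 ≤ b t := by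
  obtain ⟨K, hK⟩ := exists_norm_le hF
  let S : Fin 3 → ℝ → ℝ≥0∞ := fun i t => ⨆ n, ENNReal.ofReal (‖dq i (step n) (F t)‖ ^ 2)
  have hm : ∀ i, AEMeasurable (S i) (volume.restrict (Ioo 0 T)) := fun i =>
    AEMeasurable.iSup fun n => ENNReal.measurable_ofReal.comp_aemeasurable
      ((((dq i (step n)).continuous.comp_continuousOn (hF.mono Ioo_subset_Icc_self)).norm.pow
        2).aemeasurable measurableSet_Ioo)
  have hle : ∀ i, ∀ t ∈ Ioo 0 T, S i t ≤ X t := fun i t ht => iSup_le fun n => by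
    by_cases hx : X t < ⊤
    · obtain ⟨h1, h2⟩ := hXF t (Ioo_subset_Icc_self ht) hx
      exact (ENNReal.ofReal_le_ofReal ((pow_le_pow_left₀ (norm_nonneg _)
        (norm_dq_le h1 i _) 2).trans (norm_D_sq_le_nsq _ i))).trans h2
    · rw [not_lt_top_iff.1 hx]
      exact le_top
  have hfin : ∀ i, ∫⁻ t in Ioo 0 T, S i t ≠ ⊤ := fun i =>
    ((setLIntegral_mono' measurableSet_Ioo (hle i)).trans_lt hX).ne
  refine ⟨fun t => 4 * (K ^ 2 + ∑ i, (S i t).toReal), ?_, ?_⟩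
  · exact ((integrableOn_const (by simp)).add (integrable_finsetSum _ fun i _ =>
      integrable_toReal_of_lintegral_ne_top (hm i) (hfin i))).const_mul 4
  · filter_upwards [ae_all_iff.2 fun i => ae_lt_top' (hm i) (hfin i),
      ae_restrict_mem measurableSet_Ioo] with t ht htm
    have hd : ∀ i n, ‖dq i (step n) (F t)‖ ^ 2 ≤ (S i t).toReal := fun i n =>
      (ENNReal.ofReal_le_iff_le_toReal (ht i).ne).1
        (le_iSup (fun n => ENNReal.ofReal (‖dq i (step n) (F t)‖ ^ 2)) n)
    have h1 : F t ∈ Hs 1 := mem_Hs_one_of_norm_dq_le (c := √(∑ i, (S i t).toReal)) fun i n => by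
      refine Real.le_sqrt_of_sq_le ((hd i n).trans ?_)
      exact Finset.single_le_sum (f := fun i => (S i t).toReal)
        (fun i _ => ENNReal.toReal_nonneg) (Finset.mem_univ i)
    refine ⟨h1, ?_⟩
    have h2 : ∀ i, ‖D i (F t)‖ ^ 2 ≤ (S i t).toReal := fun i =>
      le_of_tendsto (((tendsto_dq h1 i).comp tendsto_step).norm.pow 2)
        (Eventually.of_forall fun n => hd i n)
    refine (sq_add_sum_le ‖F t‖ fun i => ‖D i (F t)‖).trans ?_
    have h3 := pow_le_pow_left₀ (norm_nonneg _) (hK t (Ioo_subset_Icc_self htm)) 2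
    have h4 := Finset.sum_le_sum fun i (_ : i ∈ Finset.univ) => h2 i
    linarith

theorem nsq_D_le (m : ℕ) (f : L2) (i : Fin 3) : nsq m (D i f) ≤ nsq (m + 1) f := by
  have := Finset.single_le_sum (f := fun i => nsq m (D i f)) (fun i _ => nsq_nonneg _ _)
    (Finset.mem_univ i)
  rw [nsq_succ]
  linarith [sq_nonneg ‖f‖]

theorem ae_mem_succ {T : ℝ} {m : ℕ} {F : ℝ → L2} (hm : ∀ t ∈ Icc 0 T, F t ∈ Hs m)
    (hF : ∀ t ∈ Icc 0 T, Tendsto (fun s => nm m (F s - F t)) (𝓝[Icc 0 T] t) (𝓝 0))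
    {X : ℝ → ℝ≥0∞} (hX : ∫⁻ t in Ioo 0 T, X t < ⊤)
    (hXF : ∀ t ∈ Icc 0 T, X t < ⊤ →
      F t ∈ Hs (m + 1) ∧ ENNReal.ofReal (nsq (m + 1) (F t)) ≤ X t) :
    ∃ b : ℝ → ℝ, IntegrableOn b (Ioo 0 T) ∧
      ∀ᵐ t ∂(volume.restrict (Ioo 0 T)), F t ∈ Hs (m + 1) ∧ nm (m + 1) (F t) ^ 2 ≤ b t := by
  have hc : ContinuousOn F (Icc 0 T) := fun t ht => tendsto_of_nm (hF t ht)
  induction m generalizing F with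
  | zero => exact ae_mem_one hc hX hXF
  | succ m ih =>
    have hcD : ∀ i, ∀ t ∈ Icc 0 T,
        Tendsto (fun s => nm m (D i (F s) - D i (F t))) (𝓝[Icc 0 T] t) (𝓝 0) := by
      refine fun i t ht => squeeze_zero' (Eventually.of_forall fun s => nm_nonneg _ _) ?_ (hF t ht)
      filter_upwards [self_mem_nhdsWithin] with s hs
      rw [← D_sub (Hs_mono (by omega) (hm s hs)) (Hs_mono (by omega) (hm t ht))]
      exact nm_D_le m _ i
    have key := fun i => ih (F := fun t => D i (F t)) (fun t ht => D_mem (hm t ht) i) (hcD i)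
      (fun t ht hx => by
        obtain ⟨h1, h2⟩ := hXF t ht hx
        exact ⟨D_mem h1 i, (ENNReal.ofReal_le_ofReal (nsq_D_le (m + 1) _ i)).trans h2⟩)
      (fun t ht => tendsto_of_nm (hcD i t ht))
    choose b hb hbm using key
    obtain ⟨K, hK⟩ := exists_norm_le hc
    have hsum : IntegrableOn (fun t => ∑ i, b i t) (Ioo 0 T) :=
      integrable_finsetSum _ fun i _ => hb i
    have hK2 : IntegrableOn (fun _ => K ^ 2) (Ioo 0 T) := integrableOn_const (by simp)
    have hadd : IntegrableOn (fun t => K ^ 2 + ∑ i, b i t) (Ioo 0 T) := hK2.add hsum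
    refine ⟨fun t => 4 * (K ^ 2 + ∑ i, b i t), hadd.const_mul 4, ?_⟩
    filter_upwards [ae_all_iff.2 hbm, ae_restrict_mem measurableSet_Ioo] with t ht htm
    have htI := Ioo_subset_Icc_self htm
    refine ⟨mem_Hs_of_D (Hs_mono (by omega) (hm t htI)) fun i => (ht i).1, ?_⟩
    rw [nm_succ]
    refine (sq_add_sum_le _ _).trans ?_
    have h3 := pow_le_pow_left₀ (norm_nonneg _) (hK t htI) 2
    have h4 := Finset.sum_le_sum fun i (_ : i ∈ Finset.univ) => (ht i).2
    linarith

/-- `f` is a curve in `H^m`, with derivative `f'` in `H^n`. -/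
structure Curve (m n : ℕ) (T : ℝ) (f f' : ℝ → L2) : Prop where
  mem : ∀ t ∈ Icc 0 T, f t ∈ Hs m
  cont : ∀ t ∈ Icc 0 T, Tendsto (fun s => nm m (f s - f t)) (𝓝[Icc 0 T] t) (𝓝 0)
  mem' : ∀ t ∈ Icc 0 T, f' t ∈ Hs n
  cont' : ∀ t ∈ Icc 0 T, Tendsto (fun s => nm n (f' s - f' t)) (𝓝[Icc 0 T] t) (𝓝 0)
  slope : ∀ t ∈ Icc 0 T,
    Tendsto (fun s => nm n ((s - t)⁻¹ • (f s - f t) - f' t)) (𝓝[Icc 0 T \ {t}] t) (𝓝 0)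

/-- The square of the `H^m`-norm of `f` is integrable. -/
def SqIntegrable (m : ℕ) (T : ℝ) (f : ℝ → L2) : Prop :=
  ∃ X : ℝ → ℝ≥0∞, ∫⁻ t in Ioo 0 T, X t < ⊤ ∧
    ∀ t ∈ Icc 0 T, X t < ⊤ → f t ∈ Hs m ∧ ENNReal.ofReal (nsq m (f t)) ≤ X t

section Curves

variable {m n : ℕ} {T : ℝ} {f f' : ℝ → L2} {b b' : ℝ → ℝ}

theorem Curve.derivOn (h : Curve m n T f f') : DerivOn T f f' := by
  intro t ht
  rw [hasDerivWithinAt_iff_tendsto_slope]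
  refine tendsto_iff_norm_sub_tendsto_zero.2 (squeeze_zero (fun s => norm_nonneg _) (fun s => ?_)
    (h.slope t ht))
  rw [slope_def_module]
  exact norm_le_nm _ _

theorem exists_nm_le {F : ℝ → L2} (hm : ∀ t ∈ Icc 0 T, F t ∈ Hs m)
    (hF : ∀ t ∈ Icc 0 T, Tendsto (fun s => nm m (F s - F t)) (𝓝[Icc 0 T] t) (𝓝 0)) :
    ∃ K, ∀ t ∈ Icc 0 T, nm m (F t) ≤ K := by
  have hc : ContinuousOn (fun t => nm m (F t)) (Icc 0 T) := by
    intro t ht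
    refine tendsto_iff_norm_sub_tendsto_zero.2 (squeeze_zero' (Eventually.of_forall fun s =>
      norm_nonneg _) ?_ (hF t ht))
    filter_upwards [self_mem_nhdsWithin] with s hs
    have hst := (Hs m).sub_mem (hm s hs) (hm t ht)
    have h1 := nm_add_le hst (hm t ht)
    have h2 := nm_sub_le (hm s hs) hst
    rw [sub_add_cancel] at h1
    rw [sub_sub_cancel] at h2
    rw [Real.norm_eq_abs, abs_le]
    constructor <;> linarith
  obtain ⟨K, hK⟩ := (isCompact_Icc.image_of_continuousOn hc).isBounded.exists_norm_le
  exact ⟨K, fun t ht => (le_abs_self _).trans (hK _ (mem_image_of_mem _ ht))⟩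

theorem Curve.bounded (h : Curve m n T f f') :
    ∃ K, ∀ t ∈ Icc 0 T, nm m (f t) ≤ K ∧ nm n (f' t) ≤ K := by
  obtain ⟨K, hK⟩ := exists_nm_le h.mem h.cont
  obtain ⟨K', hK'⟩ := exists_nm_le h.mem' h.cont'
  exact ⟨max K K', fun t ht => ⟨(hK t ht).trans (le_max_left _ _),
    (hK' t ht).trans (le_max_right _ _)⟩⟩

theorem Mild.mono (h : Mild T b f f') (hb : ∀ t, b t ≤ b' t) : Mild T b' f f' where
  deriv := h.deriv
  mem := h.mem
  mem' := h.mem'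
  sq := h.sq.mono fun t ht => ht.trans (hb t)
  sq' := h.sq'.mono fun t ht => ht.trans (hb t)
  bounded := h.bounded

theorem Parabolic.mono (h : Parabolic T b f f') (hb : ∀ t, b t ≤ b' t) : Parabolic T b' f f' where
  toMild := h.toMild.mono hb
  mem4 := h.mem4
  sq4 := h.sq4.mono fun t ht => ht.trans (hb t)

theorem Curve.exists_mild (h : Curve 3 2 T f f') :
    ∃ b : ℝ → ℝ, IntegrableOn b (Ioo 0 T) ∧ (∀ t, 0 ≤ b t) ∧ Mild T b f f' := by
  obtain ⟨K, hK⟩ := h.bounded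
  refine ⟨fun _ => K ^ 2, integrableOn_const (by simp), fun _ => sq_nonneg _, h.derivOn, h.mem,
    ?_, ?_, ?_, K, fun t ht => ⟨(norm_le_nm _ _).trans (hK t ht).1,
      (norm_le_nm _ _).trans (hK t ht).2⟩⟩ <;>
  filter_upwards [ae_restrict_mem measurableSet_Ioo] with t ht
  · exact h.mem' t (Ioo_subset_Icc_self ht)
  · exact pow_le_pow_left₀ (nm_nonneg _ _) (hK t (Ioo_subset_Icc_self ht)).1 2
  · exact pow_le_pow_left₀ (nm_nonneg _ _) (hK t (Ioo_subset_Icc_self ht)).2 2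

theorem Curve.exists_parabolic (h : Curve 3 1 T f f') (h4 : SqIntegrable 4 T f)
    (h2 : SqIntegrable 2 T f') :
    ∃ b : ℝ → ℝ, IntegrableOn b (Ioo 0 T) ∧ (∀ t, 0 ≤ b t) ∧ Parabolic T b f f' := by
  obtain ⟨K, hK⟩ := h.bounded
  obtain ⟨X, hX, hXf⟩ := h4
  obtain ⟨X', hX', hXf'⟩ := h2
  obtain ⟨b, hb, hbf⟩ := ae_mem_succ h.mem h.cont hX hXf
  obtain ⟨b', hb', hbf'⟩ := ae_mem_succ h.mem' h.cont' hX' hXf'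
  refine ⟨fun t => |b t| + |b' t|, hb.abs.add hb'.abs,
    fun t => add_nonneg (abs_nonneg _) (abs_nonneg _), ⟨h.derivOn, h.mem, ?_, ?_, ?_,
    K, fun t ht => ⟨(norm_le_nm _ _).trans (hK t ht).1, (norm_le_nm _ _).trans (hK t ht).2⟩⟩, ?_, ?_⟩
  · exact hbf'.mono fun t ht => ht.1
  · refine hbf.mono fun t ht => ?_
    have := pow_le_pow_left₀ (nm_nonneg _ _) (nm_mono_succ 3 (f t)) 2
    linarith [ht.2, le_abs_self (b t), abs_nonneg (b' t)]
  · exact hbf'.mono fun t ht => by linarith [ht.2, le_abs_self (b' t), abs_nonneg (b t)]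
  · exact hbf.mono fun t ht => ht.1
  · exact hbf.mono fun t ht => by linarith [ht.2, le_abs_self (b t), abs_nonneg (b' t)]

end Curves

theorem hom_le_nm_sq {n m : ℕ} (h : n ≤ m) (f : L2) : hom n f ≤ nm m f ^ 2 := by
  refine le_trans ?_ (nsq_le_nm_sq m f)
  rw [nsq_eq_sum]
  exact Finset.single_le_sum (f := fun n => hom n f) (fun n _ => hom_nonneg _ _)
    (Finset.mem_range.2 (by omega))

theorem Fields.diss_le {U : Fields} {c μ₁ μ₂ m₀ : ℝ} (h₁ : 0 ≤ μ₁) (h₂ : 0 ≤ μ₂) (hm₁ : μ₁ ≤ m₀)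
    (hm₂ : μ₂ ≤ m₀) (hρ : nm 3 U.ρ ^ 2 ≤ c) (hu : ∀ i, nm 4 (U.u i) ^ 2 ≤ c)
    (hu4 : ∀ i, U.u i ∈ Hs 4) (hη : nm 4 U.η ^ 2 ≤ c) (hτ : ∀ i j, nm 4 (U.τ i j) ^ 2 ≤ c) :
    U.diss μ₁ μ₂ ≤ (37 + 24 * m₀) * c := by
  have hR : U.dR ≤ 2 * c := by
    have h1 := hom_le_nm_sq (n := 1) (m := 3) (by omega) U.ρ
    have h3 := hom_le_nm_sq (n := 3) (m := 3) le_rfl U.ρ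
    unfold Fields.dR
    linarith
  have hE : U.dE ≤ 2 * c := by
    have h1 := hom_le_nm_sq (n := 1) (m := 4) (by omega) U.η
    have h3 := hom_le_nm_sq (n := 4) (m := 4) le_rfl U.η
    unfold Fields.dE
    linarith
  have hU : U.dU ≤ 3 * (2 * c) := sum_le_three fun i => by
    have h1 := hom_le_nm_sq (n := 1) (m := 4) (by omega) (U.u i)
    have h3 := hom_le_nm_sq (n := 3) (m := 4) (by omega) (U.u i)
    linarith [hu i]
  have hW : U.dW ≤ 3 * (2 * c) := sum_le_three fun i => by
    have h1 := hom_le_nm_sq (n := 1) (m := 4) (by omega) (U.u i)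
    have h3 := hom_le_nm_sq (n := 4) (m := 4) le_rfl (U.u i)
    linarith [hu i]
  have hS : U.dS ≤ 3 * (3 * (3 * c)) := sum_le_three fun i => sum_le_three fun j => by
    have h0 := hom_le_nm_sq (n := 0) (m := 4) (by omega) (U.τ i j)
    have h1 := hom_le_nm_sq (n := 1) (m := 4) (by omega) (U.τ i j)
    have h3 := hom_le_nm_sq (n := 4) (m := 4) le_rfl (U.τ i j)
    linarith [hτ i j]
  have hD : U.dD ≤ 18 * c := by
    have h0 := hom_le_nm_sq (n := 0) (m := 3) (by omega) (dv U.u)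
    have h3 := hom_le_nm_sq (n := 3) (m := 3) le_rfl (dv U.u)
    have h : nm 3 (dv U.u) ^ 2 ≤ 9 * c := by
      have h1 : nm 3 (dv U.u) ≤ ∑ i, nm 4 (U.u i) :=
        (nm_sum_le _ fun l _ => D_mem (hu4 l) l).trans (Finset.sum_le_sum fun l _ => nm_D_le 3 _ l)
      have h2 : (∑ i, nm 4 (U.u i)) ^ 2 ≤ 3 * ∑ i, nm 4 (U.u i) ^ 2 := by
        simpa using sq_sum_le_card_mul_sum_sq (s := Finset.univ) (f := fun i => nm 4 (U.u i))
      have h3 := sum_le_three hu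
      exact (pow_le_pow_left₀ (nm_nonneg _ _) h1 2).trans (by linarith)
    unfold Fields.dD
    linarith
  have c0 : 0 ≤ c := (sq_nonneg _).trans hρ
  have p1 := (mul_le_mul_of_nonneg_left hW h₁).trans
    (mul_le_mul_of_nonneg_right hm₁ (by positivity))
  have p2 := (mul_le_mul_of_nonneg_left hD h₂).trans
    (mul_le_mul_of_nonneg_right hm₂ (by positivity))
  unfold Fields.diss
  linarith

/-- A strong solution as a curve in the Lebesgue space. -/
structure Model.Solution (m : Model) (T μ κ : ℝ) (U V : ℝ → Fields) : Prop where
  ρ : Curve 3 2 T (fun t => (U t).ρ) (fun t => (V t).ρ)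
  u : ∀ i, Curve 3 1 T (fun t => (U t).u i) (fun t => (V t).u i)
  η : Curve 3 1 T (fun t => (U t).η) (fun t => (V t).η)
  τ : ∀ i j, Curve 3 1 T (fun t => (U t).τ i j) (fun t => (V t).τ i j)
  u4 : ∀ i, SqIntegrable 4 T (fun t => (U t).u i)
  η4 : SqIntegrable 4 T (fun t => (U t).η)
  τ4 : ∀ i j, SqIntegrable 4 T (fun t => (U t).τ i j)
  u2 : ∀ i, SqIntegrable 2 T (fun t => (V t).u i)
  η2 : SqIntegrable 2 T (fun t => (V t).η)
  τ2 : ∀ i j, SqIntegrable 2 T (fun t => (V t).τ i j)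
  symm : ∀ t ∈ Icc 0 T, ∀ i j, (U t).τ i j = (U t).τ j i
  solves : ∀ t ∈ Icc 0 T, Solves (m.coef μ κ) (m.ncoef μ κ) (U t) (V t) (m.fH (U t)) (m.fG (U t))
    (m.fA (U t))

theorem Regular.mono {T : ℝ} {b b' : ℝ → ℝ} {U V : ℝ → Fields} (R : Regular T b U V)
    (hb : ∀ t, b t ≤ b' t) (hi : IntegrableOn b' (Ioo 0 T)) : Regular T b' U V where
  integrable := hi
  ρ := R.ρ.mono hb
  u i := (R.u i).mono hb
  η := R.η.mono hb
  τ i j := (R.τ i j).mono hb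
  ρ_mem' := R.ρ_mem'
  ρ_slope := R.ρ_slope

theorem Model.Solution.exists_regular {m : Model} {T μ κ : ℝ} {U V : ℝ → Fields}
    (S : m.Solution T μ κ U V) : ∃ b : ℝ → ℝ, (∀ t, 0 ≤ b t) ∧ Regular T b U V := by
  obtain ⟨b₀, i₀, n₀, h₀⟩ := S.ρ.exists_mild
  choose b₁ i₁ n₁ h₁ using fun i => (S.u i).exists_parabolic (S.u4 i) (S.u2 i)
  obtain ⟨b₂, i₂, n₂, h₂⟩ := S.η.exists_parabolic S.η4 S.η2
  choose b₃ i₃ n₃ h₃ using fun i j => (S.τ i j).exists_parabolic (S.τ4 i j) (S.τ2 i j)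
  have s₁ : ∀ t, 0 ≤ ∑ i, b₁ i t := fun t => Finset.sum_nonneg fun i _ => n₁ i t
  have s₃ : ∀ i t, 0 ≤ ∑ j, b₃ i j t := fun i t => Finset.sum_nonneg fun j _ => n₃ i j t
  have s₃' : ∀ t, 0 ≤ ∑ i, ∑ j, b₃ i j t := fun t => Finset.sum_nonneg fun i _ => s₃ i t
  have le₁ : ∀ i t, b₁ i t ≤ ∑ i, b₁ i t := fun i t =>
    Finset.single_le_sum (f := fun i => b₁ i t) (fun i _ => n₁ i t) (Finset.mem_univ i)
  have le₃ : ∀ i j t, b₃ i j t ≤ ∑ i, ∑ j, b₃ i j t := fun i j t =>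
    (Finset.single_le_sum (f := fun j => b₃ i j t) (fun j _ => n₃ i j t) (Finset.mem_univ j)).trans
    (Finset.single_le_sum (f := fun i => ∑ j, b₃ i j t) (fun i _ => s₃ i t) (Finset.mem_univ i))
  refine ⟨fun t => b₀ t + ∑ i, b₁ i t + b₂ t + ∑ i, ∑ j, b₃ i j t,
    fun t => by linarith [n₀ t, s₁ t, n₂ t, s₃' t], ?_, h₀.mono fun t => ?_,
    fun i => (h₁ i).mono fun t => ?_, h₂.mono fun t => ?_, fun i j => (h₃ i j).mono fun t => ?_,
    S.ρ.mem', S.ρ.slope⟩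
  · have k₁ : IntegrableOn (fun t => ∑ i, b₁ i t) (Ioo 0 T) :=
      integrable_finsetSum _ fun i _ => i₁ i
    have k₃ : IntegrableOn (fun t => ∑ i, ∑ j, b₃ i j t) (Ioo 0 T) :=
      integrable_finsetSum _ fun i _ => integrable_finsetSum _ fun j _ => i₃ i j
    exact ((i₀.add k₁).add i₂).add k₃
  · linarith [s₁ t, n₂ t, s₃' t]
  · linarith [n₀ t, le₁ i t, n₂ t, s₃' t]
  · linarith [n₀ t, s₁ t, s₃' t]
  · linarith [n₀ t, s₁ t, n₂ t, le₃ i j t]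

theorem Fields.diss_nonneg (U : Fields) {μ₁ μ₂ : ℝ} (h₁ : 0 ≤ μ₁) (h₂ : 0 ≤ μ₂) :
    0 ≤ U.diss μ₁ μ₂ := U.dR_nonneg.trans (U.diss_terms h₁ h₂).1

/-- The energy estimate for small solutions. -/
theorem Model.exists_energy (m : Model) : ∃ q > 0, ∃ c > 0, ∃ C > 0, ∃ M₁ > 0,
    ∀ (T μ κ M₀ : ℝ) (U V : ℝ → Fields), M₀ ≤ M₁ → 0 ≤ μ → μ ≤ 1 → 0 ≤ κ → κ ≤ 2 →
    m.Solution T μ κ U V → (∀ t ∈ Icc 0 T, (U t).Small M₀) →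
    ∃ E E' : ℝ → ℝ, Evol T E E' ∧
      (∀ t ∈ Icc 0 T, q * (U t).total ≤ E t ∧ E t ≤ C * (U t).total) ∧
      ∀ᵐ t ∂(volume.restrict (Ioo 0 T)), (∀ i, (U t).u i ∈ Hs 4) ∧ (U t).η ∈ Hs 4 ∧
        (∀ i j, (U t).τ i j ∈ Hs 4) ∧ E' t ≤ -c * (U t).diss (μ / m.d) (κ / m.d) := by
  have hd := m.d_pos
  obtain ⟨Λ, c, hc, CR, HR⟩ := m.exists_rate
  obtain ⟨CB, hCB, HB⟩ := m.exists_bounds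
  obtain ⟨CW, hCW, HW⟩ := m.exists_weight_bounds
  obtain ⟨M', hM', HM'⟩ := exists_pos_mul_le (CR * CB ^ 2) (half_pos hc)
  obtain ⟨M, hM0, hM1, hMM'⟩ : ∃ M > 0, M ≤ 1 ∧ M ≤ M' :=
    ⟨min 1 M', lt_min one_pos hM', min_le_left _ _, min_le_right _ _⟩
  have hMc := HM' M hM0.le hMM'
  have hw := Λ.w_nonneg
  have hw' := Λ.w'_pos
  have hσ := Λ.σ_pos
  have ht := Λ.t_pos
  refine ⟨min (1 / 4) (min (Λ.w' / 2) (Λ.σ * Λ.t / 2)),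
    lt_min (by norm_num) (lt_min (by positivity) (by positivity)), c / 2, half_pos hc,
    4 + 3 * Λ.w' + Λ.w + 2 * (Λ.σ * Λ.t), by positivity, M / (CB + CW), by positivity, ?_⟩
  intro T μ κ M₀ U V hM₀ hμ hμ1 hκ hκ2 S hS
  have h₁ : 0 ≤ μ / m.d := by positivity
  have h₂ : 0 ≤ κ / m.d := by positivity
  have hV : ∀ t ∈ Icc 0 T, (V t).ρ = m.rhsρ (U t) := fun t ht => (S.solves t ht).ρ
  have bM : ∀ t ∈ Icc 0 T, CB * M₀ ≤ M ∧ CW * M₀ ≤ M := by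
    intro t ht
    have M00 : 0 ≤ M₀ := (nm_nonneg _ _).trans (hS t ht).ρ_le
    rw [le_div_iff₀ (by positivity)] at hM₀
    have := mul_nonneg (by linarith : 0 ≤ CB) M00
    have := mul_nonneg (by linarith : 0 ≤ CW) M00
    constructor <;> linarith
  have W := fun t ht => HW (U t) (V t) M₀ M (hS t ht) (bM t ht).2 hM1 (hV t ht)
  obtain ⟨b, hb0, R⟩ := S.exists_regular
  set Z : ℝ → ℝ := fun t => √(CB ^ 2 * (U t).diss (μ / m.d) (κ / m.d)) with hZdef
  have hZ2 : ∀ t, Z t ^ 2 = CB ^ 2 * (U t).diss (μ / m.d) (κ / m.d) := fun t =>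
    Real.sq_sqrt (mul_nonneg (sq_nonneg _) ((U t).diss_nonneg h₁ h₂))
  obtain ⟨k, hk⟩ : ∃ k, k = CB ^ 2 * (37 + 24 * (2 / m.d)) := ⟨_, rfl⟩
  have hk0 : 0 ≤ k := by rw [hk]; positivity
  have R' : Regular T (fun t => (1 + k) * b t) U V :=
    R.mono (fun t => by nlinarith [mul_nonneg hk0 (hb0 t)]) (R.integrable.const_mul _)
  have hreg : ∀ᵐ t ∂(volume.restrict (Ioo 0 T)), (∀ i, (U t).u i ∈ Hs 4) ∧ (U t).η ∈ Hs 4 ∧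
      (∀ i j, (U t).τ i j ∈ Hs 4) := by
    filter_upwards [ae_all_iff.2 fun i => (R.u i).mem4, R.η.mem4,
      ae_all_iff.2 fun i => ae_all_iff.2 fun j => (R.τ i j).mem4] with t h1 h2 h3
    exact ⟨h1, h2, h3⟩
  have hB : ∀ᵐ t ∂(volume.restrict (Ioo 0 T)), Bounds (U t) (m.fH (U t)) (m.fG (U t))
      (m.fA (U t)) M (Z t) μ κ := by
    filter_upwards [hreg, ae_restrict_mem measurableSet_Ioo] with t h1 htm
    have htI := Ioo_subset_Icc_self htm
    exact HB (U t) M₀ M (Z t) μ κ (hS t htI) (bM t htI).1 hM1 hμ hμ1 hκ hκ2 h1.1 h1.2.1 h1.2.2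
      (Real.sqrt_nonneg _) (hZ2 t).ge
  have hZb : ∀ᵐ t ∂(volume.restrict (Ioo 0 T)), Z t ^ 2 ≤ (1 + k) * b t := by
    filter_upwards [hreg, R.ρ.sq, ae_all_iff.2 fun i => (R.u i).sq4, R.η.sq4,
      ae_all_iff.2 fun i => ae_all_iff.2 fun j => (R.τ i j).sq4] with t h1 h2 h3 h4 h5
    have e1 : μ / m.d ≤ 2 / m.d := div_le_div_of_nonneg_right (by linarith) hd.le
    have e2 : κ / m.d ≤ 2 / m.d := div_le_div_of_nonneg_right hκ2 hd.le
    have := mul_le_mul_of_nonneg_left (Fields.diss_le h₁ h₂ e1 e2 h2 h3 h1.1 h4 h5) (sq_nonneg CB)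
    rw [hZ2]
    refine this.trans ?_
    rw [← mul_assoc, ← hk]
    linarith [hb0 t]
  have WC : WeightCurve T M M (fun t => m.fϖ (U t)) (fun t => m.fϖ' (U t) (V t)) := by
    refine ⟨fun t ht => ?_, fun t ht => (W t ht).2.1, fun t ht => (W t ht).2.2.1,
      fun t ht => (W t ht).2.2.2.2⟩
    exact hasDerivWithinAt_Mu_cmp m.smooth_q ht (fun s hs => Hs_mono_succ (S.ρ.mem s hs))
      (S.ρ.mem' t ht) (fun s hs => (W s hs).1) (S.ρ.slope t ht)
  have hMle : ∀ t ∈ Icc 0 T, M₀ ≤ M := fun t ht =>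
    (le_mul_of_one_le_left ((nm_nonneg _ _).trans (hS t ht).ρ_le) hCB).trans (bM t ht).1
  have key := R'.evol_energy (K := m.coef μ κ) (N := m.ncoef μ κ) WC
    (fun t ht => ((hS t ht).ρ_le).trans (hMle t ht))
    (fun t ht i => ((hS t ht).u_le i).trans (hMle t ht)) hB hZb
    (fun t ht => (S.solves t ht).ρ) Λ
  refine ⟨_, _, key, fun t ht => ⟨?_, ?_⟩, ?_⟩
  · exact le_energy Λ (hS t ht).ρ_mem (hS t ht).u_mem (hS t ht).τ_mem (W t ht).2.2.2.1
  · exact energy_le Λ (hS t ht).ρ_mem (hS t ht).u_mem (hS t ht).τ_mem (W t ht).2.2.2.1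
  · filter_upwards [hreg, hB, ae_restrict_mem measurableSet_Ioo] with t h1 h2 htm
    have htI := Ioo_subset_Icc_self htm
    refine ⟨h1.1, h1.2.1, h1.2.2, ?_⟩
    refine (HR (U t) (V t) _ _ M (Z t) μ κ h2 (S.solves t htI) (S.symm t htI) (W t htI).2.1
      (W t htI).2.2.1 (W t htI).2.2.2.2 (m.fH_eq (W t htI).1)).trans ?_
    have e := mul_le_mul_of_nonneg_right hMc ((U t).diss_nonneg h₁ h₂)
    rw [hZ2]
    linarith

/-! ### Functions and their classes in `L²` -/

open Classical in
/-- The class of a function in `L²` (and `0` if it is not square integrable). -/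
def cls (f : Space → ℝ) : L2 := if h : MemLp f 2 volume then h.toLp f else 0

theorem coe_cls {f : Space → ℝ} (h : MemLp f 2 volume) : (cls f : Space → ℝ) =ᵐ[volume] f := by
  rw [cls, dif_pos h]
  exact h.coeFn_toLp

theorem cls_eq {f : Space → ℝ} {F : L2} (h : f =ᵐ[volume] F) : cls f = F := by
  have hm : MemLp f 2 volume := (memLp_congr_ae h).2 (Lp.memLp F)
  exact Lp.ext ((coe_cls hm).trans h)

theorem cls_sub {f g : Space → ℝ} (hf : MemLp f 2 volume) (hg : MemLp g 2 volume) :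
    cls (f - g) = cls f - cls g :=
  cls_eq (((coe_cls hf).symm.sub (coe_cls hg).symm).trans (Lp.coeFn_sub _ _).symm)

theorem cls_smul {f : Space → ℝ} (hf : MemLp f 2 volume) (c : ℝ) : cls (c • f) = c • cls f :=
  cls_eq (((coe_cls hf).symm.const_smul c).trans (Lp.coeFn_smul _ _).symm)

theorem IsWeakPartial.isD {i : Fin 3} {f g : Space → ℝ} (h : IsWeakPartial i f g)
    (hf : MemLp f 2 volume) (hg : MemLp g 2 volume) : IsD i (cls f) (cls g) := by
  intro φ
  rw [L2.inner_test, L2.inner_test]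
  have e1 : ∫ x, cls f x * φ.d i x = ∫ x, f x * fderiv ℝ φ x (EuclideanSpace.single i 1) :=
    integral_congr_ae ((coe_cls hf).mono fun x hx => by simp only [hx, Test.d_apply])
  have e2 : ∫ x, cls g x * φ x = ∫ x, g x * φ x :=
    integral_congr_ae ((coe_cls hg).mono fun x hx => by simp only [hx])
  rw [e1, e2]
  exact h.2.2 φ φ.smooth φ.compact

theorem IsD.isWeakPartial {i : Fin 3} {f : Space → ℝ} {F G : L2} (h : IsD i F G)
    (hf : f =ᵐ[volume] F) : IsWeakPartial i f G := by
  refine ⟨(locallyIntegrable_L2 F).congr hf.symm, locallyIntegrable_L2 G, fun φ h1 h2 => ?_⟩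
  have e := h ⟨φ, h1, h2⟩
  rw [L2.inner_test, L2.inner_test] at e
  refine Eq.trans (integral_congr_ae (hf.mono fun x hx => ?_)) e
  simp only [hx, Test.d_apply]

theorem IsWeakPartial.unique {i : Fin 3} {f g g' : Space → ℝ} (h : IsWeakPartial i f g)
    (h' : IsWeakPartial i f g') : g =ᵐ[volume] g' := by
  refine ae_eq_of_integral_contDiff_smul_eq h.2.1 h'.2.1 fun φ h1 h2 => ?_
  have e := h.2.2 φ h1 h2
  rw [h'.2.2 φ h1 h2, neg_inj] at e
  simp only [smul_eq_mul, mul_comm (φ _)]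
  exact e.symm

theorem isWeakPartial_weakPartial {i : Fin 3} {f : Space → ℝ} (h : ∃ g, IsWeakPartial i f g) :
    IsWeakPartial i f (weakPartial i f) := by
  rw [weakPartial, dif_pos h]
  exact h.choose_spec

theorem weakPartial_ae {f : Space → ℝ} {F : L2} (hf : f =ᵐ[volume] F) (hF : F ∈ Hs 1) (i : Fin 3) :
    weakPartial i f =ᵐ[volume] D i F :=
  (isWeakPartial_weakPartial ⟨_, (isD_of_mem hF i).isWeakPartial hf⟩).unique
    ((isD_of_mem hF i).isWeakPartial hf)

theorem eLpNorm_sq {f : Space → ℝ} {F : L2} (hf : f =ᵐ[volume] F) :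
    eLpNorm f 2 volume ^ 2 = ENNReal.ofReal (‖F‖ ^ 2) := by
  rw [eLpNorm_congr_ae hf, ENNReal.ofReal_pow (norm_nonneg _), Lp.norm_def,
    ENNReal.ofReal_toReal (Lp.eLpNorm_ne_top F)]

theorem sobSq_eq {m : ℕ} {f : Space → ℝ} {F : L2} (hf : f =ᵐ[volume] F) (hF : F ∈ Hs m) :
    sobSq m f = ENNReal.ofReal (nsq m F) := by
  induction m generalizing f F with
  | zero => exact eLpNorm_sq hf
  | succ m ih =>
    have h1 : F ∈ Hs 1 := Hs_mono (by omega) hF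
    have hw := fun i => weakPartial_ae hf h1 i
    rw [sobSq, if_pos fun i => ⟨_, (isD_of_mem h1 i).isWeakPartial hf⟩, eLpNorm_sq hf, nsq_succ,
      ENNReal.ofReal_add (sq_nonneg _) (Finset.sum_nonneg fun i _ => nsq_nonneg _ _),
      ENNReal.ofReal_sum_of_nonneg fun i _ => nsq_nonneg _ _]
    exact congrArg _ (Finset.sum_congr rfl fun i _ => ih (hw i) (D_mem hF i))

theorem memLp_of_sobSq {m : ℕ} {f : Space → ℝ} (hf : AEStronglyMeasurable f volume)
    (h : sobSq m f < ⊤) : MemLp f 2 volume := by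
  refine ⟨hf, ?_⟩
  have h2 : eLpNorm f 2 volume ^ 2 < ⊤ := by
    cases m with
    | zero => exact h
    | succ m =>
      rw [sobSq] at h
      split_ifs at h with hd
      · exact lt_of_le_of_lt le_self_add h
      · exact absurd h (lt_irrefl _)
  exact (ENNReal.pow_lt_top_iff.1 h2).resolve_right (by norm_num)

theorem cls_mem {m : ℕ} {f : Space → ℝ} (hf : AEStronglyMeasurable f volume)
    (h : sobSq m f < ⊤) : cls f ∈ Hs m := by
  induction m generalizing f with
  | zero => exact mem_Hs_zero _
  | succ m ih =>
    have hm := memLp_of_sobSq hf h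
    rw [sobSq] at h
    split_ifs at h with hd
    · intro i
      have hi := isWeakPartial_weakPartial (hd i)
      have hs : sobSq m (weakPartial i f) < ⊤ :=
        (ENNReal.sum_lt_top.1 (lt_of_le_of_lt le_add_self h)) i (Finset.mem_univ i)
      have ha : AEStronglyMeasurable (weakPartial i f) volume := hi.2.1.aestronglyMeasurable
      exact ⟨cls (weakPartial i f), ih ha hs, hi.isD hm (memLp_of_sobSq ha hs)⟩
    · exact absurd h (lt_irrefl _)

theorem MemH.memLp {m : ℕ} {f : Space → ℝ} (h : MemH m f) : MemLp f 2 volume :=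
  memLp_of_sobSq h.1 h.2

theorem MemH.mem {m : ℕ} {f : Space → ℝ} (h : MemH m f) : cls f ∈ Hs m := cls_mem h.1 h.2

theorem MemH.coe {m : ℕ} {f : Space → ℝ} (h : MemH m f) : f =ᵐ[volume] cls f :=
  (coe_cls h.memLp).symm

theorem MemH.sobSq {m : ℕ} {f : Space → ℝ} (h : MemH m f) :
    sobSq m f = ENNReal.ofReal (nsq m (cls f)) := sobSq_eq h.coe h.mem

theorem tendsto_nm_of_nsq {ι : Type*} {l : Filter ι} {m : ℕ} {F : ι → L2}
    (h : Tendsto (fun s => ENNReal.ofReal (nsq m (F s))) l (𝓝 0)) :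
    Tendsto (fun s => nm m (F s)) l (𝓝 0) := by
  have h1 : Tendsto (fun s => nsq m (F s)) l (𝓝 0) := by
    have := (ENNReal.continuousAt_toReal ENNReal.zero_ne_top).tendsto.comp h
    simpa only [Function.comp_def, ENNReal.toReal_ofReal (nsq_nonneg _ _), ENNReal.toReal_zero]
      using this
  have h2 : Tendsto (fun s => √(4 ^ m * nsq m (F s))) l (𝓝 0) := by
    simpa using (h1.const_mul ((4 : ℝ) ^ m)).sqrt
  exact squeeze_zero (fun _ => nm_nonneg _ _)
    (fun s => Real.le_sqrt_of_sq_le (nm_sq_le_nsq m (F s))) h2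

theorem tendsto_nm_cls {ι : Type*} {l : Filter ι} {m : ℕ} {F : ι → Space → ℝ} {G : ι → L2}
    (hF : ∀ᶠ s in l, F s =ᵐ[volume] G s) (hG : ∀ᶠ s in l, G s ∈ Hs m)
    (h : Tendsto (fun s => sobSq m (F s)) l (𝓝 0)) : Tendsto (fun s => nm m (G s)) l (𝓝 0) := by
  refine tendsto_nm_of_nsq (h.congr' ?_)
  filter_upwards [hF, hG] with s h1 h2 using sobSq_eq h1 h2

theorem ContH.cont {m : ℕ} {T : ℝ} {f : ℝ → Space → ℝ} (h : ContH m T f) :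
    ∀ t ∈ Icc 0 T, Tendsto (fun s => nm m (cls (f s) - cls (f t))) (𝓝[Icc 0 T] t) (𝓝 0) := by
  intro t ht
  refine tendsto_nm_cls ?_ ?_ (h.2 t ht) <;> filter_upwards [self_mem_nhdsWithin] with s hs
  · exact ((h.1 s hs).coe.sub (h.1 t ht).coe).trans (Lp.coeFn_sub _ _).symm
  · exact (Hs m).sub_mem (h.1 s hs).mem (h.1 t ht).mem

theorem HasTimeDerivH.curve {m n : ℕ} (hmn : n ≤ m) {T : ℝ} {f g : ℝ → Space → ℝ}
    (h : ContH m T f) (hd : HasTimeDerivH n T f g) :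
    Curve m n T (fun t => cls (f t)) (fun t => cls (g t)) where
  mem t ht := (h.1 t ht).mem
  cont := h.cont
  mem' t ht := (hd.1.1 t ht).mem
  cont' := hd.1.cont
  slope := by
    intro t ht
    refine tendsto_nm_cls ?_ ?_ (hd.2 t ht) <;> filter_upwards [self_mem_nhdsWithin] with s hs
    · have e : (s - t)⁻¹ • (cls (f s) - cls (f t)) - cls (g t)
          = cls ((s - t)⁻¹ • (f s - f t) - g t) := by
        have m1 := (h.1 s hs.1).memLp
        have m2 := (h.1 t ht).memLp
        rw [cls_sub ((m1.sub m2).const_smul _) (hd.1.1 t ht).memLp, cls_smul (m1.sub m2),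
          cls_sub m1 m2]
      rw [e]
      exact (coe_cls ((((h.1 s hs.1).memLp.sub (h.1 t ht).memLp).const_smul _).sub
        (hd.1.1 t ht).memLp)).symm
    · exact (Hs n).sub_mem ((Hs n).smul_mem _ (Hs_mono hmn ((Hs m).sub_mem (h.1 s hs.1).mem
        (h.1 t ht).mem))) (hd.1.1 t ht).mem

theorem SqIntegrableH.sqIntegrable {m n : ℕ} {T : ℝ} {f : ℝ → Space → ℝ}
    (h : SqIntegrableH m T f) (hc : ContH n T f) : SqIntegrable m T (fun t => cls (f t)) := by
  refine ⟨fun t => sobSq m (f t), h, fun t ht hx => ?_⟩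
  have h1 := cls_mem (hc.1 t ht).1 hx
  exact ⟨h1, (sobSq_eq (hc.1 t ht).coe h1).ge⟩

/-- The classes of the unknowns in `L²`. -/
def State.fields (U : State) : Fields :=
  ⟨cls U.ρ, fun i => cls (U.u i), cls U.η, fun i j => cls (U.τ i j)⟩

/-- All unknowns are in `H³`. -/
structure State.MemH3 (U : State) : Prop where
  ρ : MemH 3 U.ρ
  u : ∀ i, MemH 3 (U.u i)
  η : MemH 3 U.η
  τ : ∀ i j, MemH 3 (U.τ i j)

namespace State.MemH3

variable {U : State} (h : U.MemH3)
include h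

theorem normSq : U.normSq 3 = ENNReal.ofReal (nsq 3 U.fields.ρ + ∑ i, nsq 3 (U.fields.u i)
    + nsq 3 U.fields.η + ∑ i, ∑ j, nsq 3 (U.fields.τ i j)) := by
  have hs : ∀ {F : Fin 3 → ℝ}, (∀ i, 0 ≤ F i) → 0 ≤ ∑ i, F i := fun h =>
    Finset.sum_nonneg fun i _ => h i
  have n3 := nsq_nonneg 3
  rw [State.normSq, h.ρ.sobSq, h.η.sobSq, ENNReal.ofReal_add, ENNReal.ofReal_add,
    ENNReal.ofReal_add, ENNReal.ofReal_sum_of_nonneg, ENNReal.ofReal_sum_of_nonneg]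
  · simp only [fun i => (h.u i).sobSq, fun i j => (h.τ i j).sobSq, State.fields]
    simp only [ENNReal.ofReal_sum_of_nonneg fun i _ => n3 _]
  all_goals first
    | exact n3 _
    | exact fun _ _ => n3 _
    | exact fun _ _ => hs fun _ => n3 _
    | exact hs fun _ => n3 _
    | exact hs fun _ => hs fun _ => n3 _
    | exact add_nonneg (n3 _) (hs fun _ => n3 _)
    | exact add_nonneg (add_nonneg (n3 _) (hs fun _ => n3 _)) (n3 _)

end State.MemH3

/-! ### The coefficients of the system -/

/-- A smooth function which is the identity near `0` and stays close to `0`. -/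
theorem exists_truncation {d : ℝ} (hd : 0 < d) : ∃ χ : ℝ → ℝ, ContDiff ℝ ∞ χ ∧
    (∀ s, |s| ≤ d / 2 → χ s = s) ∧ ∀ s, |χ s| < d := by
  let φ : ContDiffBump (0 : ℝ) := ⟨d / 2, 3 * d / 4, by positivity, by linarith⟩
  refine ⟨fun s => φ s * s, φ.contDiff.mul contDiff_id, fun s hs => ?_, fun s => ?_⟩
  · change φ s * s = s
    rw [φ.one_of_mem_closedBall (by simpa using hs), one_mul]
  · change |φ s * s| < d
    by_cases h : |s| < 3 * d / 4
    · rw [abs_mul, abs_of_nonneg φ.nonneg]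
      exact lt_of_le_of_lt (mul_le_of_le_one_left (abs_nonneg _) φ.le_one) (by linarith)
    · have : φ s = 0 := φ.zero_of_le_dist (by simpa using not_lt.1 h)
      rw [this, zero_mul, abs_zero]
      exact hd

namespace Params

variable (P : Params)

theorem dPressure_eq (s : ℝ) : P.dPressure s = P.a * (P.γ * s ^ (P.γ - 1)) :=
  ((Real.hasDerivAt_rpow_const (Or.inr P.one_lt_γ.le)).const_mul P.a).deriv

theorem dPressure_pos : 0 < P.dPressure P.ρt := by
  rw [dPressure_eq]
  have := P.a_pos
  have := P.one_lt_γ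
  have := Real.rpow_pos_of_pos P.ρt_pos (P.γ - 1)
  positivity

theorem r₁_pos : 0 < P.r₁ := Real.sqrt_pos.2 P.dPressure_pos

theorem r₃_pos : 0 < P.r₃ := one_div_pos.2 P.r₁_pos

theorem β_pos : 0 < P.β := div_pos P.r₁_pos P.ρt_pos

theorem κ_nonneg : 0 ≤ P.κ :=
  add_nonneg (mul_nonneg P.k_pos.le (sub_nonneg.2 P.one_le_L))
    (mul_nonneg (mul_nonneg two_pos.le P.z_nonneg) P.ηt_pos.le)

theorem h_zero : P.h 0 = 0 := by simp [h]

theorem g_zero : P.g 0 = 0 := by simp [g]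

theorem contDiffAt_h {s : ℝ} (hs : 0 < s + P.ρt) : ContDiffAt ℝ ∞ P.h s := by
  have h1 : ContDiffAt ℝ ∞ (fun s => s + P.ρt) s := contDiffAt_id.add contDiffAt_const
  have h2 : ContDiffAt ℝ ∞ (fun s => P.a * (P.γ * (s + P.ρt) ^ (P.γ - 1))) s :=
    contDiffAt_const.mul (contDiffAt_const.mul
      (ContDiffAt.comp (g := fun x : ℝ => x ^ (P.γ - 1)) s
        (Real.contDiffAt_rpow_const_of_ne hs.ne') h1))
  unfold h
  simp only [dPressure_eq]
  exact (contDiffAt_const.sub (h2.div h1 hs.ne')).mul contDiffAt_const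

theorem contDiffAt_g {s : ℝ} (hs : 0 < s + P.ρt) : ContDiffAt ℝ ∞ P.g s := by
  have h1 : ContDiffAt ℝ ∞ (fun s => s + P.ρt) s := contDiffAt_id.add contDiffAt_const
  exact (contDiffAt_const.sub (contDiffAt_const.div h1 hs.ne')).mul contDiffAt_const

theorem r₁_add_pos {s : ℝ} (hs : 0 < s + P.ρt) : 0 < P.r₁ + P.β * s := by
  have : P.r₁ + P.β * s = P.β * (s + P.ρt) := by
    have h := P.ρt_pos.ne'
    have e : P.β * P.ρt = P.r₁ := div_mul_cancel₀ _ h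
    rw [← e]; ring
  rw [this]
  exact mul_pos P.β_pos hs

/-- The truncation used to extend the coefficients. -/
def trunc : ℝ → ℝ := (exists_truncation P.ρt_pos).choose

theorem trunc_contDiff : ContDiff ℝ ∞ P.trunc := (exists_truncation P.ρt_pos).choose_spec.1

theorem trunc_eq {s : ℝ} (hs : |s| ≤ P.ρt / 2) : P.trunc s = s :=
  (exists_truncation P.ρt_pos).choose_spec.2.1 s hs

theorem trunc_add_pos (s : ℝ) : 0 < P.trunc s + P.ρt := by
  have := (abs_lt.1 ((exists_truncation P.ρt_pos).choose_spec.2.2 s)).1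
  change -P.ρt < P.trunc s at this
  linarith

theorem trunc_zero : P.trunc 0 = 0 := P.trunc_eq (by rw [abs_zero]; exact (half_pos P.ρt_pos).le)

theorem smooth₀_comp_trunc {f : ℝ → ℝ} (hf : ∀ s, 0 < s + P.ρt → ContDiffAt ℝ ∞ f s)
    (h0 : f 0 = 0) : Smooth₀ fun s => f (P.trunc s) where
  smooth := contDiff_iff_contDiffAt.2 fun s =>
    (hf _ (P.trunc_add_pos s)).comp s P.trunc_contDiff.contDiffAt
  zero := by rw [P.trunc_zero, h0]

/-- The coefficients of the system. -/
def model : Model where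
  r₁ := P.r₁
  r₂ := P.r₂
  r₃ := P.r₃
  b := P.β * P.ηt
  ε := P.ε
  a := P.A₀ / (2 * P.lam)
  c := P.β * P.k * P.ηt
  β := P.β
  k := P.k
  α := P.κ
  e₁ := -(2 * P.z / (P.β * P.ρt))
  e₂ := 2 * P.z
  d := P.ρt
  w := P.r₂ / (P.β * P.ηt)
  w' := P.r₃ / (2 * (P.β * P.k * P.ηt))
  p := P.ηt / P.ρt
  R₀ := P.ρt / 2
  h := fun s => P.h (P.trunc s)
  g := fun s => P.g (P.trunc s)
  q := fun s => (-P.h (P.trunc s) - P.β * P.trunc s) / (P.r₁ + P.β * P.trunc s)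
  r₁_pos := P.r₁_pos
  r₃_nonneg := P.r₃_pos.le
  ε_pos := P.ε_pos
  a_pos := div_pos P.A₀_pos (mul_pos two_pos P.lam_pos)
  c_pos := mul_pos (mul_pos P.β_pos P.k_pos) P.ηt_pos
  d_pos := P.ρt_pos
  R₀_pos := half_pos P.ρt_pos
  w_nonneg := div_nonneg (div_nonneg P.κ_nonneg P.r₁_pos.le) (mul_pos P.β_pos P.ηt_pos).le
  w'_pos := div_pos P.r₃_pos (mul_pos two_pos (mul_pos (mul_pos P.β_pos P.k_pos) P.ηt_pos))
  r₂_eq := (div_mul_cancel₀ _ (mul_pos P.β_pos P.ηt_pos).ne').symm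
  r₃_eq := by
    have h : ∀ x y : ℝ, y ≠ 0 → x = 2 * (x / (2 * y)) * y := fun x y hy => by field_simp
    exact h _ _ (mul_pos (mul_pos P.β_pos P.k_pos) P.ηt_pos).ne'
  p_mul := by
    change P.ηt / P.ρt * P.r₁ = P.r₁ / P.ρt * P.ηt
    ring
  smooth_h := P.smooth₀_comp_trunc (fun _ hs => P.contDiffAt_h hs) P.h_zero
  smooth_g := P.smooth₀_comp_trunc (fun _ hs => P.contDiffAt_g hs) P.g_zero
  smooth_q := P.smooth₀_comp_trunc (f := fun s => (-P.h s - P.β * s) / (P.r₁ + P.β * s))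
    (fun s hs => ((P.contDiffAt_h hs).neg.sub (contDiffAt_const.mul contDiffAt_id)).div
      (contDiffAt_const.add (contDiffAt_const.mul contDiffAt_id)) (P.r₁_add_pos hs).ne')
    (by simp [P.h_zero])
  weight := by
    intro s hs
    have h1 := (P.r₁_add_pos (P.trunc_add_pos s)).ne'
    rw [P.trunc_eq hs] at h1 ⊢
    field_simp
    ring

end Params

/-! ### The equations in `L²` -/

/-- `F` is the class of `f`. -/
def Rep (f : Space → ℝ) (F : L2) : Prop := f =ᵐ[volume] F

namespace Rep

variable {f g : Space → ℝ} {F G : L2}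

theorem add (hf : Rep f F) (hg : Rep g G) : Rep (fun x => f x + g x) (F + G) :=
  (EventuallyEq.add hf hg).trans (Lp.coeFn_add _ _).symm

theorem sub (hf : Rep f F) (hg : Rep g G) : Rep (fun x => f x - g x) (F - G) :=
  (EventuallyEq.sub hf hg).trans (Lp.coeFn_sub _ _).symm

theorem smul (hf : Rep f F) (c : ℝ) : Rep (fun x => c * f x) (c • F) :=
  (EventuallyEq.const_smul hf c).trans (Lp.coeFn_smul _ _).symm

theorem mul (hf : Rep f F) (hg : Rep g G) {K : ℝ} (hK : Bdd F K) :
    Rep (fun x => f x * g x) (Mu F G) :=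
  (EventuallyEq.mul hf hg).trans (coe_Mu hK G).symm

theorem sum {f : Fin 3 → Space → ℝ} {F : Fin 3 → L2} (h : ∀ i, Rep (f i) (F i)) :
    Rep (fun x => ∑ i, f i x) (∑ i, F i) := by
  simp only [Fin.sum_univ_three]
  exact ((h 0).add (h 1)).add (h 2)

theorem eq (hf : Rep f F) (hg : Rep g G) (h : ∀ᵐ x, f x = g x) : F = G :=
  Lp.ext ((hf.symm.trans h).trans hg)

theorem weak (hf : Rep f F) (hF : F ∈ Hs 1) (i : Fin 3) : Rep (weakPartial i f) (D i F) :=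
  weakPartial_ae hf hF i

theorem divergence {v : Fin 3 → Space → ℝ} {V : Fin 3 → L2} (h : ∀ i, Rep (v i) (V i))
    (hV : ∀ i, V i ∈ Hs 1) : Rep (divergence v) (dv V) :=
  Rep.sum fun i => (h i).weak (hV i) i

theorem laplacian (hf : Rep f F) (hF : F ∈ Hs 2) : Rep (laplacian f) (lap F) :=
  Rep.sum fun i => (hf.weak (Hs_mono_succ hF) i).weak (D_mem hF i) i

theorem divergence_mul {v : Fin 3 → Space → ℝ} {V : Fin 3 → L2} (hf : Rep f F)
    (h : ∀ i, Rep (v i) (V i)) (hF : F ∈ Hs 3) (hV : ∀ i, V i ∈ Hs 3) :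
    Rep (OldroydB.divergence fun i y => f y * v i y) (Mu F (dv V) + ∑ l, Mu (V l) (D l F)) := by
  have hF2 : F ∈ Hs 2 := Hs_mono_succ hF
  have hV2 : ∀ i, V i ∈ Hs 2 := fun i => Hs_mono_succ (hV i)
  have h1 : ∀ i, Rep (weakPartial i fun y => f y * v i y) (D i (Mu F (V i))) := fun i =>
    (hf.mul (h i) (bdd_of_mem hF2)).weak (Mu_mem_one hF2 (Hs_mono_succ (hV2 i))) i
  have h2 := Rep.sum h1
  have e : Mu F (dv V) + ∑ l, Mu (V l) (D l F) = ∑ i, D i (Mu F (V i)) := by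
    rw [dv, map_sum, ← Finset.sum_add_distrib]
    exact Finset.sum_congr rfl fun i _ => (D_Mu' hF2 (hV2 i) i).symm
  rw [e]
  exact h2

end Rep

section Rearrange

variable {E : Type*} [AddCommGroup E] [Module ℝ E] {v d N x y z t s q : E} {a b c e f : ℝ}

theorem solve_mass (h : v + a • d = N) : v = -a • d + N := by
  rw [← h]; module

theorem solve_momentum (h : v + a • x + b • y - c • z - e • t - f • s = N) :
    v = (-a • x - b • y + c • z + e • t + f • s) + N := by
  rw [← h]; module

theorem solve_polymer (h : v + a • d - e • t = N) : v = (-a • d + e • t) + N := by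
  rw [← h]; module

theorem solve_stress (h : v + a • x - e • t - c • (s + q) = N) :
    v = (-a • x + e • t + c • (s + q)) + N := by
  rw [← h]; module


end Rearrange

namespace State

variable {P : Params} {μ ν : ℝ} {U V : State}

theorem MemH3.rep_div (hU : U.MemH3) : Rep (divergence U.u) (dv U.fields.u) :=
  Rep.divergence (fun i => (hU.u i).coe) fun i => Hs_mono (by omega) (hU.u i).mem

theorem SolvesAt.eq_ρ (h : SolvesAt P μ ν U V) (hU : U.MemH3) (hV : MemLp V.ρ 2 volume) :
    V.fields.ρ = (P.model.coef μ (μ + ν)).linR U.fields.u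
      + (P.model.ncoef μ (μ + ν)).nlR U.fields := by
  have r0 : Rep V.ρ V.fields.ρ := (coe_cls hV).symm
  have r1 := Rep.divergence_mul hU.ρ.coe (fun i => (hU.u i).coe) hU.ρ.mem (fun i => (hU.u i).mem)
  exact solve_mass ((r0.add (hU.rep_div.smul P.r₁)).eq (r1.smul (-P.β)) h.mass)

theorem SolvesAt.eq_η (h : SolvesAt P μ ν U V) (hU : U.MemH3) (hV : MemLp V.η 2 volume) :
    V.fields.η = (P.model.coef μ (μ + ν)).linE U.fields.u U.fields.η
      + (P.model.ncoef μ (μ + ν)).nlE U.fields := by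
  have r0 : Rep V.η V.fields.η := (coe_cls hV).symm
  have r1 := Rep.divergence_mul hU.η.coe (fun i => (hU.u i).coe) hU.η.mem (fun i => (hU.u i).mem)
  have r2 := Rep.laplacian hU.η.coe (Hs_mono_succ hU.η.mem)
  exact solve_polymer (((r0.add (hU.rep_div.smul (P.β * P.ηt))).sub (r2.smul P.ε)).eq
    (r1.smul (-P.β)) h.polymer)

theorem SolvesAt.eq_τ (h : SolvesAt P μ ν U V) (hU : U.MemH3) (i j : Fin 3)
    (hV : MemLp (V.τ i j) 2 volume) :
    V.fields.τ i j = (P.model.coef μ (μ + ν)).linS U.fields.u U.fields.τ i j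
      + (P.model.ncoef μ (μ + ν)).nlS U.fields i j := by
  have r0 : Rep (V.τ i j) (V.fields.τ i j) := (coe_cls hV).symm
  have ru : ∀ i, Rep (U.u i) (U.fields.u i) := fun i => (hU.u i).coe
  have rτ : ∀ i j, Rep (U.τ i j) (U.fields.τ i j) := fun i j => (hU.τ i j).coe
  have rη : Rep U.η U.fields.η := hU.η.coe
  have mu : ∀ i, U.fields.u i ∈ Hs 1 := fun i => Hs_mono (by omega) (hU.u i).mem
  have bη : Bdd U.fields.η (Csob * nm 2 U.fields.η) := bdd_of_mem (Hs_mono_succ hU.η.mem)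
  have bτ : ∀ i j, Bdd (U.fields.τ i j) (Csob * nm 2 (U.fields.τ i j)) := fun i j =>
    bdd_of_mem (Hs_mono_succ (hU.τ i j).mem)
  have rs := ((ru i).weak (mu i) j).add ((ru j).weak (mu j) i)
  have r1 := (Rep.divergence_mul (rτ i j) ru (hU.τ i j).mem (fun i => (hU.u i).mem)).smul (-P.β)
  have r2 := Rep.laplacian (rτ i j) (Hs_mono_succ (hU.τ i j).mem)
  have r3 := (Rep.sum fun l => ((rτ l j).mul ((ru i).weak (mu i) l) (bτ l j)).add
    ((rτ i l).mul ((ru j).weak (mu j) l) (bτ i l))).smul P.β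
  have r4 := ((rη.mul ((ru i).weak (mu i) j) bη).add (rη.mul ((ru j).weak (mu j) i) bη)).smul
    (P.β * P.k)
  refine solve_stress ((((r0.add ((rτ i j).smul (P.A₀ / (2 * P.lam)))).sub (r2.smul P.ε)).sub
    (rs.smul (P.β * P.k * P.ηt))).eq ((r1.add r3).add r4) ?_)
  filter_upwards [h.stress i j] with x hx
  refine hx.trans ?_
  have e1 : (fun l y => U.u l y * U.τ i j y) = fun l y => U.τ i j y * U.u l y := by
    funext l y; ring
  have e2 : ∀ l, weakPartial l (U.u i) x * U.τ l j x + U.τ i l x * weakPartial l (U.u j) x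
      = U.τ l j x * weakPartial l (U.u i) x + U.τ i l x * weakPartial l (U.u j) x := fun l => by ring
  simp only [S₄, symGrad, e1, e2]
  ring

theorem SolvesAt.eq_u (h : SolvesAt P μ ν U V) (hU : U.MemH3) (i : Fin 3)
    (hV : MemLp (V.u i) 2 volume) (hρ : Bdd U.fields.ρ P.model.R₀) :
    V.fields.u i = (P.model.coef μ (μ + ν)).linU U.fields.ρ U.fields.u U.fields.η U.fields.τ i
      + (P.model.ncoef μ (μ + ν)).nlU U.fields (P.model.fH U.fields) (P.model.fG U.fields)
        (P.model.fA U.fields) i := by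
  have r0 : Rep (V.u i) (V.fields.u i) := (coe_cls hV).symm
  have rρ : Rep U.ρ U.fields.ρ := hU.ρ.coe
  have rη : Rep U.η U.fields.η := hU.η.coe
  have ru : ∀ i, Rep (U.u i) (U.fields.u i) := fun i => (hU.u i).coe
  have rτ : ∀ j, Rep (U.τ i j) (U.fields.τ i j) := fun j => (hU.τ i j).coe
  have h1 : ∀ {F : L2}, F ∈ Hs 3 → F ∈ Hs 1 := fun h => Hs_mono (by omega) h
  have bu : ∀ i, Bdd (U.fields.u i) (Csob * nm 2 (U.fields.u i)) := fun i =>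
    bdd_of_mem (Hs_mono_succ (hU.u i).mem)
  have bη : Bdd U.fields.η (Csob * nm 2 U.fields.η) := bdd_of_mem (Hs_mono_succ hU.η.mem)
  have hev : ∀ᵐ x, |U.ρ x| ≤ P.ρt / 2 := by
    filter_upwards [rρ, hρ] with x hx hx'
    rw [hx]
    exact hx'
  have rH : Rep (fun x => P.h (U.ρ x)) (P.model.fH U.fields) := by
    refine EventuallyEq.symm ((coe_cmp P.model.smooth_h hρ).trans ?_)
    filter_upwards [rρ, hev] with x hx hx'
    change P.h (P.trunc (U.fields.ρ x)) = P.h (U.ρ x)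
    rw [← hx, P.trunc_eq hx']
  have rG : Rep (fun x => P.g (U.ρ x)) (P.model.fG U.fields) := by
    refine EventuallyEq.symm ((coe_cmp P.model.smooth_g hρ).trans ?_)
    filter_upwards [rρ, hev] with x hx hx'
    change P.g (P.trunc (U.fields.ρ x)) = P.g (U.ρ x)
    rw [← hx, P.trunc_eq hx']
  have bH : ∃ K, Bdd (P.model.fH U.fields) K := by
    obtain ⟨K, -, hK⟩ := norm_cmp_le P.model.smooth_h P.model.R₀
    exact ⟨_, (hK _ hρ).2 _ hρ⟩
  have bG : ∃ K, Bdd (P.model.fG U.fields) K := by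
    obtain ⟨K, -, hK⟩ := norm_cmp_le P.model.smooth_g P.model.R₀
    exact ⟨_, (hK _ hρ).2 _ hρ⟩
  obtain ⟨KH, bH⟩ := bH
  obtain ⟨KG, bG⟩ := bG
  have rA := ((rG.smul P.κ).add (rη.smul (-(2 * P.z / (P.β * P.ρt))))).add
    ((rG.mul rη bG).smul (2 * P.z))
  have bA : Bdd (P.model.fA U.fields) _ :=
    ((bG.smul P.κ).add (bη.smul (-(2 * P.z / (P.β * P.ρt))))).add ((bG.Mu bη).smul (2 * P.z))
  have rDρ := rρ.weak (h1 hU.ρ.mem) i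
  have rDη := rη.weak (h1 hU.η.mem) i
  have rdτ : Rep (U.divStress i) (dv (U.fields.τ i)) :=
    Rep.divergence rτ fun j => h1 (hU.τ i j).mem
  have rL := (ru i).laplacian (Hs_mono_succ (hU.u i).mem)
  have rD := hU.rep_div.weak (Hs_mono_succ (OldroydB.dv_mem fun i => (hU.u i).mem)) i
  have rT := Rep.sum fun j => (ru j).mul ((ru i).weak (h1 (hU.u i).mem) j) (bu j)
  have lhs := ((((r0.add (rDρ.smul P.r₁)).add (rDη.smul P.r₂)).sub (rdτ.smul P.r₃)).sub
    (rL.smul (P.μ₁ μ))).sub (rD.smul (P.μ₂ μ ν))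
  have rhs := ((((rT.smul (-P.β)).add (rH.mul rDρ bH)).add ((Rep.mul rA rDη bA).sub
    (rG.mul rdτ bG))).sub ((rG.mul rL bG).smul (μ * P.β))).sub
    ((rG.mul rD bG).smul ((μ + ν) * P.β))
  refine solve_momentum (lhs.eq rhs ?_)
  filter_upwards [h.momentum i] with x hx
  refine hx.trans ?_
  have hβ := P.β_pos.ne'
  have e : 2 * P.z / (P.β * (U.ρ x + P.ρt)) = 2 * P.z / (P.β * P.ρt) - 2 * P.z * P.g (U.ρ x) := by
    rw [Params.g, ← div_div, ← div_div, div_eq_mul_one_div _ (U.ρ x + P.ρt),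
      div_eq_mul_one_div _ P.ρt]
    ring
  simp only [S₂, e]
  ring

theorem SolvesAt.solves (h : SolvesAt P μ ν U V) (hU : U.MemH3) (hVρ : MemLp V.ρ 2 volume)
    (hVu : ∀ i, MemLp (V.u i) 2 volume) (hVη : MemLp V.η 2 volume)
    (hVτ : ∀ i j, MemLp (V.τ i j) 2 volume) (hρ : Bdd U.fields.ρ P.model.R₀) :
    Solves (P.model.coef μ (μ + ν)) (P.model.ncoef μ (μ + ν)) U.fields V.fields
      (P.model.fH U.fields) (P.model.fG U.fields) (P.model.fA U.fields) :=
  ⟨h.eq_ρ hU hVρ, fun i => h.eq_u hU i (hVu i) hρ, h.eq_η hU hVη, fun i j => h.eq_τ hU i j (hVτ i j)⟩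

end State

theorem sum_nsq_D (m : ℕ) (f : L2) :
    ∑ i, nsq m (D i f) = ∑ n ∈ Finset.range (m + 1), hom (n + 1) f := by
  simp only [nsq_eq_sum, hom_succ]
  exact Finset.sum_comm

theorem gradSq_eq {m : ℕ} {f : Space → ℝ} {F : L2} (hf : f =ᵐ[volume] F) (hF : F ∈ Hs (m + 1)) :
    gradSq m f = ENNReal.ofReal (∑ n ∈ Finset.range (m + 1), hom (n + 1) F) := by
  rw [← sum_nsq_D, ENNReal.ofReal_sum_of_nonneg fun i _ => nsq_nonneg _ _]
  exact Finset.sum_congr rfl fun i _ =>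
    sobSq_eq (weakPartial_ae hf (Hs_mono (by omega) hF) i) (D_mem hF i)

theorem gradSq_two_le {f : Space → ℝ} {F : L2} (hf : f =ᵐ[volume] F) (hF : F ∈ Hs 3) :
    gradSq 2 f ≤ ENNReal.ofReal (2 * (hom 1 F + hom 3 F)) := by
  rw [gradSq_eq hf hF]
  refine ENNReal.ofReal_le_ofReal ?_
  simp only [Finset.sum_range_succ, Finset.sum_range_zero, zero_add]
  linarith [hom_two_le hF]

theorem gradSq_three_le {f : Space → ℝ} {F : L2} (hf : f =ᵐ[volume] F) (hF : F ∈ Hs 4) :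
    gradSq 3 f ≤ ENNReal.ofReal (2 * (hom 1 F + hom 4 F)) := by
  rw [gradSq_eq hf hF]
  refine ENNReal.ofReal_le_ofReal ?_
  simp only [Finset.sum_range_succ, Finset.sum_range_zero, zero_add]
  linarith [hom_mid_le hF]

theorem sum_le_ofReal_sum {X : Fin 3 → ℝ≥0∞} {F : Fin 3 → ℝ}
    (h : ∀ i, X i ≤ ENNReal.ofReal (F i)) (h0 : ∀ i, 0 ≤ F i) :
    ∑ i, X i ≤ ENNReal.ofReal (∑ i, F i) := by
  rw [ENNReal.ofReal_sum_of_nonneg fun i _ => h0 i]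
  exact Finset.sum_le_sum fun i _ => h i

theorem add_le_ofReal_add {x y : ℝ≥0∞} {a b : ℝ} (hx : x ≤ ENNReal.ofReal a)
    (hy : y ≤ ENNReal.ofReal b) (ha : 0 ≤ a) (hb : 0 ≤ b) : x + y ≤ ENNReal.ofReal (a + b) := by
  rw [ENNReal.ofReal_add ha hb]
  exact add_le_add hx hy

theorem total_le_nsq (U : Fields) : U.total ≤ nsq 3 U.ρ + ∑ i, nsq 3 (U.u i) + nsq 3 U.η
    + ∑ i, ∑ j, nsq 3 (U.τ i j) := by
  have h : ∀ f, topq f ≤ nsq 3 f := fun f => by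
    rw [nsq_eq_sum]
    simp only [Finset.sum_range_succ, Finset.sum_range_zero, zero_add, topq]
    linarith [hom_nonneg 1 f, hom_nonneg 2 f]
  exact add_le_add (add_le_add (add_le_add (h _) (Finset.sum_le_sum fun i _ => h _)) (h _))
    (Finset.sum_le_sum fun i _ => Finset.sum_le_sum fun j _ => h _)

theorem Fields.Small.nsq_le_total {U : Fields} {M : ℝ} (S : U.Small M) :
    nsq 3 U.ρ + ∑ i, nsq 3 (U.u i) + nsq 3 U.η + ∑ i, ∑ j, nsq 3 (U.τ i j) ≤ 2 * U.total := by
  simp only [Fields.total, mul_add, Finset.mul_sum]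
  exact add_le_add (add_le_add (add_le_add (nsq_three_le S.ρ_mem)
    (Finset.sum_le_sum fun i _ => nsq_three_le (S.u_mem i))) (nsq_three_le S.η_mem))
    (Finset.sum_le_sum fun i _ => Finset.sum_le_sum fun j _ => nsq_three_le (S.τ_mem i j))

theorem Fields.total_nonneg (U : Fields) : 0 ≤ U.total :=
  add_nonneg (add_nonneg (add_nonneg (topq_nonneg _) (Finset.sum_nonneg fun _ _ => topq_nonneg _))
    (topq_nonneg _)) (Finset.sum_nonneg fun _ _ => Finset.sum_nonneg fun _ _ => topq_nonneg _)

namespace State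

variable {U : State}

theorem MemH3.small (h : U.MemH3) {δ : ℝ} (hδ : 0 ≤ δ)
    (hU : U.normSq 3 ≤ ENNReal.ofReal (δ ^ 2)) : U.fields.Small (8 * δ) := by
  have key : ∀ {f : Space → ℝ}, MemH 3 f → sobSq 3 f ≤ U.normSq 3 → nm 3 (cls f) ≤ 8 * δ := by
    intro f hf hle
    rw [hf.sobSq] at hle
    have h1 := (ENNReal.ofReal_le_ofReal_iff (sq_nonneg δ)).1 (hle.trans hU)
    have h2 := nm_sq_le_nsq 3 (cls f)
    exact abs_le_of_sq_le_sq' (by nlinarith) (by positivity) |>.2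
  have hu : ∀ i, sobSq 3 (U.u i) ≤ ∑ i, sobSq 3 (U.u i) := fun i =>
    Finset.single_le_sum (f := fun i => sobSq 3 (U.u i)) (fun _ _ => zero_le) (Finset.mem_univ i)
  have hτ : ∀ i j, sobSq 3 (U.τ i j) ≤ ∑ i, ∑ j, sobSq 3 (U.τ i j) := fun i j =>
    (Finset.single_le_sum (f := fun j => sobSq 3 (U.τ i j)) (fun _ _ => zero_le)
      (Finset.mem_univ j)).trans (Finset.single_le_sum (f := fun i => ∑ j, sobSq 3 (U.τ i j))
      (fun _ _ => zero_le) (Finset.mem_univ i))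
  exact ⟨h.ρ.mem, fun i => (h.u i).mem, h.η.mem, fun i j => (h.τ i j).mem,
    key h.ρ ((le_self_add.trans le_self_add).trans le_self_add),
    fun i => key (h.u i) (((hu i).trans le_add_self).trans (le_self_add.trans le_self_add)),
    key h.η (le_add_self.trans le_self_add),
    fun i j => key (h.τ i j) ((hτ i j).trans le_add_self)⟩

variable {μ₁ μ₂ : ℝ}

theorem MemH3.dissipation_le (h : U.MemH3) (hη : U.fields.η ∈ Hs 4)
    (hτ : ∀ i j, U.fields.τ i j ∈ Hs 4) (h₁ : 0 ≤ μ₁) (h₂ : 0 ≤ μ₂) :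
    U.dissipation ≤ ENNReal.ofReal (8 * U.fields.diss μ₁ μ₂) := by
  have h0 : ∀ n (f : L2), 0 ≤ hom n f := hom_nonneg
  have hs : ∀ {F : Fin 3 → ℝ}, (∀ i, 0 ≤ F i) → 0 ≤ ∑ i, F i := fun h =>
    Finset.sum_nonneg fun i _ => h i
  have n2 : ∀ m n (f : L2), 0 ≤ 2 * (hom m f + hom n f) := fun m n f => by
    linarith [h0 m f, h0 n f]
  have nρ := n2 1 3 U.fields.ρ
  have nu : ∀ i, 0 ≤ 2 * (hom 1 (U.fields.u i) + hom 3 (U.fields.u i)) := fun i => n2 _ _ _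
  have nη := n2 1 4 U.fields.η
  have nτ : ∀ i j, 0 ≤ 2 * (hom 1 (U.fields.τ i j) + hom 4 (U.fields.τ i j)) := fun i j => n2 _ _ _
  refine (add_le_ofReal_add (add_le_ofReal_add (gradSq_two_le h.ρ.coe h.ρ.mem)
    (sum_le_ofReal_sum (fun i => gradSq_two_le (h.u i).coe (h.u i).mem) nu) nρ (hs nu))
    (add_le_ofReal_add (gradSq_three_le h.η.coe hη) (sum_le_ofReal_sum (fun i =>
      sum_le_ofReal_sum (fun j => gradSq_three_le (h.τ i j).coe (hτ i j)) (nτ i))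
      fun i => hs (nτ i)) nη (hs fun i => hs (nτ i))) (add_nonneg nρ (hs nu))
    (add_nonneg nη (hs fun i => hs (nτ i)))).trans (ENNReal.ofReal_le_ofReal ?_)
  obtain ⟨dR, dU, dE, dS, -, -⟩ := U.fields.diss_terms h₁ h₂
  have e1 : ∑ i, 2 * (hom 1 (U.fields.u i) + hom 3 (U.fields.u i)) = 2 * U.fields.dU := by
    rw [Fields.dU, Finset.mul_sum]
  have e2 : ∑ i, ∑ j, 2 * (hom 1 (U.fields.τ i j) + hom 4 (U.fields.τ i j))
      ≤ 2 * U.fields.dS := by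
    simp only [Fields.dS, Finset.mul_sum]
    exact Finset.sum_le_sum fun i _ => Finset.sum_le_sum fun j _ => by
      linarith [h0 0 (U.fields.τ i j)]
  have e3 : 2 * (hom 1 U.fields.ρ + hom 3 U.fields.ρ) = 2 * U.fields.dR := rfl
  have e4 : 2 * (hom 1 U.fields.η + hom 4 U.fields.η) = 2 * U.fields.dE := rfl
  exact (add_le_add (add_le_add e3.le e1.le) (add_le_add e4.le e2)).trans (by linarith)

theorem MemH3.viscousDissipation_le (P : Params) {μ ν : ℝ} (h : U.MemH3)
    (hu : ∀ i, U.fields.u i ∈ Hs 4) (h₁ : 0 ≤ P.μ₁ μ) (h₂ : 0 ≤ P.μ₂ μ ν) :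
    U.viscousDissipation P μ ν ≤ ENNReal.ofReal (4 * U.fields.diss (P.μ₁ μ) (P.μ₂ μ ν)) := by
  have nu : ∀ i, 0 ≤ 2 * (hom 1 (U.fields.u i) + hom 4 (U.fields.u i)) := fun i => by
    linarith [hom_nonneg 1 (U.fields.u i), hom_nonneg 4 (U.fields.u i)]
  have a1 : ∑ i, gradSq 3 (U.u i) ≤ ENNReal.ofReal (2 * U.fields.dW) := by
    rw [Fields.dW, Finset.mul_sum]
    exact sum_le_ofReal_sum (fun i => gradSq_three_le (h.u i).coe (hu i)) nu
  have hd : dv U.fields.u ∈ Hs 3 := dv_mem hu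
  have a2 : sobSq 3 (divergence U.u) ≤ ENNReal.ofReal (2 * U.fields.dD) := by
    rw [sobSq_eq h.rep_div hd]
    exact ENNReal.ofReal_le_ofReal (nsq_three_le hd)
  obtain ⟨-, -, -, -, dW, dD⟩ := U.fields.diss_terms h₁ h₂
  have b1 : ENNReal.ofReal (P.μ₁ μ) * ∑ i, gradSq 3 (U.u i)
      ≤ ENNReal.ofReal (P.μ₁ μ * (2 * U.fields.dW)) := by
    rw [ENNReal.ofReal_mul h₁]; gcongr
  have b2 : ENNReal.ofReal (P.μ₂ μ ν) * sobSq 3 (divergence U.u)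
      ≤ ENNReal.ofReal (P.μ₂ μ ν * (2 * U.fields.dD)) := by
    rw [ENNReal.ofReal_mul h₂]; gcongr
  refine (add_le_ofReal_add b1 b2 (mul_nonneg h₁ ?_) (mul_nonneg h₂ ?_)).trans
    (ENNReal.ofReal_le_ofReal (by linarith))
  · linarith [U.fields.dW_nonneg]
  · linarith [U.fields.dD_nonneg]

end State

namespace IsStrongSolution

variable {P : Params} {μ ν T : ℝ} {U₀ : State} {U V : ℝ → State}

theorem memH3 (h : IsStrongSolution P μ ν T U₀ U V) {t : ℝ} (ht : t ∈ Icc 0 T) : (U t).MemH3 :=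
  ⟨h.ρ_cont.1 t ht, fun i => (h.u_cont i).1 t ht, h.η_cont.1 t ht, fun i j => (h.τ_cont i j).1 t ht⟩

theorem solution (h : IsStrongSolution P μ ν T U₀ U V)
    (hρ : ∀ t ∈ Icc 0 T, Bdd (U t).fields.ρ P.model.R₀) :
    P.model.Solution T μ (μ + ν) (fun t => (U t).fields) (fun t => (V t).fields) where
  ρ := h.ρ_deriv.curve (by norm_num) h.ρ_cont
  u i := (h.u_deriv i).curve (by norm_num) (h.u_cont i)
  η := h.η_deriv.curve (by norm_num) h.η_cont
  τ i j := (h.τ_deriv i j).curve (by norm_num) (h.τ_cont i j)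
  u4 i := (h.u_sq i).sqIntegrable (h.u_cont i)
  η4 := h.η_sq.sqIntegrable h.η_cont
  τ4 i j := (h.τ_sq i j).sqIntegrable (h.τ_cont i j)
  u2 i := (h.ut_sq i).sqIntegrable (h.u_deriv i).1
  η2 := h.ηt_sq.sqIntegrable h.η_deriv.1
  τ2 i j := (h.τt_sq i j).sqIntegrable (h.τ_deriv i j).1
  symm t ht i j := cls_eq ((h.symmetric t ht i j).trans ((h.τ_cont j i).1 t ht).coe)
  solves t ht := (h.solves t ht).solves (h.memH3 ht) (h.ρ_deriv.1.1 t ht).memLp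
    (fun i => ((h.u_deriv i).1.1 t ht).memLp) (h.η_deriv.1.1 t ht).memLp
    (fun i j => ((h.τ_deriv i j).1.1 t ht).memLp) (hρ t ht)

end IsStrongSolution

theorem Evol.le_initial {T : ℝ} {E E' : ℝ → ℝ} (h : Evol T E E')
    (h0 : ∀ᵐ s ∂(volume.restrict (Ioo 0 T)), E' s ≤ 0) {t : ℝ} (ht : t ∈ Icc 0 T) : E t ≤ E 0 := by
  rw [h.2 t ht]
  have : ∫ s in Ioo 0 t, E' s ≤ 0 := integral_nonpos_of_ae
    (ae_restrict_of_ae_restrict_of_subset (Ioo_subset_Ioo_right ht.2) h0)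
  linarith

theorem exists_apriori_bound (P : Params) : ∃ C : ℝ, 1 ≤ C ∧ ∃ δ > 0,
    ∀ (μ ν T : ℝ) (U₀ : State) (U V : ℝ → State), 0 ≤ μ → μ ≤ 1 → 0 ≤ μ + ν → μ + ν ≤ 2 →
      0 < T → IsStrongSolution P μ ν T U₀ U V →
      (∀ t ∈ Icc 0 T, (U t).normSq 3 ≤ ENNReal.ofReal (δ ^ 2)) →
      ∀ t ∈ Icc 0 T, (U t).normSq 3 + (∫⁻ s in Ioo 0 t, (U s).dissipation)
        + (∫⁻ s in Ioo 0 t, (U s).viscousDissipation P μ ν) ≤ ENNReal.ofReal C * U₀.normSq 3 := by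
  obtain ⟨q, hq, c, hc, C, hC, M₁, hM₁, key⟩ := P.model.exists_energy
  have hCs : 0 < Csob + 1 := by have := Csob_pos; linarith
  obtain ⟨δ, hδ0, hδ1, hδ2⟩ : ∃ δ > 0, 8 * δ ≤ M₁ ∧ Csob * (8 * δ) ≤ P.model.R₀ := by
    refine ⟨min M₁ (P.model.R₀ / (Csob + 1)) / 8,
      div_pos (lt_min hM₁ (div_pos P.model.R₀_pos hCs)) (by norm_num), ?_, ?_⟩
    · linarith [min_le_left M₁ (P.model.R₀ / (Csob + 1))]
    · have h1 := (le_div_iff₀ hCs).1 (min_le_right M₁ (P.model.R₀ / (Csob + 1)))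
      have h2 : 0 ≤ min M₁ (P.model.R₀ / (Csob + 1)) :=
        (lt_min hM₁ (div_pos P.model.R₀_pos hCs)).le
      linarith
  refine ⟨1 + (2 / q + 12 / c) * C, by linarith [show 0 ≤ (2 / q + 12 / c) * C by positivity],
    δ, hδ0, ?_⟩
  intro μ ν T U₀ U V hμ hμ1 hκ hκ2 hT h hδ t ht
  have S : ∀ t ∈ Icc 0 T, (U t).fields.Small (8 * δ) := fun t ht =>
    (h.memH3 ht).small hδ0.le (hδ t ht)
  obtain ⟨E, E', hE, hb, hae⟩ := key T μ (μ + ν) (8 * δ) _ _ hδ1 hμ hμ1 hκ hκ2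
    (h.solution fun t ht => (bdd_of_nm_three (S t ht).ρ_mem (S t ht).ρ_le).mono hδ2) S
  have h₁ : 0 ≤ P.μ₁ μ := div_nonneg hμ P.ρt_pos.le
  have h₂ : 0 ≤ P.μ₂ μ ν := div_nonneg hκ P.ρt_pos.le
  have hdec : ∀ᵐ s ∂(volume.restrict (Ioo 0 T)), c * (U s).fields.diss (P.μ₁ μ) (P.μ₂ μ ν) ≤ -E' s := by
    filter_upwards [hae] with s hs
    have : E' s ≤ -c * (U s).fields.diss (P.μ₁ μ) (P.μ₂ μ ν) := hs.2.2.2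
    linarith
  have hneg : ∀ᵐ s ∂(volume.restrict (Ioo 0 T)), E' s ≤ 0 := by
    filter_upwards [hdec] with s hs
    linarith [mul_nonneg hc.le ((U s).fields.diss_nonneg h₁ h₂)]
  have hscale : ∀ {b : ℝ}, 0 ≤ b → ∀ {X : ℝ → ℝ≥0∞}, (∀ᵐ s ∂(volume.restrict (Ioo 0 T)),
      X s ≤ ENNReal.ofReal (b * (U s).fields.diss (P.μ₁ μ) (P.μ₂ μ ν))) →
      ∫⁻ s in Ioo 0 t, X s ≤ ENNReal.ofReal (b / c * E 0) := by
    intro b hb0 X hX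
    have hbc : 0 ≤ b / c := div_nonneg hb0 hc.le
    refine ((hE.const_mul (b / c)).lintegral_le ?_ ?_ ht).trans (ENNReal.ofReal_le_ofReal ?_)
    · filter_upwards [hX, hdec] with s h1 h2
      refine h1.trans (ENNReal.ofReal_le_ofReal ?_)
      have h3 := mul_le_mul_of_nonneg_left h2 hbc
      rw [← mul_assoc, div_mul_cancel₀ _ hc.ne'] at h3
      linarith
    · filter_upwards [hneg] with s hs using mul_nonpos_of_nonneg_of_nonpos hbc hs
    · have h1 : 0 ≤ E t := (mul_nonneg hq.le (U t).fields.total_nonneg).trans (hb t ht).1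
      linarith [mul_nonneg hbc h1]
  have hD : ∫⁻ s in Ioo 0 t, (U s).dissipation ≤ ENNReal.ofReal (8 / c * E 0) := by
    refine hscale (by norm_num) ?_
    filter_upwards [hae, ae_restrict_mem measurableSet_Ioo] with s hs hsT
    exact (h.memH3 (Ioo_subset_Icc_self hsT)).dissipation_le hs.2.1 hs.2.2.1 h₁ h₂
  have hW : ∫⁻ s in Ioo 0 t, (U s).viscousDissipation P μ ν ≤ ENNReal.ofReal (4 / c * E 0) := by
    refine hscale (by norm_num) ?_
    filter_upwards [hae, ae_restrict_mem measurableSet_Ioo] with s hs hsT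
    exact (h.memH3 (Ioo_subset_Icc_self hsT)).viscousDissipation_le P hs.1 h₁ h₂
  have hN : (U t).normSq 3 ≤ ENNReal.ofReal (2 / q * E 0) := by
    rw [(h.memH3 ht).normSq]
    refine ENNReal.ofReal_le_ofReal ((S t ht).nsq_le_total.trans ?_)
    have h1 := mul_le_mul_of_nonneg_left ((hb t ht).1.trans (hE.le_initial hneg ht))
      (div_nonneg zero_le_two hq.le)
    rwa [← mul_assoc, div_mul_cancel₀ _ hq.ne'] at h1
  have h0T : (0 : ℝ) ∈ Icc 0 T := ⟨le_rfl, hT.le⟩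
  have hE0 : 0 ≤ E 0 := (mul_nonneg hq.le (U 0).fields.total_nonneg).trans (hb 0 h0T).1
  refine (add_le_ofReal_add (add_le_ofReal_add hN hD (by positivity) (by positivity)) hW
    (by positivity) (by positivity)).trans ?_
  rw [← h.initial, (h.memH3 h0T).normSq, ← ENNReal.ofReal_mul (by positivity)]
  refine ENNReal.ofReal_le_ofReal ?_
  have h1 := total_le_nsq (U 0).fields
  have h2 := mul_le_mul_of_nonneg_left ((hb 0 h0T).2.trans (mul_le_mul_of_nonneg_left h1 hC.le))
    (show 0 ≤ 2 / q + 12 / c by positivity)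
  have h3 := (U 0).fields.total_nonneg.trans h1
  have e : 8 / c * E 0 + 4 / c * E 0 = 12 / c * E 0 := by ring
  linarith

end OldroydB

end

theorem proposition3p2 (P : OldroydB.Params) :
    ∃ C θ δ : ℝ, 1 ≤ C ∧ 0 < θ ∧ 3 * θ / 2 < δ ∧ √C * θ ≤ 2 * δ / 3 ∧
      ∀ μ ν : ℝ, 0 ≤ μ → 0 ≤ 2 * μ + 3 * ν → μ ≤ 1 → ν ≤ 1 →
      ∀ (T : ℝ) (U₀ : OldroydB.State) (U V : ℝ → OldroydB.State), 0 < T →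
        OldroydB.IsStrongSolution P μ ν T U₀ U V →
        U₀.normSq 3 ≤ ENNReal.ofReal (θ ^ 2) →
        (∀ t ∈ Icc 0 T, (U t).normSq 3 ≤ ENNReal.ofReal (δ ^ 2)) →
        (∀ t ∈ Icc 0 T,
          (U t).normSq 3
            + (∫⁻ s in Ioo 0 t, (U s).dissipation)
            + (∫⁻ s in Ioo 0 t, (U s).viscousDissipation P μ ν)
            ≤ ENNReal.ofReal C * U₀.normSq 3) ∧
        ENNReal.ofReal C * U₀.normSq 3 ≤ ENNReal.ofReal (2 * δ / 3) := by
  obtain ⟨C, hC, δ, hδ, key⟩ := OldroydB.exists_apriori_bound P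
  have hC0 : 0 < C := by linarith
  obtain ⟨θ, hθ0, hθ1, hθδ⟩ : ∃ θ > 0, θ ≤ 1 ∧ C * θ ≤ δ / 3 := by
    refine ⟨min 1 (δ / 3 / C), lt_min one_pos (by positivity), min_le_left _ _, ?_⟩
    rw [mul_comm, ← le_div_iff₀ hC0]
    exact min_le_right _ _
  have h1 : θ ≤ C * θ := le_mul_of_one_le_left hθ0.le hC
  have h2 : √C * θ ≤ C * θ :=
    mul_le_mul_of_nonneg_right (Real.sqrt_le_iff.2 ⟨hC0.le, by nlinarith⟩) hθ0.le
  refine ⟨C, θ, δ, hC, hθ0, by linarith, by linarith, ?_⟩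
  intro μ ν hμ hμν hμ1 hν1 T U₀ U V hT h hU₀ hU
  refine ⟨key μ ν T U₀ U V hμ hμ1 (by linarith) (by linarith) hT h hU, ?_⟩
  calc ENNReal.ofReal C * U₀.normSq 3 ≤ ENNReal.ofReal C * ENNReal.ofReal (θ ^ 2) := by gcongr
    _ = ENNReal.ofReal (C * θ ^ 2) := (ENNReal.ofReal_mul hC0.le).symm
    _ ≤ ENNReal.ofReal (2 * δ / 3) := ENNReal.ofReal_le_ofReal (by
      nlinarith [mul_le_mul_of_nonneg_left hθ1 (mul_nonneg hC0.le hθ0.le)])
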